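/- **Setting.** Let $n\ge 1$, $V=\mathbb C^n$ with the bilinear form $(x,y)=\sum_i x_iy_i$ and standard basis $e_1,\dots,e_n$; let $R=\{\pm e_i\pm e_j\ (i<j),\ \pm 2e_i\}$ be the root system $C_n$, with simple roots $\alpha_i=e_i-e_{i+1}$ $(i<n)$, $\alpha_n=2e_n$, Weyl group $W$ and coroot lattice $Q^\vee=\mathbb Z^n$. Let $\hbar\in\mathbb C\setminus\pi i\mathbb Q$, $q=e^{\hbar/2}$, $t_0,t_1,t_n,u_0,u_n\in\mathbb C\setminus\{0\}$ (for $n=1$ the parameter $t_1$ of short roots does not occur and the nodes are $0,n$); put $t_i=t_1$, $u_i=1$ for $0<i<n$. Let $\alpha_0(x)=\hbar-2x_1$, $\alpha_i(x)=(\alpha_i,x)$ for $i\geq 1$, let $s_0,\dots,s_n$ be the reflections in the hyperplanes $\alpha_i(x)=0$, generating the affine Weyl group $\widetilde W=W\ltimes\tau(Q^\vee)$, where $\tau(\lambda)x=x+\hbar\lambda$. Affine transformations act on functions by $(gf)(x)=f(g^{-1}x)$. In the smash product of the meromorphic functions on $V$ with the affine transformations put $$T_i=t_i+t_i^{-1}\,\frac{(1-t_iu_ie^{-\alpha_i(x)/2})(1+t_iu_i^{-1}e^{-\alpha_i(x)/2})}{1-e^{-\alpha_i(x)}}\,(s_i-1),\qquad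 i=0,\dots,n,$$ $T_w=T_{i_1}\cdots T_{i_l}$ for a reduced expression $w=s_{i_1}\cdots s_{i_l}$, $Y^{\lambda-\nu}=T_{\tau(\lambda)}T_{\tau(\nu)}^{-1}$ for dominant $\lambda,\nu\in Q^\vee$, and $m_\lambda(Y)=\sum_{\nu\in W\lambda}Y^\nu$. Writing $m_\lambda(Y)=\sum_{\nu\in Q^\vee,\,w\in W}g_{\nu,w}\,\tau(\nu)w$, let $M_\lambda=\sum_{\nu,w}g_{\nu,w}\,\tau(\nu)$ (its restriction to $W$-invariant functions). Let $S_0\subset\{\alpha_1,\dots,\alpha_n\}$, let $\eta\colon R\to\mathbb C$ be $W$-invariant, with values $\eta_1$ on the short roots and $\eta_n$ on the long roots, and let $\mathcal D_0=\{x\in V\mid(\alpha,x)=\eta_\alpha\ \forall\alpha\in S_0\}$. Let $\bar\lambda$ be the orthogonal projection of $\lambda$ to $\overline V=\{x\mid(\alpha,x)=0\ \forall\alpha\in S_0\}$. For a difference operator $D=\sum_\lambda g_\lambda\tau(\lambda)$ put $$\overline D=\sum_{\lambda'}\Big(\sum_{\lambda:\bar\lambda=\lambda'}g_\lambda\Big)\Big|_{\mathcal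 D_0}\tau(\lambda')$$ whenever the restrictions to $\mathcal D_0$ are well-defined meromorphic functions. Assume: 1. for every irreducible component $S_\ell$ of $S_0$ not containing $\alpha_n$, with maximal root $\theta_\ell=\sum_{\alpha\in S_\ell}n_\alpha\alpha$, one has $\eta_{\theta_\ell}+\sum_{\alpha\in S_\ell}n_\alpha\eta_\alpha=\hbar$; 2. $t_1^2=e^{\eta_1}$ if $n>1$; 3. $\epsilon_nt_nu_n^{\epsilon_n}=e^{\eta_n/2}$ for some $\epsilon_n=\pm1$ and, if $\alpha_n\in S_0$, for this $\epsilon_n$ and some $\epsilon_0=\pm1$ also $\epsilon_0\epsilon_n\,t_nt_0u_n^{\epsilon_n}u_0^{\epsilon_0}t_1^{2(\tilde k-1)}q^{-1}=1$, where $\tilde k$ is the number of simple roots in the irreducible component of $S_0$ containing $\alpha_n$. **Theorem.** The restricted operators $\overline{M_\lambda}$ are well defined for all $\lambda\in Q^\vee$, and their linear span $\overline{\mathfrak R}$ over $\mathbb C$ is a commutative algebra. Let $\nu_j=e_1+\dots+e_j$ and $J=\{j\mid\alpha_j\notin S_0\}$. Then $|J|=\dim\mathcal D_0$, and the operators $\overline{M_{-\nu_j}}$,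 $j\in J$, are algebraically independent over $\mathbb C$ elements of $\overline{\mathfrak R}$. -/

import Mathlib

noncomputable section

namespace Koornwinder

/-! ### Meromorphic functions and operators on a complex affine space -/

section Functions

variable {E : Type*} [NormedAddCommGroup E] [NormedSpace ℂ E]

/-- The algebra of entire holomorphic functions on a complex affine space `P`. -/
def Hol (P : Type*) [AddTorsor E P] : Subalgebra ℂ (P → ℂ) where
  carrier := {f | ∀ p : P, Differentiable ℂ fun v : E => f (v +ᵥ p)}
  mul_mem' hf hg p := (hf p).mul (hg p)
  add_mem' hf hg p := (hf p).add (hg p)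
  algebraMap_mem' c _ := differentiable_const c

variable (P : Type*) [AddTorsor E P]

instance : IsDomain (Hol P) := by
  have hnt : Nontrivial (Hol P) := by
    refine ⟨⟨0, 1, fun h => ?_⟩⟩
    obtain ⟨p⟩ : Nonempty P := inferInstance
    have := congrFun (congrArg Subtype.val h) p
    simp at this
  have hnz : NoZeroDivisors (Hol P) := by
    refine ⟨fun {f g} hfg => ?_⟩
    by_contra! hcon
    obtain ⟨hf, hg⟩ := hcon
    obtain ⟨a, ha⟩ : ∃ a, f.1 a ≠ 0 := by
      by_contra! h
      exact hf (Subtype.ext (funext h))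
    obtain ⟨b, hb⟩ : ∃ b, g.1 b ≠ 0 := by
      by_contra! h
      exact hg (Subtype.ext (funext h))
    have key : ∀ h : Hol P,
        AnalyticOnNhd ℂ (fun z : ℂ => h.1 ((z • (b -ᵥ a)) +ᵥ a)) Set.univ := by
      intro h z _
      refine Differentiable.analyticAt (f := fun z : ℂ => h.1 ((z • (b -ᵥ a)) +ᵥ a)) ?_ z
      exact (h.2 a).comp (differentiable_id.smul_const (b -ᵥ a))
    rcases AnalyticOnNhd.eq_zero_or_eq_zero_of_mul_eq_zero (key f) (key g)
      (fun z _ => congrFun (congrArg Subtype.val hfg) _) isPreconnected_univ with h | h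
    · exact ha (by simpa using h 0 trivial)
    · exact hb (by simpa using h 1 trivial)
  exact NoZeroDivisors.to_isDomain _

/-- The field of meromorphic functions on a (finite-dimensional) complex affine space `P`: every
meromorphic function on `ℂ^N` is a quotient of two entire functions. -/
def Mer : Type _ := FractionRing (Hol P)

instance : Field (Mer P) := inferInstanceAs (Field (FractionRing (Hol P)))

instance : Algebra (Hol P) (Mer P) := inferInstanceAs (Algebra (Hol P) (FractionRing (Hol P)))

instance : IsFractionRing (Hol P) (Mer P) :=
  inferInstanceAs (IsFractionRing (Hol P) (FractionRing (Hol P)))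

instance : Algebra ℂ (Mer P) := ((algebraMap (Hol P) (Mer P)).comp (algebraMap ℂ (Hol P))).toAlgebra

instance : IsScalarTower ℂ (Hol P) (Mer P) := IsScalarTower.of_algebraMap_eq fun _ => rfl

variable [FiniteDimensional ℂ E]

/-- An affine transformation `g` acts on entire functions by `(g • f)(x) = f(g⁻¹ x)`. -/
instance : MulSemiringAction (P ≃ᵃ[ℂ] P) (Hol P) where
  smul g f := ⟨fun x => f.1 (g⁻¹ x), fun p => by
    have h := (f.2 (g⁻¹ p)).comp
      (LinearMap.toContinuousLinearMap (g⁻¹).linear.toLinearMap).differentiable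
    have e : (fun v : E => f.1 (g⁻¹ (v +ᵥ p))) =
        (fun v : E => f.1 (v +ᵥ g⁻¹ p)) ∘
          (LinearMap.toContinuousLinearMap (g⁻¹).linear.toLinearMap) := by
      funext v
      simp [AffineEquiv.map_vadd]
    rw [e]
    exact h⟩
  one_smul _ := rfl
  mul_smul a b f := Subtype.ext (funext fun x => by
    change f.1 ((a * b)⁻¹ x) = f.1 (b⁻¹ (a⁻¹ x))
    rw [mul_inv_rev]; rfl)
  smul_zero _ := rfl
  smul_add _ _ _ := rfl
  smul_one _ := rfl
  smul_mul _ _ _ := rfl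

/-- The induced action of affine transformations on meromorphic functions. -/
instance : MulSemiringAction (P ≃ᵃ[ℂ] P) (Mer P) :=
  IsFractionRing.mulSemiringAction (P ≃ᵃ[ℂ] P) (Hol P) (Mer P)

instance : SMulCommClass (P ≃ᵃ[ℂ] P) ℂ (Mer P) where
  smul_comm g c x := by
    have hc : ∀ c : ℂ, g • (algebraMap ℂ (Mer P) c) = algebraMap ℂ (Mer P) c := by
      intro c
      rw [IsScalarTower.algebraMap_apply ℂ (Hol P) (Mer P)]
      exact IsFractionRing.ringEquivOfRingEquiv_algebraMap
        (MulSemiringAction.toRingEquiv (P ≃ᵃ[ℂ] P) (Hol P) g) (algebraMap ℂ (Hol P) c)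
    rw [Algebra.smul_def, Algebra.smul_def, smul_mul', hc]

/-- The smash product of meromorphic functions on `P` with affine transformations of `P`: finite
sums `∑ φ_g g`, acting on functions by `(φ g) f (x) = φ(x) f(g⁻¹ x)` and multiplied by
`(φ g)(ψ h) = φ (g • ψ) (g h)`. The difference operators are the elements all of whose `g` are
translations. -/
abbrev Op : Type _ := SkewMonoidAlgebra (Mer P) (P ≃ᵃ[ℂ] P)

end Functions

/-! ### The root system `C_n` -/

/-- `V = ℂ^n`. -/
abbrev V (n : ℕ) : Type := EuclideanSpace ℂ (Fin n)

/-- The standard symmetric bilinear form on `V`. -/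
def form {n : ℕ} (x y : V n) : ℂ := ∑ i, x i * y i

/-- The standard basis vector `e_i`. -/
def e {n : ℕ} (i : Fin n) : V n := EuclideanSpace.single i 1

/-- The roots `±e_i ± e_j` (`i ≠ j`) and `±2e_i` of `C_n`. -/
def roots (n : ℕ) : Set (V n) :=
  {α | (∃ i j : Fin n, i ≠ j ∧ ∃ a b : ℤˣ, α = (a : ℤ) • e i + (b : ℤ) • e j) ∨
    ∃ (i : Fin n) (a : ℤˣ), α = (2 * (a : ℤ)) • e i}

/-- The simple roots `e_i - e_{i+1}` (all indices but the last one) and `2e_n` (last index). -/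
def simpleRoot {n : ℕ} (i : Fin n) : V n :=
  if h : i.val + 1 < n then e i - e ⟨i.val + 1, h⟩ else (2 : ℂ) • e i

/-- The last node of the Dynkin diagram, corresponding to the simple root `2e_n`. -/
def lastNode (n : ℕ) [NeZero n] : Fin n := ⟨n - 1, Nat.pred_lt (NeZero.ne n)⟩

/-- `α^∨ = 2α/(α,α)`. -/
def check {n : ℕ} (a : V n) : V n := (2 / form a a) • a

theorem form_add {n : ℕ} (a x y : V n) : form a (x + y) = form a x + form a y := by
  simp [form, mul_add, Finset.sum_add_distrib]

theorem form_smul {n : ℕ} (a : V n) (c : ℂ) (x : V n) : form a (c • x) = c * form a x := by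
  simp only [form, PiLp.smul_apply, smul_eq_mul, Finset.mul_sum]
  exact Finset.sum_congr rfl fun i _ => by ring

theorem form_sub {n : ℕ} (a x y : V n) : form a (x - y) = form a x - form a y := by
  simp [form, mul_sub, Finset.sum_sub_distrib]

/-- The reflection map `x ↦ x - α(x) (α^{(1)})^∨` of an affine functional
`α = [a, c] : x ↦ (a, x) + c`. -/
def reflFun {n : ℕ} (a : V n) (c : ℂ) (x : V n) : V n := x - (form a x + c) • check a

theorem reflFun_involutive {n : ℕ} (a : V n) (c : ℂ) : Function.Involutive (reflFun a c) := by
  intro x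
  unfold reflFun check
  by_cases h : form a a = 0
  · simp [h]
  · rw [form_sub, form_smul, form_smul, div_mul_cancel₀ _ h, sub_sub, ← add_smul]
    have : form a x + c + (form a x - (form a x + c) * 2 + c) = 0 := by ring
    rw [this, zero_smul, sub_zero]

/-- The reflection `s_α` of an affine functional `α = [a, c]` as an affine transformation. -/
def refl {n : ℕ} (a : V n) (c : ℂ) : V n ≃ᵃ[ℂ] V n where
  toEquiv := (reflFun_involutive a c).toPerm
  linear := LinearEquiv.ofInvolutive
    { toFun := reflFun a 0
      map_add' := fun x y => by
        simp only [reflFun, form_add, add_zero, add_smul]; abel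
      map_smul' := fun r x => by
        simp only [reflFun, form_smul, add_zero, mul_smul, smul_sub, RingHom.id_apply] }
    (reflFun_involutive a 0)
  map_vadd' p v := by
    change reflFun a c (v + p) = reflFun a 0 v + reflFun a c p
    simp only [reflFun, form_add, add_zero, add_smul]; abel

/-- The Weyl group `W` of `C_n`. -/
def weyl (n : ℕ) : Subgroup (V n ≃ᵃ[ℂ] V n) :=
  Subgroup.closure {w | ∃ α ∈ roots n, w = refl α 0}

/-- The coroot lattice of `C_n` is `ℤ^n`; this is its embedding in `V`. -/
def latt {n : ℕ} (l : Fin n → ℤ) : V n := ∑ i, (l i : ℂ) • e i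

/-- The orbit `W l` in the coroot lattice. -/
def orbit {n : ℕ} (l : Fin n → ℤ) : Set (Fin n → ℤ) :=
  {m | ∃ w ∈ weyl n, w (latt l) = latt m}

/-- `ν_j = e_1 + ... + e_j`. -/
def nu {n : ℕ} (j : Fin n) : Fin n → ℤ := fun i => if i ≤ j then 1 else 0

/-! ### The Noumi representation and the Cherednik-Dunkl operators -/

/-- The parameters of the DAHA of type `(C_n^∨, C_n)`. -/
structure Params where
  hbar : ℂ
  t₀ : ℂˣ
  t₁ : ℂˣ
  tn : ℂˣ
  u₀ : ℂˣ
  un : ℂˣ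

namespace Params

variable (p : Params) {n : ℕ} [NeZero n]

/-- `q = e^{ħ/2}`. -/
def q : ℂ := Complex.exp (p.hbar / 2)

/-- The linear part of the affine simple root `α_i`; the index `none` is the affine node `0`. -/
def affLin : Option (Fin n) → V n
  | none => -((2 : ℂ) • e 0)
  | some i => simpleRoot i

/-- The constant term of the affine simple root `α_i`, where `α_0 = [-2e_1, ħ]`. -/
def affConst : Option (Fin n) → ℂ
  | none => p.hbar
  | some _ => 0

/-- The parameter `t_i`. -/
def t : Option (Fin n) → ℂˣ
  | none => p.t₀
  | some i => if i = lastNode n then p.tn else p.t₁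

/-- The parameter `u_i`. -/
def u : Option (Fin n) → ℂˣ
  | none => p.u₀
  | some i => if i = lastNode n then p.un else 1

/-- The entire function `x ↦ e^{(a, x) + c}`. -/
def expHol (a : V n) (c : ℂ) : Hol (V n) :=
  ⟨fun x => Complex.exp (form a x + c), fun y => by
    have hl : ∀ i : Fin n, Differentiable ℂ fun v : V n => (v + y) i := fun i =>
      ((EuclideanSpace.proj (𝕜 := ℂ) i).differentiable).comp (differentiable_id.add_const y)
    exact ((Differentiable.fun_sum fun i _ => (hl i).const_mul (a i)).add_const c).cexp⟩

/-- The meromorphic function `e^{-r α_i(x)}`. -/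
def expAff (r : ℂ) (i : Option (Fin n)) : Mer (V n) :=
  algebraMap (Hol (V n)) (Mer (V n)) (expHol (-(r • affLin i)) (-(r * p.affConst i)))

/-- The coefficient
`t_i⁻¹ (1 - t_i u_i e^{-α_i(x)/2}) (1 + t_i u_i⁻¹ e^{-α_i(x)/2}) / (1 - e^{-α_i(x)})`. -/
def coef (i : Option (Fin n)) : Mer (V n) :=
  algebraMap ℂ (Mer (V n)) ((p.t i)⁻¹ : ℂˣ) *
    ((1 - algebraMap ℂ (Mer (V n)) (p.t i * p.u i) * p.expAff (1 / 2) i) *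
      (1 + algebraMap ℂ (Mer (V n)) (p.t i * ((p.u i)⁻¹ : ℂˣ)) * p.expAff (1 / 2) i)) /
    (1 - p.expAff 1 i)

/-- The simple affine reflection `s_i`. -/
def s (i : Option (Fin n)) : V n ≃ᵃ[ℂ] V n := refl (affLin i) (p.affConst i)

/-- The generator `T_i = t_i + coef_i (s_i - 1)` in the Noumi representation. -/
def T (i : Option (Fin n)) : Op (V n) :=
  algebraMap ℂ (Op (V n)) (p.t i) +
    SkewMonoidAlgebra.single 1 (p.coef i) * (SkewMonoidAlgebra.single (p.s i) 1 - 1)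

/-- The product `s_{i_1} ... s_{i_l}` of a word. -/
def wordProd (l : List (Option (Fin n))) : V n ≃ᵃ[ℂ] V n := (l.map p.s).prod

/-- The word `l` is a reduced expression of `w` in the simple affine reflections. -/
def IsReducedWord (w : V n ≃ᵃ[ℂ] V n) (l : List (Option (Fin n))) : Prop :=
  p.wordProd l = w ∧ ∀ l', p.wordProd l' = w → l.length ≤ l'.length

/-- `T_w = T_{i_1} ... T_{i_l}` for a reduced expression `w = s_{i_1} ... s_{i_l}` of an element of
the affine Weyl group (by the braid relations the product does not depend on the expression). -/
def Tw (w : V n ≃ᵃ[ℂ] V n) : Op (V n) :=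
  ((Classical.epsilon (p.IsReducedWord w)).map p.T).prod

/-- The shift `τ(l) : x ↦ x + ħ l` for `l` in the coroot lattice. -/
def shift (l : Fin n → ℤ) : V n ≃ᵃ[ℂ] V n := AffineEquiv.constVAdd ℂ (V n) (p.hbar • latt l)

/-- The coefficient `m_j` in the expansion `l = ∑ m_j ν_j`. -/
def nuCoef (l : Fin n → ℤ) (j : Fin n) : ℤ :=
  if h : j.val + 1 < n then l j - l ⟨j.val + 1, h⟩ else l j

/-- The dominant coroot lattice element `∑ max(m_j, 0) ν_j`, where `l = ∑ m_j ν_j`; thus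
`l = domPart l - domPart (-l)`. -/
def domPart (l : Fin n → ℤ) : Fin n → ℤ := ∑ j, max (nuCoef l j) 0 • nu j

/-- The Cherednik-Dunkl operator `Y^l = T_{τ(l')} T_{τ(l'')}⁻¹`, where `l = l' - l''` and `l'`, `l''`
are dominant (the result does not depend on the choice of `l'`, `l''`). -/
def Y (l : Fin n → ℤ) : Op (V n) :=
  p.Tw (p.shift (domPart l)) * Ring.inverse (p.Tw (p.shift (domPart (-l))))

/-- `m_l(Y) = ∑_{m ∈ W l} Y^m`. -/
def mY (l : Fin n → ℤ) : Op (V n) := ∑ᶠ m ∈ orbit l, p.Y m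

end Params

/-- The restriction of operators to `W`-invariant functions,
`∑ g_{λ,w} τ(λ) w ↦ ∑ g_{λ,w} τ(λ)`: an affine map `g` is replaced by the translation by `g 0`. -/
def Res {n : ℕ} (D : Op (V n)) : Op (V n) :=
  SkewMonoidAlgebra.mapDomain (fun g => AffineEquiv.constVAdd ℂ (V n) (g 0)) D

/-- The difference operator `M_l = Res (m_l(Y))`. -/
def Params.M (p : Params) {n : ℕ} [NeZero n] (l : Fin n → ℤ) : Op (V n) := Res (p.mY l)

/-! ### The plane `D_0` and the restriction of difference operators to it -/

/-- The `W`-invariant function on roots of `C_n` with value `η₁` on the short roots `±e_i ± e_j`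
and `ηn` on the long roots `±2e_i`. -/
def eta {n : ℕ} (η₁ ηn : ℂ) (α : V n) : ℂ := if form α α = 4 then ηn else η₁

/-- The plane `D_0 = {x | (α, x) = η_α for all α ∈ S_0}`; `S` is the set of indices of the simple
roots in `S_0`. -/
def D0 {n : ℕ} (S : Finset (Fin n)) (η₁ ηn : ℂ) : AffineSubspace ℂ (V n) where
  carrier := {x | ∀ i ∈ S, form (simpleRoot i) x = eta η₁ ηn (simpleRoot i)}
  smul_vsub_vadd_mem' c x y z hx hy hz i hi := by
    simp only [vsub_eq_sub, vadd_eq_add, form_add, form_smul, form_sub]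
    rw [hx i hi, hy i hi, hz i hi]; ring

theorem form_e {n : ℕ} (i : Fin n) (x : V n) : form (e i) x = x i := by
  simp [form, e]

theorem form_comm {n : ℕ} (x y : V n) : form x y = form y x := by
  simp [form, mul_comm]

instance {n : ℕ} (S : Finset (Fin n)) (η₁ ηn : ℂ) : Nonempty (D0 S η₁ ηn) := by
  refine ⟨⟨WithLp.toLp 2 fun i => ηn / 2 + ((n : ℂ) - 1 - (i.val : ℂ)) * η₁, fun i _ => ?_⟩⟩
  unfold simpleRoot eta
  split_ifs with h h1 h1
  · exfalso
    have hne : i ≠ ⟨i.val + 1, h⟩ := fun hh => by simpa using congrArg Fin.val hh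
    rw [form_sub, form_comm, form_e, form_comm _ (e ⟨i.val + 1, h⟩), form_e] at h1
    simp [e, hne, hne.symm] at h1
    norm_num at h1
  · rw [form_comm, form_sub, form_comm, form_e, form_comm, form_e]
    push_cast
    ring
  · have hi : (n : ℂ) = i.val + 1 := by
      have := i.2
      exact_mod_cast (by omega : n = i.val + 1)
    rw [form_comm, form_smul, form_comm, form_e]
    simp only [hi]
    ring
  · exfalso
    apply h1
    rw [form_smul, form_comm, form_smul, form_e]
    simp [e]
    norm_num

section Restriction

variable {n : ℕ} (A : AffineSubspace ℂ (V n)) [Nonempty A]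

/-- The restriction of entire functions to an affine subspace. -/
def resHol (f : Hol (V n)) : Hol A :=
  ⟨fun x => f.1 x, fun x => (f.2 x.1).comp A.direction.subtypeL.differentiable⟩

/-- The meromorphic function `h` on `A` is the restriction of the meromorphic function `g` on `V`:
`g = a / b` for some entire functions such that `b` does not vanish identically on `A`, and
`h` is the quotient of the restrictions. -/
def IsRestr (g : Mer (V n)) (h : Mer A) : Prop :=
  ∃ a b : Hol (V n), resHol A b ≠ 0 ∧
    g = algebraMap (Hol (V n)) (Mer (V n)) a / algebraMap (Hol (V n)) (Mer (V n)) b ∧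
    h = algebraMap (Hol A) (Mer A) (resHol A a) / algebraMap (Hol A) (Mer A) (resHol A b)

open Classical in
/-- The restriction of a meromorphic function to `A` (and `0` if it is not defined). -/
def restr (g : Mer (V n)) : Mer A := if h : ∃ r, IsRestr A g r then h.choose else 0

/-- The sum of the coefficients `g_λ` of `D = ∑ g_λ τ(λ)` over all shifts `ħλ` with a given orthogonal
projection to the direction `V̄` of `A`. For `A = D_0` the space `V̄` is defined by equations with
real coefficients, so that the orthogonal projections with respect to the Hermitian and the
bilinear form coincide. -/
def projCoeff (D : Op (V n)) : A.direction →₀ Mer (V n) :=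
  Finsupp.mapDomain (fun g : V n ≃ᵃ[ℂ] V n => A.direction.orthogonalProjectionOnto (g 0)) D.coeff

/-- The restriction of the difference operator `D` to `A` is well defined. -/
def Restrictable (D : Op (V n)) : Prop := ∀ v, ∃ r, IsRestr A (projCoeff A D v) r

/-- The restriction of a difference operator `D = ∑ g_λ τ(λ)` to `A`, that is
`∑_{λ'} (∑_{λ : λ̄ = λ'} g_λ)|_A τ(λ')`. -/
def bar (D : Op (V n)) : Op A :=
  (projCoeff A D).sum fun v g =>
    SkewMonoidAlgebra.single (AffineEquiv.constVAdd ℂ A v) (restr A g)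

end Restriction

/-- The restricted operator `M̄_l`. -/
def Params.Mbar (p : Params) {n : ℕ} [NeZero n] (S : Finset (Fin n)) (η₁ ηn : ℂ)
    (l : Fin n → ℤ) : Op (D0 S η₁ ηn) :=
  bar (D0 S η₁ ηn) (p.M l)

/-- The algebra `R̄` generated by the operators `M̄_l`, `l ∈ ℤ^n`. -/
def Params.Rbar (p : Params) {n : ℕ} [NeZero n] (S : Finset (Fin n)) (η₁ ηn : ℂ) :
    Subalgebra ℂ (Op (D0 S η₁ ηn)) :=
  Algebra.adjoin ℂ (Set.range (p.Mbar S η₁ ηn))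

theorem Params.Mbar_mem (p : Params) {n : ℕ} [NeZero n] (S : Finset (Fin n)) (η₁ ηn : ℂ)
    (l : Fin n → ℤ) : p.Mbar S η₁ ηn l ∈ p.Rbar S η₁ ηn :=
  Algebra.subset_adjoin ⟨l, rfl⟩

/-- A family of elements of a commutative subalgebra of a (noncommutative) algebra is algebraically
independent. -/
def AlgIndep {B ι : Type*} [Ring B] [Algebra ℂ B] (A : Subalgebra ℂ B)
    (hA : ∀ x ∈ A, ∀ y ∈ A, x * y = y * x) (f : ι → A) : Prop :=
  letI : CommRing A :=
    { (inferInstance : Ring A) with mul_comm := fun x y => Subtype.ext (hA x x.2 y y.2) }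
  AlgebraicIndependent ℂ f

/-! ### Irreducible components and generalized Coxeter numbers -/

/-- The irreducible component of `S` that contains `i ∈ S`: the nodes connected to `i` in the Dynkin
diagram of `S`. -/
def component {n : ℕ} (S : Finset (Fin n)) (i : Fin n) : Set (Fin n) :=
  {j | Relation.ReflTransGen
    (fun a b => a ∈ S ∧ b ∈ S ∧ form (simpleRoot a) (simpleRoot b) ≠ 0) i j}

/-- `h` is the generalized Coxeter number `η_θ + ∑ m_j η_{α_j}` of the root system with the simple
roots `α_j`, `j ∈ C`, where `θ = ∑ m_j α_j` is its maximal root. -/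
def IsCoxeterNumber {n : ℕ} (η₁ ηn : ℂ) (C : Set (Fin n)) (h : ℂ) : Prop :=
  ∃ m : Fin n → ℕ, (∀ j ∉ C, m j = 0) ∧
    (∑ j, m j • simpleRoot j) ∈ roots n ∧
    (∀ k : Fin n → ℤ, (∀ j ∉ C, k j = 0) → (∑ j, k j • simpleRoot j) ∈ roots n →
      ∀ j, k j ≤ m j) ∧
    h = eta η₁ ηn (∑ j, m j • simpleRoot j) + ∑ j, (m j : ℂ) * eta η₁ ηn (simpleRoot j)

end Koornwinder

end

noncomputable section
set_option linter.unusedSectionVars false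
namespace Koornwinder

/-! ### The affine Weyl group -/

section AffineWeyl

variable {n : ℕ}

/-! The operators T_i generate an algebra `HH` acting on functions on V, and the value of a function
φ on the plane wD_0 is the restriction of w⁻¹φ to D_0. The assumptions on the parameters are made so
that, for a suitable set `Pos` of elements w of the affine Weyl group, the functions vanishing on
all planes wD_0 with w in `Pos` form an `HH`-submodule: passing from w to s_iw either stays in
`Pos`, or the numerator of the coefficient of s_i − 1 in T_i vanishes on wD_0 (`Good.stab`).
Moreover each such w acts on D_0, up to an element of W, by a translation of D_0 into itself
(`Good.transl`). An operator in `HH` commuting with T_1, …, T_n preserves W-invariance, so modulo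
the submodule its effect on W-invariant functions is determined by D_0 alone and is the effect of
its restriction. Hence restriction to D_0 is multiplicative on such operators
(`restr_projCoeff_mul`, `bar_mul`).

The denominators 1 − e^{−α_i} may vanish identically on wD_0, and there T_i acts as a divided
difference. Functions are therefore replaced by families indexed by the group, regular on D_0 and
equivariant under the reflections for which this happens (`E0`). Applying D to delta families shows
that the summed coefficients are regular on D_0 (`restrictable_of_mem`).

The operators m_λ(Y) fit into this picture. The product of the T_i along a reduced word depends only
on the group element (`Tprod_eq`), lengths add for dominant translations (`TwU_shift_add`), so the
Y^l commute (`YU_comm`); T_i commutes with Y^l + Y^{s_il} for i ≥ 1 (`commute_YU_add`), hence with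
orbit sums (`commute_mY`); and a product of orbit sums is a combination of orbit sums
(`mY_mul_mem`). So the restricted operators commute and their span is an algebra.

Algebraic independence comes from leading terms. If the entries of l are 0 and ±1, then Y^l, acting
on symmetric functions, has at τ(l) a coefficient that is a product of nonzero factors, and its
other translations are shorter than l or of the same length and dominate l (`yLead`). Consequently
−ν_j is the extreme translation in M_{−ν_j}; the roots in its coefficient pair nontrivially with
ν_j, which for α_j ∉ S_0 is a direction of D_0, so the coefficient survives restriction
(`leadP_mY`). Leading terms multiply, and the ν_j are linearly independent (`algIndep`). -/

theorem latt_apply (l : Fin n → ℤ) (j : Fin n) : latt l j = l j := by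
  simp [latt, e, Pi.single_apply]

theorem form_latt (l : Fin n → ℤ) (x : V n) : form (latt l) x = ∑ j, (l j : ℂ) * x j := by
  simp [form, latt_apply]

theorem form_simpleRoot_lt {i : Fin n} (h : i.val + 1 < n) (x : V n) :
    form (simpleRoot i) x = x i - x ⟨i.val + 1, h⟩ := by
  rw [simpleRoot, dif_pos h, form_comm, form_sub, form_comm, form_e, form_comm, form_e]

theorem form_simpleRoot_last {i : Fin n} (h : ¬ i.val + 1 < n) (x : V n) :
    form (simpleRoot i) x = 2 * x i := by
  rw [simpleRoot, dif_neg h, form_comm, form_smul, form_comm, form_e]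

theorem eq_of_form_eq {x y : V n} (h : ∀ z, form x z = form y z) : x = y := by
  ext i
  have := h (e i)
  rwa [form_comm, form_e, form_comm, form_e] at this

variable [NeZero n]

theorem lastNode_iff (i : Fin n) : i = lastNode n ↔ ¬ i.val + 1 < n := by
  rw [Fin.ext_iff, lastNode]
  have := i.2
  simp only
  omega

namespace Params

variable (p : Params)

/-- The affine simple root `α_i` as a function on `V`. -/
def al (i : Option (Fin n)) (x : V n) : ℂ := form (affLin i) x + p.affConst i

theorem al_none (x : V n) : p.al none x = p.hbar - 2 * x 0 := by
  have : form (affLin none) x = -(2 * x 0) := by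
    have h : (affLin none : V n) = (-2 : ℂ) • e 0 := by simp [affLin]
    rw [h, form_comm, form_smul, form_comm, form_e]; ring
  rw [al, this, affConst]; ring

theorem al_lt {i : Fin n} (h : i.val + 1 < n) (x : V n) :
    p.al (some i) x = x i - x ⟨i.val + 1, h⟩ := by
  simp [al, affLin, affConst, form_simpleRoot_lt h]

theorem al_last {i : Fin n} (h : ¬ i.val + 1 < n) (x : V n) : p.al (some i) x = 2 * x i := by
  simp [al, affLin, affConst, form_simpleRoot_last h]

theorem s_apply (i : Option (Fin n)) (x : V n) : p.s i x = x - p.al i x • check (affLin i) := rfl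

theorem check_none : check (affLin none : V n) = -e 0 := by
  have h : (affLin none : V n) = (-2 : ℂ) • e 0 := by simp [affLin]
  have h2 : form (affLin none : V n) (affLin none) = 4 := by
    rw [h, form_smul, form_comm, form_smul, form_e]; simp [e]; norm_num
  rw [check, h2, h, smul_smul]; norm_num

theorem check_lt {i : Fin n} (h : i.val + 1 < n) :
    check (affLin (some i)) = e i - e ⟨i.val + 1, h⟩ := by
  have hne : i ≠ ⟨i.val + 1, h⟩ := fun hh => by simpa using congrArg Fin.val hh
  have h1 : affLin (some i) = e i - e ⟨i.val + 1, h⟩ := by simp [affLin, simpleRoot, h]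
  have h2 : form (affLin (some i)) (affLin (some i)) = 2 := by
    change form (simpleRoot i) (simpleRoot i) = 2
    rw [form_simpleRoot_lt h, simpleRoot, dif_pos h]
    simp [e, hne, hne.symm]; norm_num
  rw [check, h2, h1]; norm_num

theorem check_last {i : Fin n} (h : ¬ i.val + 1 < n) : check (affLin (some i)) = e i := by
  have h1 : affLin (some i) = (2 : ℂ) • e i := by simp [affLin, simpleRoot, h]
  have h2 : form (affLin (some i)) (affLin (some i)) = 4 := by
    change form (simpleRoot i) (simpleRoot i) = 4
    rw [form_simpleRoot_last h, simpleRoot, dif_neg h]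
    simp [e]; norm_num
  rw [check, h2, h1, smul_smul]; norm_num

theorem s_none_apply (x : V n) (j : Fin n) :
    p.s none x j = if j = 0 then p.hbar - x 0 else x j := by
  rw [s_apply, al_none, check_none]
  by_cases h : j = 0
  · subst h; simp [e]; ring
  · simp [e, h]

theorem s_lt_apply {i : Fin n} (h : i.val + 1 < n) (x : V n) (j : Fin n) :
    p.s (some i) x j = x (Equiv.swap i ⟨i.val + 1, h⟩ j) := by
  have hne : i ≠ ⟨i.val + 1, h⟩ := fun hh => by simpa using congrArg Fin.val hh
  rw [s_apply, al_lt _ h, check_lt h]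
  by_cases h1 : j = i
  · subst h1; simp [e, hne]
  · by_cases h2 : j = ⟨i.val + 1, h⟩
    · rw [h2]; simp [e, hne.symm]
    · rw [Equiv.swap_apply_of_ne_of_ne h1 h2]; simp [e, h1, h2]

theorem s_last_apply {i : Fin n} (h : ¬ i.val + 1 < n) (x : V n) (j : Fin n) :
    p.s (some i) x j = if j = i then - x i else x j := by
  rw [s_apply, al_last _ h, check_last h]
  by_cases h1 : j = i
  · subst h1; simp [e]; ring
  · simp [e, h1]

theorem s_mul_self (i : Option (Fin n)) : p.s i * p.s i = 1 := by
  ext x : 1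
  exact reflFun_involutive (affLin i) (p.affConst i) x

theorem s_inv (i : Option (Fin n)) : (p.s i)⁻¹ = p.s i :=
  inv_eq_of_mul_eq_one_left (p.s_mul_self i)

theorem s_s_apply (i : Option (Fin n)) (x : V n) : p.s i (p.s i x) = x :=
  reflFun_involutive (affLin i) (p.affConst i) x

theorem al_s (i : Option (Fin n)) (x : V n) : p.al i (p.s i x) = - p.al i x := by
  rcases i with _ | i
  · simp only [al_none, s_none_apply, if_true]; ring
  · by_cases h : i.val + 1 < n
    · simp only [al_lt _ h, s_lt_apply _ h, Equiv.swap_apply_left, Equiv.swap_apply_right]; ring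
    · simp only [al_last _ h, s_last_apply _ h, if_true]; ring

variable (n) in
/-- The affine Weyl group, generated by the simple affine reflections. -/
def affW : Subgroup (V n ≃ᵃ[ℂ] V n) := Subgroup.closure (Set.range p.s)

theorem s_mem (i : Option (Fin n)) : p.s i ∈ p.affW n := Subgroup.subset_closure ⟨i, rfl⟩

theorem wordProd_nil : p.wordProd ([] : List (Option (Fin n))) = 1 := rfl

theorem wordProd_cons (i : Option (Fin n)) (l) : p.wordProd (i :: l) = p.s i * p.wordProd l := by
  simp [wordProd]

theorem wordProd_append (l l' : List (Option (Fin n))) :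
    p.wordProd (l ++ l') = p.wordProd l * p.wordProd l' := by
  simp [wordProd]

theorem wordProd_reverse (l : List (Option (Fin n))) :
    p.wordProd l.reverse = (p.wordProd l)⁻¹ := by
  induction l with
  | nil => simp [wordProd]
  | cons i l ih =>
    rw [List.reverse_cons, wordProd_append, ih, wordProd_cons, wordProd_cons, wordProd_nil,
      mul_one, mul_inv_rev, s_inv]

theorem mem_affW_iff {g : V n ≃ᵃ[ℂ] V n} : g ∈ p.affW n ↔ ∃ l, p.wordProd l = g := by
  constructor
  · intro h
    induction h using Subgroup.closure_induction with
    | mem x hx => obtain ⟨i, rfl⟩ := hx; exact ⟨[i], by simp [wordProd]⟩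
    | one => exact ⟨[], rfl⟩
    | mul x y _ _ hx hy =>
      obtain ⟨l, rfl⟩ := hx; obtain ⟨l', rfl⟩ := hy
      exact ⟨l ++ l', wordProd_append _ _ _⟩
    | inv x _ hx => obtain ⟨l, rfl⟩ := hx; exact ⟨l.reverse, wordProd_reverse _ _⟩
  · rintro ⟨l, rfl⟩
    exact Subgroup.list_prod_mem _ fun x hx => by
      obtain ⟨i, _, rfl⟩ := List.mem_map.1 hx
      exact p.s_mem i

theorem wordProd_mem (l : List (Option (Fin n))) : p.wordProd l ∈ p.affW n :=
  p.mem_affW_iff.2 ⟨l, rfl⟩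

/-- `g` permutes the coordinates, changes signs and translates by a lattice vector. -/
def NF (g : V n ≃ᵃ[ℂ] V n) (σ : Equiv.Perm (Fin n)) (ε : Fin n → ℤˣ) (μ : Fin n → ℤ) : Prop :=
  ∀ x j, g x j = ((ε j : ℤ) : ℂ) * x (σ j) + p.hbar * μ j

variable {p} in
theorem NF.mul {g g' : V n ≃ᵃ[ℂ] V n} {σ σ' ε ε' μ μ'} (h : p.NF g σ ε μ) (h' : p.NF g' σ' ε' μ') :
    p.NF (g * g') (σ' * σ) (fun j => ε j * ε' (σ j)) (fun j => ε j * μ' (σ j) + μ j) := by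
  intro x j
  change g (g' x) j = _
  rw [h, h', show (σ' * σ) j = σ' (σ j) from rfl]
  push_cast
  ring

theorem NF_s (i : Option (Fin n)) : ∃ σ ε μ, p.NF (p.s i) σ ε μ := by
  rcases i with _ | i
  · refine ⟨1, fun j => if j = 0 then -1 else 1, fun j => if j = 0 then 1 else 0, fun x j => ?_⟩
    rw [s_none_apply]
    by_cases h : j = 0
    · subst h; simp; ring
    · simp [h]
  · by_cases h : i.val + 1 < n
    · exact ⟨Equiv.swap i ⟨i.val + 1, h⟩, fun _ => 1, fun _ => 0, fun x j => by
        rw [s_lt_apply _ h]; simp⟩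
    · refine ⟨1, fun j => if j = i then -1 else 1, fun j => 0, fun x j => ?_⟩
      rw [s_last_apply _ h]
      by_cases h : j = i
      · subst h; simp
      · simp [h]

theorem exists_NF {g : V n ≃ᵃ[ℂ] V n} (hg : g ∈ p.affW n) : ∃ σ ε μ, p.NF g σ ε μ := by
  obtain ⟨l, rfl⟩ := p.mem_affW_iff.1 hg
  induction l with
  | nil => exact ⟨1, fun _ => 1, fun _ => 0, fun x j => by simp [wordProd]⟩
  | cons i l ih =>
    obtain ⟨σ, ε, μ, h⟩ := ih (p.wordProd_mem l)
    obtain ⟨σ', ε', μ', h'⟩ := p.NF_s i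
    rw [wordProd_cons]
    exact ⟨_, _, _, h'.mul h⟩

variable {p} in
theorem NF.linear {g : V n ≃ᵃ[ℂ] V n} {σ ε μ} (h : p.NF g σ ε μ) (x : V n) (j : Fin n) :
    g.linear x j = ((ε j : ℤ) : ℂ) * x (σ j) := by
  have : g x = g.linear x + g 0 := by simpa using g.map_vadd 0 x
  have h2 := congrArg (fun v : V n => v j) this
  simp only [PiLp.add_apply, h x, h 0] at h2
  simpa using h2.symm

theorem form_linear {g : V n ≃ᵃ[ℂ] V n} (hg : g ∈ p.affW n) (x y : V n) :
    form (g.linear x) (g.linear y) = form x y := by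
  obtain ⟨σ, ε, μ, h⟩ := p.exists_NF hg
  unfold form
  rw [← Equiv.sum_comp σ fun j => x j * y j]
  refine Finset.sum_congr rfl fun j _ => ?_
  rw [h.linear, h.linear]
  rcases Int.units_eq_one_or (ε j) with h | h <;> simp [h]

/-- The affine real roots as functions on `V`. -/
def rts : Set (V n → ℂ) :=
  {f | ∃ (a b : Fin n) (ε δ : ℤˣ) (m : ℤ), (a = b → ε = δ) ∧
    ∀ x, f x = ((ε : ℤ) : ℂ) * x a + ((δ : ℤ) : ℂ) * x b + m * p.hbar}

theorem al_mem (i : Option (Fin n)) : p.al i ∈ p.rts (n := n) := by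
  rcases i with _ | i
  · exact ⟨0, 0, -1, -1, 1, by simp, fun x => by rw [al_none]; push_cast; ring⟩
  · by_cases h : i.val + 1 < n
    · refine ⟨i, ⟨i.val + 1, h⟩, 1, -1, 0, fun hh => ?_, fun x => by
        rw [al_lt _ h]; push_cast; ring⟩
      simpa using congrArg Fin.val hh
    · exact ⟨i, i, 1, 1, 0, by simp, fun x => by rw [al_last _ h]; push_cast; ring⟩

theorem rts_comp {f : V n → ℂ} (hf : f ∈ p.rts) {g : V n ≃ᵃ[ℂ] V n} (hg : g ∈ p.affW n) :
    (fun x => f (g x)) ∈ p.rts := by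
  obtain ⟨σ, ε', μ, h⟩ := p.exists_NF hg
  obtain ⟨a, b, ε, δ, m, hab, hf⟩ := hf
  refine ⟨σ a, σ b, ε * ε' a, δ * ε' b, m + ε * μ a + δ * μ b, fun hh => ?_, fun x => ?_⟩
  · have := σ.injective hh
    rw [hab this, this]
  · change f (g x) = _
    rw [hf, h, h]; push_cast; ring

theorem rts_neg {f : V n → ℂ} (hf : f ∈ p.rts) : (fun x => - f x) ∈ p.rts := by
  obtain ⟨a, b, ε, δ, m, hab, hf⟩ := hf
  refine ⟨a, b, -ε, -δ, -m, fun hh => by rw [hab hh], fun x => ?_⟩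
  change - f x = _
  rw [hf]; push_cast; ring

variable (n) in
/-- The scale in which the base point is integral. -/
def scale : ℤ := 2 * n + 2

/-- The lattice point `ħ y / scale`. -/
def pt (y : Fin n → ℤ) : V n := (p.hbar / scale n) • latt y

variable (n) in
/-- A real multiple of the quotient by `ħ`; it detects the sign at points of `ħℝ^n`. -/
def hv (z : ℂ) : ℝ := (scale n * z / p.hbar).re

variable (n) in
/-- The base point, an interior point of the fundamental alcove. -/
def X0 : V n := p.pt fun j => n - j.val

theorem hv_neg (z : ℂ) : p.hv n (-z) = - p.hv n z := by simp [hv, neg_div]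

theorem hv_add (z w : ℂ) : p.hv n (z + w) = p.hv n z + p.hv n w := by
  simp [hv, mul_add, add_div]

theorem scale_ne : (scale n : ℂ) ≠ 0 := by
  rw [scale]; exact_mod_cast (by omega : (2 * (n : ℤ) + 2) ≠ 0)

variable {p}

theorem pt_apply (y : Fin n → ℤ) (j : Fin n) : p.pt y j = p.hbar / scale n * y j := by
  simp [pt, latt_apply]

theorem hv_rts (h0 : p.hbar ≠ 0) {f : V n → ℂ} {a b : Fin n} {ε δ : ℤˣ} {m : ℤ}
    (hf : ∀ x, f x = ((ε : ℤ) : ℂ) * x a + ((δ : ℤ) : ℂ) * x b + m * p.hbar) (y : Fin n → ℤ) :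
    p.hv n (f (p.pt y)) = ((ε * y a + δ * y b + m * scale n : ℤ) : ℝ) := by
  have hs := scale_ne (n := n)
  have : scale n * f (p.pt y) / p.hbar = ((ε * y a + δ * y b + m * scale n : ℤ) : ℂ) := by
    rw [hf, pt_apply, pt_apply]
    push_cast
    field_simp
  rw [hv, this, Complex.intCast_re]

theorem NF.pt (h0 : p.hbar ≠ 0) {g : V n ≃ᵃ[ℂ] V n} {σ ε μ} (h : p.NF g σ ε μ) (y : Fin n → ℤ) :
    g (p.pt y) = p.pt fun j => ε j * y (σ j) + scale n * μ j := by
  have hs := scale_ne (n := n)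
  ext j
  rw [h, pt_apply, pt_apply]
  push_cast
  field_simp

/-- For `omega` the product m · `scale n` is an atom. The points compared below have small
coordinates, so exact values are needed only for |m| ≤ 1 and a bound suffices otherwise. -/
theorem mul_scale_cases (m : ℤ) : (m ≤ -2 ∧ m * scale n ≤ -2 * scale n) ∨
    (m = -1 ∧ m * scale n = - scale n) ∨ (m = 0 ∧ m * scale n = 0) ∨
    (m = 1 ∧ m * scale n = scale n) ∨ (2 ≤ m ∧ 2 * scale n ≤ m * scale n) := by
  have hs : 0 ≤ scale n := by rw [scale]; omega
  rcases le_or_gt m (-2) with h | h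
  · exact .inl ⟨h, by nlinarith⟩
  rcases le_or_gt 2 m with h' | h'
  · exact .inr (.inr (.inr (.inr ⟨h', by nlinarith⟩)))
  · have : m = -1 ∨ m = 0 ∨ m = 1 := by omega
    rcases this with rfl | rfl | rfl <;> simp

/-- In units of ħ/(2n+2) the coordinates of X_0 are n, …, 1. They are distinct and positive, and the
sum of any two is at most 2n < 2n+2, so no affine root vanishes there. -/
theorem hv_X0_ne (h0 : p.hbar ≠ 0) {f : V n → ℂ} (hf : f ∈ p.rts) : p.hv n (f (p.X0 n)) ≠ 0 := by
  obtain ⟨a, b, ε, δ, m, hab, hf⟩ := hf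
  rw [X0, hv_rts h0 hf]
  have ha := a.2
  have hb := b.2
  have hab' : a.val = b.val → ε = δ := fun h => hab (Fin.ext h)
  have hm := mul_scale_cases (n := n) m
  simp only [scale] at hm ⊢
  intro h
  replace h := (Int.cast_eq_zero (α := ℝ)).1 h
  rcases Int.units_eq_one_or ε with rfl | rfl <;> rcases Int.units_eq_one_or δ with rfl | rfl <;>
    simp at h hab' <;> omega

/-- Explicit coordinates of s_iX_0 turn the signs of roots into linear integer arithmetic. The entry
n + 2 is (2n+2) − n, coming from ħ − x_1. -/
theorem s_X0 (h0 : p.hbar ≠ 0) (i : Option (Fin n)) : ∃ y : Fin n → ℤ, p.s i (p.X0 n) = p.pt y ∧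
    ∀ j, y j = match i with
      | none => if j.val = 0 then n + 2 else n - j.val
      | some i => if i.val + 1 < n then
          (if j.val = i.val then n - j.val - 1 else if j.val = i.val + 1 then n - j.val + 1
            else n - j.val)
          else if j.val = i.val then - (n - j.val) else n - j.val := by
  have hs := scale_ne (n := n)
  refine ⟨_, ?_, fun j => rfl⟩
  ext j
  rw [X0]
  have hs' : (scale n : ℂ) = 2 * n + 2 := by simp [scale]
  rcases i with _ | i
  · rw [s_none_apply, pt_apply, pt_apply, pt_apply]
    simp only
    have : j = 0 ↔ j.val = 0 := by rw [Fin.ext_iff]; simp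
    by_cases hj : j.val = 0
    · rw [if_pos (this.2 hj), if_pos hj]; simp; field_simp; rw [hs']; ring
    · rw [if_neg (mt this.1 hj), if_neg hj]
  · by_cases h : i.val + 1 < n
    · rw [s_lt_apply _ h, pt_apply, pt_apply]
      simp only [h, if_true]
      congr 2
      by_cases h1 : j = i
      · subst h1; simp; ring
      · have h1' : j.val ≠ i.val := fun hh => h1 (Fin.ext hh)
        by_cases h2 : j = ⟨i.val + 1, h⟩
        · subst h2; simp; ring
        · have h2' : j.val ≠ i.val + 1 := fun hh => h2 (Fin.ext hh)
          rw [Equiv.swap_apply_of_ne_of_ne h1 h2]; simp [h1', h2']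
    · rw [s_last_apply _ h, pt_apply, pt_apply, pt_apply]
      simp only [h, if_false]
      by_cases h1 : j = i
      · subst h1; simp; ring
      · have h1' : j.val ≠ i.val := fun hh => h1 (Fin.ext hh)
        simp [h1, h1']

/-- The reflection `s_i` preserves the positivity of all roots but `α_i`. -/
theorem eq_al (h0 : p.hbar ≠ 0) {f : V n → ℂ} (hf : f ∈ p.rts) (i : Option (Fin n))
    (h1 : 0 < p.hv n (f (p.X0 n))) (h2 : p.hv n (f (p.s i (p.X0 n))) < 0) : f = p.al i := by
  obtain ⟨a, b, ε, δ, m, hab, hf⟩ := hf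
  obtain ⟨y, hy, hy'⟩ := s_X0 h0 i
  rw [hy, hv_rts h0 hf] at h2
  rw [X0, hv_rts h0 hf] at h1
  replace h1 := (Int.cast_pos (R := ℝ)).1 h1
  replace h2 := (Int.cast_lt_zero (R := ℝ)).1 h2
  rw [hy' a, hy' b] at h2
  have ha := a.2
  have hb := b.2
  have hab' : a.val = b.val → ε = δ := fun h => hab (Fin.ext h)
  have hm := mul_scale_cases (n := n) m
  simp only [scale] at hm h1 h2
  have hz : ((0 : Fin n) : ℕ) = 0 := by simp
  funext x
  rw [hf]
  rcases i with _ | i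
  · rw [al_none]
    have : ε = -1 ∧ δ = -1 ∧ a.val = 0 ∧ b.val = 0 ∧ m = 1 := by
      simp only at h2
      rcases Int.units_eq_one_or ε with rfl | rfl <;> rcases Int.units_eq_one_or δ with rfl | rfl <;>
        simp at h1 h2 hab' ⊢ <;> split_ifs at h2 <;> omega
    obtain ⟨rfl, rfl, ha, hb, rfl⟩ := this
    rw [show a = 0 from Fin.ext (by simpa using ha), show b = 0 from Fin.ext (by simpa using hb)]
    push_cast; ring
  · by_cases h : i.val + 1 < n
    · simp only [h, if_true] at h2
      rw [al_lt _ h]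
      have : m = 0 ∧ ((ε = 1 ∧ δ = -1 ∧ a.val = i.val ∧ b.val = i.val + 1) ∨
          (ε = -1 ∧ δ = 1 ∧ a.val = i.val + 1 ∧ b.val = i.val)) := by
        rcases Int.units_eq_one_or ε with rfl | rfl <;>
          rcases Int.units_eq_one_or δ with rfl | rfl <;>
          simp at h1 h2 hab' ⊢ <;> split_ifs at h2 <;> omega
      obtain ⟨rfl, ⟨rfl, rfl, ha, hb⟩ | ⟨rfl, rfl, ha, hb⟩⟩ := this
      · rw [show a = i from Fin.ext ha, show b = ⟨i.val + 1, h⟩ from Fin.ext hb]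
        push_cast; ring
      · rw [show b = i from Fin.ext hb, show a = ⟨i.val + 1, h⟩ from Fin.ext ha]
        push_cast; ring
    · simp only [h, if_false] at h2
      have hi := i.2
      rw [al_last _ h]
      have : ε = 1 ∧ δ = 1 ∧ a.val = i.val ∧ b.val = i.val ∧ m = 0 := by
        rcases Int.units_eq_one_or ε with rfl | rfl <;>
          rcases Int.units_eq_one_or δ with rfl | rfl <;>
          simp at h1 h2 hab' ⊢ <;> split_ifs at h2 <;> omega
      obtain ⟨rfl, rfl, ha, hb, rfl⟩ := this
      rw [show a = i from Fin.ext ha, show b = i from Fin.ext hb]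
      push_cast; ring

/-- Conjugation of simple reflections. -/
theorem s_mul_eq_mul_s {g : V n ≃ᵃ[ℂ] V n} (hg : g ∈ p.affW n) {i j : Option (Fin n)}
    (h : ∀ x, p.al i (g x) = p.al j x) : p.s i * g = g * p.s j := by
  have hlin : ∀ v x, g (x - v) = g x - g.linear v := fun v x => by
    have := g.map_vadd x (-v)
    rw [sub_eq_neg_add, ← vadd_eq_add, this, map_neg, vadd_eq_add, sub_eq_neg_add]
  have h1 : g.linear (affLin j) = affLin i := by
    apply eq_of_form_eq
    intro z
    obtain ⟨x, rfl⟩ := g.linear.surjective z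
    rw [form_linear p hg]
    have h2 := h (0 - x)
    have h3 := h 0
    rw [hlin] at h2
    simp only [al, form_sub] at h2 h3
    linear_combination h2 - h3
  have h2 : g.linear (check (affLin j)) = check (affLin i) := by
    rw [check, check, map_smul, h1, ← h1, form_linear p hg]
  ext x : 1
  change p.s i (g x) = g (p.s j x)
  rw [s_apply, s_apply, hlin, map_smul, h, h2]

/-- Along the gallery from X_0 given by the prefixes of the word, f goes from positive to negative.
At the step where the sign changes, the pulled back root is made negative by one simple reflection,
so it is simple by `eq_al`. -/
theorem exchange (h0 : p.hbar ≠ 0) (l : List (Option (Fin n))) : ∀ f ∈ p.rts (n := n),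
    0 < p.hv n (f (p.X0 n)) → p.hv n (f (p.wordProd l (p.X0 n))) < 0 →
    ∃ l₁ j l₂, l = l₁ ++ j :: l₂ ∧ ∀ x, f (p.wordProd l₁ x) = p.al j x := by
  induction l with
  | nil => intro f _ h1 h2; exact absurd h1 h2.le.not_gt
  | cons j l ih =>
    intro f hf h1 h2
    have hf' := p.rts_comp hf (p.s_mem j)
    rcases (hv_X0_ne h0 hf').lt_or_gt with h3 | h3
    · exact ⟨[], j, l, rfl, fun x => by rw [eq_al h0 hf j h1 h3]; rfl⟩
    · rw [wordProd_cons] at h2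
      obtain ⟨l₁, k, l₂, rfl, h⟩ := ih _ hf' h3 h2
      exact ⟨j :: l₁, k, l₂, rfl, fun x => by rw [wordProd_cons]; exact h x⟩

/-- If α_i were negative at X_0, then `eq_al` applied to −α_i would give −α_i = α_i. -/
theorem al_X0_pos (h0 : p.hbar ≠ 0) (i : Option (Fin n)) : 0 < p.hv n (p.al i (p.X0 n)) := by
  rcases (hv_X0_ne h0 (p.al_mem i)).lt_or_gt with h | h
  · have h3 := eq_al h0 (p.rts_neg (p.al_mem i)) i (by rw [hv_neg]; linarith)
      (by rw [al_s, neg_neg]; exact h)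
    have h4 := congrFun h3 (p.X0 n)
    have h5 : p.al i (p.X0 n) = 0 := by linear_combination (-1 / 2 : ℂ) * h4
    rw [h5] at h
    simp [hv] at h
  · exact h

/-- The exchange condition in deletion form: the root found by `exchange` conjugates s_i past the
prefix into the letter j, and the two copies of s_j cancel. -/
theorem exists_shorter (h0 : p.hbar ≠ 0) (i : Option (Fin n)) (l : List (Option (Fin n)))
    (h : p.hv n (p.al i (p.wordProd l (p.X0 n))) < 0) :
    ∃ l', p.wordProd l' = p.s i * p.wordProd l ∧ l'.length + 1 = l.length := by
  obtain ⟨l₁, j, l₂, rfl, hj⟩ := exchange h0 l _ (p.al_mem i) (al_X0_pos h0 i) h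
  refine ⟨l₁ ++ l₂, ?_, by simp; omega⟩
  rw [wordProd_append, wordProd_append, wordProd_cons, ← mul_assoc,
    s_mul_eq_mul_s (p.wordProd_mem l₁) hj, mul_assoc, ← mul_assoc (p.s j), s_mul_self, one_mul]

theorem exists_reduced {w : V n ≃ᵃ[ℂ] V n} (hw : w ∈ p.affW n) : ∃ l, p.IsReducedWord w l := by
  classical
  have hex : ∃ k, ∃ l, p.wordProd l = w ∧ l.length = k := by
    obtain ⟨l, hl⟩ := p.mem_affW_iff.1 hw; exact ⟨_, l, hl, rfl⟩
  obtain ⟨l, hl, hk⟩ := Nat.find_spec hex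
  exact ⟨l, hl, fun l' hl' => by rw [hk]; exact Nat.find_min' hex ⟨l', hl', rfl⟩⟩

theorem IsReducedWord.tail {w : V n ≃ᵃ[ℂ] V n} {i l} (h : p.IsReducedWord w (i :: l)) :
    p.IsReducedWord (p.s i * w) l := by
  constructor
  · rw [← h.1, wordProd_cons, ← mul_assoc, s_mul_self, one_mul]
  · intro l' hl'
    have := h.2 (i :: l') (by rw [wordProd_cons, hl', ← mul_assoc, s_mul_self, one_mul])
    simpa using this

theorem al_ne (h0 : p.hbar ≠ 0) {w : V n ≃ᵃ[ℂ] V n} (hw : w ∈ p.affW n) (i : Option (Fin n)) :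
    p.hv n (p.al i (w (p.X0 n))) ≠ 0 := 
  hv_X0_ne h0 (f := fun x => p.al i (w x)) (p.rts_comp (p.al_mem i) hw)

/-- With `IsReducedWord.cons`, this says that the sign of α_i at wX_0 decides whether s_i shortens
or lengthens w. -/
theorem IsReducedWord.head (h0 : p.hbar ≠ 0) {w : V n ≃ᵃ[ℂ] V n} {i l}
    (h : p.IsReducedWord w (i :: l)) : p.hv n (p.al i (w (p.X0 n))) < 0 := by
  have hw : w ∈ p.affW n := by rw [← h.1]; exact p.wordProd_mem _
  by_contra! hc
  have hc := lt_of_le_of_ne hc (al_ne h0 hw i).symm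
  have h2 : p.hv n (p.al i (p.wordProd l (p.X0 n))) < 0 := by
    rw [h.tail.1]
    change p.hv n (p.al i (p.s i (w (p.X0 n)))) < 0
    rw [al_s, hv_neg]; linarith
  obtain ⟨l', hl', hlen⟩ := exists_shorter h0 i l h2
  have := h.2 l' (by rw [hl', h.tail.1, ← mul_assoc, s_mul_self, one_mul])
  simp at this
  omega

theorem IsReducedWord.cons (h0 : p.hbar ≠ 0) {w : V n ≃ᵃ[ℂ] V n} {i l} (h : p.IsReducedWord w l)
    (hi : 0 < p.hv n (p.al i (w (p.X0 n)))) : p.IsReducedWord (p.s i * w) (i :: l) := by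
  refine ⟨by rw [wordProd_cons, h.1], fun l' hl' => ?_⟩
  obtain ⟨l'', hl'', hlen⟩ := exists_shorter h0 i l' (by
    rw [hl']
    change p.hv n (p.al i (p.s i (w (p.X0 n)))) < 0
    rw [al_s, hv_neg]; linarith)
  have := h.2 l'' (by rw [hl'', hl', ← mul_assoc, s_mul_self, one_mul])
  simp; omega

end Params
end AffineWeyl
end Koornwinder
end

noncomputable section
set_option linter.unusedSectionVars false
namespace Koornwinder

/-! ### Demazure–Lusztig operators in a skew group algebra -/

section DemazureLusztig

variable {K G : Type*} [Field K] [Group G] [MulSemiringAction G K]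

open SkewMonoidAlgebra

/-- The operator `a + (t - a) s`. -/
def dl (s : G) (t a : K) : SkewMonoidAlgebra K G := single 1 a + single s (t - a)

theorem dl_comm {s r : G} {t a t' a' : K} (h : s * r = r * s) (h1 : s • a' = a') (h2 : s • t' = t')
    (h3 : r • a = a) (h4 : r • t = t) : dl s t a * dl r t' a' = dl r t' a' * dl s t a := by
  simp only [dl, mul_add, add_mul, single_mul_single, one_smul, one_mul, mul_one, smul_sub, h1, h2,
    h3, h4, h, mul_comm a', mul_comm (t' - a')]
  abel

theorem dl_sq {s : G} {t k a : K} (hs : s * s = 1) (ht : s • t = t) (ha : s • a = k - a)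
    (hk : t * (t - k) = 1) : dl s t a * dl s t a = single 1 k * dl s t a + 1 := by
  simp only [dl, mul_add, add_mul, single_mul_single, one_smul, one_mul, mul_one, smul_sub, ha, ht,
    hs, one_def]
  have h1 : a * a + (t - a) * (t - (k - a)) = k * a + 1 := by linear_combination hk
  have h2 : a * (t - a) + (t - a) * (k - a) = k * (t - a) := by ring
  have h1' := congrArg (single (1 : G)) h1
  have h2' := congrArg (single s) h2
  simp only [single_add] at h1' h2'
  linear_combination (norm := abel) h1' + h2'

/-- Coefficients at the six elements of the dihedral group are compared. The identities e1, e2, e3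
are multiples of `rel`, the addition law for the coefficients a, b, d attached to the three positive
roots of A_2; the other three are commutativity. -/
theorem dl_braid3 {s r : G} {t k a b d : K} (hs : s * s = 1) (hr : r * r = 1)
    (h : s * (r * s) = r * (s * r)) (hst : s • t = t) (hrt : r • t = t)
    (sa : s • a = k - a) (rb : r • b = k - b) (sb : s • b = d) (ra : r • a = d) (sd : s • d = b)
    (rd : r • d = a) (rel : a * b = d * (a + b - k)) :
    dl s t a * (dl r t b * dl s t a) = dl r t b * (dl s t a * dl r t b) := by
  have e1 := congrArg (single (1 : G)) (show a * (b * a) + (t - a) * (d * (t - (k - a))) =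
    b * (a * b) + (t - b) * (d * (t - (k - b))) by linear_combination (a - b) * rel)
  have e2 := congrArg (single s) (show a * (b * (t - a)) + (t - a) * (d * (k - a)) =
    b * ((t - a) * d) by linear_combination (t - a) * rel)
  have e3 := congrArg (single r) (show a * ((t - b) * d) =
    b * (a * (t - b)) + (t - b) * (d * (k - b)) by linear_combination (b - t) * rel)
  have e4 := congrArg (single (r * s)) (show a * ((t - b) * (t - d)) = (t - b) * ((t - d) * a) by
    ring)
  have e5 := congrArg (single (s * r)) (show (t - a) * ((t - d) * b) = b * ((t - a) * (t - d)) by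
    ring)
  have e6 := congrArg (single (r * (s * r))) (show (t - a) * ((t - d) * (t - b)) =
    (t - b) * ((t - d) * (t - a)) by ring)
  simp only [dl, mul_add, add_mul, single_mul_single, one_smul, one_mul, mul_one, smul_sub,
    smul_mul', sa, sb, sd, ra, rb, rd, hst, hrt, h, hs, hr]
  simp only [single_add] at e1 e2 e3
  linear_combination (norm := abel) e1 + e2 + e3 + e4 + e5 + e6

/-- The analogue for C_2: a, a' belong to the short positive roots and b, b' to the long ones. Of
the eight coefficient identities, e1 to e4 are multiples of `rel` and the others hold without it. -/
theorem dl_braid4 {s r : G} {t k a a' T l b b' : K} (hs : s * s = 1) (hr : r * r = 1)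
    (h : s * (r * (s * r)) = r * (s * (r * s))) (hst : s • t = t) (hrt : r • t = t)
    (hsT : s • T = T) (hrT : r • T = T) (hsl : s • l = l) (hrk : r • k = k)
    (sa : s • a = k - a) (rb : r • b = l - b) (sb : s • b = b') (ra : r • a = a') (sa' : s • a' = a')
    (rb' : r • b' = b') (sb' : s • b' = b) (ra' : r • a' = a)
    (rel : a * b + a' * (l - b) + b' * (k - a - a') = 0) :
    dl s t a * (dl r T b * (dl s t a * dl r T b)) =
      dl r T b * (dl s t a * (dl r T b * dl s t a)) := by
  have hs' : ∀ g, s * (s * g) = g := fun g => by rw [← mul_assoc, hs, one_mul]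
  have hr' : ∀ g, r * (r * g) = g := fun g => by rw [← mul_assoc, hr, one_mul]
  have e1 := congrArg (single r) (show a * (b * (a * (T - b))) + a * ((T - b) * (a' * (l - b))) +
      (t - a) * (b' * ((t - (k - a)) * (T - b))) = b * (a * ((T - b) * a')) +
      (T - b) * (a' * ((l - b) * a')) + (T - b) * ((t - a') * (b' * (t - (k - a')))) by
    linear_combination (a - a') * (T - b) * rel)
  have e2 := congrArg (single s) (show a * (b * ((t - a) * b')) + (t - a) * (b' * ((k - a) * b')) +
      (t - a) * ((T - b') * (a' * (T - (l - b')))) = b * (a * (b * (t - a))) +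
      b * ((t - a) * (b' * (k - a))) + (T - b) * (a' * ((T - (l - b)) * (t - a))) by
    linear_combination (b' - b) * (t - a) * rel)
  have e3 := congrArg (single (s * r)) (show a * (b * ((t - a) * (T - b'))) +
      (t - a) * (b' * ((k - a) * (T - b'))) + (t - a) * ((T - b') * (a' * (l - b'))) =
      b * ((t - a) * ((T - b') * a')) by linear_combination (t - a) * (T - b') * rel)
  have e4 := congrArg (single (r * s)) (show a * ((T - b) * ((t - a') * b')) =
      b * (a * ((T - b) * (t - a'))) + (T - b) * (a' * ((l - b) * (t - a'))) +
      (T - b) * ((t - a') * (b' * (k - a'))) by linear_combination - (T - b) * (t - a') * rel)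
  have e5 := congrArg (single (1 : G)) (show a * (b * (a * b)) +
      a * ((T - b) * (a' * (T - (l - b)))) + (t - a) * (b' * ((t - (k - a)) * b)) =
      b * (a * (b * a)) + b * ((t - a) * (b' * (t - (k - a)))) +
      (T - b) * (a' * ((T - (l - b)) * a)) by ring)
  have e6 := congrArg (single (r * (s * r))) (show a * ((T - b) * ((t - a') * (T - b'))) =
    (T - b) * ((t - a') * ((T - b') * a)) by ring)
  have e7 := congrArg (single (s * (r * s))) (show (t - a) * ((T - b') * ((t - a') * b)) =
    b * ((t - a) * ((T - b') * (t - a'))) by ring)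
  have e8 := congrArg (single (r * (s * (r * s)))) (show (t - a) * ((T - b') * ((t - a') * (T - b))) =
    (T - b) * ((t - a') * ((T - b') * (t - a))) by ring)
  simp only [dl, mul_add, add_mul, single_mul_single, one_smul, one_mul, mul_one, smul_sub,
    smul_mul', sa, sb, sa', sb', ra, rb, ra', rb', hst, hrt, hsT, hrT, hsl, hrk, h, hs, hr, hs', hr']
  simp only [single_add] at e1 e2 e3 e4 e5
  linear_combination (norm := abel) e1 + e2 + e3 + e4 + e5 + e6 + e7 + e8

end DemazureLusztig
end Koornwinder
end

noncomputable section
set_option linter.unusedSectionVars false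
namespace Koornwinder

/-! ### Exponentials of affine functions -/

section Exponentials

variable {n : ℕ}

/-- Affine functions on `V`. -/
def Aff (f : V n → ℂ) : Prop := ∃ a c, ∀ x, f x = form a x + c

theorem Aff.const (c : ℂ) : Aff (fun _ : V n => c) := ⟨0, c, fun x => by simp [form]⟩

theorem Aff.add {f g : V n → ℂ} (hf : Aff f) (hg : Aff g) : Aff (fun x => f x + g x) := by
  obtain ⟨a, c, hf⟩ := hf
  obtain ⟨b, d, hg⟩ := hg
  refine ⟨a + b, c + d, fun x => ?_⟩
  change f x + g x = _
  rw [hf, hg, form_comm (a + b), form_add, form_comm a, form_comm b]; ring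

theorem Aff.mul {f : V n → ℂ} (hf : Aff f) (r : ℂ) : Aff (fun x => r * f x) := by
  obtain ⟨a, c, hf⟩ := hf
  refine ⟨r • a, r * c, fun x => ?_⟩
  change r * f x = _
  rw [hf, form_comm (r • a), form_smul, form_comm a]; ring

theorem Aff.neg {f : V n → ℂ} (hf : Aff f) : Aff (fun x => - f x) := by
  simpa using hf.mul (-1)

theorem Aff.coord (j : Fin n) : Aff (fun x : V n => x j) := ⟨e j, 0, fun x => by simp [form_e]⟩

theorem Aff.sum {ι : Type*} (s : Finset ι) {f : ι → V n → ℂ} (h : ∀ i ∈ s, Aff (f i)) :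
    Aff (fun x => ∑ i ∈ s, f i x) := by
  classical
  induction s using Finset.induction_on with
  | empty => simpa using Aff.const 0
  | insert a s ha ih =>
    simp only [Finset.sum_insert ha]
    exact (h a (by simp)).add (ih fun i hi => h i (by simp [hi]))

theorem Aff.comp {f : V n → ℂ} (hf : Aff f) (g : V n ≃ᵃ[ℂ] V n) : Aff (fun x => f (g x)) := by
  obtain ⟨a, c, hf⟩ := hf
  have h : ∀ x, f (g x) = ∑ j, x j * form a (g.linear (e j)) + (form a (g 0) + c) := by
    intro x
    have hx : x = ∑ j, x j • e j := by ext j; simp [e, Pi.single_apply]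
    have : g x = g.linear x + g 0 := by simpa using g.map_vadd 0 x
    rw [hf, this, form_add, add_assoc]
    congr 1
    have hl : ∀ (s : Finset (Fin n)), form a (g.linear (∑ j ∈ s, x j • e j)) =
        ∑ j ∈ s, x j * form a (g.linear (e j)) := by
      intro s
      classical
      induction s using Finset.induction_on with
      | empty => simp [form]
      | insert j s hj ih =>
        rw [Finset.sum_insert hj, Finset.sum_insert hj, map_add, form_add, ih, map_smul, form_smul]
    conv_lhs => rw [hx]
    exact hl _
  refine (funext h : (fun x => f (g x)) = _) ▸ ?_
  exact (Aff.sum _ fun j _ => by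
    simpa [mul_comm] using (Aff.coord j).mul (form a (g.linear (e j)))).add (Aff.const _)

open Classical in
/-- The entire function `e^f`, for an affine function `f`. -/
def exn (f : V n → ℂ) : Hol (V n) :=
  if h : (fun x => Complex.exp (f x)) ∈ Hol (V n) then ⟨_, h⟩ else 1

theorem exn_apply {f : V n → ℂ} (hf : Aff f) (x : V n) : (exn f).1 x = Complex.exp (f x) := by
  obtain ⟨a, c, hf⟩ := hf
  have h : (fun x => Complex.exp (f x)) ∈ Hol (V n) := by
    have : (fun x => Complex.exp (f x)) = (Params.expHol a c).1 := by
      funext x; rw [hf]; rfl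
    rw [this]; exact (Params.expHol a c).2
  rw [exn, dif_pos h]

theorem hol_ext {P : Type*} {E : Type*} [NormedAddCommGroup E] [NormedSpace ℂ E] [AddTorsor E P]
    {f g : Hol P} (h : ∀ x, f.1 x = g.1 x) : f = g :=
  Subtype.ext (funext h)

/-- Entire functions as meromorphic functions. -/
abbrev toM (f : Hol (V n)) : Mer (V n) := algebraMap (Hol (V n)) (Mer (V n)) f

theorem toM_injective : Function.Injective (toM (n := n)) := IsFractionRing.injective _ _

theorem toM_ne_zero {f : Hol (V n)} {x : V n} (h : f.1 x ≠ 0) : toM f ≠ 0 := by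
  intro h0
  rw [toM, map_eq_zero_iff _ (IsFractionRing.injective _ _)] at h0
  rw [h0] at h
  exact h rfl

theorem smul_toM (g : V n ≃ᵃ[ℂ] V n) (f : Hol (V n)) : g • toM f = toM (g • f) :=
  IsFractionRing.ringEquivOfRingEquiv_algebraMap
    (MulSemiringAction.toRingEquiv (V n ≃ᵃ[ℂ] V n) (Hol (V n)) g) f

theorem smul_hol_apply (g : V n ≃ᵃ[ℂ] V n) (f : Hol (V n)) (x : V n) :
    (g • f).1 x = f.1 (g⁻¹ x) := rfl

theorem smul_C (g : V n ≃ᵃ[ℂ] V n) (c : ℂ) :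
    g • algebraMap ℂ (Mer (V n)) c = algebraMap ℂ (Mer (V n)) c := smul_algebraMap g c

/-- The meromorphic function `e^f`. -/
def exM (f : V n → ℂ) : Mer (V n) := toM (exn f)

theorem exM_add {f g : V n → ℂ} (hf : Aff f) (hg : Aff g) :
    exM f * exM g = exM (fun x => f x + g x) := by
  rw [exM, exM, exM, toM, ← map_mul]
  congr 1
  refine hol_ext fun x => ?_
  change (exn f).1 x * (exn g).1 x = _
  rw [exn_apply hf, exn_apply hg, exn_apply (hf.add hg), Complex.exp_add]

theorem exM_zero : exM (fun _ : V n => 0) = 1 := by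
  rw [exM, ← map_one (algebraMap (Hol (V n)) (Mer (V n)))]
  congr 1
  refine hol_ext fun x => ?_
  rw [exn_apply (Aff.const 0), Complex.exp_zero]; rfl

theorem exM_ne_zero {f : V n → ℂ} (hf : Aff f) : exM f ≠ 0 :=
  toM_ne_zero (x := 0) (by rw [exn_apply hf]; exact Complex.exp_ne_zero _)

theorem exM_neg {f : V n → ℂ} (hf : Aff f) : exM (fun x => - f x) = (exM f)⁻¹ := by
  refine eq_inv_of_mul_eq_one_left ?_
  rw [exM_add hf.neg hf]
  simp [exM_zero]

theorem smul_exM (g : V n ≃ᵃ[ℂ] V n) {f : V n → ℂ} (hf : Aff f) :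
    g • exM f = exM (fun x => f (g⁻¹ x)) := by
  rw [exM, smul_toM, exM]
  congr 1
  refine hol_ext fun x => ?_
  rw [smul_hol_apply, exn_apply hf, exn_apply (hf.comp g⁻¹)]

theorem one_sub_exM_ne {f : V n → ℂ} (hf : Aff f) {x : V n} (h : Complex.exp (f x) ≠ 1) :
    1 - exM f ≠ 0 := by
  have : 1 - exM f = toM (1 - exn f) := by rw [toM, map_sub, map_one]; rfl
  rw [this]
  refine toM_ne_zero (x := x) ?_
  change 1 - (exn f).1 x ≠ 0
  rw [exn_apply hf]
  exact sub_ne_zero.2 h.symm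

end Exponentials

namespace Params

variable {n : ℕ} [NeZero n] (p : Params)

theorem aff_al (i : Option (Fin n)) : Aff (p.al i) := ⟨affLin i, p.affConst i, fun _ => rfl⟩

theorem expAff_eq (r : ℂ) (i : Option (Fin n)) : p.expAff r i = exM fun x => -(r * p.al i x) := by
  rw [expAff, exM]
  congr 1
  refine hol_ext fun x => ?_
  rw [exn_apply ((p.aff_al i).mul r).neg]
  change Complex.exp (form (-(r • affLin i)) x + _) = _
  congr 1
  rw [al, form_comm, ← neg_smul, form_smul, form_comm]
  ring

/-- `X_i = e^{-α_i}`. -/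
def XX (i : Option (Fin n)) : Mer (V n) := exM fun x => - p.al i x

/-- `Z_i = e^{-α_i/2}`. -/
def ZZ (i : Option (Fin n)) : Mer (V n) := exM fun x => -(1 / 2 * p.al i x)

theorem ZZ_sq (i : Option (Fin n)) : p.ZZ i ^ 2 = p.XX i := by
  rw [sq, ZZ, exM_add ((p.aff_al i).mul _).neg ((p.aff_al i).mul _).neg, XX]
  congr 1; funext x; ring

/-- Complex constants as meromorphic functions. -/
abbrev cM (c : ℂ) : Mer (V n) := algebraMap ℂ (Mer (V n)) c

/-- `t_i` as a meromorphic function. -/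
def tM (i : Option (Fin n)) : Mer (V n) := cM (p.t i : ℂ)

/-- `t_i - t_i⁻¹` as a meromorphic function. -/
def kM (i : Option (Fin n)) : Mer (V n) := cM ((p.t i : ℂ) - (p.t i : ℂ)⁻¹)

theorem tM_ne (i : Option (Fin n)) : p.tM i ≠ 0 := by
  rw [tM, cM, map_ne_zero_iff _ (FaithfulSMul.algebraMap_injective _ _)]; exact (p.t i).ne_zero

theorem tM_mul (i : Option (Fin n)) : p.tM i * (p.tM i - p.kM i) = 1 := by
  rw [tM, kM, cM, cM, map_sub, map_inv₀]
  have := p.tM_ne i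
  rw [tM, cM] at this
  field_simp
  ring

/-- The coefficient at `1` in `T_i`. -/
def aM (i : Option (Fin n)) : Mer (V n) := p.tM i - p.coef i

theorem T_eq (i : Option (Fin n)) : p.T i = dl (p.s i) (p.tM i) (p.aM i) := by
  rw [T, dl, aM, sub_sub_cancel, mul_sub, SkewMonoidAlgebra.single_mul_single, mul_one, one_mul,
    smul_one, mul_one, sub_eq_add_neg, sub_eq_add_neg, SkewMonoidAlgebra.single_add,
    SkewMonoidAlgebra.single_neg]
  change SkewMonoidAlgebra.single 1 (p.tM i) + _ = _
  abel

theorem exists_al_exp (i : Option (Fin n)) : ∃ x, Complex.exp (- p.al i x) ≠ 1 := by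
  have : ∃ x, p.al i x = 1 := by
    rcases i with _ | i
    · refine ⟨WithLp.toLp 2 fun _ => (p.hbar - 1) / 2, ?_⟩
      rw [al_none]; simp; ring
    · by_cases h : i.val + 1 < n
      · refine ⟨WithLp.toLp 2 fun j => if j = i then 1 else 0, ?_⟩
        have hne : i ≠ ⟨i.val + 1, h⟩ := fun hh => by simpa using congrArg Fin.val hh
        rw [al_lt _ h]; simp [hne.symm]
      · refine ⟨WithLp.toLp 2 fun j => 1 / 2, ?_⟩
        rw [al_last _ h]; simp
  obtain ⟨x, hx⟩ := this
  refine ⟨x, ?_⟩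
  rw [hx]
  intro h
  have h2 := congrArg (fun z : ℂ => ‖z‖) h
  simp only [Complex.norm_exp] at h2
  simp at h2

theorem one_sub_XX (i : Option (Fin n)) : 1 - p.XX i ≠ 0 := by
  obtain ⟨x, hx⟩ := p.exists_al_exp i
  exact one_sub_exM_ne (p.aff_al i).neg hx

/-- The short affine simple roots. -/
def IsShort (i : Option (Fin n)) : Prop := ∃ j : Fin n, i = some j ∧ j.val + 1 < n

/-- Since u_i = 1, the two factors combine and e^{−α_i/2} disappears. This matters because half a
short root has no integral coefficients, and only exponentials of integral functions behave well
under reflections later on. -/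
theorem coef_short {i : Option (Fin n)} (h : IsShort i) :
    p.coef i = (p.tM i)⁻¹ * (1 - p.tM i ^ 2 * p.XX i) / (1 - p.XX i) := by
  obtain ⟨j, rfl, hj⟩ := h
  have hu : p.u (some j) = 1 := by
    rw [u, if_neg]; rw [lastNode_iff]; exact not_not.2 hj
  rw [coef, hu, expAff_eq, expAff_eq]
  change _ * ((1 - _ * p.ZZ (some j)) * (1 + _ * p.ZZ (some j))) / _ = _
  rw [← ZZ_sq]
  have : (exM fun x => -(1 * p.al (some j) x)) = p.ZZ (some j) ^ 2 := by
    rw [ZZ_sq, XX]; simp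
  rw [this]
  simp only [Units.val_one, mul_one, inv_one, Units.val_inv_eq_inv_val, map_inv₀]
  change (p.tM _)⁻¹ * ((1 - p.tM _ * _) * (1 + p.tM _ * _)) / _ = _
  ring

/-- `u_i` as a meromorphic function. -/
def uM (i : Option (Fin n)) : Mer (V n) := cM (p.u i : ℂ)

theorem uM_ne (i : Option (Fin n)) : p.uM i ≠ 0 := by
  rw [uM, cM, map_ne_zero_iff _ (FaithfulSMul.algebraMap_injective _ _)]; exact (p.u i).ne_zero

theorem coef_eq (i : Option (Fin n)) : p.coef i = (p.tM i)⁻¹ *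
    ((1 - p.tM i * p.uM i * p.ZZ i) * (1 + p.tM i * (p.uM i)⁻¹ * p.ZZ i)) / (1 - p.ZZ i ^ 2) := by
  rw [coef, expAff_eq, expAff_eq]
  have : (exM fun x => -(1 * p.al i x)) = p.ZZ i ^ 2 := by
    rw [ZZ_sq, XX]; simp
  rw [this]
  simp only [Units.val_inv_eq_inv_val, map_inv₀, map_mul]
  rfl

theorem aM_short {i : Option (Fin n)} (h : IsShort i) : p.aM i = p.kM i / (1 - p.XX i) := by
  have h1 := p.one_sub_XX i
  have h2 := p.tM_ne i
  have h3 := p.tM_mul i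
  rw [aM, p.coef_short h]
  field_simp
  linear_combination h3

/-- `u_i - u_i⁻¹` as a meromorphic function. -/
def lM (i : Option (Fin n)) : Mer (V n) := p.uM i - (p.uM i)⁻¹

/-- In this form s_i, which inverts Z_i = e^{−α_i/2}, visibly sends a_i to k_i − a_i; that is the
quadratic relation. -/
theorem aM_eq (i : Option (Fin n)) :
    p.aM i = (p.kM i + p.lM i * p.ZZ i) / (1 - p.ZZ i ^ 2) := by
  have h1 := p.one_sub_XX i
  rw [← ZZ_sq] at h1
  have h2 := p.tM_ne i
  have h3 := p.tM_mul i
  have h4 := p.uM_ne i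
  have h5 : p.kM i = p.tM i - (p.tM i)⁻¹ := by field_simp; linear_combination -h3
  rw [aM, coef_eq, h5, lM]
  field_simp
  ring

end Params
end Koornwinder
end

noncomputable section
set_option linter.unusedSectionVars false
namespace Koornwinder
namespace Params

variable {n : ℕ} [NeZero n] {p : Params}

/-! ### Braid relations -/

theorem smul_XX (i : Option (Fin n)) (g : V n ≃ᵃ[ℂ] V n) :
    g • p.XX i = exM fun x => - p.al i (g⁻¹ x) := smul_exM g (p.aff_al i).neg

theorem smul_ZZ (i : Option (Fin n)) (g : V n ≃ᵃ[ℂ] V n) :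
    g • p.ZZ i = exM fun x => -(1 / 2 * p.al i (g⁻¹ x)) := smul_exM g ((p.aff_al i).mul _).neg

theorem smul_tM (i : Option (Fin n)) (g : V n ≃ᵃ[ℂ] V n) : g • p.tM i = p.tM i := smul_C _ _

theorem smul_kM (i : Option (Fin n)) (g : V n ≃ᵃ[ℂ] V n) : g • p.kM i = p.kM i := smul_C _ _

theorem smul_uM (i : Option (Fin n)) (g : V n ≃ᵃ[ℂ] V n) : g • p.uM i = p.uM i := smul_C _ _

theorem smul_lM (i : Option (Fin n)) (g : V n ≃ᵃ[ℂ] V n) : g • p.lM i = p.lM i := by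
  rw [lM, smul_sub, smul_inv₀', smul_uM]

theorem XX_ne (i : Option (Fin n)) : p.XX i ≠ 0 := exM_ne_zero (p.aff_al i).neg

theorem ZZ_ne (i : Option (Fin n)) : p.ZZ i ≠ 0 := exM_ne_zero ((p.aff_al i).mul _).neg

theorem s_smul_ZZ (i : Option (Fin n)) : p.s i • p.ZZ i = (p.ZZ i)⁻¹ := by
  rw [smul_ZZ, s_inv, ZZ, ← exM_neg ((p.aff_al i).mul _).neg]
  congr 1; funext x; rw [al_s]; ring

theorem s_smul_aM (i : Option (Fin n)) : p.s i • p.aM i = p.kM i - p.aM i := by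
  have h1 := p.one_sub_XX i
  rw [← ZZ_sq] at h1
  have h2 := ZZ_ne (p := p) i
  have h3 : p.ZZ i ^ 2 - 1 ≠ 0 := fun h => h1 (by linear_combination -h)
  rw [aM_eq, smul_div₀', smul_sub, smul_add, smul_mul', smul_pow', smul_one, s_smul_ZZ, smul_kM,
    smul_lM]
  field_simp
  ring

theorem T_sq (i : Option (Fin n)) :
    p.T i * p.T i = algebraMap ℂ (Op (V n)) ((p.t i : ℂ) - (p.t i : ℂ)⁻¹) * p.T i + 1 := by
  rw [T_eq]
  exact dl_sq (p.s_mul_self i) (smul_tM _ _) (s_smul_aM i) (p.tM_mul i)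

theorem smul_aM_of_fix {i j : Option (Fin n)} (h : ∀ x : V n, p.al j (p.s i x) = p.al j x) :
    p.s i • p.aM j = p.aM j := by
  have : p.s i • p.ZZ j = p.ZZ j := by
    rw [smul_ZZ, s_inv, ZZ]; congr 1; funext x; rw [h]
  rw [aM_eq, smul_div₀', smul_sub, smul_add, smul_mul', smul_pow', smul_one, this, smul_kM, smul_lM]

theorem s_comm {i j : Option (Fin n)} (h : ∀ x : V n, p.al i (p.s j x) = p.al i x) :
    p.s i * p.s j = p.s j * p.s i := s_mul_eq_mul_s (p.s_mem j) h

theorem T_comm {i j : Option (Fin n)} (h : ∀ x : V n, p.al i (p.s j x) = p.al i x)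
    (h' : ∀ x : V n, p.al j (p.s i x) = p.al j x) : p.T i * p.T j = p.T j * p.T i := by
  rw [T_eq, T_eq]
  exact dl_comm (s_comm h) (smul_aM_of_fix h') (smul_tM _ _) (smul_aM_of_fix h) (smul_tM _ _)

theorem s_braid3 {i j : Option (Fin n)} (h : ∀ x : V n, p.al i (p.s j x) = p.al i x + p.al j x)
    (h' : ∀ x : V n, p.al j (p.s i x) = p.al j x + p.al i x) :
    p.s i * (p.s j * p.s i) = p.s j * (p.s i * p.s j) := by
  rw [← mul_assoc (p.s j)]
  refine s_mul_eq_mul_s (mul_mem (p.s_mem j) (p.s_mem i)) fun x => ?_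
  change p.al i (p.s j (p.s i x)) = _
  rw [h, h', al_s]; ring

theorem T_braid3 {i j : Option (Fin n)} (hi : IsShort i) (hj : IsShort j)
    (ht : p.t i = p.t j) (h : ∀ x : V n, p.al i (p.s j x) = p.al i x + p.al j x)
    (h' : ∀ x : V n, p.al j (p.s i x) = p.al j x + p.al i x) :
    p.T i * (p.T j * p.T i) = p.T j * (p.T i * p.T j) := by
  have htM : p.tM j = p.tM i := by rw [tM, tM, ht]
  have hkM : p.kM j = p.kM i := by rw [kM, kM, ht]
  have h1 := p.one_sub_XX i
  have h2 := p.one_sub_XX j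
  have e1 : p.s i • p.XX j = p.XX i * p.XX j := by
    rw [smul_XX, s_inv, XX, XX, exM_add (p.aff_al i).neg (p.aff_al j).neg]
    congr 1; funext x; rw [h']; ring
  have e2 : p.s j • p.XX i = p.XX i * p.XX j := by
    rw [smul_XX, s_inv, XX, XX, exM_add (p.aff_al i).neg (p.aff_al j).neg]
    congr 1; funext x; rw [h]; ring
  have h3 : 1 - p.XX i * p.XX j ≠ 0 := by
    rw [← e1, ← smul_one (p.s i), ← smul_sub]
    exact (smul_ne_zero_iff_ne _).2 h2
  have e3 : p.s i • p.XX i = (p.XX i)⁻¹ := by rw [← ZZ_sq, smul_pow', s_smul_ZZ, inv_pow]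
  have e4 : p.s j • p.XX j = (p.XX j)⁻¹ := by rw [← ZZ_sq, smul_pow', s_smul_ZZ, inv_pow]
  have n1 := XX_ne (p := p) i
  have n2 := XX_ne (p := p) j
  rw [T_eq, T_eq, htM]
  refine dl_braid3 (k := p.kM i) (d := p.kM i / (1 - p.XX i * p.XX j)) (p.s_mul_self i)
    (p.s_mul_self j) (s_braid3 h h') (smul_tM _ _) (smul_tM _ _) (s_smul_aM i)
    (hkM ▸ s_smul_aM j) ?_ ?_ ?_ ?_ ?_
  · rw [aM_short _ hj, smul_div₀', smul_sub, smul_one, smul_kM, e1, hkM]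
  · rw [aM_short _ hi, smul_div₀', smul_sub, smul_one, smul_kM, e2]
  · rw [aM_short _ hj, smul_div₀', smul_sub, smul_one, smul_kM, smul_mul', e1, e3, hkM,
      inv_mul_cancel_left₀ n1]
  · rw [aM_short _ hi, smul_div₀', smul_sub, smul_one, smul_kM, smul_mul', e2, e4,
      mul_inv_cancel_right₀ n2]
  · rw [aM_short _ hi, aM_short _ hj, hkM]
    field_simp
    ring

theorem s_braid4 {i j : Option (Fin n)} (h : ∀ x : V n, p.al i (p.s j x) = p.al i x + p.al j x)
    (h' : ∀ x : V n, p.al j (p.s i x) = p.al j x + 2 * p.al i x) :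
    p.s i * (p.s j * (p.s i * p.s j)) = p.s j * (p.s i * (p.s j * p.s i)) := by
  have := s_mul_eq_mul_s (p := p) (i := i) (j := i)
    (mul_mem (p.s_mem j) (mul_mem (p.s_mem i) (p.s_mem j))) fun x => ?_
  · simpa only [mul_assoc] using this
  · change p.al i (p.s j (p.s i (p.s j x))) = _
    rw [h, h', al_s, h, al_s]; ring

theorem T_braid4 {i j : Option (Fin n)} (hi : IsShort i)
    (h : ∀ x : V n, p.al i (p.s j x) = p.al i x + p.al j x)
    (h' : ∀ x : V n, p.al j (p.s i x) = p.al j x + 2 * p.al i x) :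
    p.T i * (p.T j * (p.T i * p.T j)) = p.T j * (p.T i * (p.T j * p.T i)) := by
  have h1 := p.one_sub_XX i
  have h2 := p.one_sub_XX j
  rw [← ZZ_sq] at h2
  have n1 := XX_ne (p := p) i
  have n2 := ZZ_ne (p := p) j
  have e1 : p.s i • p.ZZ j = p.XX i * p.ZZ j := by
    rw [smul_ZZ, s_inv, XX, ZZ, exM_add (p.aff_al i).neg ((p.aff_al j).mul _).neg]
    congr 1; funext x; rw [h']; ring
  have e2 : p.s j • p.XX i = p.XX i * p.ZZ j ^ 2 := by
    rw [ZZ_sq, smul_XX, s_inv, XX, XX, exM_add (p.aff_al i).neg (p.aff_al j).neg]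
    congr 1; funext x; rw [h]; ring
  have e3 : p.s i • p.XX i = (p.XX i)⁻¹ := by rw [← ZZ_sq, smul_pow', s_smul_ZZ, inv_pow]
  have h3 : 1 - (p.XX i * p.ZZ j) ^ 2 ≠ 0 := by
    rw [← e1, ← smul_one (p.s i), ← smul_pow', ← smul_sub]
    exact (smul_ne_zero_iff_ne _).2 h2
  have h4 : 1 - p.XX i * p.ZZ j ^ 2 ≠ 0 := by
    rw [← e2, ← smul_one (p.s j), ← smul_sub]
    exact (smul_ne_zero_iff_ne _).2 h1
  rw [T_eq, T_eq]
  refine dl_braid4 (k := p.kM i) (l := p.kM j) (a' := p.kM i / (1 - p.XX i * p.ZZ j ^ 2))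
    (b' := (p.kM j + p.lM j * (p.XX i * p.ZZ j)) / (1 - (p.XX i * p.ZZ j) ^ 2)) (p.s_mul_self i)
    (p.s_mul_self j) (s_braid4 h h') (smul_tM _ _) (smul_tM _ _) (smul_tM _ _) (smul_tM _ _)
    (smul_kM _ _) (smul_kM _ _) (s_smul_aM i) (s_smul_aM j) ?_ ?_ ?_ ?_ ?_ ?_ ?_
  · rw [aM_eq, smul_div₀', smul_sub, smul_add, smul_mul', smul_pow', smul_one, smul_kM, smul_lM, e1]
  · rw [aM_short _ hi, smul_div₀', smul_sub, smul_one, smul_kM, e2]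
  · rw [smul_div₀', smul_sub, smul_one, smul_kM, smul_mul', smul_pow', e1, e3]
    congr 2; field_simp
  · rw [smul_div₀', smul_sub, smul_add, smul_mul', smul_pow', smul_mul', smul_one, smul_kM, smul_lM,
      e2, s_smul_ZZ]
    have : p.XX i * p.ZZ j ^ 2 * (p.ZZ j)⁻¹ = p.XX i * p.ZZ j := by field_simp
    rw [this]
  · rw [smul_div₀', smul_sub, smul_add, smul_mul', smul_pow', smul_mul', smul_one, smul_kM, smul_lM,
      e1, e3, inv_mul_cancel_left₀ n1, aM_eq]
  · rw [smul_div₀', smul_sub, smul_one, smul_kM, smul_mul', smul_pow', e2, s_smul_ZZ, inv_pow,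
      mul_inv_cancel_right₀ (pow_ne_zero 2 n2), aM_short _ hi]
  · rw [aM_short _ hi, aM_eq]
    generalize p.XX i = X at *
    generalize p.ZZ j = Z at *
    have h5 : 1 - X ^ 2 * Z ^ 2 ≠ 0 := by rwa [← mul_pow]
    rw [mul_pow]
    field_simp
    ring

/-- The five possibilities for a pair of different affine simple roots. -/
inductive Link (p : Params) (i j : Option (Fin n)) : Prop
  | comm (h : ∀ x : V n, p.al i (p.s j x) = p.al i x)
      (h' : ∀ x : V n, p.al j (p.s i x) = p.al j x)
  | three (hi : IsShort i) (hj : IsShort j) (ht : p.t i = p.t j)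
      (h : ∀ x : V n, p.al i (p.s j x) = p.al i x + p.al j x)
      (h' : ∀ x : V n, p.al j (p.s i x) = p.al j x + p.al i x)
  | four (hi : IsShort i) (h : ∀ x : V n, p.al i (p.s j x) = p.al i x + p.al j x)
      (h' : ∀ x : V n, p.al j (p.s i x) = p.al j x + 2 * p.al i x)
  | four' (hj : IsShort j) (h : ∀ x : V n, p.al j (p.s i x) = p.al j x + p.al i x)
      (h' : ∀ x : V n, p.al i (p.s j x) = p.al i x + 2 * p.al j x)
  -- Occurs only for n = 1, where α_0 + α_1 is the constant ħ and there is no braid relation.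
  | inf (h : ∀ x : V n, p.al i x + p.al j x = p.hbar)

theorem Link.symm {i j : Option (Fin n)} (h : Link p i j) : Link p j i := by
  cases h with
  | comm h h' => exact .comm h' h
  | three hi hj ht h h' => exact .three hj hi ht.symm h' h
  | four hi h h' => exact .four' hi h h'
  | four' hj h h' => exact .four hj h h'
  | inf h => exact .inf fun x => by rw [add_comm, h]

theorem s_lt_apply' {i : Fin n} (h : i.val + 1 < n) (x : V n) (j : Fin n) :
    p.s (some i) x j = if j.val = i.val then x ⟨i.val + 1, h⟩ else
      if j.val = i.val + 1 then x i else x j := by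
  rw [s_lt_apply _ h, Equiv.swap_apply_def]
  by_cases h1 : j.val = i.val
  · rw [if_pos (Fin.ext h1), if_pos h1]
  · rw [if_neg (fun hh => h1 (congrArg Fin.val hh)), if_neg h1]
    by_cases h2 : j.val = i.val + 1
    · rw [if_pos (Fin.ext h2), if_pos h2]
    · rw [if_neg (fun hh => h2 (congrArg Fin.val hh)), if_neg h2]

theorem s_last_apply' {i : Fin n} (h : ¬ i.val + 1 < n) (x : V n) (j : Fin n) :
    p.s (some i) x j = if j.val = i.val then - x i else x j := by
  rw [s_last_apply _ h]; simp only [Fin.ext_iff]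

theorem s_none_apply' (x : V n) (j : Fin n) :
    p.s none x j = if j.val = 0 then p.hbar - x 0 else x j := by
  rw [s_none_apply]; simp only [Fin.ext_iff, Fin.val_zero]

theorem link_none (b : Fin n) : Link p none (some b) := by
  have hb := b.2
  by_cases h0 : b.val = 0
  · have hb0 : b = 0 := Fin.ext (by simpa using h0)
    by_cases hl : b.val + 1 < n
    · refine .four' ⟨b, rfl, hl⟩ (fun x => ?_) (fun x => ?_)
      · rw [al_lt _ hl, al_lt _ hl, al_none, s_none_apply', s_none_apply', if_pos h0,
          if_neg (by simp), show x b = x 0 by rw [hb0]]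
        ring
      · rw [al_none, al_none, al_lt _ hl, s_lt_apply' hl, if_pos (by simp [h0]),
          show x b = x 0 by rw [hb0]]
        ring
    · refine .inf fun x => ?_
      rw [al_none, al_last _ hl, hb0]; ring
  · by_cases hl : b.val + 1 < n
    · refine .comm (fun x => ?_) (fun x => ?_)
      · rw [al_none, al_none, s_lt_apply' hl, if_neg (by simp; omega), if_neg (by simp)]
      · rw [al_lt _ hl, al_lt _ hl, s_none_apply', s_none_apply', if_neg h0, if_neg (by simp)]
    · refine .comm (fun x => ?_) (fun x => ?_)
      · rw [al_none, al_none, s_last_apply' hl, if_neg (by simp; omega)]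
      · rw [al_last _ hl, al_last _ hl, s_none_apply', if_neg h0]

theorem link_lt {a b : Fin n} (hab : a.val < b.val) : Link p (some a) (some b) := by
  have hb := b.2
  have ha : a.val + 1 < n := by omega
  by_cases h1 : b.val = a.val + 1
  · have hb1 : b = ⟨a.val + 1, ha⟩ := Fin.ext h1
    by_cases hl : b.val + 1 < n
    · refine .three ⟨a, rfl, ha⟩ ⟨b, rfl, hl⟩ ?_ (fun x => ?_) (fun x => ?_)
      · rw [t, t, if_neg (by rw [lastNode_iff]; omega), if_neg (by rw [lastNode_iff]; omega)]
      · rw [al_lt _ ha, al_lt _ ha, al_lt _ hl, s_lt_apply' hl, s_lt_apply' hl,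
          if_neg (by omega), if_neg (by omega), if_pos (by simp [h1]),
          show x b = x ⟨a.val + 1, ha⟩ by rw [hb1]]
        ring
      · rw [al_lt _ ha, al_lt _ hl, al_lt _ hl, s_lt_apply' ha, s_lt_apply' ha,
          if_neg (by omega), if_pos h1, if_neg (by simp; omega), if_neg (by simp; omega),
          show x b = x ⟨a.val + 1, ha⟩ by rw [hb1]]
        ring
    · refine .four ⟨a, rfl, ha⟩ (fun x => ?_) (fun x => ?_)
      · rw [al_lt _ ha, al_lt _ ha, al_last _ hl, s_last_apply' hl, s_last_apply' hl,
          if_neg (by omega), if_pos (by simp [h1]), hb1]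
        ring
      · rw [al_lt _ ha, al_last _ hl, al_last _ hl, s_lt_apply' ha, if_neg (by omega), if_pos h1,
          hb1]
        ring
  · by_cases hl : b.val + 1 < n
    · refine .comm (fun x => ?_) (fun x => ?_)
      · rw [al_lt _ ha, al_lt _ ha, s_lt_apply' hl, s_lt_apply' hl, if_neg (by omega),
          if_neg (by omega), if_neg (by simp; omega), if_neg (by simp; omega)]
      · rw [al_lt _ hl, al_lt _ hl, s_lt_apply' ha, s_lt_apply' ha, if_neg (by omega), if_neg h1,
          if_neg (by simp; omega), if_neg (by simp; omega)]
    · refine .comm (fun x => ?_) (fun x => ?_)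
      · rw [al_lt _ ha, al_lt _ ha, s_last_apply' hl, s_last_apply' hl, if_neg (by omega),
          if_neg (by simp; omega)]
      · rw [al_last _ hl, al_last _ hl, s_lt_apply' ha, if_neg (by omega), if_neg h1]

theorem link {i j : Option (Fin n)} (h : i ≠ j) : Link p i j := by
  rcases i with _ | a <;> rcases j with _ | b
  · exact absurd rfl h
  · exact link_none b
  · exact (link_none a).symm
  · rcases lt_trichotomy a.val b.val with h1 | h1 | h1
    · exact link_lt h1
    · exact absurd (congrArg some (Fin.ext h1)) h
    · exact (link_lt h1).symm

/-- The product of the operators `T_i` along a word. -/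
def Tprod (p : Params) (l : List (Option (Fin n))) : Op (V n) := (l.map p.T).prod

theorem IsReducedWord.of_descent (h0 : p.hbar ≠ 0) {w : V n ≃ᵃ[ℂ] V n} {i l}
    (hi : p.hv n (p.al i (w (p.X0 n))) < 0) (h : p.IsReducedWord (p.s i * w) l) :
    p.IsReducedWord w (i :: l) := by
  have := h.cons h0 (i := i) (by
    change 0 < p.hv n (p.al i (p.s i (w (p.X0 n))))
    rw [al_s, hv_neg]; linarith)
  rwa [← mul_assoc, s_mul_self, one_mul] at this

/-- Two different left descents lead to reduced words related by a braid relation. -/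
theorem exists_braid (h0 : p.hbar ≠ 0) {w : V n ≃ᵃ[ℂ] V n} (hw : w ∈ p.affW n)
    {i j : Option (Fin n)} (hij : Link p i j) (hi : p.hv n (p.al i (w (p.X0 n))) < 0)
    (hj : p.hv n (p.al j (w (p.X0 n))) < 0) : ∃ A B l, p.IsReducedWord w (i :: (A ++ l)) ∧
      p.IsReducedWord w (j :: (B ++ l)) ∧ p.Tprod (i :: A) = p.Tprod (j :: B) := by
  have two : ∀ z, p.hv n (2 * z) = 2 * p.hv n z := fun z => by rw [two_mul, hv_add, two_mul]
  -- The double bond is treated once and used for both orders of the short and the long node.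
  have four : ∀ {i j : Option (Fin n)}, IsShort i →
      (∀ x : V n, p.al i (p.s j x) = p.al i x + p.al j x) →
      (∀ x : V n, p.al j (p.s i x) = p.al j x + 2 * p.al i x) →
      p.hv n (p.al i (w (p.X0 n))) < 0 → p.hv n (p.al j (w (p.X0 n))) < 0 →
      ∃ l, p.IsReducedWord w (i :: ([j, i, j] ++ l)) ∧ p.IsReducedWord w (j :: ([i, j, i] ++ l)) := by
    intro i j hs h h' hi hj
    obtain ⟨l, hl⟩ := exists_reduced (p := p) (w := p.s j * (p.s i * (p.s j * (p.s i * w))))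
      (mul_mem (p.s_mem j) (mul_mem (p.s_mem i) (mul_mem (p.s_mem j) (mul_mem (p.s_mem i) hw))))
    refine ⟨l, .of_descent h0 hi (.of_descent h0 ?_ (.of_descent h0 ?_ (.of_descent h0 ?_ hl))),
      .of_descent h0 hj (.of_descent h0 ?_ (.of_descent h0 ?_ (.of_descent h0 ?_ ?_)))⟩
    · change p.hv n (p.al j (p.s i (w (p.X0 n)))) < 0
      rw [h', hv_add, two]; linarith
    · change p.hv n (p.al i (p.s j (p.s i (w (p.X0 n))))) < 0
      rw [h, h', al_s]; simp only [hv_add, hv_neg, two]; linarith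
    · change p.hv n (p.al j (p.s i (p.s j (p.s i (w (p.X0 n)))))) < 0
      rw [h', h, al_s, h', al_s]; simp only [hv_add, hv_neg, two]; linarith
    · change p.hv n (p.al i (p.s j (w (p.X0 n)))) < 0
      rw [h, hv_add]; linarith
    · change p.hv n (p.al j (p.s i (p.s j (w (p.X0 n))))) < 0
      rw [h', h, al_s]; simp only [hv_add, hv_neg, two]; linarith
    · change p.hv n (p.al i (p.s j (p.s i (p.s j (w (p.X0 n)))))) < 0
      rw [h, h', al_s, h, al_s]; simp only [hv_add, hv_neg, two]; linarith
    · have := congrArg (· * w) (s_braid4 h h')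
      simp only [mul_assoc] at this
      rwa [this]
  cases hij with
  | comm h h' =>
    obtain ⟨l, hl⟩ := exists_reduced (p := p) (w := p.s j * (p.s i * w))
      (mul_mem (p.s_mem j) (mul_mem (p.s_mem i) hw))
    refine ⟨[j], [i], l, .of_descent h0 hi (.of_descent h0 ?_ hl),
      .of_descent h0 hj (.of_descent h0 ?_ ?_), ?_⟩
    · change p.hv n (p.al j (p.s i (w (p.X0 n)))) < 0
      rwa [h']
    · change p.hv n (p.al i (p.s j (w (p.X0 n)))) < 0
      rwa [h]
    · have := congrArg (· * w) (s_comm h)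
      simp only [mul_assoc] at this
      rwa [this]
    · simpa [Tprod] using T_comm h h'
  | three hsi hsj ht h h' =>
    obtain ⟨l, hl⟩ := exists_reduced (p := p) (w := p.s i * (p.s j * (p.s i * w)))
      (mul_mem (p.s_mem i) (mul_mem (p.s_mem j) (mul_mem (p.s_mem i) hw)))
    refine ⟨[j, i], [i, j], l, .of_descent h0 hi (.of_descent h0 ?_ (.of_descent h0 ?_ hl)),
      .of_descent h0 hj (.of_descent h0 ?_ (.of_descent h0 ?_ ?_)), ?_⟩
    · change p.hv n (p.al j (p.s i (w (p.X0 n)))) < 0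
      rw [h', hv_add]; linarith
    · change p.hv n (p.al i (p.s j (p.s i (w (p.X0 n))))) < 0
      rw [h, h', al_s]; simp only [hv_add, hv_neg]; linarith
    · change p.hv n (p.al i (p.s j (w (p.X0 n)))) < 0
      rw [h, hv_add]; linarith
    · change p.hv n (p.al j (p.s i (p.s j (w (p.X0 n))))) < 0
      rw [h', h, al_s]; simp only [hv_add, hv_neg]; linarith
    · have := congrArg (· * w) (s_braid3 h h')
      simp only [mul_assoc] at this
      rwa [← this]
    · simpa [Tprod] using T_braid3 hsi hsj ht h h'
  | four hs h h' =>
    obtain ⟨l, h1, h2⟩ := four hs h h' hi hj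
    exact ⟨_, _, l, h1, h2, by simpa [Tprod] using T_braid4 hs h h'⟩
  | four' hs h h' =>
    obtain ⟨l, h1, h2⟩ := four hs h h' hj hi
    exact ⟨_, _, l, h2, h1, by simpa [Tprod] using (T_braid4 hs h h').symm⟩
  | inf h =>
    -- Two roots with sum ħ cannot both be negative at one point, since ħ itself is positive for
    -- `hv`.
    have h1 := congrArg (p.hv n) (h (w (p.X0 n)))
    rw [hv_add, hv, hv, hv, mul_div_assoc _ p.hbar, div_self h0, mul_one] at h1
    have h2 : (0 : ℝ) < scale n := by rw [scale]; positivity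
    rw [Complex.intCast_re] at h1
    rw [hv] at hi hj
    linarith

/-- The product of the `T_i` along a reduced word depends on the group element only. -/
theorem Tprod_eq (h0 : p.hbar ≠ 0) (N : ℕ) : ∀ (w : V n ≃ᵃ[ℂ] V n) (l l' : List (Option (Fin n))),
    l.length = N → p.IsReducedWord w l → p.IsReducedWord w l' → p.Tprod l = p.Tprod l' := by
  induction N with
  | zero =>
    intro w l l' hl h h'
    have := h'.2 l h.1
    rw [List.length_eq_zero_iff.1 hl, List.length_eq_zero_iff.1 (by omega : l'.length = 0)]
  | succ N ih =>
    intro w l l' hl h h'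
    have hw : w ∈ p.affW n := h.1 ▸ p.wordProd_mem l
    have hlen : l'.length = N + 1 := by
      have h1 := h'.2 l h.1
      have h2 := h.2 l' h'.1
      omega
    obtain ⟨i, l, rfl⟩ := List.exists_cons_of_length_eq_add_one hl
    obtain ⟨j, l', rfl⟩ := List.exists_cons_of_length_eq_add_one hlen
    simp only [List.length_cons, Nat.add_right_cancel_iff] at hl hlen
    have cons : ∀ (i : Option (Fin n)) l, p.Tprod (i :: l) = p.T i * p.Tprod l := fun i l => by simp [Tprod]
    have app : ∀ l l' : List (Option (Fin n)), p.Tprod (l ++ l') = p.Tprod l * p.Tprod l' := fun i l => by simp [Tprod]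
    by_cases hij : i = j
    · subst hij
      rw [cons, cons, ih _ _ _ hl h.tail h'.tail]
    -- Matsumoto's argument: both first letters are descents of w, so w has reduced words beginning
    -- with the two sides of their braid relation. The induction hypothesis links each given word to
    -- the one with the same first letter.
    · obtain ⟨A, B, l'', h1, h2, h3⟩ := exists_braid h0 hw (link hij) (h.head h0) (h'.head h0)
      rw [cons, ih _ _ _ hl h.tail h1.tail, ← cons, ← List.cons_append, app, h3, ← app,
        List.cons_append, cons, cons, ih _ _ _ hlen h'.tail h2.tail]

end Params
end Koornwinder
end

noncomputable section
set_option linter.unusedSectionVars false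
namespace Koornwinder
namespace Params

variable {n : ℕ} [NeZero n] {p : Params}

/-! ### Signed permutations and translations -/

theorem NF.ext {g g' : V n ≃ᵃ[ℂ] V n} {σ ε μ} (h : p.NF g σ ε μ) (h' : p.NF g' σ ε μ) :
    g = g' := by
  ext x j
  rw [h, h']

variable (n) in
/-- The subgroup generated by the reflections `s_1, ..., s_n`. -/
def finW (p : Params) : Subgroup (V n ≃ᵃ[ℂ] V n) :=
  Subgroup.closure (Set.range fun i : Fin n => p.s (some i))

theorem s_mem_finW (i : Fin n) : p.s (some i) ∈ p.finW n := Subgroup.subset_closure ⟨i, rfl⟩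

theorem finW_le : p.finW n ≤ p.affW n := by
  rw [finW, Subgroup.closure_le]
  rintro _ ⟨i, rfl⟩
  exact p.s_mem _

theorem NF_one : p.NF (1 : V n ≃ᵃ[ℂ] V n) 1 (fun _ => 1) 0 := fun x j => by simp

theorem exists_perm (σ : Equiv.Perm (Fin n)) :
    ∃ g ∈ p.finW n, p.NF g σ (fun _ => 1) 0 := by
  obtain ⟨m, rfl⟩ := Nat.exists_eq_succ_of_ne_zero (NeZero.ne n)
  have h : σ ∈ Submonoid.closure
      (Set.range fun i : Fin m => Equiv.swap i.castSucc i.succ) := by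
    rw [Equiv.Perm.mclosure_swap_castSucc_succ]; trivial
  induction h using Submonoid.closure_induction with
  | mem x hx =>
    obtain ⟨i, rfl⟩ := hx
    refine ⟨_, s_mem_finW i.castSucc, fun x j => ?_⟩
    have hi : i.castSucc.val + 1 < m.succ := by simp
    rw [s_lt_apply _ hi]
    have : (⟨i.castSucc.val + 1, hi⟩ : Fin (m + 1)) = i.succ := Fin.ext (by simp)
    rw [this]; simp
  | one => exact ⟨1, one_mem _, NF_one⟩
  | mul x y _ _ hx hy =>
    obtain ⟨g, hg, h⟩ := hx
    obtain ⟨g', hg', h'⟩ := hy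
    -- The permutation in `NF` acts on indices, so products are reversed.
    refine ⟨g' * g, mul_mem hg' hg, ?_⟩
    have := h'.mul h
    simp only [mul_one, Pi.zero_apply, mul_zero, add_zero] at this
    exact this

/-- The sign change of the coordinate `k`. -/
def flip (k : Fin n) : V n ≃ᵃ[ℂ] V n := refl ((2 : ℂ) • e k) 0

theorem flip_apply (k : Fin n) (x : V n) (j : Fin n) :
    flip k x j = if j = k then - x k else x j := by
  have h1 : form ((2 : ℂ) • e k) x = 2 * x k := by
    rw [form_comm, form_smul, form_comm, form_e]
  have h2 : form ((2 : ℂ) • e k) ((2 : ℂ) • e k) = 4 := by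
    rw [form_smul, form_comm, form_smul, form_e]; simp [e]; norm_num
  have h3 : flip k x = x - (2 * x k) • e k := by
    change reflFun _ _ _ = _
    rw [reflFun, check, h1, h2, smul_smul, smul_smul]; norm_num; ring_nf
  rw [h3]
  by_cases h : j = k
  · subst h; simp [e]; ring
  · simp [e, h]

theorem flip_mem (k : Fin n) : flip k ∈ p.finW n := by
  obtain ⟨g, hg, h⟩ := exists_perm (p := p) (Equiv.swap k (lastNode n))
  have hl : ¬ (lastNode n).val + 1 < n := (lastNode_iff _).1 rfl
  have : flip k = g * p.s (some (lastNode n)) * g := by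
    ext x j
    change _ = g (p.s _ (g x)) j
    rw [h, s_last_apply _ hl, h, h, flip_apply]
    by_cases hj : j = k
    · subst hj; simp
    · have : Equiv.swap k (lastNode n) j ≠ lastNode n := by
        intro hh
        rw [Equiv.swap_apply_eq_iff, Equiv.swap_apply_right] at hh
        exact hj hh
      simp [hj, this]
  rw [this]
  exact mul_mem (mul_mem hg (s_mem_finW _)) hg

theorem exists_signed (σ : Equiv.Perm (Fin n)) (ε : Fin n → ℤˣ) :
    ∃ g ∈ p.finW n, p.NF g σ ε 0 := by
  classical
  have key : ∀ A : Finset (Fin n), ∃ g ∈ p.finW n,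
      p.NF g 1 (fun j => if j ∈ A then -1 else 1) 0 := by
    intro A
    induction A using Finset.induction_on with
    | empty => exact ⟨1, one_mem _, by simpa using NF_one⟩
    | insert a A ha ih =>
      obtain ⟨g, hg, h⟩ := ih
      refine ⟨flip a * g, mul_mem (flip_mem a) hg, fun x j => ?_⟩
      change flip a (g x) j = _
      rw [flip_apply, h, h]
      by_cases hj : j = a
      · subst hj; simp [ha]
      · simp [hj]
  obtain ⟨g, hg, h⟩ := key (Finset.univ.filter fun j => ε j = -1)
  obtain ⟨g', hg', h'⟩ := exists_perm (p := p) σ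
  refine ⟨g * g', mul_mem hg hg', fun x j => ?_⟩
  change g (g' x) j = _
  rw [h, h']
  rcases Int.units_eq_one_or (ε j) with h | h <;> simp [h]

theorem mem_finW_of_NF {g : V n ≃ᵃ[ℂ] V n} {σ ε} (h : p.NF g σ ε 0) : g ∈ p.finW n := by
  obtain ⟨g', hg', h'⟩ := exists_signed (p := p) σ ε
  rwa [h.ext h']

theorem exists_NF_finW {g : V n ≃ᵃ[ℂ] V n} (hg : g ∈ p.finW n) : ∃ σ ε, p.NF g σ ε 0 := by
  have h0 : g 0 = 0 := by
    induction hg using Subgroup.closure_induction with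
    | mem x hx =>
      obtain ⟨i, rfl⟩ := hx
      have : p.al (some i) 0 = 0 := by simp [al, form, affConst]
      rw [s_apply, this, zero_smul, sub_zero]
    | one => rfl
    | mul x y _ _ hx hy => change x (y 0) = 0; rw [hy, hx]
    | inv x _ hx => 
      have := congrArg (x⁻¹ : V n ≃ᵃ[ℂ] V n) hx
      rw [← this]
      exact (x.symm_apply_apply 0)
  obtain ⟨σ, ε, μ, h⟩ := p.exists_NF (finW_le hg)
  refine ⟨σ, ε, fun x j => ?_⟩
  have := h 0 j
  rw [h0] at this
  simp only [PiLp.zero_apply, mul_zero, zero_add] at this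
  rw [h, ← this]; simp

theorem shift_apply (l : Fin n → ℤ) (x : V n) (j : Fin n) :
    p.shift l x j = x j + p.hbar * l j := by
  change (p.hbar • latt l + x) j = _
  simp [latt_apply, add_comm]

theorem NF_shift (l : Fin n → ℤ) : p.NF (p.shift l) 1 (fun _ => 1) l := fun x j => by
  rw [shift_apply]; simp

theorem shift_add (l l' : Fin n → ℤ) : p.shift (l + l') = p.shift l * p.shift l' := by
  ext x j
  change _ = p.shift l (p.shift l' x) j
  rw [shift_apply, shift_apply, shift_apply]; simp; ring

theorem shift_zero : p.shift (0 : Fin n → ℤ) = 1 := by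
  ext x j; rw [shift_apply]; simp

theorem shift_neg (l : Fin n → ℤ) : p.shift (-l) = (p.shift l)⁻¹ :=
  eq_inv_of_mul_eq_one_left (by rw [← shift_add, neg_add_cancel, shift_zero])

theorem shift_zero_eq : p.shift (Pi.single (0 : Fin n) 1) = p.s none * flip 0 := by
  ext x j
  change _ = p.s none (flip 0 x) j
  rw [shift_apply, s_none_apply, flip_apply, flip_apply]
  by_cases h : j = 0
  · subst h; simp; ring
  · simp [h]

theorem shift_mem (l : Fin n → ℤ) : p.shift l ∈ p.affW n := by
  let A : AddSubgroup (Fin n → ℤ) :=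
    { carrier := {l | p.shift l ∈ p.affW n}
      add_mem' := fun {a b} ha hb => by
        change p.shift (a + b) ∈ p.affW n
        rw [shift_add]; exact mul_mem ha hb
      zero_mem' := by change p.shift (0 : Fin n → ℤ) ∈ p.affW n; rw [shift_zero]; exact one_mem _
      neg_mem' := fun {a} ha => by
        change p.shift (-a) ∈ p.affW n
        rw [shift_neg]; exact inv_mem ha }
  have h1 : ∀ j : Fin n, (Pi.single j 1 : Fin n → ℤ) ∈ A := by
    intro j
    change p.shift _ ∈ p.affW n
    obtain ⟨g, hg, h⟩ := exists_perm (p := p) (Equiv.swap 0 j)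
    have : p.shift (Pi.single j 1) = g * p.shift (Pi.single 0 1) * g := by
      ext x i
      change _ = g (p.shift _ (g x)) i
      rw [h, shift_apply, shift_apply, h]
      have : Equiv.swap 0 j i = 0 ↔ i = j := by
        rw [Equiv.swap_apply_eq_iff, Equiv.swap_apply_left]
      simp [Pi.single_apply, this]
    rw [this, shift_zero_eq]
    exact mul_mem (mul_mem (finW_le hg) (mul_mem (p.s_mem _) (finW_le (flip_mem _)))) (finW_le hg)
  have h2 : l = ∑ j, l j • (Pi.single j 1 : Fin n → ℤ) := by
    funext i; simp [Finset.sum_apply, Pi.single_apply]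
  have : l ∈ A := by
    rw [h2]; exact A.sum_mem fun j _ => A.zsmul_mem (h1 j) _
  exact this

theorem shift_pt (h0 : p.hbar ≠ 0) (l y : Fin n → ℤ) :
    p.shift l (p.pt y) = p.pt fun j => y j + scale n * l j := by
  rw [(NF_shift l).pt h0]; simp

/-! ### The operators `T_w` -/

theorem T_mul_inv (i : Option (Fin n)) :
    p.T i * (p.T i - algebraMap ℂ (Op (V n)) ((p.t i : ℂ) - (p.t i : ℂ)⁻¹)) = 1 := by
  rw [mul_sub, T_sq, ← Algebra.commutes]; abel

theorem T_inv_mul (i : Option (Fin n)) :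
    (p.T i - algebraMap ℂ (Op (V n)) ((p.t i : ℂ) - (p.t i : ℂ)⁻¹)) * p.T i = 1 := by
  rw [sub_mul, T_sq]; abel

/-- `T_i` as a unit. -/
def TU (p : Params) (i : Option (Fin n)) : (Op (V n))ˣ := ⟨p.T i, _, T_mul_inv i, T_inv_mul i⟩

theorem TU_val (i : Option (Fin n)) : (p.TU i : Op (V n)) = p.T i := rfl

theorem Tprod_eq_prod (l : List (Option (Fin n))) : p.Tprod l = ((l.map p.TU).prod : (Op (V n))ˣ) := by
  induction l with
  | nil => simp [Tprod]
  | cons i l ih => simp only [Tprod, List.map_cons, List.prod_cons, Units.val_mul] at ih ⊢; rw [ih]; rfl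

/-- `T_w` as a unit. -/
def TwU (p : Params) (w : V n ≃ᵃ[ℂ] V n) : (Op (V n))ˣ :=
  ((Classical.epsilon (p.IsReducedWord w)).map p.TU).prod

theorem TwU_val (w : V n ≃ᵃ[ℂ] V n) : (p.TwU w : Op (V n)) = p.Tw w := (Tprod_eq_prod _).symm

theorem TwU_eq (h0 : p.hbar ≠ 0) {w : V n ≃ᵃ[ℂ] V n} {l} (h : p.IsReducedWord w l) :
    p.TwU w = (l.map p.TU).prod := by
  apply Units.ext
  rw [TwU, ← Tprod_eq_prod, ← Tprod_eq_prod]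
  exact Tprod_eq h0 _ w _ _ rfl (Classical.epsilon_spec ⟨l, h⟩) h

theorem isReducedWord_nil : p.IsReducedWord (1 : V n ≃ᵃ[ℂ] V n) [] := ⟨rfl, fun _ _ => by simp⟩

theorem TwU_one (h0 : p.hbar ≠ 0) : p.TwU (1 : V n ≃ᵃ[ℂ] V n) = 1 := by
  rw [TwU_eq h0 isReducedWord_nil]; rfl

theorem TwU_s_mul (h0 : p.hbar ≠ 0) {w : V n ≃ᵃ[ℂ] V n} (hw : w ∈ p.affW n) {i : Option (Fin n)}
    (h : 0 < p.hv n (p.al i (w (p.X0 n)))) : p.TwU (p.s i * w) = p.TU i * p.TwU w := by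
  obtain ⟨l, hl⟩ := exists_reduced hw
  rw [TwU_eq h0 hl, TwU_eq h0 (hl.cons h0 h)]; simp

theorem TwU_s (h0 : p.hbar ≠ 0) (i : Option (Fin n)) : p.TwU (p.s i) = p.TU i := by
  have := TwU_s_mul h0 (one_mem (p.affW n)) (al_X0_pos h0 i)
  rwa [mul_one, TwU_one h0, mul_one] at this

/-- `T_{wz} = T_w T_z` if the lengths add. -/
theorem TwU_mul (h0 : p.hbar ≠ 0) {w z : V n ≃ᵃ[ℂ] V n} (hw : w ∈ p.affW n) (hz : z ∈ p.affW n)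
    (h : ∀ f ∈ p.rts, 0 < p.hv n (f (p.X0 n)) → p.hv n (f (w⁻¹ (p.X0 n))) < 0 →
      0 < p.hv n (f (z (p.X0 n)))) : p.TwU (w * z) = p.TwU w * p.TwU z := by
  obtain ⟨l, hl⟩ := exists_reduced hw
  induction l generalizing w with
  | nil =>
    have : w = 1 := hl.1.symm
    rw [this, one_mul, TwU_one h0, one_mul]
  | cons i l ih =>
    have hv := mul_mem (p.s_mem i) hw
    set v := p.s i * w with hv_def
    have hwv : w = p.s i * v := by rw [hv_def, ← mul_assoc, s_mul_self, one_mul]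
    have hiv : 0 < p.hv n (p.al i (v (p.X0 n))) := by
      have := hl.head h0
      rw [hwv] at this
      change p.hv n (p.al i (p.s i (v (p.X0 n)))) < 0 at this
      rw [al_s, hv_neg] at this
      linarith
    have hvv : ∀ x, v⁻¹ (v x) = x := fun x => v.symm_apply_apply x
    have hvv' : ∀ x, v (v⁻¹ x) = x := fun x => v.apply_symm_apply x
    have hw' : ∀ x, w⁻¹ x = v⁻¹ (p.s i x) := fun x => by
      rw [hwv, mul_inv_rev, s_inv]; rfl
    have hvz := ih hv (fun f hf h1 h2 => h f hf h1 ?_) hl.tail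
    · rw [hwv, mul_assoc, TwU_s_mul h0 (mul_mem hv hz), hvz, TwU_s_mul h0 hv hiv, mul_assoc]
      -- The root α_i ∘ v is positive at X_0 and negative at w⁻¹X_0, so by hypothesis it is positive
      -- at zX_0, which means that s_i lengthens vz.
      refine h _ (p.rts_comp (p.al_mem i) hv) hiv ?_
      rw [hw', hvv', al_s, hv_neg]
      linarith [al_X0_pos h0 i]
    · rw [hw']
      -- The hypothesis passes from w to v: among positive roots s_i changes the sign of α_i only,
      -- and −f ∘ v⁻¹ = α_i would make f negative at X_0.
      have hf' := p.rts_neg (p.rts_comp hf (inv_mem hv))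
      rcases (hv_X0_ne h0 (p.rts_comp (p.rts_comp hf (inv_mem hv)) (p.s_mem i))).lt_or_gt with h3 | h3
      · exact h3
      · have := eq_al h0 hf' i (by rw [hv_neg]; linarith) (by rw [hv_neg]; linarith)
        have h4 := congrFun this (v (p.X0 n))
        simp only [hvv] at h4
        rw [← h4, hv_neg] at hiv
        linarith

/-- Dominant elements of the coroot lattice. -/
def Dom (l : Fin n → ℤ) : Prop := Antitone l ∧ ∀ i, 0 ≤ l i

theorem Dom.add {l l' : Fin n → ℤ} (h : Dom l) (h' : Dom l') : Dom (l + l') :=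
  ⟨h.1.add h'.1, fun i => add_nonneg (h.2 i) (h'.2 i)⟩

theorem dom_zero : Dom (0 : Fin n → ℤ) := ⟨fun _ _ _ => le_rfl, fun _ => le_rfl⟩

theorem dom_nu (j : Fin n) : Dom (nu j) := by
  refine ⟨fun a b hab => ?_, fun i => ?_⟩
  · simp only [nu]; split_ifs <;> omega
  · simp only [nu]; split_ifs <;> omega

/-- A positive root made negative by τ(−l) has positive pairing with l. Its pairing with the
dominant l' is then nonnegative, so τ(l') keeps it positive and lengths add. -/
theorem TwU_shift_add (h0 : p.hbar ≠ 0) {l l' : Fin n → ℤ} (h : Dom l) (h' : Dom l') :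
    p.TwU (p.shift (l + l')) = p.TwU (p.shift l) * p.TwU (p.shift l') := by
  rw [shift_add]
  refine TwU_mul h0 (shift_mem l) (shift_mem l') ?_
  rintro f ⟨a, b, ε, δ, m, hab, hf⟩ h1 h2
  rw [← shift_neg, X0, shift_pt h0, hv_rts h0 hf] at h2
  rw [X0, shift_pt h0, hv_rts h0 hf]
  rw [X0, hv_rts h0 hf] at h1
  replace h1 := (Int.cast_pos (R := ℝ)).1 h1
  replace h2 := (Int.cast_lt_zero (R := ℝ)).1 h2
  refine (Int.cast_pos (R := ℝ)).2 ?_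
  have hs : 0 < scale n := by rw [scale]; omega
  have h3 : 0 < ε * l a + δ * l b := by
    simp only [Pi.neg_apply] at h2
    by_contra! hc
    nlinarith
  have h4 : 0 ≤ ε * l' a + δ * l' b := by
    have := h.2 a
    have := h.2 b
    have := h'.2 a
    have := h'.2 b
    rcases Int.units_eq_one_or ε with rfl | rfl <;> rcases Int.units_eq_one_or δ with rfl | rfl <;>
      simp at h3 ⊢
    · omega
    · rcases le_total a b with hab | hab
      · have := h'.1 hab; omega
      · have := h.1 hab; omega
    · rcases le_total b a with hab | hab
      · have := h'.1 hab; omega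
      · have := h.1 hab; omega
    · omega
  nlinarith

end Params
end Koornwinder
end

noncomputable section
set_option linter.unusedSectionVars false
namespace Koornwinder
namespace Params

variable {n : ℕ} [NeZero n] {p : Params}

/-! ### The Cherednik-Dunkl operators -/

theorem nuCoef_lt {j : Fin n} (h : j.val + 1 < n) (l : Fin n → ℤ) :
    nuCoef l j = l j - l ⟨j.val + 1, h⟩ := dif_pos h

theorem nuCoef_last {j : Fin n} (h : ¬ j.val + 1 < n) (l : Fin n → ℤ) : nuCoef l j = l j := dif_neg h

theorem nuCoef_add (l l' : Fin n → ℤ) (j : Fin n) : nuCoef (l + l') j = nuCoef l j + nuCoef l' j := by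
  simp only [nuCoef, Pi.add_apply]; split_ifs <;> ring

theorem nuCoef_neg (l : Fin n → ℤ) (j : Fin n) : nuCoef (-l) j = - nuCoef l j := by
  simp only [nuCoef, Pi.neg_apply]; split_ifs <;> ring

theorem nuCoef_nu (k j : Fin n) : nuCoef (nu k) j = if j = k then 1 else 0 := by
  have hj := j.2
  have hk := k.2
  simp only [nuCoef, nu, Fin.le_def, Fin.ext_iff]
  split_ifs <;> omega

theorem nuCoef_sum (c : Fin n → ℤ) (j : Fin n) : nuCoef (∑ k, c k • nu k) j = c j := by
  have : nuCoef (∑ k, c k • nu k) j = ∑ k, c k * nuCoef (nu k) j := by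
    by_cases h : j.val + 1 < n
    · simp only [nuCoef_lt h, Finset.sum_apply, Pi.smul_apply, smul_eq_mul, mul_sub,
        Finset.sum_sub_distrib]
    · simp only [nuCoef_last h, Finset.sum_apply, Pi.smul_apply, smul_eq_mul]
  rw [this]
  simp [nuCoef_nu]

theorem eq_of_nuCoef {l l' : Fin n → ℤ} (h : ∀ j, nuCoef l j = nuCoef l' j) : l = l' := by
  have key : ∀ m : ℕ, ∀ j : Fin n, j.val + m + 1 = n → l j = l' j := by
    intro m
    induction m with
    | zero =>
      intro j hj
      have hl : ¬ j.val + 1 < n := by omega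
      have := h j
      rwa [nuCoef_last hl, nuCoef_last hl] at this
    | succ m ih =>
      intro j hj
      have hl : j.val + 1 < n := by omega
      have h1 := h j
      rw [nuCoef_lt hl, nuCoef_lt hl, ih ⟨j.val + 1, hl⟩ (by simp; omega)] at h1
      linarith
  funext j
  exact key (n - 1 - j.val) j (by have := j.2; omega)

theorem nuCoef_domPart (l : Fin n → ℤ) (j : Fin n) : nuCoef (domPart l) j = max (nuCoef l j) 0 :=
  nuCoef_sum _ _

theorem domPart_sub (l : Fin n → ℤ) : domPart l + -domPart (-l) = l := by
  refine eq_of_nuCoef fun j => ?_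
  rw [nuCoef_add, nuCoef_neg, nuCoef_domPart, nuCoef_domPart, nuCoef_neg]
  rcases le_total (nuCoef l j) 0 with h | h
  · rw [max_eq_right h, max_eq_left (by linarith)]; ring
  · rw [max_eq_left h, max_eq_right (by linarith)]; ring

theorem dom_domPart (l : Fin n → ℤ) : Dom (domPart l) := by
  rw [domPart]
  refine Finset.sum_induction _ Dom (fun _ _ => Dom.add) dom_zero fun j _ => ?_
  obtain ⟨h1, h2⟩ := dom_nu j
  have : 0 ≤ max (nuCoef l j) 0 := le_max_right _ _
  refine ⟨fun a b hab => ?_, fun i => ?_⟩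
  · simp only [Pi.smul_apply, smul_eq_mul]
    exact mul_le_mul_of_nonneg_left (h1 hab) this
  · simp only [Pi.smul_apply, smul_eq_mul]
    exact mul_nonneg this (h2 i)

/-- `T_{τ(l)}` as a unit. -/
def U (p : Params) (l : Fin n → ℤ) : (Op (V n))ˣ := p.TwU (p.shift l)

/-- `Y^l` as a unit. -/
def YU (p : Params) (l : Fin n → ℤ) : (Op (V n))ˣ := p.U (domPart l) * (p.U (domPart (-l)))⁻¹

theorem YU_val (l : Fin n → ℤ) : (p.YU l : Op (V n)) = p.Y l := by
  rw [YU, Y, Units.val_mul, U, U, TwU_val, ← TwU_val (p.shift (domPart (-l))), Ring.inverse_unit]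

theorem U_comm (h0 : p.hbar ≠ 0) {a b : Fin n → ℤ} (ha : Dom a) (hb : Dom b) :
    p.U a * p.U b = p.U b * p.U a := by
  rw [U, U, ← TwU_shift_add h0 ha hb, ← TwU_shift_add h0 hb ha, add_comm]

/-- Allows each computation to use the dominant decomposition that suits it in place of `domPart`.
-/
theorem YU_eq (h0 : p.hbar ≠ 0) {l a b : Fin n → ℤ} (ha : Dom a) (hb : Dom b) (h : l + b = a) :
    p.YU l = p.U a * (p.U b)⁻¹ := by
  have h1 : p.U (domPart l) * p.U b = p.U a * p.U (domPart (-l)) := by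
    rw [U, U, U, U, ← TwU_shift_add h0 (dom_domPart _) hb, ← TwU_shift_add h0 ha (dom_domPart _)]
    congr 2
    rw [← h]
    nth_rw 2 [← domPart_sub l]
    abel
  rw [YU, mul_inv_eq_iff_eq_mul, mul_assoc, ← mul_inv_eq_iff_eq_mul.2 h1]
  have h2 := U_comm h0 (dom_domPart (-l)) hb
  have h3 : (p.U b)⁻¹ * p.U (domPart (-l)) = p.U (domPart (-l)) * (p.U b)⁻¹ := by
    rw [inv_mul_eq_iff_eq_mul, ← mul_assoc, ← h2, mul_inv_cancel_right]
  rw [h3, ← mul_assoc, inv_mul_cancel_right, mul_inv_cancel_right]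

theorem YU_dom (h0 : p.hbar ≠ 0) {a : Fin n → ℤ} (ha : Dom a) : p.YU a = p.U a := by
  rw [YU_eq h0 ha dom_zero (add_zero a), U, U, shift_zero, TwU_one h0, inv_one, mul_one]

theorem YU_zero (h0 : p.hbar ≠ 0) : p.YU (0 : Fin n → ℤ) = 1 := by
  rw [YU_dom h0 dom_zero, U, shift_zero, TwU_one h0]

theorem YU_add (h0 : p.hbar ≠ 0) (l l' : Fin n → ℤ) : p.YU (l + l') = p.YU l * p.YU l' := by
  have h1 := dom_domPart l
  have h2 := dom_domPart (-l)
  have h3 := dom_domPart l'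
  have h4 := dom_domPart (-l')
  rw [YU_eq h0 (h1.add h3) (h2.add h4) (by
    linear_combination -domPart_sub l - domPart_sub l'), YU, YU]
  simp only [U, TwU_shift_add h0 h1 h3, TwU_shift_add h0 h2 h4]
  change p.U _ * p.U _ * (p.U _ * p.U _)⁻¹ = p.U _ * (p.U _)⁻¹ * (p.U _ * (p.U _)⁻¹)
  have h5 : (p.U (domPart (-l)))⁻¹ * p.U (domPart l') = p.U (domPart l') * (p.U (domPart (-l)))⁻¹ := by
    rw [inv_mul_eq_iff_eq_mul, ← mul_assoc, U_comm h0 h2 h3, mul_inv_cancel_right]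
  rw [U_comm h0 h2 h4, mul_inv_rev, mul_assoc, mul_assoc, ← mul_assoc (p.U (domPart (-l)))⁻¹, h5]
  simp only [mul_assoc]

theorem YU_comm (h0 : p.hbar ≠ 0) (l l' : Fin n → ℤ) : p.YU l * p.YU l' = p.YU l' * p.YU l := by
  rw [← YU_add h0, ← YU_add h0, add_comm]

theorem YU_neg (h0 : p.hbar ≠ 0) (l : Fin n → ℤ) : p.YU (-l) = (p.YU l)⁻¹ :=
  eq_inv_of_mul_eq_one_left (by rw [← YU_add h0, neg_add_cancel, YU_zero h0])

theorem YU_zsmul (h0 : p.hbar ≠ 0) (l : Fin n → ℤ) (k : ℤ) : p.YU (k • l) = p.YU l ^ k := by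
  let f : Multiplicative (Fin n → ℤ) →* (Op (V n))ˣ :=
    { toFun := fun l => p.YU l.toAdd
      map_one' := YU_zero h0
      map_mul' := fun a b => YU_add h0 _ _ }
  exact map_zpow f (Multiplicative.ofAdd l) k

/-! ### Relations with the generators -/

theorem al_shift (i : Fin n) (l : Fin n → ℤ) (x : V n) : p.al (some i) (p.shift l x) =
    p.al (some i) x + p.hbar * ((if i.val + 1 < n then 1 else 2) * nuCoef l i) := by
  by_cases h : i.val + 1 < n
  · rw [al_lt _ h, al_lt _ h, shift_apply, shift_apply, nuCoef_lt h, if_pos h]; push_cast; ring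
  · rw [al_last _ h, al_last _ h, shift_apply, nuCoef_last h, if_neg h]; ring

/-- If l is orthogonal to α_i, then s_iτ(l) = τ(l)s_i, and both products are length additive, so T
of this element factors in two ways. -/
theorem TU_U_comm (h0 : p.hbar ≠ 0) {i : Fin n} {l : Fin n → ℤ} (hi : nuCoef l i = 0) :
    p.TU (some i) * p.U l = p.U l * p.TU (some i) := by
  have hal : ∀ (l : Fin n → ℤ), nuCoef l i = 0 → ∀ x, p.al (some i) (p.shift l x) = p.al (some i) x := by
    intro l hl x
    rw [al_shift, hl]; simp
  have h1 := TwU_s_mul h0 (shift_mem l) (i := some i) (by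
    rw [hal l hi]; exact al_X0_pos h0 _)
  have h2 := TwU_mul h0 (shift_mem l) (p.s_mem (some i)) (by
    intro f hf hf1 hf2
    rcases (hv_X0_ne h0 (p.rts_comp hf (p.s_mem (some i)))).lt_or_gt with h3 | h3
    · have := eq_al h0 hf _ hf1 h3
      rw [this, ← shift_neg, hal _ (by rw [nuCoef_neg, hi, neg_zero])] at hf2
      linarith [al_X0_pos (n := n) h0 (some i)]
    · exact h3)
  rw [s_mul_eq_mul_s (shift_mem l) (hal l hi), h2, TwU_s h0] at h1
  exact h1.symm

theorem TU_YU_comm (h0 : p.hbar ≠ 0) {i : Fin n} {l : Fin n → ℤ} (hi : nuCoef l i = 0) :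
    p.TU (some i) * p.YU l = p.YU l * p.TU (some i) := by
  have h1 := TU_U_comm h0 (p := p) (i := i) (l := domPart l) (by rw [nuCoef_domPart, hi, max_self])
  have h2 := TU_U_comm h0 (p := p) (i := i) (l := domPart (-l)) (by
    rw [nuCoef_domPart, nuCoef_neg, hi, neg_zero, max_self])
  have h3 : Commute (p.TU (some i)) (p.U (domPart (-l))) := h2
  exact (show Commute _ _ from h1).mul_right h3.inv_right

/-- The action of the reflection `s_i`, `i ≥ 1`, on the coroot lattice. -/
def sl (i : Fin n) (l : Fin n → ℤ) : Fin n → ℤ := fun j =>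
  if h : i.val + 1 < n then l (Equiv.swap i ⟨i.val + 1, h⟩ j) else if j = i then - l i else l j

theorem sl_lt {i : Fin n} (h : i.val + 1 < n) (l : Fin n → ℤ) (j : Fin n) :
    sl i l j = if j.val = i.val then l ⟨i.val + 1, h⟩ else if j.val = i.val + 1 then l i else l j := by
  rw [sl, dif_pos h]
  by_cases h1 : j = i
  · subst h1; simp
  · have h1' : j.val ≠ i.val := fun hh => h1 (Fin.ext hh)
    by_cases h2 : j = ⟨i.val + 1, h⟩
    · rw [h2]; simp
    · have h2' : j.val ≠ i.val + 1 := fun hh => h2 (Fin.ext hh)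
      rw [Equiv.swap_apply_of_ne_of_ne h1 h2]; simp [h1', h2']

theorem sl_last {i : Fin n} (h : ¬ i.val + 1 < n) (l : Fin n → ℤ) (j : Fin n) :
    sl i l j = if j = i then - l i else l j := by
  rw [sl, dif_neg h]

theorem sl_add (i : Fin n) (l l' : Fin n → ℤ) : sl i (l + l') = sl i l + sl i l' := by
  funext j
  simp only [sl, Pi.add_apply]
  split_ifs <;> ring

theorem sl_eq_self {i : Fin n} {l : Fin n → ℤ} (h : nuCoef l i = 0) : sl i l = l := by
  funext j
  by_cases hi : i.val + 1 < n
  · rw [nuCoef_lt hi] at h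
    rw [sl_lt hi]
    split_ifs with h1 h2
    · rw [show j = i from Fin.ext h1]; linarith
    · rw [show j = ⟨i.val + 1, hi⟩ from Fin.ext h2]; linarith
    · rfl
  · rw [nuCoef_last hi] at h
    rw [sl_last hi]
    split_ifs with h1
    · rw [h1, h, neg_zero]
    · rfl

theorem sl_sl (i : Fin n) (l : Fin n → ℤ) : sl i (sl i l) = l := by
  funext j
  simp only [sl]
  split_ifs with h1 h2 <;> simp_all

theorem nuCoef_sl (i : Fin n) (l : Fin n → ℤ) : nuCoef (sl i l) i = - nuCoef l i := by
  by_cases hi : i.val + 1 < n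
  · rw [nuCoef_lt hi, nuCoef_lt hi, sl_lt hi, sl_lt hi]; simp
  · rw [nuCoef_last hi, nuCoef_last hi, sl_last hi]; simp

theorem s_mul_shift (i : Fin n) (l : Fin n → ℤ) :
    p.s (some i) * p.shift l = p.shift (sl i l) * p.s (some i) := by
  ext x j
  change p.s _ (p.shift l x) j = p.shift _ (p.s _ x) j
  rw [shift_apply]
  by_cases hi : i.val + 1 < n
  · rw [s_lt_apply _ hi, s_lt_apply _ hi, shift_apply, sl, dif_pos hi]
  · rw [s_last_apply _ hi, s_last_apply _ hi, shift_apply, shift_apply, sl_last hi]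
    split_ifs <;> push_cast <;> ring

theorem dom_nu_add (i : Fin n) : Dom (nu i + sl i (nu i)) ∨ ¬ i.val + 1 < n := by
  by_cases hi : i.val + 1 < n
  · refine .inl ⟨fun a b hab => ?_, fun a => ?_⟩ <;>
      simp only [Pi.add_apply, sl_lt hi, nu, Fin.le_def] at * <;> split_ifs <;> omega
  · exact .inr hi

/-- Both sides are T of the element τ(ν_i)s_iτ(ν_i) = s_iτ(ν_i + s_iν_i). On the left s_i shortens
τ(ν_i), which produces T_i⁻¹; all remaining products are length additive. -/
theorem U_nu_rel (h0 : p.hbar ≠ 0) {i : Fin n} (hi : i.val + 1 < n) :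
    p.U (nu i) * (p.TU (some i))⁻¹ * p.U (nu i) = p.TU (some i) * p.U (nu i + sl i (nu i)) := by
  set s := p.s (some i) with hs
  have hm : p.shift (nu i) * s ∈ p.affW n := mul_mem (shift_mem _) (p.s_mem _)
  have hinv : ∀ x, (p.shift (nu i) * s)⁻¹ x = s (p.shift (-nu i) x) := fun x => by
    rw [mul_inv_rev, hs, s_inv, ← shift_neg]; rfl
  have h1 : p.TwU (p.shift (nu i) * s) = p.U (nu i) * (p.TU (some i))⁻¹ := by
    rw [eq_mul_inv_iff_mul_eq, ← TwU_s h0, ← TwU_mul h0 hm (p.s_mem _), mul_assoc, s_mul_self, mul_one]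
    · rfl
    intro f hf hf1 hf2
    rcases (hv_X0_ne h0 (p.rts_comp hf (p.s_mem (some i)))).lt_or_gt with h3 | h3
    · have := eq_al h0 hf _ hf1 h3
      rw [hinv, this, al_s, hv_neg, X0, shift_pt h0] at hf2
      have := hv_rts (p := p) h0 (f := p.al (some i)) (a := i) (b := ⟨i.val + 1, hi⟩) (ε := 1) (δ := -1)
        (m := 0) (fun x => by rw [al_lt _ hi]; push_cast; ring)
      rw [this] at hf2
      have h4 : nu i i = 1 := by simp [nu]
      have h5 : nu i ⟨i.val + 1, hi⟩ = 0 := by simp [nu, Fin.le_def]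
      simp only [Pi.neg_apply, h4, h5] at hf2
      have h6 := (Int.cast_pos (R := ℝ)).1 (neg_lt_zero.1 hf2)
      simp [scale] at h6
      have := i.2
      omega
    · exact h3
  have h2 : p.TwU (p.shift (nu i) * s * p.shift (nu i)) = p.TwU (p.shift (nu i) * s) * p.U (nu i) := by
    refine TwU_mul h0 hm (shift_mem _) ?_
    intro f hf hf1 hf2
    rw [hinv] at hf2
    rcases (hv_X0_ne h0 (p.rts_comp hf (shift_mem (nu i)))).lt_or_gt with h3 | h3
    swap
    · exact h3
    exfalso
    obtain ⟨a, b, ε, δ, m, hab, hf⟩ := hf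
    -- The point at which a root must be negative to be an inversion; its integral coordinates
    -- reduce length additivity to a finite case check.
    have hpt : s (p.shift (-nu i) (p.X0 n)) = p.pt fun j => if j.val = i.val then n - (i.val + 1) else
        if j.val = i.val + 1 then n - i.val - scale n else n - j.val - scale n * nu i j := by
      rw [X0, shift_pt h0]
      ext j
      rw [hs, s_lt_apply' hi, pt_apply, pt_apply, pt_apply, pt_apply]
      have h4 : nu i i = 1 := by simp [nu]
      have h5 : nu i ⟨i.val + 1, hi⟩ = 0 := by simp [nu, Fin.le_def]
      simp only [Pi.neg_apply]
      split_ifs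
      · rw [h5]; simp
      · rw [h4]; simp; left; ring
      · simp; left; ring
    rw [hpt, hv_rts h0 hf] at hf2
    rw [X0, shift_pt h0, hv_rts h0 hf] at h3
    rw [X0, hv_rts h0 hf] at hf1
    replace hf1 := (Int.cast_pos (R := ℝ)).1 hf1
    replace hf2 := (Int.cast_lt_zero (R := ℝ)).1 hf2
    replace h3 := (Int.cast_lt_zero (R := ℝ)).1 h3
    have ha := a.2
    have hb := b.2
    have hab' : a.val = b.val → ε = δ := fun h => hab (Fin.ext h)
    have hm := mul_scale_cases (n := n) m
    simp only [scale, nu, Fin.le_def, mul_ite, mul_one, mul_zero] at hm hf1 hf2 h3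
    rcases Int.units_eq_one_or ε with rfl | rfl <;> rcases Int.units_eq_one_or δ with rfl | rfl <;>
      simp at hf1 hf2 h3 hab' <;> split_ifs at hf2 h3 <;> omega
  have h3 : p.shift (nu i) * s * p.shift (nu i) = s * p.shift (nu i + sl i (nu i)) := by
    have : p.shift (nu i) * s = s * p.shift (sl i (nu i)) := by
      rw [s_mul_shift, sl_sl]
    rw [this, mul_assoc, ← shift_add, add_comm]
  have h4 : p.TwU (s * p.shift (nu i + sl i (nu i))) = p.TU (some i) * p.U (nu i + sl i (nu i)) := by
    refine TwU_s_mul h0 (shift_mem _) ?_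
    rw [al_shift, nuCoef_add, nuCoef_sl]
    simpa using al_X0_pos h0 _
  rw [← h4, ← h3, h2, h1]

/-- In l = ν_i + (l − ν_i) the second summand is orthogonal to α_i, hence fixed by s_i and with
Y-operator commuting with T_i. What remains is the case l = ν_i, which is `U_nu_rel`. -/
theorem YU_sl_one (h0 : p.hbar ≠ 0) {i : Fin n} (hi : i.val + 1 < n) {l : Fin n → ℤ}
    (hl : nuCoef l i = 1) : p.YU (sl i l) = (p.TU (some i))⁻¹ * p.YU l * (p.TU (some i))⁻¹ := by
  have hnu : nuCoef (nu i) i = 1 := by simp [nuCoef_nu]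
  have hc : nuCoef (l - nu i) i = 0 := by rw [sub_eq_add_neg, nuCoef_add, nuCoef_neg, hl, hnu]; rfl
  have h1 : p.YU (sl i (nu i)) = (p.TU (some i))⁻¹ * p.YU (nu i) * (p.TU (some i))⁻¹ := by
    rw [YU_eq h0 ((dom_nu_add i).resolve_right (not_not.2 hi)) (dom_nu i) (add_comm _ _),
      YU_dom h0 (dom_nu i), mul_inv_eq_iff_eq_mul, mul_assoc, mul_assoc, eq_inv_mul_iff_mul_eq,
      ← U_nu_rel h0 hi, mul_assoc]
  have h2 : l = nu i + (l - nu i) := by abel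
  have h3 := TU_YU_comm h0 (p := p) hc
  rw [h2, sl_add, sl_eq_self hc, YU_add h0, YU_add h0, h1]
  have h4 : (p.TU (some i))⁻¹ * p.YU (l - nu i) = p.YU (l - nu i) * (p.TU (some i))⁻¹ :=
    (show Commute _ _ from h3).inv_left
  simp only [mul_assoc]
  rw [h4]

end Params
end Koornwinder
end

/-! ### Commutation of T_i with symmetric combinations of the Y^l. -/

noncomputable section
set_option linter.unusedSectionVars false
namespace Koornwinder
namespace Params

variable {n : ℕ} [NeZero n] {p : Params}

/-- The constants `t_i - t_i⁻¹`. -/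
def kC (p : Params) (i : Option (Fin n)) : Op (V n) :=
  algebraMap ℂ (Op (V n)) ((p.t i : ℂ) - (p.t i : ℂ)⁻¹)

theorem kC_comm (i : Option (Fin n)) (x : Op (V n)) : p.kC i * x = x * p.kC i := Algebra.commutes _ _

theorem TU_inv_eq (i : Option (Fin n)) : (((p.TU i)⁻¹ : (Op (V n))ˣ) : Op (V n)) = p.T i - p.kC i := rfl

section ring

variable {A : Type*} [Ring A]

/-- A quadratic relation for `T` and `B = T⁻¹AT⁻¹` imply that `T` commutes with `A + B`. -/
theorem comm_add_conj {T : Aˣ} {a k : A} (hT : ((T⁻¹ : Aˣ) : A) = T - k) (hk : ∀ x, k * x = x * k) :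
    Commute (T : A) (a + (T⁻¹ : Aˣ) * a * (T⁻¹ : Aˣ)) := by
  change (T : A) * _ = _ * T
  rw [mul_add, add_mul, mul_assoc, mul_assoc, mul_assoc, Units.mul_inv_cancel_left, Units.inv_mul, mul_one,
    hT, mul_sub, sub_mul, hk]
  abel

/-- The rank one situation at the last node, where Y^{e_n} = XT with both X and T quadratic.
Expanding with the two quadratic relations, the terms TXT and X⁻¹ appear on both sides. -/
theorem comm_add_inv {T X : Aˣ} {k l : A} (hT : ((T⁻¹ : Aˣ) : A) = T - k) (hk : ∀ x, k * x = x * k)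
    (hX : ((X⁻¹ : Aˣ) : A) = X - l) (hl : ∀ x, l * x = x * l) :
    Commute (T : A) ((X * T : Aˣ) + ((X * T)⁻¹ : Aˣ)) := by
  have hX' : (X : A) = (X⁻¹ : Aˣ) + l := by rw [hX]; abel
  have h1 : (T : A) * ((X * T : Aˣ) + ((X * T)⁻¹ : Aˣ)) = T * X * T + (X⁻¹ : Aˣ) := by
    rw [mul_inv_rev, Units.val_mul, Units.val_mul, mul_add, Units.mul_inv_cancel_left, mul_assoc]
  have h2 : ((T⁻¹ : Aˣ) : A) * X = T * X - k * X := by rw [hT, sub_mul]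
  have h3 : (T : A) * T = 1 + k * T := by
    have := T.mul_inv
    rw [hT, mul_sub, ← hk] at this
    rw [← this]; abel
  have h4 : ((T⁻¹ : Aˣ) : A) * (X⁻¹ : Aˣ) * T = T * X * T - k * X * T - l := by
    rw [hX, mul_sub, sub_mul, h2, sub_mul, ← hl, mul_assoc l, Units.inv_mul, mul_one]
  change _ = _ * (T : A)
  rw [h1, mul_inv_rev, Units.val_mul, Units.val_mul, add_mul, h4, mul_assoc (X : A), h3, mul_add, mul_one,
    ← mul_assoc (X : A), ← hk, hX]
  abel

/-- Newton's recursion expresses power sums of commuting a, b through a + b and ab. -/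
theorem comm_pow_add {T a b : A} (hab : Commute a b) (h1 : Commute T (a + b)) (h2 : Commute T (a * b))
    (k : ℕ) : Commute T (a ^ k + b ^ k) := by
  induction k using Nat.twoStepInduction with
  | zero => simp only [pow_zero]; exact (Commute.one_right _).add_right (Commute.one_right _)
  | one => simpa using h1
  | more k ih1 ih2 =>
    have : a ^ (k + 2) + b ^ (k + 2) = (a ^ (k + 1) + b ^ (k + 1)) * (a + b) - (a * b) * (a ^ k + b ^ k) := by
      have e1 : b ^ (k + 1) * a = a * b * b ^ k := by
        rw [mul_assoc, ← pow_succ']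
        exact ((hab.pow_right (k + 1)).eq).symm
      have e2 : a ^ (k + 1) * b = a * b * a ^ k := by
        rw [(hab.pow_left (k + 1)).eq, pow_succ', ← mul_assoc, hab.eq]
      rw [add_mul, mul_add, mul_add, e1, e2, mul_add, ← pow_succ, ← pow_succ]; abel
    rw [this]
    exact (ih2.mul_right h1).sub_right (h2.mul_right ih1)

end ring

theorem nuCoef_single {i : Fin n} (k : Fin n) (hk : k.val ≤ i.val) :
    nuCoef (Pi.single k 1 : Fin n → ℤ) i = if k = i then 1 else 0 := by
  have hi := i.2
  simp only [nuCoef, Pi.single_apply, Fin.ext_iff]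
  split_ifs <;> omega

theorem sl_single {i : Fin n} (hi : i.val + 1 < n) :
    sl i (Pi.single i 1 : Fin n → ℤ) = Pi.single ⟨i.val + 1, hi⟩ 1 := by
  funext j
  rw [sl_lt hi]
  simp only [Pi.single_apply, Fin.ext_iff]
  split_ifs <;> omega

theorem YU_single_succ (h0 : p.hbar ≠ 0) {i : Fin n} (hi : i.val + 1 < n) :
    p.YU (Pi.single ⟨i.val + 1, hi⟩ 1) =
      (p.TU (some i))⁻¹ * p.YU (Pi.single i 1) * (p.TU (some i))⁻¹ := by
  rw [← sl_single hi]
  exact YU_sl_one h0 hi (by rw [nuCoef_single _ le_rfl, if_pos rfl])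

/-- `T` of the sign change of the coordinate `k`. -/
def PU (p : Params) (k : Fin n) : (Op (V n))ˣ := p.TwU (flip k)

theorem flip_last : flip (lastNode n) = p.s (some (lastNode n)) := by
  ext x j
  rw [flip_apply, s_last_apply _ ((lastNode_iff _).1 rfl)]

theorem PU_last (h0 : p.hbar ≠ 0) : p.PU (lastNode n) = p.TU (some (lastNode n)) := by
  rw [PU, flip_last (p := p), TwU_s h0]

theorem flip_inv (k : Fin n) : (flip k)⁻¹ = flip k := by
  refine inv_eq_of_mul_eq_one_left ?_
  ext x j
  change flip k (flip k x) j = x j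
  rw [flip_apply, flip_apply, flip_apply]
  split_ifs with h1 <;> simp_all

theorem flip_pt (k : Fin n) (y : Fin n → ℤ) :
    flip k (p.pt y) = p.pt fun j => if j = k then - y j else y j := by
  ext j
  rw [flip_apply, pt_apply, pt_apply, pt_apply]
  split_ifs with h
  · rw [h]; push_cast; ring
  · rfl

/-- The sign change of coordinate i is s_i times the sign change of coordinate i + 1 times s_i, and
this factorization is length additive. -/
theorem PU_succ (h0 : p.hbar ≠ 0) {i : Fin n} (hi : i.val + 1 < n) :
    p.PU i = p.TU (some i) * p.PU ⟨i.val + 1, hi⟩ * p.TU (some i) := by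
  set k : Fin n := ⟨i.val + 1, hi⟩ with hk
  have hik : i ≠ k := fun hh => by simpa [hk] using congrArg Fin.val hh
  have hik' : i ≠ ⟨i.val + 1, hi⟩ := hik
  have h1 : flip i = p.s (some i) * (flip k * p.s (some i)) := by
    ext x j
    change _ = p.s _ (flip k (p.s _ x)) j
    rw [s_lt_apply _ hi, flip_apply, flip_apply, s_lt_apply _ hi, s_lt_apply _ hi, Equiv.swap_apply_right]
    by_cases h : j = i
    · subst h; simp [hk]
    · by_cases h' : j = k
      · rw [h', hk, Equiv.swap_apply_right]; simp [hik', hik'.symm]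
      · rw [Equiv.swap_apply_of_ne_of_ne h h', Equiv.swap_apply_of_ne_of_ne h h']; simp [h, h']
  have hfs := mul_mem (finW_le (flip_mem k)) (p.s_mem (some i))
  have hz := i.2
  have hal := hv_rts (p := p) h0 (f := p.al (some i)) (a := i) (b := k) (ε := 1) (δ := -1)
        (m := 0) (fun x => by rw [al_lt _ hi]; push_cast; ring)
  have hs0 : p.s (some i) (p.X0 n) = p.pt fun j => if j = i then n - i.val - 1 else
      if j = k then n - i.val else n - j.val := by
    ext j
    rw [X0, s_lt_apply' hi, pt_apply, pt_apply, pt_apply, pt_apply]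
    simp only [Fin.ext_iff, hk]
    split_ifs <;> push_cast <;> ring
  rw [PU, h1, TwU_s_mul h0 hfs, TwU_mul h0 (finW_le (flip_mem k)) (p.s_mem _), TwU_s h0, ← mul_assoc]
  · rfl
  · intro f hf hf1 hf2
    rcases (hv_X0_ne h0 (p.rts_comp hf (p.s_mem (some i)))).lt_or_gt with h3 | h3
    · have := eq_al h0 hf _ hf1 h3
      rw [flip_inv, this, X0, flip_pt, hal] at hf2
      have h6 := (Int.cast_lt_zero (R := ℝ)).1 hf2
      simp [hik] at h6
      omega
    · exact h3
  · change 0 < p.hv n (p.al _ (flip k (p.s _ _)))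
    rw [hs0, flip_pt, hal]
    refine (Int.cast_pos (R := ℝ)).2 ?_
    simp [hik, hik.symm]
    omega

/-- The translation by e_1 is s_0 times the reflection in 2e_1, and s_0 lengthens that reflection.
-/
theorem YU_zero_single (h0 : p.hbar ≠ 0) :
    p.YU (Pi.single 0 1 : Fin n → ℤ) = p.TU none * p.PU 0 := by
  have hd : Dom (Pi.single 0 1 : Fin n → ℤ) := by
    have : (Pi.single 0 1 : Fin n → ℤ) = nu 0 := by
      funext j; simp [nu, Pi.single_apply]
    rw [this]; exact dom_nu 0
  rw [YU_dom h0 hd, U, shift_zero_eq, TwU_s_mul h0 (finW_le (flip_mem 0)), PU]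
  have hal := hv_rts (p := p) (n := n) h0 (f := p.al none) (a := 0) (b := 0) (ε := -1) (δ := -1)
        (m := 1) (fun x => by rw [al_none]; push_cast; ring)
  rw [X0, flip_pt, hal]
  refine (Int.cast_pos (R := ℝ)).2 ?_
  simp [scale]
  omega

/-- The product `T_1 ... T_m`. -/
def gU (p : Params) : ℕ → (Op (V n))ˣ
  | 0 => 1
  | m + 1 => gU p m * if h : m < n then p.TU (some ⟨m, h⟩) else 1

/-- `Y^{e_k} P_k⁻¹` is a conjugate of `T_0`. -/
theorem YU_single (h0 : p.hbar ≠ 0) (k : Fin n) :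
    p.YU (Pi.single k 1) = (p.gU k.val)⁻¹ * p.TU none * p.gU k.val * p.PU k := by
  obtain ⟨k, hk⟩ := k
  induction k with
  | zero =>
    have := YU_zero_single (n := n) h0
    rw [gU, inv_one, one_mul, mul_one]
    exact this
  | succ k ih =>
    have hg := ih (by omega)
    simp only at hg ⊢
    rw [gU, dif_pos (by omega), YU_single_succ h0 (i := ⟨k, by omega⟩) hk, hg,
      PU_succ h0 (i := ⟨k, by omega⟩) hk]
    group

/-- `Y^{e_n} T_n⁻¹` satisfies the quadratic relation of `T_0`. -/
theorem exists_YU_last (h0 : p.hbar ≠ 0) : ∃ X : (Op (V n))ˣ,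
    p.YU (Pi.single (lastNode n) 1) = X * p.TU (some (lastNode n)) ∧
    ((X⁻¹ : (Op (V n))ˣ) : Op (V n)) = X - p.kC (none : Option (Fin n)) := by
  have hg := YU_single (n := n) h0 (lastNode n)
  rw [PU_last h0] at hg
  refine ⟨_, hg, ?_⟩
  simp only [mul_inv_rev, Units.val_mul, inv_inv, TU_inv_eq, TU_val, mul_sub, sub_mul]
  rw [kC_comm, ← mul_assoc, ← mul_assoc, Units.inv_mul, one_mul]

/-- A consequence of the Bernstein–Lusztig relations. Splitting off an s_i-invariant summand reduces
l to k e_i with k ≥ 0 (for negative pairing l and s_il change roles), and `comm_pow_add` reduces k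
to 1. For i < n, Y^{e_{i+1}} = T_i⁻¹Y^{e_i}T_i⁻¹; for i = n, Y^{e_n}T_n⁻¹ satisfies the quadratic
relation of T_0. -/
theorem commute_YU_add (h0 : p.hbar ≠ 0) (i : Fin n) (l : Fin n → ℤ) :
    Commute (p.T (some i)) (p.YU l + p.YU (sl i l)) := by
  have key : ∀ k : ℕ, ∀ l : Fin n → ℤ, nuCoef l i = k →
      Commute (p.T (some i)) (p.YU l + p.YU (sl i l)) := by
    intro k l hk
    set d : Fin n → ℤ := Pi.single i 1 with hd
    have hd1 : nuCoef d i = 1 := by rw [hd, nuCoef_single _ le_rfl, if_pos rfl]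
    have hc : nuCoef (l - (k : ℤ) • d) i = 0 := by
      have : nuCoef ((k : ℤ) • d) i = k * nuCoef d i := by
        simp only [nuCoef, Pi.smul_apply, smul_eq_mul]; split_ifs <;> ring
      rw [sub_eq_add_neg, nuCoef_add, nuCoef_neg, this, hk, hd1]; ring
    have hsk : sl i ((k : ℤ) • d) = (k : ℤ) • sl i d := by
      funext j; simp only [sl, Pi.smul_apply, smul_eq_mul]; split_ifs <;> ring
    have e1 : p.YU l = p.YU (l - (k : ℤ) • d) * p.YU d ^ k := by
      rw [← zpow_natCast, ← YU_zsmul h0, ← YU_add h0]; congr 1; abel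
    have e2 : p.YU (sl i l) = p.YU (l - (k : ℤ) • d) * p.YU (sl i d) ^ k := by
      rw [← zpow_natCast, ← YU_zsmul h0, ← hsk, ← YU_add h0]
      nth_rw 1 [← sl_eq_self hc]
      rw [← sl_add]
      congr 2; abel
    rw [e1, e2, Units.val_mul, Units.val_mul, ← mul_add, Units.val_pow_eq_pow_val,
      Units.val_pow_eq_pow_val]
    refine Commute.mul_right ?_ ?_
    · have := TU_YU_comm h0 (p := p) hc
      exact congrArg Units.val this
    have hcm : Commute (p.YU d : Op (V n)) (p.YU (sl i d)) := congrArg Units.val (YU_comm h0 _ _)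
    refine comm_pow_add hcm ?_ ?_ k
    · by_cases hi : i.val + 1 < n
      · rw [YU_sl_one h0 hi hd1, Units.val_mul, Units.val_mul]
        exact comm_add_conj (T := p.TU (some i)) (TU_inv_eq _) (kC_comm _)
      · have hsd : sl i d = -d := by
          funext j
          rw [sl_last hi, hd]
          by_cases h : j = i
          · subst h; simp
          · simp [h]
        rw [hsd, YU_neg h0]
        obtain ⟨X, hX, hX'⟩ := exists_YU_last (n := n) h0
        have hil := (lastNode_iff i).2 hi
        rw [← hil] at hX
        rw [hd, hX]
        exact comm_add_inv (T := p.TU (some i)) (TU_inv_eq _) (kC_comm _) hX' (kC_comm _)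
    · rw [← Units.val_mul, ← YU_add h0]
      exact congrArg Units.val (TU_YU_comm h0 (p := p) (i := i) (l := d + sl i d) (by
        rw [nuCoef_add, nuCoef_sl]; ring))
  obtain ⟨k, hk | hk⟩ := Int.eq_nat_or_neg (nuCoef l i)
  · exact key k l hk
  · have := key k (sl i l) (by rw [nuCoef_sl, hk, neg_neg])
    rwa [sl_sl, add_comm] at this

end Params
end Koornwinder
end

noncomputable section
set_option linter.unusedSectionVars false
namespace Koornwinder
namespace Params

variable {n : ℕ} [NeZero n] {p : Params}

/-! ### Orbit sums -/

variable (n) in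
/-- Signed permutations. -/
abbrev SP : Type := Equiv.Perm (Fin n) × (Fin n → ℤˣ)

/-- The action of signed permutations on the coroot lattice. -/
def sact (g : SP n) (l : Fin n → ℤ) : Fin n → ℤ := fun j => g.2 j * l (g.1 j)

/-- The product of signed permutations. -/
def smul' (g h : SP n) : SP n := (h.1 * g.1, fun j => g.2 j * h.2 (g.1 j))

/-- The inverse of a signed permutation. -/
def sinv (g : SP n) : SP n := (g.1⁻¹, fun j => g.2 (g.1⁻¹ j))

theorem sact_mul (g h : SP n) (l : Fin n → ℤ) : sact (smul' g h) l = sact g (sact h l) := by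
  funext j; simp [sact, smul', mul_assoc]

theorem sinv_mul_cancel (g h : SP n) : smul' (sinv g) (smul' g h) = h := by
  refine Prod.ext ?_ ?_
  · simp [smul', sinv, mul_assoc]
  · funext j
    have : g.2 (g.1⁻¹ j) * (g.2 (g.1⁻¹ j) * h.2 j) = h.2 j := by
      rw [← mul_assoc, Int.units_mul_self, one_mul]
    simpa [smul', sinv] using this

theorem sinv_sinv (g : SP n) : sinv (sinv g) = g := by
  refine Prod.ext ?_ ?_
  · simp [sinv]
  · funext j; simp [sinv]

theorem mul_sinv_cancel (g h : SP n) : smul' g (smul' (sinv g) h) = h := by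
  have := sinv_mul_cancel (sinv g) h
  rwa [sinv_sinv] at this

/-- Left multiplication by a signed permutation. -/
def smulEquiv (g : SP n) : SP n ≃ SP n :=
  ⟨smul' g, smul' (sinv g), sinv_mul_cancel g, mul_sinv_cancel g⟩

theorem sact_add (g : SP n) (l l' : Fin n → ℤ) : sact g (l + l') = sact g l + sact g l' := by
  funext j; simp [sact, mul_add]

theorem refl_long (k : Fin n) (a : ℤˣ) : refl ((2 * (a : ℤ)) • e k) 0 = (flip k : V n ≃ᵃ[ℂ] V n) := by
  ext x : 1
  change reflFun _ _ _ = reflFun _ _ _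
  have h : ((2 * (a : ℤ)) • e k : V n) = ((a : ℤ) : ℂ) • ((2 : ℂ) • e k) := by
    rw [smul_smul, ← Int.cast_smul_eq_zsmul ℂ]; push_cast; rw [mul_comm]
  rw [h]
  rcases Int.units_eq_one_or a with rfl | rfl
  · simp
  · have hn : ∀ b y : V n, reflFun (-b) 0 y = reflFun b 0 y := by
      intro b y
      have h1 : form (-b) (-b) = form b b := by simp [form]
      have h2 : form (-b) y = - form b y := by simp [form]
      simp only [reflFun, check, h1, h2]
      simp
    simpa using hn _ x

theorem NF_refl_short {i j : Fin n} (hij : i ≠ j) (a b : ℤˣ) :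
    p.NF (refl ((a : ℤ) • e i + (b : ℤ) • e j) 0) (Equiv.swap i j)
      (fun k => if k = i ∨ k = j then -(a * b) else 1) 0 := by
  intro x k
  change reflFun _ _ _ k = _
  set α : V n := (a : ℤ) • e i + (b : ℤ) • e j with hα
  have h0 : α = ((a : ℤ) : ℂ) • e i + ((b : ℤ) : ℂ) • e j := by
    rw [Int.cast_smul_eq_zsmul, Int.cast_smul_eq_zsmul]
  have h1 : ∀ y, form α y = (a : ℤ) * y i + (b : ℤ) * y j := by
    intro y
    rw [h0, form_comm, form_add, form_smul, form_smul, form_comm, form_e, form_comm, form_e]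
  have h2 : form α α = 2 := by
    rw [h1, h0]
    rcases Int.units_eq_one_or a with rfl | rfl <;> rcases Int.units_eq_one_or b with rfl | rfl <;>
      simp [e, hij, hij.symm] <;> norm_num
  rw [reflFun, check, h2, h1, h0]
  rcases eq_or_ne k i with rfl | hi
  · rcases Int.units_eq_one_or a with rfl | rfl <;> rcases Int.units_eq_one_or b with rfl | rfl <;>
      simp [e, hij]
  · rcases eq_or_ne k j with rfl | hj
    · rcases Int.units_eq_one_or a with rfl | rfl <;> rcases Int.units_eq_one_or b with rfl | rfl <;>
        simp [e, hij.symm]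
    · simp [e, hi, hj, Equiv.swap_apply_of_ne_of_ne hi hj]

theorem weyl_eq : weyl n = p.finW n := by
  refine le_antisymm ?_ ?_
  · rw [weyl, Subgroup.closure_le]
    rintro _ ⟨α, ⟨i, j, hij, a, b, rfl⟩ | ⟨i, a, rfl⟩, rfl⟩
    · exact mem_finW_of_NF (NF_refl_short hij a b)
    · rw [refl_long]; exact flip_mem i
  · rw [finW, Subgroup.closure_le]
    rintro _ ⟨i, rfl⟩
    refine Subgroup.subset_closure ⟨simpleRoot i, ?_, rfl⟩
    by_cases h : i.val + 1 < n
    · refine .inl ⟨i, ⟨i.val + 1, h⟩, fun hh => ?_, 1, -1, ?_⟩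
      · simpa using congrArg Fin.val hh
      · simp [simpleRoot, h, sub_eq_add_neg]
    · refine .inr ⟨i, 1, ?_⟩
      simp only [simpleRoot, h, dif_neg, not_false_eq_true]
      rw [← Int.cast_smul_eq_zsmul ℂ]; simp

theorem latt_injective : Function.Injective (latt (n := n)) := by
  intro l l' h
  funext j
  have := congrArg (fun v : V n => v j) h
  simpa [latt_apply] using this

theorem mem_orbit_iff {l m : Fin n → ℤ} : m ∈ orbit l ↔ ∃ g : SP n, sact g l = m := by
  -- The finite Weyl group does not depend on the parameters; any choice makes the description of
  -- `finW` by signed permutations available.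
  let p : Params := ⟨1, 1, 1, 1, 1, 1⟩
  have key : ∀ g : SP n, ∀ w : V n ≃ᵃ[ℂ] V n, p.NF w g.1 g.2 0 → w (latt l) = latt (sact g l) := by
    intro g w hw
    ext j
    rw [hw, latt_apply, latt_apply, sact]; simp
  constructor
  · rintro ⟨w, hw, h⟩
    rw [weyl_eq (p := p)] at hw
    obtain ⟨σ, ε, hσ⟩ := exists_NF_finW hw
    exact ⟨(σ, ε), latt_injective (by rw [← h, key (σ, ε) w hσ])⟩
  · rintro ⟨g, rfl⟩
    obtain ⟨w, hw, h⟩ := exists_signed (p := p) g.1 g.2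
    exact ⟨w, by rwa [weyl_eq (p := p)], key g w h⟩

/-- The sum of `Y^{g l}` over all signed permutations `g`. -/
def EY (p : Params) (l : Fin n → ℤ) : Op (V n) := ∑ g : SP n, p.Y (sact g l)

/-- Sums over the finite type of signed permutations are easier to manipulate than orbit sums; each
orbit element is counted as often as the stabilizer of l has elements. -/
theorem EY_eq (l : Fin n → ℤ) : ∃ c : ℕ, c ≠ 0 ∧ p.EY l = (c : ℂ) • p.mY l := by
  classical
  have ho : orbit l = ((Finset.univ.image fun g : SP n => sact g l : Finset _) : Set _) := by
    ext m; simp [mem_orbit_iff]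
  have hc : ∀ g₀ : SP n, (Finset.univ.filter fun g : SP n => sact g l = sact g₀ l).card =
      (Finset.univ.filter fun g : SP n => sact g l = l).card := by
    intro g₀
    refine (Finset.card_bij (fun g _ => smul' g₀ g) ?_ ?_ ?_).symm
    · intro g hg
      simp only [Finset.mem_filter, Finset.mem_univ, true_and] at hg ⊢
      rw [sact_mul, hg]
    · intro a _ b _ hab
      exact (smulEquiv g₀).injective hab
    · intro b hb
      simp only [Finset.mem_filter, Finset.mem_univ, true_and] at hb
      refine ⟨smul' (sinv g₀) b, ?_, mul_sinv_cancel _ _⟩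
      simp only [Finset.mem_filter, Finset.mem_univ, true_and]
      rw [sact_mul, hb, ← sact_mul]
      have := sinv_mul_cancel g₀ (1, 1)
      have h1 : smul' g₀ (1, 1) = g₀ := by
        refine Prod.ext ?_ ?_
        · simp [smul']
        · funext j; simp [smul']
      rw [h1] at this
      rw [this]; funext j; simp [sact]
  refine ⟨(Finset.univ.filter fun g : SP n => sact g l = l).card, ?_, ?_⟩
  · refine (Finset.card_pos.2 ⟨(1, 1), ?_⟩).ne'
    simp only [Finset.mem_filter, Finset.mem_univ, true_and]
    funext j; simp [sact]
  · rw [mY, ho, finsum_mem_coe_finset, EY, Nat.cast_smul_eq_nsmul, Finset.smul_sum,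
      ← Finset.sum_fiberwise_of_maps_to (s := Finset.univ) (t := Finset.univ.image fun g : SP n => sact g l)
        (g := fun g : SP n => sact g l) (fun g _ => Finset.mem_image_of_mem _ (Finset.mem_univ _))]
    refine Finset.sum_congr rfl fun m hm => ?_
    obtain ⟨g₀, _, rfl⟩ := Finset.mem_image.1 hm
    rw [Finset.sum_congr rfl (g := fun _ => p.Y (sact g₀ l)) (fun g hg => by
      rw [(Finset.mem_filter.1 hg).2]), Finset.sum_const, hc]

theorem mY_eq (l : Fin n → ℤ) : ∃ c : ℂ, p.mY l = c • p.EY l := by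
  obtain ⟨c, hc, h⟩ := EY_eq (p := p) l
  refine ⟨(c : ℂ)⁻¹, ?_⟩
  rw [h, smul_smul, inv_mul_cancel₀ (by exact_mod_cast hc), one_smul]

theorem Y_add (h0 : p.hbar ≠ 0) (l l' : Fin n → ℤ) : p.Y (l + l') = p.Y l * p.Y l' := by
  rw [← YU_val, YU_add h0, Units.val_mul, YU_val, YU_val]

/-- Replacing h by gh in the inner sum turns Y^{gl}Y^{hl'} into Y^{g(l + hl')}, so the sum over g is
again symmetric. -/
theorem EY_mul (h0 : p.hbar ≠ 0) (l l' : Fin n → ℤ) :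
    p.EY l * p.EY l' = ∑ h : SP n, p.EY (l + sact h l') := by
  simp only [EY, Finset.sum_mul_sum]
  rw [Finset.sum_comm' (s := Finset.univ) (t := fun _ => Finset.univ) (t' := Finset.univ)
    (s' := fun _ => Finset.univ) (f := fun h g => p.Y (sact g (l + sact h l'))) (by simp)]
  refine Finset.sum_congr rfl fun g _ => ?_
  rw [← Equiv.sum_comp (smulEquiv g)]
  refine Finset.sum_congr rfl fun h _ => ?_
  rw [sact_add, Y_add h0, ← sact_mul]; rfl

theorem EY_comm (h0 : p.hbar ≠ 0) (l l' : Fin n → ℤ) : p.EY l * p.EY l' = p.EY l' * p.EY l := by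
  simp only [EY, Finset.sum_mul_sum]
  rw [Finset.sum_comm]
  refine Finset.sum_congr rfl fun g _ => Finset.sum_congr rfl fun h _ => ?_
  rw [← Y_add h0, ← Y_add h0, add_comm]

theorem mY_comm (h0 : p.hbar ≠ 0) (l l' : Fin n → ℤ) : p.mY l * p.mY l' = p.mY l' * p.mY l := by
  obtain ⟨c, hc⟩ := mY_eq (p := p) l
  obtain ⟨d, hd⟩ := mY_eq (p := p) l'
  rw [hc, hd, smul_mul_smul_comm, smul_mul_smul_comm, EY_comm h0, mul_comm]

theorem mY_mul_mem (h0 : p.hbar ≠ 0) (l l' : Fin n → ℤ) :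
    p.mY l * p.mY l' ∈ Submodule.span ℂ (Set.range (p.mY (n := n))) := by
  obtain ⟨c, hc⟩ := mY_eq (p := p) l
  obtain ⟨d, hd⟩ := mY_eq (p := p) l'
  rw [hc, hd, smul_mul_smul_comm, EY_mul h0]
  refine Submodule.smul_mem _ _ (Submodule.sum_mem _ fun h _ => ?_)
  obtain ⟨k, _, hk⟩ := EY_eq (p := p) (l + sact h l')
  rw [hk]
  exact Submodule.smul_mem _ _ (Submodule.subset_span ⟨_, rfl⟩)

theorem mY_zero (h0 : p.hbar ≠ 0) : p.mY (0 : Fin n → ℤ) = 1 := by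
  have : orbit (0 : Fin n → ℤ) = {0} := by
    ext m
    rw [mem_orbit_iff, Set.mem_singleton_iff]
    constructor
    · rintro ⟨g, rfl⟩; funext j; simp [sact]
    · rintro rfl; exact ⟨(1, 1), by funext j; simp [sact]⟩
  rw [mY, this, finsum_mem_singleton, ← YU_val, YU_zero h0, Units.val_one]

/-- The simple reflection as a signed permutation. -/
def sSP (i : Fin n) : SP n :=
  if h : i.val + 1 < n then (Equiv.swap i ⟨i.val + 1, h⟩, 1) else (1, fun j => if j = i then -1 else 1)

theorem sact_sSP (i : Fin n) (l : Fin n → ℤ) : sact (sSP i) l = sl i l := by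
  funext j
  by_cases h : i.val + 1 < n
  · simp [sact, sSP, sl, h]
  · rw [sl_last h]
    by_cases hj : j = i
    · subst hj; simp [sact, sSP, h]
    · simp [sact, sSP, h, hj]

theorem EY_eq_sl (i : Fin n) (l : Fin n → ℤ) : p.EY l = ∑ g : SP n, p.Y (sl i (sact g l)) := by
  rw [EY, ← Equiv.sum_comp (smulEquiv (sSP i))]
  refine Finset.sum_congr rfl fun g _ => ?_
  rw [← sact_sSP, ← sact_mul]; rfl

/-- Since g ↦ s_ig permutes the signed permutations, twice the sum is a sum of pairs Y^m + Y^{s_im}.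
-/
theorem commute_EY (h0 : p.hbar ≠ 0) (i : Fin n) (l : Fin n → ℤ) :
    Commute (p.T (some i)) ((2 : ℂ) • p.EY l) := by
  have h1 : (2 : ℂ) • p.EY l = ∑ g : SP n, (p.Y (sact g l) + p.Y (sl i (sact g l))) := by
    rw [Finset.sum_add_distrib, ← EY_eq_sl, two_smul]; rfl
  rw [h1]
  refine Commute.sum_right _ _ _ fun g _ => ?_
  rw [← YU_val, ← YU_val]
  exact commute_YU_add h0 i _

theorem commute_mY (h0 : p.hbar ≠ 0) (i : Fin n) (l : Fin n → ℤ) :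
    Commute (p.T (some i)) (p.mY l) := by
  obtain ⟨c, hc⟩ := mY_eq (p := p) l
  have : c • p.EY l = (c / 2) • ((2 : ℂ) • p.EY l) := by rw [smul_smul]; norm_num
  rw [hc, this]
  exact (commute_EY h0 i l).smul_right _

/-! ### The algebra generated by the `T_i` -/

variable (n) in
/-- The algebra generated by the `T_i`. -/
def HH (p : Params) : Subalgebra ℂ (Op (V n)) := Algebra.adjoin ℂ (Set.range p.T)

theorem T_mem_HH (i : Option (Fin n)) : p.T i ∈ p.HH n := Algebra.subset_adjoin ⟨i, rfl⟩

theorem TwU_mem_HH (w : V n ≃ᵃ[ℂ] V n) :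
    (p.TwU w : Op (V n)) ∈ p.HH n ∧ (((p.TwU w)⁻¹ : (Op (V n))ˣ) : Op (V n)) ∈ p.HH n := by
  rw [TwU]
  induction Classical.epsilon (p.IsReducedWord w) with
  | nil => simp
  | cons i l ih =>
    rw [List.map_cons, List.prod_cons, mul_inv_rev, Units.val_mul, Units.val_mul]
    exact ⟨mul_mem (T_mem_HH i) ih.1, mul_mem ih.2 (sub_mem (T_mem_HH i) (Subalgebra.algebraMap_mem _ _))⟩

theorem mY_mem_HH (l : Fin n → ℤ) : p.mY l ∈ p.HH n := by
  obtain ⟨c, hc⟩ := mY_eq (p := p) l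
  rw [hc, EY]
  refine Subalgebra.smul_mem _ (Subalgebra.sum_mem _ fun g _ => ?_) c
  rw [← YU_val, YU, Units.val_mul]
  exact mul_mem (TwU_mem_HH _).1 (TwU_mem_HH _).2

end Params
end Koornwinder
end

noncomputable section
set_option linter.unusedSectionVars false
namespace Koornwinder

/-! ### Restriction of meromorphic functions to an affine subspace -/

section Restr

variable {n : ℕ} (A : AffineSubspace ℂ (V n)) [Nonempty A]

variable {A}

theorem resHol_mul (a b : Hol (V n)) : resHol A (a * b) = resHol A a * resHol A b := rfl

theorem resHol_add (a b : Hol (V n)) : resHol A (a + b) = resHol A a + resHol A b := rfl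

theorem resHol_one : resHol A (1 : Hol (V n)) = 1 := rfl

theorem ne_zero_of_resHol {b : Hol (V n)} (h : resHol A b ≠ 0) : toM b ≠ 0 := by
  intro hb
  refine h ?_
  have : b = 0 := toM_injective (by rw [hb]; exact (map_zero _).symm)
  rw [this]; rfl

/-- Holomorphic functions on `A` as meromorphic functions. -/
abbrev toA (f : Hol A) : Mer A := algebraMap (Hol A) (Mer A) f

theorem toA_ne_zero {f : Hol A} (h : f ≠ 0) : toA f ≠ 0 := by
  rw [toA, map_ne_zero_iff _ (IsFractionRing.injective _ _)]; exact h

theorem IsRestr.unique {g : Mer (V n)} {h h' : Mer A} (H : IsRestr A g h) (H' : IsRestr A g h') :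
    h = h' := by
  obtain ⟨a, b, hb, rfl, rfl⟩ := H
  obtain ⟨a', b', hb', hg, rfl⟩ := H'
  rw [div_eq_div_iff (ne_zero_of_resHol hb) (ne_zero_of_resHol hb'), ← map_mul, ← map_mul] at hg
  have h1 := toM_injective hg
  rw [div_eq_div_iff (toA_ne_zero hb) (toA_ne_zero hb'), ← map_mul, ← map_mul, ← resHol_mul, h1,
    resHol_mul]

theorem IsRestr.add {g g' : Mer (V n)} {h h' : Mer A} (H : IsRestr A g h) (H' : IsRestr A g' h') :
    IsRestr A (g + g') (h + h') := by
  obtain ⟨a, b, hb, rfl, rfl⟩ := H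
  obtain ⟨a', b', hb', rfl, rfl⟩ := H'
  refine ⟨a * b' + b * a', b * b', mul_ne_zero hb hb', ?_, ?_⟩
  · rw [div_add_div _ _ (ne_zero_of_resHol hb) (ne_zero_of_resHol hb')]; simp
  · rw [div_add_div _ _ (toA_ne_zero hb) (toA_ne_zero hb')]; simp [resHol_add, resHol_mul]

theorem IsRestr.mul {g g' : Mer (V n)} {h h' : Mer A} (H : IsRestr A g h) (H' : IsRestr A g' h') :
    IsRestr A (g * g') (h * h') := by
  obtain ⟨a, b, hb, rfl, rfl⟩ := H
  obtain ⟨a', b', hb', rfl, rfl⟩ := H'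
  refine ⟨a * a', b * b', mul_ne_zero hb hb', ?_, ?_⟩
  · rw [div_mul_div_comm]; simp
  · rw [div_mul_div_comm]; simp [resHol_mul]

theorem isRestr_toM (a : Hol (V n)) : IsRestr A (toM a) (toA (resHol A a)) :=
  ⟨a, 1, one_ne_zero, by simp, by simp [resHol_one]⟩

theorem isRestr_C (c : ℂ) : IsRestr A (algebraMap ℂ (Mer (V n)) c) (algebraMap ℂ (Mer A) c) := by
  rw [IsScalarTower.algebraMap_apply ℂ (Hol (V n)) (Mer (V n)),
    IsScalarTower.algebraMap_apply ℂ (Hol A) (Mer A)]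
  exact isRestr_toM _

theorem IsRestr.neg {g : Mer (V n)} {h : Mer A} (H : IsRestr A g h) : IsRestr A (-g) (-h) := by
  have := (isRestr_C (A := A) (-1)).mul H
  simpa using this

theorem IsRestr.sub {g g' : Mer (V n)} {h h' : Mer A} (H : IsRestr A g h) (H' : IsRestr A g' h') :
    IsRestr A (g - g') (h - h') := by
  rw [sub_eq_add_neg, sub_eq_add_neg]; exact H.add H'.neg

theorem isRestr_zero : IsRestr A (0 : Mer (V n)) 0 := by
  simpa using isRestr_C (A := A) 0

theorem IsRestr.sum {ι : Type*} {s : Finset ι} {g : ι → Mer (V n)} {h : ι → Mer A}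
    (H : ∀ i ∈ s, IsRestr A (g i) (h i)) : IsRestr A (∑ i ∈ s, g i) (∑ i ∈ s, h i) := by
  classical
  induction s using Finset.induction_on with
  | empty => simpa using isRestr_zero
  | insert a s ha ih =>
    rw [Finset.sum_insert ha, Finset.sum_insert ha]
    exact (H a (Finset.mem_insert_self a s)).add (ih fun i hi => H i (Finset.mem_insert_of_mem hi))

theorem IsRestr.restr_eq {g : Mer (V n)} {h : Mer A} (H : IsRestr A g h) : restr A g = h := by
  have hex : ∃ r, IsRestr A g r := ⟨h, H⟩
  rw [restr, dif_pos hex]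
  exact hex.choose_spec.unique H

theorem restr_zero : restr A (0 : Mer (V n)) = 0 := isRestr_zero.restr_eq

variable (A) in
/-- The orthogonal projection onto `A`. -/
def piA (x : V n) : A :=
  A.direction.orthogonalProjectionOnto (x - (Classical.arbitrary A : A)) +ᵥ Classical.arbitrary A

theorem piA_add (v x : V n) : piA A (v + x) = A.direction.orthogonalProjectionOnto v +ᵥ piA A x := by
  rw [piA, piA, add_sub_assoc, map_add, vadd_vadd]

theorem piA_coe (x : A) : piA A x = x := by
  have : ((x : V n) - (Classical.arbitrary A : A)) = ((x -ᵥ Classical.arbitrary A : A.direction) : V n) := rfl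
  rw [piA, this, Submodule.orthogonalProjectionOnto_mem_subspace_eq_self, vsub_vadd]

variable (A) in
/-- The pull-back of holomorphic functions along the projection onto `A`. -/
def pullHol : Hol A →+* Hol (V n) where
  toFun f := ⟨fun x => f.1 (piA A x), fun x => by
    have := (f.2 (piA A x)).comp A.direction.orthogonalProjectionOnto.differentiable
    have e : (fun v : V n => f.1 (piA A (v +ᵥ x))) =
        (fun v => f.1 (v +ᵥ piA A x)) ∘ A.direction.orthogonalProjectionOnto := by
      funext v
      change f.1 _ = f.1 _
      rw [vadd_eq_add, piA_add]
    rw [e]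
    exact this⟩
  map_one' := rfl
  map_mul' _ _ := rfl
  map_zero' := rfl
  map_add' _ _ := rfl

theorem pullHol_apply (f : Hol A) (x : V n) : (pullHol A f).1 x = f.1 (piA A x) := rfl

theorem resHol_pullHol (f : Hol A) : resHol A (pullHol A f) = f :=
  Subtype.ext (funext fun x => congrArg f.1 (piA_coe x))

theorem pullHol_injective : Function.Injective (pullHol A) := fun f g h => by
  rw [← resHol_pullHol f, h, resHol_pullHol]

variable (A) in
/-- The pull-back of meromorphic functions along the projection onto `A`. -/
def pullMer : Mer A →+* Mer (V n) :=
  IsFractionRing.map (A := Hol A) (B := Hol (V n)) (K := Mer A) (L := Mer (V n)) (j := pullHol A)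
    pullHol_injective

theorem pullMer_toA (f : Hol A) : pullMer A (toA f) = toM (pullHol A f) :=
  IsLocalization.map_eq (M := nonZeroDivisors (Hol A)) (T := nonZeroDivisors (Hol (V n)))
    (Q := Mer (V n)) (S := Mer A)
    (nonZeroDivisors_le_comap_nonZeroDivisors_of_injective _ pullHol_injective) f

theorem exists_toA_div (h : Mer A) : ∃ a b : Hol A, b ≠ 0 ∧ h = toA a / toA b := by
  obtain ⟨a, b, hb, rfl⟩ := IsFractionRing.div_surjective (A := Hol A) h
  exact ⟨a, b, nonZeroDivisors.ne_zero hb, rfl⟩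

theorem isRestr_pullMer (h : Mer A) : IsRestr A (pullMer A h) h := by
  obtain ⟨a, b, hb, rfl⟩ := exists_toA_div h
  refine ⟨pullHol A a, pullHol A b, by rwa [resHol_pullHol], ?_, by rw [resHol_pullHol, resHol_pullHol]⟩
  rw [map_div₀, pullMer_toA, pullMer_toA]

theorem smul_pullMer {g : V n ≃ᵃ[ℂ] V n} (hg : ∀ x, piA A (g⁻¹ x) = piA A x) (h : Mer A) :
    g • pullMer A h = pullMer A h := by
  obtain ⟨a, b, hb, rfl⟩ := exists_toA_div h
  have : ∀ a : Hol A, g • toM (pullHol A a) = toM (pullHol A a) := fun a => by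
    rw [smul_toM]
    congr 1
    refine hol_ext fun x => ?_
    rw [smul_hol_apply, pullHol_apply, hg, pullHol_apply]
  rw [map_div₀, pullMer_toA, pullMer_toA, div_eq_mul_inv, smul_mul', smul_inv₀', this, this]

/-- Translations of a restriction. -/
theorem IsRestr.smul {g : Mer (V n)} {h : Mer A} (H : IsRestr A g h) {w : V n ≃ᵃ[ℂ] V n}
    {v : A.direction} (hw : ∀ x : A, w⁻¹ x = ((-v +ᵥ x : A) : V n)) :
    IsRestr A (w • g) (AffineEquiv.constVAdd ℂ A v • h) := by
  obtain ⟨a, b, hb, rfl, rfl⟩ := H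
  have key : ∀ a : Hol (V n), resHol A (w • a) = AffineEquiv.constVAdd ℂ A v • resHol A a := by
    intro a
    refine hol_ext fun x => ?_
    change a.1 (w⁻¹ x) = a.1 ((AffineEquiv.constVAdd ℂ A v)⁻¹ x : A)
    rw [hw]
    congr 2
  have keyA : ∀ f : Hol A, AffineEquiv.constVAdd ℂ A v • toA f = toA (AffineEquiv.constVAdd ℂ A v • f) :=
    fun f => IsFractionRing.ringEquivOfRingEquiv_algebraMap
      (MulSemiringAction.toRingEquiv (A ≃ᵃ[ℂ] A) (Hol A) (AffineEquiv.constVAdd ℂ A v)) f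
  refine ⟨w • a, w • b, ?_, ?_, ?_⟩
  · rw [key]
    intro h0
    rw [smul_eq_zero_iff_eq] at h0
    exact hb h0
  · rw [div_eq_mul_inv, smul_mul', smul_inv₀', smul_toM, smul_toM, ← div_eq_mul_inv]
  · rw [key, key]
    exact (map_div₀ (MulSemiringAction.toRingHom (A ≃ᵃ[ℂ] A) (Mer A) (AffineEquiv.constVAdd ℂ A v))
      (toA _) (toA _)).trans (congrArg₂ (· / ·) (keyA _) (keyA _))

/-! ### Regular functions and divided differences -/

/-- Affine functions with integral linear part. -/
def IntAff (f : V n → ℂ) : Prop := ∃ (l : Fin n → ℤ) (c : ℂ), ∀ x, f x = form (latt l) x + c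

theorem IntAff.aff {f : V n → ℂ} (h : IntAff f) : Aff f := by
  obtain ⟨l, c, h⟩ := h; exact ⟨latt l, c, h⟩

theorem IntAff.neg {f : V n → ℂ} (h : IntAff f) : IntAff fun x => - f x := by
  obtain ⟨l, c, h⟩ := h
  refine ⟨-l, -c, fun x => ?_⟩
  change - f x = _
  rw [h, form_latt, form_latt]; simp; ring

variable (A) in
/-- The algebra generated by the exponentials of integral functions and the functions pulled back
from `A`. -/
def A1 : Subalgebra ℂ (Hol (V n)) :=
  Algebra.adjoin ℂ ({a | ∃ f, IntAff f ∧ a = exn f} ∪ Set.range (pullHol A))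

theorem exn_mem {f : V n → ℂ} (h : IntAff f) : exn f ∈ A1 A :=
  Algebra.subset_adjoin (.inl ⟨f, h, rfl⟩)

theorem pullHol_mem (f : Hol A) : pullHol A f ∈ A1 A := Algebra.subset_adjoin (.inr ⟨f, rfl⟩)

variable (A) in
/-- Quotients of functions in `A1` defined on `A`. -/
def Reg (g : Mer (V n)) : Prop := ∃ a ∈ A1 A, ∃ b ∈ A1 A, resHol A b ≠ 0 ∧ g = toM a / toM b

theorem Reg.exists_isRestr {g : Mer (V n)} (h : Reg A g) : ∃ r, IsRestr A g r := by
  obtain ⟨a, _, b, _, hb, h⟩ := h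
  exact ⟨_, a, b, hb, h, rfl⟩

theorem Reg.add {g g' : Mer (V n)} (h : Reg A g) (h' : Reg A g') : Reg A (g + g') := by
  obtain ⟨a, ha, b, hb, hb0, rfl⟩ := h
  obtain ⟨a', ha', b', hb', hb0', rfl⟩ := h'
  refine ⟨a * b' + b * a', add_mem (mul_mem ha hb') (mul_mem hb ha'), b * b', mul_mem hb hb',
    mul_ne_zero hb0 hb0', ?_⟩
  rw [div_add_div _ _ (ne_zero_of_resHol hb0) (ne_zero_of_resHol hb0')]; simp

theorem Reg.mul {g g' : Mer (V n)} (h : Reg A g) (h' : Reg A g') : Reg A (g * g') := by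
  obtain ⟨a, ha, b, hb, hb0, rfl⟩ := h
  obtain ⟨a', ha', b', hb', hb0', rfl⟩ := h'
  refine ⟨a * a', mul_mem ha ha', b * b', mul_mem hb hb', mul_ne_zero hb0 hb0', ?_⟩
  rw [div_mul_div_comm]; simp

theorem reg_toM {a : Hol (V n)} (ha : a ∈ A1 A) : Reg A (toM a) :=
  ⟨a, ha, 1, one_mem _, one_ne_zero, by simp⟩

theorem reg_C (c : ℂ) : Reg A (algebraMap ℂ (Mer (V n)) c) := by
  rw [IsScalarTower.algebraMap_apply ℂ (Hol (V n)) (Mer (V n))]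
  exact reg_toM (Subalgebra.algebraMap_mem _ c)

theorem Reg.neg {g : Mer (V n)} (h : Reg A g) : Reg A (-g) := by
  have := (reg_C (A := A) (-1)).mul h
  simpa using this

theorem Reg.sub {g g' : Mer (V n)} (h : Reg A g) (h' : Reg A g') : Reg A (g - g') := by
  rw [sub_eq_add_neg]; exact h.add h'.neg

theorem Reg.div_toM {g : Mer (V n)} (h : Reg A g) {b : Hol (V n)} (hb : b ∈ A1 A) (hb0 : resHol A b ≠ 0) :
    Reg A (g / toM b) := by
  rw [div_eq_mul_inv]
  exact h.mul ⟨1, one_mem _, b, hb, hb0, by simp⟩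

theorem reg_pullMer (h : Mer A) : Reg A (pullMer A h) := by
  obtain ⟨a, b, hb, rfl⟩ := exists_toA_div h
  refine ⟨_, pullHol_mem a, _, pullHol_mem b, by rwa [resHol_pullHol], ?_⟩
  rw [map_div₀, pullMer_toA, pullMer_toA]

variable (A) in
/-- A reflection `r : x ↦ x - γ(x) β` such that `e^{-γ}` is `1` on `A`. -/
structure Adm (r : V n ≃ᵃ[ℂ] V n) (γ : V n → ℂ) : Prop where
  inv : r⁻¹ = r
  int : IntAff γ
  exists_coroot : ∃ β : Fin n → ℤ, A.direction.orthogonalProjectionOnto (latt β) = 0 ∧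
    ∀ x, r x = x - γ x • latt β
  exp_eq : ∀ x ∈ A, Complex.exp (- γ x) = 1

/-- With X = e^{−γ}, the quotient (X^k − 1)/(1 − X) is a Laurent polynomial in X. The induction runs
in both directions and keeps it inside `A1`. -/
theorem exists_pow_sub {γ : V n → ℂ} (hγ : IntAff γ) (k : ℤ) : ∃ q ∈ A1 A, 
    exn (fun x => -(k * γ x)) = 1 + (1 - exn fun x => - γ x) * q := by
  have hint : ∀ k : ℤ, Aff fun x => -(k * γ x) := fun k => (hγ.aff.mul _).neg
  have hX := exn_mem (A := A) hγ.neg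
  have hX' := exn_mem (A := A) hγ
  have e1 := exn_apply hγ.neg.aff
  have e2 := exn_apply hγ.aff
  have e3 : (exn fun x => - γ x) * exn γ = 1 := by
    refine hol_ext fun x => ?_
    change (exn _).1 x * (exn _).1 x = 1
    rw [e1, e2, ← Complex.exp_add]; simp
  induction k using Int.induction_on with
  | zero =>
    refine ⟨0, zero_mem _, hol_ext fun x => ?_⟩
    rw [exn_apply (hint 0)]; simp
  | succ k ih =>
    obtain ⟨q, hq, h⟩ := ih
    refine ⟨q * (exn fun x => - γ x) - 1, sub_mem (mul_mem hq hX) (one_mem _), ?_⟩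
    have : (exn fun x => -(((k + 1 : ℤ) : ℂ) * γ x)) = (exn fun x => -(((k : ℤ) : ℂ) * γ x)) *
        exn fun x => - γ x := by
      refine hol_ext fun x => ?_
      change _ = (exn _).1 x * (exn _).1 x
      rw [exn_apply (hint _), exn_apply (hint _), e1, ← Complex.exp_add]
      congr 1; push_cast; ring
    rw [this, h]; ring
  | pred k ih =>
    obtain ⟨q, hq, h⟩ := ih
    refine ⟨(1 + q) * exn γ, mul_mem (add_mem (one_mem _) hq) hX', ?_⟩
    have : (exn fun x => -(((-k - 1 : ℤ) : ℂ) * γ x)) = (exn fun x => -(((-k : ℤ) : ℂ) * γ x)) *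
        exn γ := by
      refine hol_ext fun x => ?_
      change _ = (exn _).1 x * (exn _).1 x
      rw [exn_apply (hint _), exn_apply (hint _), e2, ← Complex.exp_add]
      congr 1; push_cast; ring
    rw [this, h]
    linear_combination e3

theorem piA_sub {y : V n} (hy : A.direction.orthogonalProjectionOnto y = 0) (x : V n) (c : ℂ) :
    piA A (x - c • y) = piA A x := by
  rw [show x - c • y = (-(c • y)) + x by abel, piA_add, map_neg, map_smul, hy]; simp

/-- For integral f the reflection multiplies e^f by an integral power of e^{−γ}, and functions
pulled back from A are invariant because the coroot is orthogonal to A; sums and products follow by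
the Leibniz rule. This explains the choice of generators of `A1`, and why e^{−γ} = 1 on A is enough
even if γ is a nonzero multiple of 2πi there. -/
theorem Adm.exists_hol {r : V n ≃ᵃ[ℂ] V n} {γ : V n → ℂ} (h : Adm A r γ) {a : Hol (V n)}
    (ha : a ∈ A1 A) : ∃ q ∈ A1 A, r • a = a + (1 - exn fun x => - γ x) * q := by
  obtain ⟨β, hβ, hr⟩ := h.exists_coroot
  induction ha using Algebra.adjoin_induction with
  | mem a ha =>
    rcases ha with ⟨f, hf, rfl⟩ | ⟨f, rfl⟩
    · obtain ⟨l, c, hl⟩ := hf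
      have hf : IntAff f := ⟨l, c, hl⟩
      obtain ⟨q, hq, h1⟩ := exists_pow_sub (A := A) h.int (∑ j, l j * β j)
      refine ⟨exn f * q, mul_mem (exn_mem hf) hq, ?_⟩
      have h2 : r • exn f = exn f * exn fun x => -((∑ j, l j * β j : ℤ) * γ x) := by
        refine hol_ext fun x => ?_
        change _ = (exn _).1 x * (exn _).1 x
        rw [smul_hol_apply, h.inv, exn_apply hf.aff, exn_apply hf.aff,
          exn_apply (h.int.aff.mul _).neg, ← Complex.exp_add, hl, hl, hr, form_sub, form_smul,
          form_latt _ (latt β)]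
        congr 1
        simp only [latt_apply]
        push_cast
        ring
      rw [h2, h1]; ring
    · refine ⟨0, zero_mem _, hol_ext fun x => ?_⟩
      rw [smul_hol_apply, h.inv, hr, pullHol_apply, piA_sub hβ]
      simp [pullHol_apply]
  | algebraMap c =>
    exact ⟨0, zero_mem _, hol_ext fun x => by rw [smul_hol_apply]; simp⟩
  | add a b _ _ iha ihb =>
    obtain ⟨q, hq, h1⟩ := iha
    obtain ⟨q', hq', h2⟩ := ihb
    exact ⟨q + q', add_mem hq hq', by rw [smul_add, h1, h2]; ring⟩
  | mul a b ha hb iha ihb =>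
    obtain ⟨q, hq, h1⟩ := iha
    obtain ⟨q', hq', h2⟩ := ihb
    refine ⟨q * (b + (1 - exn fun x => - γ x) * q') + a * q', ?_, by rw [smul_mul', h1, h2]; ring⟩
    exact add_mem (mul_mem hq (add_mem hb (mul_mem (sub_mem (one_mem _) (exn_mem h.int.neg)) hq')))
      (mul_mem ha hq')

/-- The quotient rule for divided differences. The new denominator is b · (r • b), nonzero on A
because r • b and b agree there. -/
theorem Adm.exists_reg {r : V n ≃ᵃ[ℂ] V n} {γ : V n → ℂ} (h : Adm A r γ) {g : Mer (V n)}
    (hg : Reg A g) : ∃ q, Reg A q ∧ r • g = g + (1 - exM fun x => - γ x) * q := by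
  obtain ⟨a, ha, b, hb, hb0, rfl⟩ := hg
  obtain ⟨a', ha', h1⟩ := h.exists_hol ha
  obtain ⟨b', hb', h2⟩ := h.exists_hol hb
  have hX : resHol A (1 - exn fun x => - γ x) = 0 := by
    refine hol_ext fun x => ?_
    change (1 : ℂ) - (exn _).1 (x : V n) = 0
    rw [exn_apply h.int.neg.aff, h.exp_eq x x.2, sub_self]
  have hrb : resHol A (r • b) ≠ 0 := by
    rw [h2, resHol_add, resHol_mul, hX, zero_mul, add_zero]; exact hb0
  refine ⟨toM (a' * b - a * b') / toM (b * (r • b)), ⟨_, sub_mem (mul_mem ha' hb) (mul_mem ha hb'),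
    b * (r • b), mul_mem hb ?_, mul_ne_zero hb0 hrb, rfl⟩, ?_⟩
  · rw [h2]
    exact add_mem hb (mul_mem (sub_mem (one_mem _) (exn_mem h.int.neg)) hb')
  · have hb1 := ne_zero_of_resHol hb0
    have hb2 := ne_zero_of_resHol hrb
    rw [div_eq_mul_inv, smul_mul', smul_inv₀', smul_toM, smul_toM, exM]
    have e1 : toM (a' * b - a * b') = toM a' * toM b - toM a * toM b' := by simp
    have e2 : toM (b * (r • b)) = toM b * toM (r • b) := by simp
    have e3 : toM (r • a) = toM a + (1 - toM (exn fun x => - γ x)) * toM a' := by rw [h1]; simp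
    have e4 : toM (r • b) = toM b + (1 - toM (exn fun x => - γ x)) * toM b' := by rw [h2]; simp
    rw [e1, e2]
    field_simp
    rw [e3, e4]
    ring

end Restr
end Koornwinder
end

noncomputable section
set_option linter.unusedSectionVars false
namespace Koornwinder

/-! ### Operators acting on functions on the group -/

section Act

variable {n : ℕ}

/-- The action of operators on families of functions indexed by affine transformations; the family
`w ↦ w⁻¹ • φ` corresponds to the function `φ`. -/
def act (D : Op (V n)) (f : (V n ≃ᵃ[ℂ] V n) → Mer (V n)) (w : V n ≃ᵃ[ℂ] V n) : Mer (V n) :=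
  D.coeff.sum fun v d => (w⁻¹ • d) * f (v⁻¹ * w)

theorem act_zero (f) (w : V n ≃ᵃ[ℂ] V n) : act 0 f w = 0 := by simp [act]

theorem act_add (D D' : Op (V n)) (f) (w) : act (D + D') f w = act D f w + act D' f w := by
  rw [act, SkewMonoidAlgebra.coeff_add, Finsupp.sum_add_index' (by simp) (by simp [add_mul])]
  rfl

theorem act_single (v : V n ≃ᵃ[ℂ] V n) (d : Mer (V n)) (f) (w) :
    act (SkewMonoidAlgebra.single v d) f w = (w⁻¹ • d) * f (v⁻¹ * w) := by
  rw [act, SkewMonoidAlgebra.coeff_single, Finsupp.sum_single_index (by simp)]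

theorem act_add_right (D : Op (V n)) (f f') (w) :
    act D (fun w => f w + f' w) w = act D f w + act D f' w := by
  simp only [act, mul_add, Finsupp.sum_add]

theorem act_mul (D D' : Op (V n)) (f) : act (D * D') f = act D (act D' f) := by
  funext w
  induction D using SkewMonoidAlgebra.induction_on with
  | zero => rw [zero_mul, act_zero, act_zero]
  | add D₁ D₂ h1 h2 => rw [add_mul, act_add, act_add, h1, h2]
  | single v d =>
    induction D' using SkewMonoidAlgebra.induction_on with
    | zero =>
      rw [mul_zero, act_zero, act_single, act_zero, mul_zero]
    | add D₁ D₂ h1 h2 => rw [mul_add, act_add, h1, h2, act_single, act_single, act_single, act_add, mul_add]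
    | single v' d' =>
      rw [SkewMonoidAlgebra.single_mul_single, act_single, act_single, act_single, smul_mul', smul_smul,
        mul_inv_rev, mul_inv_rev, inv_inv, mul_assoc, mul_assoc]

theorem act_C (c : ℂ) (f) (w : V n ≃ᵃ[ℂ] V n) :
    act (algebraMap ℂ (Op (V n)) c) f w = algebraMap ℂ (Mer (V n)) c * f w := by
  change act (SkewMonoidAlgebra.single 1 (algebraMap ℂ (Mer (V n)) c)) f w = _
  rw [act_single, smul_C, inv_one, one_mul]

end Act

section

variable {n : ℕ}

theorem toM_mul (a b : Hol (V n)) : toM (a * b) = toM a * toM b := map_mul (algebraMap _ _) a b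

theorem toM_add (a b : Hol (V n)) : toM (a + b) = toM a + toM b := map_add (algebraMap _ _) a b

theorem toM_sub (a b : Hol (V n)) : toM (a - b) = toM a - toM b := map_sub (algebraMap _ _) a b

theorem toM_one : toM (1 : Hol (V n)) = 1 := map_one (algebraMap _ _)

end

/-! ### Families of functions stable under the T_i: regularity and vanishing on A. -/

namespace Params

variable {n : ℕ} [NeZero n] {p : Params}

theorem act_T (i : Option (Fin n)) (f) (w : V n ≃ᵃ[ℂ] V n) : act (p.T i) f w =
    p.tM i * f w + (w⁻¹ • p.coef i) * (f (p.s i * w) - f w) := by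
  rw [T_eq, dl, act_add, act_single, act_single, aM, smul_sub, smul_sub, smul_tM, inv_one, one_mul, s_inv,
    smul_sub, smul_tM]
  ring

/-- The numerator of the coefficient of `T_i` as a function of the value of `α_i`. -/
def numC (p : Params) (i : Option (Fin n)) (z : ℂ) : ℂ :=
  (p.t i : ℂ)⁻¹ * ((1 - p.t i * p.u i * Complex.exp (-(1 / 2 * z))) *
    (1 + p.t i * (p.u i : ℂ)⁻¹ * Complex.exp (-(1 / 2 * z))))

theorem intAff_coord (a : Fin n) (k : ℤ) (c : ℂ) : IntAff fun x : V n => (k : ℂ) * x a + c := by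
  refine ⟨Pi.single a k, c, fun x => ?_⟩
  rw [form_latt]
  simp [Pi.single_apply]

theorem intAff_rts {f : V n → ℂ} (hf : f ∈ p.rts) : IntAff f := by
  obtain ⟨a, b, ε, δ, m, -, hf⟩ := hf
  refine ⟨Pi.single a (ε : ℤ) + Pi.single b (δ : ℤ), m * p.hbar, fun x => ?_⟩
  rw [form_latt, hf]
  simp [Pi.single_apply, add_mul, Finset.sum_add_distrib]

theorem intAff_half {i : Option (Fin n)} (hi : ¬ IsShort i) {w : V n ≃ᵃ[ℂ] V n} (hw : w ∈ p.affW n) :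
    IntAff fun x => 1 / 2 * p.al i (w x) := by
  obtain ⟨σ, ε, μ, h⟩ := p.exists_NF hw
  rcases i with _ | i
  · have := intAff_coord (σ 0) (-(ε 0 : ℤ)) (1 / 2 * p.hbar - p.hbar * μ 0)
    convert this using 2 with x
    rw [al_none, h]; push_cast; ring
  · have hl : ¬ i.val + 1 < n := fun h => hi ⟨i, rfl, h⟩
    have := intAff_coord (σ i) (ε i : ℤ) (p.hbar * μ i)
    convert this using 2 with x
    rw [al_last _ hl, h]; ring

/-- The numerator lies in `A1` in both cases: half of a long root is integral, and for a short root
only e^{−α_i} occurs. Its values are recorded by `numC`, so vanishing on A can be read off from the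
value of the root. -/
theorem smul_coef {A : AffineSubspace ℂ (V n)} [Nonempty A] (i : Option (Fin n)) {w : V n ≃ᵃ[ℂ] V n}
    (hw : w ∈ p.affW n) : ∃ N ∈ A1 A, (∀ x, N.1 x = p.numC i (p.al i (w x))) ∧
      w⁻¹ • p.coef i = toM N / (1 - exM fun x => - p.al i (w x)) := by
  have hZaff : Aff fun x => 1 / 2 * p.al i (w x) := ((p.aff_al i).mul _).comp w
  have hZ : w⁻¹ • p.ZZ i = exM fun x => -(1 / 2 * p.al i (w x)) := by rw [smul_ZZ, inv_inv]
  have hXeq : (exM fun x => -(1 / 2 * p.al i (w x))) ^ 2 = exM fun x => - p.al i (w x) := by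
    rw [pow_two, exM_add hZaff.neg hZaff.neg]; congr 1; funext x; ring
  have hcoef : w⁻¹ • p.coef i = (p.tM i)⁻¹ * ((1 - p.tM i * p.uM i * exM fun x => -(1 / 2 * p.al i (w x))) *
      (1 + p.tM i * (p.uM i)⁻¹ * exM fun x => -(1 / 2 * p.al i (w x)))) /
      (1 - exM fun x => - p.al i (w x)) := by
    rw [coef_eq, div_eq_mul_inv, smul_mul', smul_inv₀', smul_mul', smul_inv₀', smul_mul', smul_sub, smul_add,
      smul_sub, smul_mul', smul_mul', smul_mul', smul_mul', smul_inv₀', smul_pow', hZ, hXeq, smul_tM, smul_uM,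
      smul_one, ← div_eq_mul_inv]
  have hCt : ∀ c : ℂ, cM c = toM (algebraMap ℂ (Hol (V n)) c) := fun c =>
    IsScalarTower.algebraMap_apply ℂ (Hol (V n)) (Mer (V n)) c
  have hti : (p.tM i)⁻¹ = toM (algebraMap ℂ (Hol (V n)) (p.t i : ℂ)⁻¹) := by
    rw [← hCt, tM, cM, cM, map_inv₀]
  have hui : (p.uM i)⁻¹ = toM (algebraMap ℂ (Hol (V n)) (p.u i : ℂ)⁻¹) := by
    rw [← hCt, uM, cM, cM, map_inv₀]
  by_cases hi : IsShort i
  · have hu : p.u i = 1 := by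
      obtain ⟨j, rfl, hj⟩ := hi
      have : ¬ j = lastNode n := fun h => (lastNode_iff j).1 h hj
      simp [u, this]
    have hint : IntAff fun x => - p.al i (w x) := (intAff_rts (p.rts_comp (p.al_mem i) hw)).neg
    refine ⟨algebraMap ℂ _ (p.t i : ℂ)⁻¹ * (1 - algebraMap ℂ _ ((p.t i : ℂ) ^ 2) *
      exn fun x => - p.al i (w x)), mul_mem (Subalgebra.algebraMap_mem _ _) (sub_mem (one_mem _)
        (mul_mem (Subalgebra.algebraMap_mem _ _) (exn_mem hint))), fun x => ?_, ?_⟩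
    · change (p.t i : ℂ)⁻¹ * (1 - (p.t i : ℂ) ^ 2 * (exn fun x => - p.al i (w x)).1 x) = _
      rw [exn_apply hint.aff, numC, hu]
      have : Complex.exp (- p.al i (w x)) = Complex.exp (-(1 / 2 * p.al i (w x))) ^ 2 := by
        rw [← Complex.exp_nat_mul]; congr 1; push_cast; ring
      rw [this]; simp; ring
    · rw [hcoef, ← hXeq]
      have hu1 : p.uM i = 1 := by rw [uM, hu]; simp
      congr 1
      have ht2 : toM (algebraMap ℂ (Hol (V n)) ((p.t i : ℂ) ^ 2)) = p.tM i ^ 2 := by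
        rw [← hCt, cM, map_pow]; rfl
      rw [hu1, hti, toM_mul, toM_sub, toM_mul, toM_one, ht2]
      congr 1
      change _ = _ - _ * exM fun x => - p.al i (w x)
      rw [← hXeq]
      ring
  · have hint := (intAff_half hi hw).neg
    refine ⟨algebraMap ℂ _ (p.t i : ℂ)⁻¹ *
      ((1 - algebraMap ℂ _ (p.t i : ℂ) * algebraMap ℂ _ (p.u i : ℂ) *
        exn fun x => -(1 / 2 * p.al i (w x))) *
      (1 + algebraMap ℂ _ (p.t i : ℂ) * algebraMap ℂ _ (p.u i : ℂ)⁻¹ *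
        exn fun x => -(1 / 2 * p.al i (w x)))), ?_, fun x => ?_, ?_⟩
    · have hC := Subalgebra.algebraMap_mem (A1 A)
      exact mul_mem (hC _) (mul_mem (sub_mem (one_mem _) (mul_mem (mul_mem (hC _) (hC _)) (exn_mem hint)))
        (add_mem (one_mem _) (mul_mem (mul_mem (hC _) (hC _)) (exn_mem hint))))
    · change (p.t i : ℂ)⁻¹ * ((1 - (p.t i : ℂ) * (p.u i : ℂ) *
        (exn fun x => -(1 / 2 * p.al i (w x))).1 x) * (1 + (p.t i : ℂ) * (p.u i : ℂ)⁻¹ *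
        (exn fun x => -(1 / 2 * p.al i (w x))).1 x)) = _
      rw [exn_apply hint.aff, numC]
    · rw [hcoef]
      congr 1
      simp only [hti, hui, toM_mul, toM_sub, toM_add, toM_one, ← hCt]
      rfl

theorem NF.inv_linear {g : V n ≃ᵃ[ℂ] V n} {σ ε μ} (h : p.NF g σ ε μ) (b : Fin n → ℤ) :
    g.linear (latt b) = latt fun j => ε j * b (σ j) := by
  ext j
  rw [h.linear, latt_apply, latt_apply]; push_cast; rfl

theorem exists_check (i : Option (Fin n)) : ∃ b : Fin n → ℤ, check (affLin i) = latt b := by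
  rcases i with _ | i
  · refine ⟨-Pi.single 0 1, ?_⟩
    rw [check_none]; ext j
    rw [latt_apply]; simp [e, Pi.single_apply]
  · by_cases h : i.val + 1 < n
    · refine ⟨Pi.single i 1 - Pi.single ⟨i.val + 1, h⟩ 1, ?_⟩
      rw [check_lt h]; ext j
      rw [latt_apply]; simp [e, Pi.single_apply]
    · refine ⟨Pi.single i 1, ?_⟩
      rw [check_last h]; ext j
      rw [latt_apply]; simp [e, Pi.single_apply]

/-- A lattice vector is real, so pairing to zero in the bilinear form is orthogonality in the
Hermitian form. -/
theorem orthogonalProjection_latt (L : Submodule ℂ (V n)) (b : Fin n → ℤ) (h : ∀ v ∈ L, form (latt b) v = 0) :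
    L.orthogonalProjectionOnto (latt b) = 0 := by
  rw [Submodule.orthogonalProjectionOnto_eq_zero_iff, Submodule.mem_orthogonal]
  intro v hv
  have h1 := congrArg (starRingEnd ℂ) (h v hv)
  rw [form_latt, map_sum, map_zero] at h1
  rw [PiLp.inner_apply, ← h1]
  refine Finset.sum_congr rfl fun j _ => ?_
  rw [latt_apply]
  simp

theorem map_sub_smul (g : V n ≃ᵃ[ℂ] V n) (x v : V n) (c : ℂ) : g (x - c • v) = g x - c • g.linear v := by
  have := g.map_vadd x (-(c • v))
  rw [sub_eq_neg_add, ← vadd_eq_add, this, map_neg, map_smul, vadd_eq_add, sub_eq_neg_add]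

/-- If α_i ∘ w had nonzero pairing with a direction of A, its value could be changed by exactly 1
inside A, but e ≠ 1. So the root is constant on A and its coroot is orthogonal to A. -/
theorem adm_of_exp {A : AffineSubspace ℂ (V n)} [Nonempty A] {i : Option (Fin n)} {w : V n ≃ᵃ[ℂ] V n}
    (hw : w ∈ p.affW n) (h : ∀ x ∈ A, Complex.exp (- p.al i (w x)) = 1) :
    Adm A (w⁻¹ * p.s i * w) (fun x => p.al i (w x)) := by
  obtain ⟨b, hb⟩ := exists_check i
  obtain ⟨σ, ε, μ, hN⟩ := p.exists_NF (inv_mem hw)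
  refine ⟨by rw [mul_inv_rev, mul_inv_rev, s_inv, inv_inv, mul_assoc],
    intAff_rts (p.rts_comp (p.al_mem i) hw), ⟨fun j => ε j * b (σ j), ?_, fun x => ?_⟩, h⟩
  · refine orthogonalProjection_latt _ _ fun v hv => ?_
    obtain ⟨x₀, hx₀⟩ : Nonempty A := inferInstance
    have key : form (affLin i) (w.linear v) = 0 := by
      by_contra hc
      set c := form (affLin i) (w.linear v) with hcdef
      have h1 : ∀ z : ℂ, p.al i (w (x₀ - z • v)) = p.al i (w x₀) - z * c := by
        intro z
        rw [map_sub_smul, al, al, form_sub, form_smul]; ring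
      have h2 := h (x₀ - c⁻¹ • v) (by
        have := AffineSubspace.vadd_mem_of_mem_direction (A.direction.smul_mem (-c⁻¹) hv) hx₀
        rwa [vadd_eq_add, neg_smul, neg_add_eq_sub] at this)
      rw [h1, inv_mul_cancel₀ hc, neg_sub, sub_eq_add_neg, Complex.exp_add, h x₀ hx₀, mul_one] at h2
      have := congrArg (fun z : ℂ => ‖z‖) h2
      simp [Complex.norm_exp] at this
    rw [← hN.inv_linear, ← hb, ← form_linear p hw]
    have : w.linear ((w⁻¹ : V n ≃ᵃ[ℂ] V n).linear (check (affLin i))) = check (affLin i) :=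
      w.linear.apply_symm_apply _
    rw [this, form_comm, check, form_smul, form_comm (w.linear v), key, mul_zero]
  · change w⁻¹ (p.s i (w x)) = _
    rw [s_apply, map_sub_smul, hb, hN.inv_linear]
    congr 1
    exact w.symm_apply_apply x

/-- Families of functions regular on `A` and equivariant under the reflections `r` for which the
denominators vanish on `A`. -/
def E0 (p : Params) (A : AffineSubspace ℂ (V n)) [Nonempty A] (f : (V n ≃ᵃ[ℂ] V n) → Mer (V n)) : Prop :=
  (∀ w ∈ p.affW n, Reg A (f w)) ∧
    ∀ w ∈ p.affW n, ∀ r ∈ p.affW n, ∀ γ, Adm A r γ → f (w * r) = r • f w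

variable {A : AffineSubspace ℂ (V n)} [Nonempty A]

theorem mem_conj {w : V n ≃ᵃ[ℂ] V n} (hw : w ∈ p.affW n) (i : Option (Fin n)) :
    w⁻¹ * p.s i * w ∈ p.affW n := mul_mem (mul_mem (inv_mem hw) (p.s_mem i)) hw

theorem E0.diff {f : (V n ≃ᵃ[ℂ] V n) → Mer (V n)} (hf : p.E0 A f) {w : V n ≃ᵃ[ℂ] V n} (hw : w ∈ p.affW n)
    {i : Option (Fin n)} (h : ∀ x ∈ A, Complex.exp (- p.al i (w x)) = 1) :
    ∃ q, Reg A q ∧ f (p.s i * w) - f w = (1 - exM fun x => - p.al i (w x)) * q := by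
  have hadm := adm_of_exp hw h
  obtain ⟨q, hq, h1⟩ := hadm.exists_reg (hf.1 w hw)
  refine ⟨q, hq, ?_⟩
  have := hf.2 w hw _ (mem_conj hw i) _ hadm
  rw [← mul_assoc, ← mul_assoc, mul_inv_cancel, one_mul] at this
  rw [this, h1]; ring

theorem one_sub_exM_comp_ne {w : V n ≃ᵃ[ℂ] V n} (i : Option (Fin n)) :
    (1 - exM fun x => - p.al i (w x)) ≠ 0 := by
  obtain ⟨x, hx⟩ := p.exists_al_exp i
  refine one_sub_exM_ne ((p.aff_al i).neg.comp w) (x := w⁻¹ x) ?_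
  rwa [show w (w⁻¹ x) = x from w.apply_symm_apply x]

theorem one_sub_exM_eq (f : V n → ℂ) : 1 - exM f = toM (1 - exn f) := by
  rw [exM, toM_sub, toM_one]

theorem resHol_one_sub_ne {f : V n → ℂ} (hf : Aff f) {x : V n} (hx : x ∈ A) (h : Complex.exp (f x) ≠ 1) :
    resHol A (1 - exn f) ≠ 0 := by
  intro h0
  have := congrFun (congrArg Subtype.val h0) ⟨x, hx⟩
  change 1 - (exn f).1 x = 0 at this
  rw [exn_apply hf] at this
  exact h (sub_eq_zero.1 this).symm

/-- The reflection part of `T_i` is regular. -/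
theorem E0.reg_coef {f : (V n ≃ᵃ[ℂ] V n) → Mer (V n)} (hf : p.E0 A f) {w : V n ≃ᵃ[ℂ] V n}
    (hw : w ∈ p.affW n) (i : Option (Fin n)) : Reg A ((w⁻¹ • p.coef i) * (f (p.s i * w) - f w)) := by
  obtain ⟨N, hN, -, h⟩ := smul_coef (A := A) i hw
  rw [h]
  -- If the denominator vanishes identically on A, then s_iw = wr with r = w⁻¹s_iw admissible, and
  -- equivariance makes the difference divisible by the denominator. Otherwise the denominator is
  -- invertible on A.
  by_cases hc : ∀ x ∈ A, Complex.exp (- p.al i (w x)) = 1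
  · obtain ⟨q, hq, h1⟩ := hf.diff hw hc
    rw [h1, ← mul_assoc, div_mul_cancel₀ _ (one_sub_exM_comp_ne i)]
    exact (reg_toM hN).mul hq
  · push Not at hc
    obtain ⟨x, hx, hc⟩ := hc
    have hint := (intAff_rts (p.rts_comp (p.al_mem i) hw)).neg
    refine Reg.mul ?_ ((hf.1 _ (mul_mem (p.s_mem i) hw)).sub (hf.1 _ hw))
    rw [one_sub_exM_eq]
    exact (reg_toM hN).div_toM (sub_mem (one_mem _) (exn_mem hint)) (resHol_one_sub_ne hint.aff hx hc)

theorem E0.act_T {f : (V n ≃ᵃ[ℂ] V n) → Mer (V n)} (hf : p.E0 A f) (i : Option (Fin n)) :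
    p.E0 A (act (p.T i) f) := by
  refine ⟨fun w hw => ?_, fun w hw r hr γ hadm => ?_⟩
  · rw [Params.act_T]
    exact ((reg_C _).mul (hf.1 w hw)).add (hf.reg_coef hw i)
  · rw [Params.act_T, Params.act_T, hf.2 w hw r hr γ hadm, ← mul_assoc,
      hf.2 _ (mul_mem (p.s_mem i) hw) r hr γ hadm, smul_add, smul_mul', smul_mul', smul_tM, smul_sub, smul_smul,
      mul_inv_rev, hadm.inv]

theorem E0.add {f f' : (V n ≃ᵃ[ℂ] V n) → Mer (V n)} (hf : p.E0 A f) (hf' : p.E0 A f') :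
    p.E0 A fun w => f w + f' w :=
  ⟨fun w hw => (hf.1 w hw).add (hf'.1 w hw), fun w hw r hr γ h => by
    simp only [hf.2 w hw r hr γ h, hf'.2 w hw r hr γ h, smul_add]⟩

theorem E0.smul {f : (V n ≃ᵃ[ℂ] V n) → Mer (V n)} (hf : p.E0 A f) (c : ℂ) :
    p.E0 A fun w => algebraMap ℂ (Mer (V n)) c * f w :=
  ⟨fun w hw => (reg_C c).mul (hf.1 w hw), fun w hw r hr γ h => by
    simp only [hf.2 w hw r hr γ h, smul_mul', smul_C]⟩

theorem E0.act {D : Op (V n)} (hD : D ∈ p.HH n) : ∀ {f : (V n ≃ᵃ[ℂ] V n) → Mer (V n)}, p.E0 A f →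
    p.E0 A (act D f) := by
  induction hD using Algebra.adjoin_induction with
  | mem D hD => obtain ⟨i, rfl⟩ := hD; exact fun hf => hf.act_T i
  | algebraMap c =>
    intro f hf
    have : Koornwinder.act (algebraMap ℂ (Op (V n)) c) f = fun w => algebraMap ℂ (Mer (V n)) c * f w :=
      funext fun w => act_C c f w
    rw [this]; exact hf.smul c
  | add D D' _ _ h h' =>
    intro f hf
    have : Koornwinder.act (D + D') f = fun w => Koornwinder.act D f w + Koornwinder.act D' f w :=
      funext fun w => act_add D D' f w
    rw [this]; exact (h hf).add (h' hf)
  | mul D D' _ _ h h' =>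
    intro f hf
    rw [act_mul]; exact h (h' hf)

/-- A set of group elements such that the families vanishing on it after restriction to `A` are
stable under the `T_i`. -/
def Stab (p : Params) (A : AffineSubspace ℂ (V n)) (P : (V n ≃ᵃ[ℂ] V n) → Prop) : Prop :=
  ∀ w ∈ p.affW n, P w → ∀ i : Option (Fin n),
    (P (p.s i * w) ∧ ∃ x ∈ A, Complex.exp (- p.al i (w x)) ≠ 1) ∨
    ∀ x ∈ A, p.numC i (p.al i (w x)) = 0

/-- Families vanishing on `P` after restriction to `A`. -/
def I0 (p : Params) (A : AffineSubspace ℂ (V n)) [Nonempty A] (P : (V n ≃ᵃ[ℂ] V n) → Prop)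
    (f : (V n ≃ᵃ[ℂ] V n) → Mer (V n)) : Prop :=
  p.E0 A f ∧ ∀ w ∈ p.affW n, P w → IsRestr A (f w) 0

/-- If s_iw stays in P, the coefficient is regular on A and both values of f vanish there. Otherwise
the numerator vanishes on A, while the remaining quotient, possibly a divided difference, is
regular. -/
theorem I0.act_T {P : (V n ≃ᵃ[ℂ] V n) → Prop} (hP : p.Stab A P) {f : (V n ≃ᵃ[ℂ] V n) → Mer (V n)}
    (hf : p.I0 A P f) (i : Option (Fin n)) : p.I0 A P (act (p.T i) f) := by
  refine ⟨hf.1.act_T i, fun w hw hPw => ?_⟩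
  rw [Params.act_T]
  have h0 : IsRestr A (p.tM i * f w) 0 := by
    have := (isRestr_C (A := A) (p.t i : ℂ)).mul (hf.2 w hw hPw)
    rw [mul_zero] at this
    exact this
  suffices IsRestr A ((w⁻¹ • p.coef i) * (f (p.s i * w) - f w)) 0 by simpa using h0.add this
  obtain ⟨N, hN, hNx, h⟩ := smul_coef (A := A) i hw
  have hint := (intAff_rts (p.rts_comp (p.al_mem i) hw)).neg
  have hsw := mul_mem (p.s_mem i) hw
  have hreg : ∀ x ∈ A, Complex.exp (- p.al i (w x)) ≠ 1 → Reg A (w⁻¹ • p.coef i) := by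
    intro x hx hc
    rw [h, one_sub_exM_eq]
    exact (reg_toM hN).div_toM (sub_mem (one_mem _) (exn_mem hint)) (resHol_one_sub_ne hint.aff hx hc)
  rcases hP w hw hPw i with ⟨hPs, x, hx, hc⟩ | h0
  · obtain ⟨r, hr⟩ := (hreg x hx hc).exists_isRestr
    simpa using hr.mul ((hf.2 _ hsw hPs).sub (hf.2 w hw hPw))
  · have hN0 : IsRestr A (toM N) 0 := by
      have := isRestr_toM (A := A) N
      have hz : resHol A N = 0 := hol_ext fun x => by
        change N.1 (x : V n) = 0
        rw [hNx, h0 x x.2]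
      rwa [hz, toA, map_zero] at this
    by_cases hc : ∀ x ∈ A, Complex.exp (- p.al i (w x)) = 1
    · obtain ⟨q, hq, h1⟩ := hf.1.diff hw hc
      rw [h, h1, ← mul_assoc, div_mul_cancel₀ _ (one_sub_exM_comp_ne i)]
      obtain ⟨r, hr⟩ := hq.exists_isRestr
      simpa using hN0.mul hr
    · push Not at hc
      obtain ⟨x, hx, hc⟩ := hc
      rw [h, div_mul_eq_mul_div, mul_div_assoc, one_sub_exM_eq]
      obtain ⟨r, hr⟩ := (((hf.1.1 _ hsw).sub (hf.1.1 _ hw)).div_toM (sub_mem (one_mem _) (exn_mem hint))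
        (resHol_one_sub_ne hint.aff hx hc)).exists_isRestr
      simpa using hN0.mul hr

theorem I0.act {P : (V n ≃ᵃ[ℂ] V n) → Prop} (hP : p.Stab A P) {D : Op (V n)} (hD : D ∈ p.HH n) :
    ∀ {f : (V n ≃ᵃ[ℂ] V n) → Mer (V n)}, p.I0 A P f → p.I0 A P (act D f) := by
  induction hD using Algebra.adjoin_induction with
  | mem D hD => obtain ⟨i, rfl⟩ := hD; exact fun hf => hf.act_T hP i
  | algebraMap c =>
    intro f hf
    refine ⟨hf.1.act (Subalgebra.algebraMap_mem _ c), fun w hw hPw => ?_⟩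
    rw [act_C]
    simpa using (isRestr_C c).mul (hf.2 w hw hPw)
  | add D D' hD hD' h h' =>
    intro f hf
    refine ⟨hf.1.act (add_mem hD hD'), fun w hw hPw => ?_⟩
    rw [act_add]
    simpa using ((h hf).2 w hw hPw).add ((h' hf).2 w hw hPw)
  | mul D D' _ _ h h' =>
    intro f hf
    rw [act_mul]; exact h (h' hf)

end Params
end Koornwinder
end

noncomputable section
set_option linter.unusedSectionVars false
namespace Koornwinder
namespace Params

variable {n : ℕ} [NeZero n] {p : Params} {A : AffineSubspace ℂ (V n)} [Nonempty A]

/-! ### Restriction is multiplicative on symmetric operators -/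

variable (A) in
/-- The family of functions given by functions of the translation part. -/
def fphi (φ : A.direction → Mer A) (w : V n ≃ᵃ[ℂ] V n) : Mer (V n) :=
  pullMer A (φ (A.direction.orthogonalProjectionOnto (w⁻¹ 0)))

theorem E0_fphi (φ : A.direction → Mer A) : p.E0 A (fphi A φ) := by
  refine ⟨fun w _ => reg_pullMer _, fun w _ r _ γ h => ?_⟩
  obtain ⟨β, hβ, hr⟩ := h.exists_coroot
  have h1 : A.direction.orthogonalProjectionOnto ((w * r)⁻¹ 0) =
      A.direction.orthogonalProjectionOnto (w⁻¹ 0) := by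
    rw [mul_inv_rev, h.inv]
    change A.direction.orthogonalProjectionOnto (r (w⁻¹ 0)) = _
    rw [hr, map_sub, map_smul, hβ, smul_zero, sub_zero]
  rw [fphi, fphi, h1, smul_pullMer]
  intro x
  rw [h.inv, hr, piA_sub hβ]

theorem act_fphi (D : Op (V n)) (φ : A.direction → Mer A) {w : V n ≃ᵃ[ℂ] V n} {v : A.direction}
    (hw : ∀ y, A.direction.orthogonalProjectionOnto (w⁻¹ y) = A.direction.orthogonalProjectionOnto y + v) :
    act D (fphi A φ) w = (projCoeff A D).sum fun u g => (w⁻¹ • g) * pullMer A (φ (u + v)) := by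
  rw [act, projCoeff, Finsupp.sum_mapDomain_index (by simp) (by simp [add_mul])]
  refine Finsupp.sum_congr fun g _ => ?_
  rw [fphi, mul_inv_rev, inv_inv]
  congr 3
  exact hw (g 0)

-- Delta functions of the projected translation part separate the coefficients of D by projected
-- shift; this is how statements about families become statements about coefficients.
open Classical in
theorem act_fphi_single (D : Op (V n)) (u : A.direction) {w : V n ≃ᵃ[ℂ] V n} {v : A.direction}
    (hw : ∀ y, A.direction.orthogonalProjectionOnto (w⁻¹ y) = A.direction.orthogonalProjectionOnto y + v) :
    act D (fphi A (Pi.single u 1)) w = w⁻¹ • projCoeff A D (u - v) := by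
  rw [act_fphi D _ hw, Finsupp.sum, Finset.sum_eq_single (u - v)]
  · simp
  · intro b _ hb
    rw [Pi.single_eq_of_ne (fun h => hb (eq_sub_of_add_eq h)), map_zero, mul_zero]
  · intro h
    rw [Finsupp.notMem_support_iff.1 h, smul_zero, zero_mul]

theorem proj_one (y : V n) : A.direction.orthogonalProjectionOnto ((1 : V n ≃ᵃ[ℂ] V n)⁻¹ y) =
    A.direction.orthogonalProjectionOnto y + 0 := by
  rw [inv_one, add_zero]; rfl

/-- Delta families lie in `E0`, which `HH` preserves. At the identity the image family equals a
summed coefficient of D, which is therefore regular on A. -/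
theorem restrictable_of_mem {D : Op (V n)} (hD : D ∈ p.HH n) : Restrictable A D := by
  classical
  intro u
  have h := ((E0_fphi (p := p) (A := A) (Pi.single u 1)).act hD).1 1 (one_mem _)
  rw [act_fphi_single D u proj_one, inv_one, one_smul, sub_zero] at h
  exact h.exists_isRestr

theorem coef_ne (i : Option (Fin n)) : p.coef i ≠ 0 := by
  have h1 := p.one_sub_XX i
  -- The reflection s_i inverts Z_i, so a constant Z_i would have square 1, contrary to 1 − Z_i² ≠
  -- 0.
  have hZ : ∀ c : ℂ, p.ZZ i ≠ cM c := by
    intro c hc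
    have h := s_smul_ZZ (p := p) i
    have h2 : p.s i • p.ZZ i = p.ZZ i := by rw [hc]; exact smul_C _ _
    rw [h2, ← mul_eq_one_iff_eq_inv₀ (ZZ_ne i), ← pow_two, ZZ_sq] at h
    rw [h, sub_self] at h1
    exact h1 rfl
  have key : ∀ c : ℂ, c ≠ 0 → 1 - cM c * p.ZZ i ≠ 0 := by
    intro c hc h
    refine hZ c⁻¹ ?_
    have hc' : (cM c : Mer (V n)) ≠ 0 := by
      rw [cM, map_ne_zero_iff _ (FaithfulSMul.algebraMap_injective _ _)]; exact hc
    rw [cM, map_inv₀, ← mul_eq_one_iff_eq_inv₀ hc', mul_comm]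
    exact (sub_eq_zero.1 h).symm
  have h2 := key (p.t i * p.u i) (mul_ne_zero (p.t i).ne_zero (p.u i).ne_zero)
  have h3 := key (-(p.t i * (p.u i : ℂ)⁻¹)) (neg_ne_zero.2 (mul_ne_zero (p.t i).ne_zero
    (inv_ne_zero (p.u i).ne_zero)))
  rw [coef_eq, ZZ_sq]
  refine div_ne_zero (mul_ne_zero (inv_ne_zero (p.tM_ne i)) (mul_ne_zero ?_ ?_)) h1
  · simpa [cM, tM, uM] using h2
  · simpa [cM, tM, uM] using h3

theorem finW_zero {u : V n ≃ᵃ[ℂ] V n} (hu : u ∈ p.finW n) : u 0 = 0 := by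
  obtain ⟨σ, ε, h⟩ := exists_NF_finW hu
  ext j
  rw [h]; simp

theorem act_C_right (D : Op (V n)) (c : ℂ) (f) (w : V n ≃ᵃ[ℂ] V n) :
    act D (fun w => algebraMap ℂ (Mer (V n)) c * f w) w = algebraMap ℂ (Mer (V n)) c * act D f w := by
  rw [act, act, Finsupp.mul_sum]
  refine Finsupp.sum_congr fun g _ => ?_
  ring

/-- The commutant of the finite Hecke algebra in the algebra generated by the `T_i`. -/
def Sym (p : Params) (D : Op (V n)) : Prop := D ∈ p.HH n ∧ ∀ i : Fin n, Commute (p.T (some i)) D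

/-- On a family depending only on w⁻¹0 the operator T_i, i ≥ 1, acts as t_i. Since D commutes with
T_i, the same holds for the image under D, and as the coefficient of s_i − 1 is nonzero this means
invariance under s_i. -/
theorem Sym.act_s {D : Op (V n)} (hD : p.Sym D) (φ : A.direction → Mer A) (i : Fin n)
    (w : V n ≃ᵃ[ℂ] V n) : act D (fphi A φ) (p.s (some i) * w) = act D (fphi A φ) w := by
  have hf : ∀ w, fphi A φ (p.s (some i) * w) = fphi A φ w := by
    intro w
    rw [fphi, fphi, mul_inv_rev, s_inv]
    change pullMer A (φ (A.direction.orthogonalProjectionOnto (w⁻¹ (p.s (some i) 0)))) = _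
    rw [finW_zero (s_mem_finW i)]
  have hT : act (p.T (some i)) (fphi A φ) = fun w => algebraMap ℂ (Mer (V n)) (p.t (some i) : ℂ) * fphi A φ w := by
    funext w
    rw [act_T, hf, sub_self, mul_zero, add_zero]; rfl
  have h1 : act (p.T (some i)) (act D (fphi A φ)) w =
      algebraMap ℂ (Mer (V n)) (p.t (some i) : ℂ) * act D (fphi A φ) w := by
    rw [← act_mul, (hD.2 i).eq, act_mul, hT, act_C_right]
  rw [act_T] at h1
  have h2 : (w⁻¹ • p.coef (some i)) * (act D (fphi A φ) (p.s (some i) * w) - act D (fphi A φ) w) = 0 :=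
    add_left_cancel (h1.trans (add_zero _).symm)
  have h3 : w⁻¹ • p.coef (some i) ≠ 0 := by
    rw [Ne, smul_eq_zero_iff_eq]; exact coef_ne _
  exact sub_eq_zero.1 ((mul_eq_zero.1 h2).resolve_left h3)

theorem Sym.act_finW {D : Op (V n)} (hD : p.Sym D) (φ : A.direction → Mer A) {u : V n ≃ᵃ[ℂ] V n}
    (hu : u ∈ p.finW n) : ∀ w : V n ≃ᵃ[ℂ] V n, act D (fphi A φ) (u * w) = act D (fphi A φ) w := by
  induction hu using Subgroup.closure_induction with
  | mem x hx => obtain ⟨i, rfl⟩ := hx; exact hD.act_s φ i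
  | one => intro w; rw [one_mul]
  | mul x y _ _ hx hy => intro w; rw [mul_assoc, hx, hy]
  | inv x _ hx => intro w; rw [← hx, ← mul_assoc, mul_inv_cancel, one_mul]

theorem inner_linear {g : V n ≃ᵃ[ℂ] V n} (hg : g ∈ p.affW n) (x y : V n) :
    inner ℂ (g.linear x) (g.linear y) = inner ℂ x y := by
  obtain ⟨σ, ε, μ, h⟩ := p.exists_NF hg
  rw [PiLp.inner_apply, PiLp.inner_apply, ← Equiv.sum_comp σ fun j => inner ℂ (x j) (y j)]
  refine Finset.sum_congr rfl fun j _ => ?_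
  rw [h.linear, h.linear]
  rcases Int.units_eq_one_or (ε j) with h | h <;> simp [h]

/-- The linear part of g is a Hermitian isometry and fixes the directions of A, so it does not
change orthogonal projections to them. -/
theorem proj_of_translation {g : V n ≃ᵃ[ℂ] V n} (hg : g ∈ p.affW n) {v : A.direction}
    (h : ∀ x : A, g x = ((v +ᵥ x : A) : V n)) (y : V n) :
    A.direction.orthogonalProjectionOnto (g y) = A.direction.orthogonalProjectionOnto y + v := by
  obtain ⟨x₀⟩ : Nonempty A := inferInstance
  have h1 : ∀ y, g y = g.linear (y - x₀) + g x₀ := fun y => by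
    have := g.map_vadd x₀ (y - x₀)
    rwa [vadd_eq_add, sub_add_cancel, vadd_eq_add] at this
  have h2 : ∀ d ∈ A.direction, g.linear d = d := by
    intro d hd
    have e1 := h1 ((⟨d, hd⟩ : A.direction) +ᵥ x₀ : A)
    rw [h, h] at e1
    have e2 : (((⟨d, hd⟩ : A.direction) +ᵥ x₀ : A) : V n) - x₀ = d := by
      change d + (x₀ : V n) - x₀ = d
      abel
    rw [e2] at e1
    change (v : V n) + (d + x₀) = g.linear d + (v + x₀) at e1
    have : g.linear d = (v : V n) + (d + x₀) - (v + x₀) := by rw [e1]; abel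
    rw [this]; abel
  have h3 : ∀ y, A.direction.orthogonalProjectionOnto (g.linear y) =
      A.direction.orthogonalProjectionOnto y := by
    intro y
    rw [← sub_eq_zero, ← map_sub, Submodule.orthogonalProjectionOnto_eq_zero_iff, Submodule.mem_orthogonal]
    intro d hd
    rw [inner_sub_right, sub_eq_zero]
    nth_rw 1 [← h2 d hd]
    exact inner_linear hg _ _
  rw [h1, h, map_add, h3, map_sub]
  have e3 : (((v +ᵥ x₀ : A) : V n)) = v + x₀ := rfl
  rw [e3, map_add, Submodule.orthogonalProjectionOnto_mem_subspace_eq_self]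
  abel

/-- Elements of `P` act on `A` by translations, up to the finite Weyl group. -/
def Transl (p : Params) (A : AffineSubspace ℂ (V n)) [Nonempty A] (P : (V n ≃ᵃ[ℂ] V n) → Prop) : Prop :=
  ∀ w ∈ p.affW n, P w → ∃ u ∈ p.finW n, ∃ v : A.direction, ∀ x : A,
    (u * w)⁻¹ (x : V n) = ((v +ᵥ x : A) : V n)

-- By symmetry of D the element w may be multiplied on the left by an element of the finite Weyl
-- group, after which its inverse acts on A as a translation. The value at w is then a translated
-- coefficient of D, whose restriction is the translate of the restricted coefficient.
open Classical in
theorem Sym.isRestr_act {P : (V n ≃ᵃ[ℂ] V n) → Prop} (hP : p.Transl A P) {D : Op (V n)} (hD : p.Sym D)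
    (u : A.direction) {w : V n ≃ᵃ[ℂ] V n} (hw : w ∈ p.affW n) (hPw : P w) :
    IsRestr A (act D (fphi A (Pi.single u 1)) w)
      (AffineEquiv.constVAdd ℂ A (A.direction.orthogonalProjectionOnto (w⁻¹ 0)) •
        restr A (projCoeff A D (u - A.direction.orthogonalProjectionOnto (w⁻¹ 0)))) := by
  obtain ⟨g, hg, v, hv⟩ := hP w hw hPw
  have hgw := inv_mem (mul_mem (finW_le hg) hw)
  have h1 := proj_of_translation hgw hv
  have h2 : A.direction.orthogonalProjectionOnto (w⁻¹ 0) = v := by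
    have := h1 0
    rw [map_zero A.direction.orthogonalProjectionOnto, zero_add, mul_inv_rev] at this
    rw [← this]
    change _ = A.direction.orthogonalProjectionOnto (w⁻¹ (g⁻¹ 0))
    rw [finW_zero (inv_mem hg)]
  rw [h2, ← hD.act_finW _ hg, act_fphi_single D u h1]
  obtain ⟨r, hr⟩ := restrictable_of_mem (A := A) hD.1 (u - v)
  rw [hr.restr_eq]
  refine hr.smul fun x => ?_
  rw [inv_inv]
  have := hv (-v +ᵥ x)
  rw [vadd_vadd, add_neg_cancel, zero_vadd] at this
  rw [← this]
  exact (g * w).apply_symm_apply _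

-- The family D'δ_u and the pull-back ψ of its restrictions differ by a family vanishing on P, and D
-- preserves such families. At the identity this compares DD'δ_u with Dψ, and the coefficients of
-- the latter are those of the product of the restricted operators.
open Classical in
theorem restr_projCoeff_mul {P : (V n ≃ᵃ[ℂ] V n) → Prop} (hS : p.Stab A P) (hP : p.Transl A P) (h1 : P 1)
    {D D' : Op (V n)} (hD : D ∈ p.HH n) (hD' : p.Sym D') (u : A.direction) :
    restr A (projCoeff A (D * D') u) = ∑ v ∈ (projCoeff A D).support, restr A (projCoeff A D v) *
      AffineEquiv.constVAdd ℂ A v • restr A (projCoeff A D' (u - v)) := by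
  set ψ : A.direction → Mer A := fun v =>
    AffineEquiv.constVAdd ℂ A v • restr A (projCoeff A D' (u - v)) with hψ
  set f := act D' (fphi A (Pi.single u 1)) with hf
  have hfE : p.E0 A f := (E0_fphi _).act hD'.1
  have hI : p.I0 A P fun w => f w + algebraMap ℂ (Mer (V n)) (-1) * fphi A ψ w := by
    refine ⟨hfE.add ((E0_fphi ψ).smul (-1)), fun w hw hPw => ?_⟩
    have e1 := hD'.isRestr_act hP u hw hPw
    have e2 := e1.sub (isRestr_pullMer (ψ (A.direction.orthogonalProjectionOnto (w⁻¹ 0))))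
    change IsRestr A (f w - fphi A ψ w) (ψ _ - ψ _) at e2
    rw [sub_self] at e2
    change IsRestr A (f w + _ * fphi A ψ w) 0
    rwa [map_neg, map_one, neg_one_mul, ← sub_eq_add_neg]
  have h2 := (hI.act hS hD).2 1 (one_mem _) h1
  -- At w = 1 the translation part is zero, so the first summand is the coefficient of DD' at u.
  rw [act_add_right, act_C_right, hf, ← act_mul, act_fphi_single _ _ proj_one,
    act_fphi _ _ proj_one, inv_one, one_smul, sub_zero] at h2
  have h3 : IsRestr A ((projCoeff A D).sum fun u g => ((1 : V n ≃ᵃ[ℂ] V n) • g) * pullMer A (ψ (u + 0)))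
      (∑ v ∈ (projCoeff A D).support, restr A (projCoeff A D v) * ψ v) := by
    refine IsRestr.sum fun v _ => ?_
    change IsRestr A (((1 : V n ≃ᵃ[ℂ] V n) • projCoeff A D v) * pullMer A (ψ (v + 0))) _
    rw [one_smul, add_zero]
    obtain ⟨r, hr⟩ := restrictable_of_mem (A := A) hD v
    rw [hr.restr_eq]
    exact hr.mul (isRestr_pullMer _)
  have h4 := h2.add h3
  rw [zero_add, map_neg, map_one, neg_one_mul, neg_add_cancel_right] at h4
  exact h4.restr_eq

end Params

/-! ### Restricted operators as difference operators on A. -/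

section Bar

variable {n : ℕ} {A : AffineSubspace ℂ (V n)} [Nonempty A]

variable (A) in
/-- The restricted coefficients of an operator. -/
def pr (D : Op (V n)) : A.direction →₀ Mer A := (projCoeff A D).mapRange (restr A) restr_zero

variable (A) in
/-- The difference operator on `A` with given coefficients. -/
def ofPr : (A.direction →₀ Mer A) →+ Op A :=
  Finsupp.liftAddHom fun v => SkewMonoidAlgebra.singleAddHom (AffineEquiv.constVAdd ℂ A v)

theorem ofPr_single (v : A.direction) (g : Mer A) :
    ofPr A (Finsupp.single v g) = SkewMonoidAlgebra.single (AffineEquiv.constVAdd ℂ A v) g :=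
  Finsupp.liftAddHom_apply_single _ _ _

theorem bar_eq (D : Op (V n)) : bar A D = ofPr A (pr A D) := by
  rw [bar, pr, ofPr, Finsupp.liftAddHom_apply, Finsupp.sum_mapRange_index (by simp)]
  rfl

theorem projCoeff_add (D D' : Op (V n)) : projCoeff A (D + D') = projCoeff A D + projCoeff A D' := by
  rw [projCoeff, SkewMonoidAlgebra.coeff_add, Finsupp.mapDomain_add]; rfl

theorem projCoeff_smul (c : ℂ) (D : Op (V n)) (v : A.direction) :
    projCoeff A (c • D) v = algebraMap ℂ (Mer (V n)) c * projCoeff A D v := by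
  rw [projCoeff, SkewMonoidAlgebra.coeff_smul, Finsupp.mapDomain_smul, Finsupp.smul_apply, Algebra.smul_def]
  rfl

theorem bar_add {D D' : Op (V n)} (h : Restrictable A D) (h' : Restrictable A D') :
    bar A (D + D') = bar A D + bar A D' := by
  rw [bar_eq, bar_eq, bar_eq, ← map_add]
  congr 1
  ext v
  obtain ⟨r, hr⟩ := h v
  obtain ⟨r', hr'⟩ := h' v
  simp only [pr, Finsupp.mapRange_apply, Finsupp.add_apply, projCoeff_add, hr.restr_eq, hr'.restr_eq,
    (hr.add hr').restr_eq]

theorem ofPr_smul (c : ℂ) (g : A.direction →₀ Mer A) : ofPr A (c • g) = c • ofPr A g := by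
  induction g using Finsupp.induction_linear with
  | zero => simp
  | add f g hf hg => rw [smul_add, map_add, map_add, hf, hg, smul_add]
  | single v a => rw [Finsupp.smul_single, ofPr_single, ofPr_single, SkewMonoidAlgebra.smul_single]

theorem bar_smul (c : ℂ) {D : Op (V n)} (h : Restrictable A D) : bar A (c • D) = c • bar A D := by
  rw [bar_eq, bar_eq, ← ofPr_smul]
  congr 1
  ext v
  obtain ⟨r, hr⟩ := h v
  rw [pr, Finsupp.mapRange_apply, projCoeff_smul, ((isRestr_C c).mul hr).restr_eq, Finsupp.smul_apply, pr,
    Finsupp.mapRange_apply, hr.restr_eq, Algebra.smul_def]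

theorem projCoeff_Res (D : Op (V n)) : projCoeff A (Res D) = projCoeff A D := by
  rw [projCoeff, projCoeff, Res, SkewMonoidAlgebra.coeff_mapDomain, ← Finsupp.mapDomain_comp]
  congr 1
  funext g
  change A.direction.orthogonalProjectionOnto (g 0 + 0) = _
  rw [add_zero]

theorem bar_Res (D : Op (V n)) : bar A (Res D) = bar A D := by rw [bar, bar, projCoeff_Res]

theorem restrictable_Res {D : Op (V n)} (h : Restrictable A D) : Restrictable A (Res D) := fun v => by
  rw [projCoeff_Res]; exact h v

theorem projCoeff_one : projCoeff A (1 : Op (V n)) = Finsupp.single 0 1 := by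
  rw [projCoeff, SkewMonoidAlgebra.coeff_one, Finsupp.mapDomain_single]
  congr 1
  exact map_zero _

theorem bar_one : bar A (1 : Op (V n)) = 1 := by
  have h1 : restr A (1 : Mer (V n)) = 1 := by
    have := isRestr_C (A := A) 1
    rw [map_one, map_one] at this
    exact this.restr_eq
  rw [bar, projCoeff_one, Finsupp.sum_single_index (by rw [restr_zero, SkewMonoidAlgebra.single_zero]), h1,
    SkewMonoidAlgebra.one_def]
  congr 1
  ext x
  change (((0 : A.direction) +ᵥ x : A) : V n) _ = _
  rw [zero_vadd]; rfl

/-- The coefficients of a product of difference operators. -/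
def conv (g g' : A.direction →₀ Mer A) : A.direction →₀ Mer A :=
  g.sum fun v a => g'.sum fun v' b => Finsupp.single (v + v') (a * AffineEquiv.constVAdd ℂ A v • b)

open Classical in
theorem conv_apply (g g' : A.direction →₀ Mer A) (u : A.direction) : conv g g' u = ∑ v ∈ g.support, g v *
    AffineEquiv.constVAdd ℂ A v • g' (u - v) := by
  rw [conv, Finsupp.sum_apply, Finsupp.sum]
  refine Finset.sum_congr rfl fun v _ => ?_
  rw [Finsupp.sum_apply, Finsupp.sum, Finset.sum_eq_single (u - v)]
  · simp
  · intro b _ hb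
    rw [Finsupp.single_apply, if_neg fun h => hb (eq_sub_of_add_eq' h)]
  · intro h
    rw [Finsupp.notMem_support_iff.1 h]; simp

theorem ofPr_mul (g g' : A.direction →₀ Mer A) : ofPr A g * ofPr A g' = ofPr A (conv g g') := by
  have h2 : ∀ g : A.direction →₀ Mer A, ofPr A g =
      g.sum fun v a => SkewMonoidAlgebra.single (AffineEquiv.constVAdd ℂ A v) a := fun g => rfl
  rw [conv, map_finsuppSum, h2 g]
  refine (Finset.sum_mul g.support (fun v =>
    (SkewMonoidAlgebra.single (AffineEquiv.constVAdd ℂ A v) (g v) : Op A)) (ofPr A g')).trans (Finset.sum_congr rfl fun v _ => ?_)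
  change _ = ofPr A (g'.sum fun v' b => Finsupp.single (v + v')
    (g v * AffineEquiv.constVAdd ℂ A v • b))
  rw [map_finsuppSum, h2 g']
  refine (Finset.mul_sum g'.support (fun v =>
    (SkewMonoidAlgebra.single (AffineEquiv.constVAdd ℂ A v) (g' v) : Op A)) _).trans (Finset.sum_congr rfl fun v' _ => ?_)
  change _ = ofPr A (Finsupp.single (v + v') (g v * AffineEquiv.constVAdd ℂ A v • g' v'))
  rw [ofPr_single, SkewMonoidAlgebra.single_mul_single]
  congr 1
  ext x
  change ((v +ᵥ (v' +ᵥ x) : A) : V n) _ = (((v + v') +ᵥ x : A) : V n) _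
  rw [vadd_vadd]

theorem Params.bar_mul [NeZero n] {p : Params} {P : (V n ≃ᵃ[ℂ] V n) → Prop} (hS : p.Stab A P)
    (hP : p.Transl A P) (h1 : P 1) {D D' : Op (V n)} (hD : D ∈ p.HH n) (hD' : p.Sym D') :
    bar A (D * D') = bar A D * bar A D' := by
  rw [bar_eq, bar_eq, bar_eq]
  rw [ofPr_mul]
  congr 1
  ext u : 1
  rw [conv_apply, pr, Finsupp.mapRange_apply, restr_projCoeff_mul hS hP h1 hD hD']
  -- A coefficient may vanish after restriction, so the support on A can be smaller; the extra terms
  -- are zero.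
  refine (Finset.sum_subset Finsupp.support_mapRange fun v _ hv => ?_).symm
  have : restr A (projCoeff A D v) = 0 := Finsupp.notMem_support_iff.1 hv
  rw [this, zero_mul]

end Bar
end Koornwinder
end

noncomputable section
set_option linter.unusedSectionVars false
namespace Koornwinder
namespace Params

variable {n : ℕ} [NeZero n] {S : Finset (Fin n)} {η₁ ηn : ℂ}

/-! ### Connected components and the plane `D_0` -/

/-- All nodes between `a` and `b` belong to `S`. -/
def Lk (S : Finset (Fin n)) (a b : Fin n) : Prop := ∀ l : Fin n, a ≤ l → l < b → l ∈ S

/-- All nodes from `a` on belong to `S`. -/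
def Tail (S : Finset (Fin n)) (a : Fin n) : Prop := ∀ l : Fin n, a ≤ l → l ∈ S

/-- With `exists_right` this delimits the block of coordinates containing j. The nodes a, …, b − 1
tie together the coordinates a, …, b, one more than there are nodes; the right end belongs to S only
if it is the last node. -/
theorem exists_left (S : Finset (Fin n)) (j : Fin n) : ∃ a ≤ j, Lk S a j ∧
    ∀ l : Fin n, l.val + 1 = a.val → l ∉ S := by
  obtain ⟨j, hj⟩ := j
  induction j with
  | zero => exact ⟨_, le_rfl, fun l h1 h2 => absurd h1 (not_le.2 h2), fun l hl => by simp at hl⟩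
  | succ j ih =>
    by_cases h : (⟨j, by omega⟩ : Fin n) ∈ S
    · obtain ⟨a, ha, hL, hm⟩ := ih (by omega)
      refine ⟨a, ha.trans (by simp [Fin.le_def]), fun l h1 h2 => ?_, hm⟩
      by_cases hl : l.val = j
      · rwa [show l = ⟨j, by omega⟩ from Fin.ext hl]
      · refine hL l h1 ?_
        simp only [Fin.lt_def] at h2 ⊢
        omega
    · refine ⟨_, le_rfl, fun l h1 h2 => absurd h1 (not_le.2 h2), fun l hl => ?_⟩
      rwa [show l = ⟨j, by omega⟩ from Fin.ext (by simpa using hl)]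

theorem exists_right (S : Finset (Fin n)) (j : Fin n) : ∃ b ≥ j, Lk S j b ∧ (b.val + 1 < n → b ∉ S) := by
  have key : ∀ m : ℕ, ∀ j : Fin n, j.val + m + 1 = n →
      ∃ b ≥ j, Lk S j b ∧ (b.val + 1 < n → b ∉ S) := by
    intro m
    induction m with
    | zero => exact fun j hj => ⟨j, le_rfl, fun l h1 h2 => absurd h1 (not_le.2 h2), fun h => by omega⟩
    | succ m ih =>
      intro j hj
      by_cases h : j ∈ S
      · obtain ⟨b, hb, hL, hm⟩ := ih ⟨j.val + 1, by omega⟩ (by simp; omega)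
        refine ⟨b, le_trans (by simp [Fin.le_def]) hb, fun l h1 h2 => ?_, hm⟩
        by_cases hl : l = j
        · rwa [hl]
        · refine hL l ?_ h2
          have : l.val ≠ j.val := fun hh => hl (Fin.ext hh)
          simp only [Fin.le_def] at h1 ⊢
          omega
      · exact ⟨j, le_rfl, fun l h1 h2 => absurd h1 (not_le.2 h2), fun _ => h⟩
  exact key (n - 1 - j.val) j (by have := j.2; omega)

theorem eta_lt {i : Fin n} (h : i.val + 1 < n) : eta η₁ ηn (simpleRoot i) = η₁ := by
  have hne : i ≠ ⟨i.val + 1, h⟩ := fun hh => by simpa using congrArg Fin.val hh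
  rw [eta, if_neg]
  rw [form_simpleRoot_lt h, simpleRoot, dif_pos h]
  simp [e, hne, hne.symm]; norm_num

theorem eta_last {i : Fin n} (h : ¬ i.val + 1 < n) : eta η₁ ηn (simpleRoot i) = ηn := by
  rw [eta, if_pos]
  rw [form_simpleRoot_last h, simpleRoot, dif_neg h]
  simp [e]; norm_num

theorem mem_D0_iff {x : V n} : x ∈ D0 S η₁ ηn ↔
    ∀ i ∈ S, form (simpleRoot i) x = eta η₁ ηn (simpleRoot i) := Iff.rfl

theorem D0_sub {x : V n} (hx : x ∈ D0 S η₁ ηn) {a b : Fin n} (hab : a ≤ b) (hL : Lk S a b) :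
    x a - x b = ((b.val : ℂ) - a.val) * η₁ := by
  obtain ⟨b, hb⟩ := b
  induction b with
  | zero =>
    have : a = ⟨0, hb⟩ := le_antisymm hab (by simp)
    rw [this]; simp
  | succ b ih =>
    rcases hab.eq_or_lt with h | h
    · rw [h]; simp
    · have hb' : b < n := by omega
      have hab' : a ≤ ⟨b, hb'⟩ := by simp only [Fin.le_def, Fin.lt_def] at h ⊢; omega
      have h1 := ih hb' hab' (fun l h1 h2 => hL l h1 (h2.trans (by simp [Fin.lt_def])))
      have h2 := mem_D0_iff.1 hx ⟨b, hb'⟩ (hL _ hab' (by simp [Fin.lt_def]))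
      rw [form_simpleRoot_lt (i := ⟨b, hb'⟩) hb, eta_lt (i := ⟨b, hb'⟩) hb] at h2
      push_cast
      simp only at h1 h2
      linear_combination h1 + h2

theorem D0_tail {x : V n} (hx : x ∈ D0 S η₁ ηn) {a : Fin n} (h : Tail S a) :
    2 * x a = ηn + 2 * ((n : ℂ) - 1 - a.val) * η₁ := by
  have hl : ¬ (lastNode n).val + 1 < n := (lastNode_iff _).1 rfl
  have ha : a ≤ lastNode n := by
    have := a.2
    simp only [Fin.le_def, lastNode]; omega
  have h1 := D0_sub hx ha fun l h1 _ => h l h1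
  have h2 := mem_D0_iff.1 hx _ (h _ ha)
  rw [form_simpleRoot_last hl, eta_last hl] at h2
  have h3 : ((lastNode n).val : ℂ) = n - 1 := by
    have := NeZero.pos n
    rw [eq_sub_iff_add_eq]
    simp only [lastNode]
    exact_mod_cast (by omega : n - 1 + 1 = n)
  rw [h3] at h1
  linear_combination 2 * h1 + h2

theorem mem_direction_iff {v : V n} : v ∈ (D0 S η₁ ηn).direction ↔
    ∀ i ∈ S, form (simpleRoot i) v = 0 := by
  obtain ⟨x₀⟩ : Nonempty (D0 S η₁ ηn) := inferInstance
  rw [← AffineSubspace.vadd_mem_iff_mem_direction v x₀.2, mem_D0_iff]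
  refine forall₂_congr fun i hi => ?_
  rw [vadd_eq_add, form_add, x₀.2 i hi, add_eq_right]

theorem adj_of_form_ne {a b : Fin n} (h : form (simpleRoot a) (simpleRoot b) ≠ 0) :
    a.val ≤ b.val + 1 ∧ b.val ≤ a.val + 1 := by
  by_contra hc
  apply h
  have ha := a.2
  have hb := b.2
  by_cases h1 : a.val + 1 < n
  · rw [form_simpleRoot_lt h1]
    by_cases h2 : b.val + 1 < n
    · simp only [simpleRoot, h2, dif_pos, e]
      simp only [PiLp.sub_apply, PiLp.single_apply, Fin.ext_iff]
      split_ifs <;> first | omega | simp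
    · simp only [simpleRoot, h2, e]
      simp only [dif_neg, not_false_eq_true, PiLp.smul_apply, PiLp.single_apply, Fin.ext_iff]
      split_ifs <;> first | omega | simp
  · rw [form_simpleRoot_last h1]
    by_cases h2 : b.val + 1 < n
    · simp only [simpleRoot, h2, dif_pos, e]
      simp only [PiLp.sub_apply, PiLp.single_apply, Fin.ext_iff]
      split_ifs <;> first | omega | simp
    · simp only [simpleRoot, h2, e]
      simp only [dif_neg, not_false_eq_true, PiLp.smul_apply, PiLp.single_apply, Fin.ext_iff]
      split_ifs <;> omega

theorem form_adj {a : Fin n} (h : a.val + 1 < n) :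
    form (simpleRoot a) (simpleRoot ⟨a.val + 1, h⟩) ≠ 0 := by
  rw [form_simpleRoot_lt h]
  have hne : a ≠ ⟨a.val + 1, h⟩ := fun hh => by simpa using congrArg Fin.val hh
  by_cases h2 : a.val + 1 + 1 < n
  · have hne2 : a ≠ ⟨a.val + 1 + 1, h2⟩ := fun hh => by
      have := congrArg Fin.val hh
      simp only at this
      omega
    simp [simpleRoot, h2, e, hne, hne2]
  · simp [simpleRoot, h2, e, hne]

/-- Intervals of nodes are components. -/
theorem component_eq {i : Fin n} {a b : ℕ} (ha : a ≤ i.val) (hb : i.val ≤ b)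
    (hS : ∀ l : Fin n, a ≤ l.val → l.val ≤ b → l ∈ S) (hl : ∀ l : Fin n, l.val + 1 = a → l ∉ S)
    (hr : ∀ l : Fin n, l.val = b + 1 → l ∉ S) :
    component S i = {l | a ≤ l.val ∧ l.val ≤ b} := by
  set R : Fin n → Fin n → Prop :=
    fun a b => a ∈ S ∧ b ∈ S ∧ form (simpleRoot a) (simpleRoot b) ≠ 0 with hR
  have hsymm : ∀ c d, R c d → R d c := fun c d h => ⟨h.2.1, h.1, by rw [form_comm]; exact h.2.2⟩
  have up : ∀ m : ℕ, ∀ c d : Fin n, d.val = c.val + m → a ≤ c.val → d.val ≤ b →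
      Relation.ReflTransGen R c d ∧ Relation.ReflTransGen R d c := by
    intro m
    induction m with
    | zero => 
      intro c d h _ _
      rw [show d = c from Fin.ext (by omega)]
      exact ⟨.refl, .refl⟩
    | succ m ih =>
      intro c d h h1 h2
      have hd := d.2
      have hc1 : c.val + m + 1 < n := by omega
      obtain ⟨h3, h4⟩ := ih c ⟨c.val + m, by omega⟩ rfl h1 (by simp; omega)
      have hde : d = ⟨c.val + m + 1, hc1⟩ := Fin.ext (by simp; omega)
      have h5 : R ⟨c.val + m, by omega⟩ d := by
        subst hde
        exact ⟨hS _ (by simp; omega) (by simp; omega), hS _ (by simp; omega) (by simp; omega),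
          form_adj (a := ⟨c.val + m, by omega⟩) hc1⟩
      exact ⟨h3.tail h5, Relation.ReflTransGen.head (hsymm _ _ h5) h4⟩
  ext l
  constructor
  · intro h
    induction h with
    | refl => exact ⟨ha, hb⟩
    | tail _ h ih =>
      rename_i c d _
      obtain ⟨h1, h2⟩ := adj_of_form_ne h.2.2
      obtain ⟨h3, h4⟩ := ih
      constructor
      · by_contra hc
        exact hl d (by omega) h.2.1
      · by_contra hc
        exact hr d (by omega) h.2.1
  · rintro ⟨h1, h2⟩
    rcases le_total i.val l.val with h | h
    · exact (up (l.val - i.val) i l (by omega) ha h2).1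
    · exact (up (i.val - l.val) l i (by omega) h1 hb).2

theorem form_simpleRoot_nu (j l : Fin n) : form (simpleRoot j) (latt (nu l)) =
    if j = l then (if l.val + 1 < n then 1 else 2) else 0 := by
  have h := nuCoef_nu l j
  by_cases hj : j.val + 1 < n
  · rw [nuCoef_lt hj] at h
    rw [form_simpleRoot_lt hj, latt_apply, latt_apply, ← Int.cast_sub, h]
    by_cases hjl : j = l
    · subst hjl; simp [hj]
    · simp [hjl]
  · rw [nuCoef_last hj] at h
    rw [form_simpleRoot_last hj, latt_apply, h]
    by_cases hjl : j = l
    · subst hjl; simp [hj]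
    · simp [hjl]

theorem form_sum_left {ι : Type*} (s : Finset ι) (f : ι → V n) (x : V n) :
    form (∑ i ∈ s, f i) x = ∑ i ∈ s, form (f i) x := by
  classical
  induction s using Finset.induction_on with
  | empty => simp [form]
  | insert a s ha ih =>
    rw [Finset.sum_insert ha, Finset.sum_insert ha, form_comm, form_add, form_comm, form_comm x, ih]

/-- The generalized Coxeter number of a component of type `A`. -/
theorem coxeter {a b : Fin n} (hab : a < b) {h : ℂ}
    (H : IsCoxeterNumber η₁ ηn {l : Fin n | a.val ≤ l.val ∧ l.val ≤ b.val - 1} h) :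
    ((b.val : ℂ) - a.val + 1) * η₁ = h := by
  obtain ⟨m, hm0, hroot, hmax, rfl⟩ := H
  have hab' : a.val < b.val := hab
  have hb := b.2
  set C := {l : Fin n | a.val ≤ l.val ∧ l.val ≤ b.val - 1} with hC
  have hsum : ∀ (k : Fin n → ℤ) (l : Fin n), form (∑ j, k j • simpleRoot j) (latt (nu l)) =
      k l * (if l.val + 1 < n then 1 else 2) := by
    intro k l
    rw [form_sum_left]
    have : ∀ j, form (k j • simpleRoot j) (latt (nu l)) =
        k j * (if j = l then (if l.val + 1 < n then 1 else 2) else 0) := by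
      intro j
      rw [← Int.cast_smul_eq_zsmul ℂ, form_comm, form_smul, form_comm, form_simpleRoot_nu]
    simp only [this]
    simp
  have hzm : ∑ j, m j • simpleRoot j = ∑ j, ((m j : ℤ)) • (simpleRoot j : V n) := by simp
  -- The root e_a − e_b is the sum of all simple roots in C, so maximality of θ bounds its
  -- coefficients below by 1.
  have hge : ∀ l ∈ C, 1 ≤ m l := by
    intro l hl
    have := hmax (fun j => if a.val ≤ j.val ∧ j.val ≤ b.val - 1 then 1 else 0)
      (fun j hj => if_neg hj) ?_ l
    · rw [if_pos (show a.val ≤ l.val ∧ l.val ≤ b.val - 1 from hl)] at this; exact_mod_cast this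
    · refine .inl ⟨a, b, hab.ne, 1, -1, ?_⟩
      -- The pairings with ν_1, ν_2, … are partial sums of coordinates, so they determine the vector
      -- coordinate by coordinate.
      have hext : ∀ x y : V n, (∀ l, form x (latt (nu l)) = form y (latt (nu l))) → x = y := by
        intro x y h
        have key : ∀ m : ℕ, ∀ hm : m < n, x ⟨m, hm⟩ = y ⟨m, hm⟩ := by
          intro m
          induction m using Nat.strong_induction_on with
          | _ m ih =>
            intro hm
            have h1 := h ⟨m, hm⟩
            simp only [form, latt_apply] at h1
            rw [← Finset.add_sum_erase _ _ (Finset.mem_univ (⟨m, hm⟩ : Fin n)),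
              ← Finset.add_sum_erase _ _ (Finset.mem_univ (⟨m, hm⟩ : Fin n))] at h1
            rw [Finset.sum_congr rfl (g := fun i => y i * (nu ⟨m, hm⟩ i : ℂ))] at h1
            · simpa [nu] using add_right_cancel h1
            · intro i hi
              by_cases him : i ≤ ⟨m, hm⟩
              · rw [ih i.val (lt_of_le_of_ne him fun hh => (Finset.ne_of_mem_erase hi) (Fin.ext hh)) i.2]
              · simp [nu, him]
        ext i
        exact key i.val i.2
      refine hext _ _ fun l => ?_
      rw [hsum, form_comm _ (latt (nu l)), form_add]
      have h1 : ∀ c : Fin n, form (latt (nu l)) (e c) = nu l c := fun c => by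
        rw [form_comm, form_e, latt_apply]
      simp only [Units.val_one, one_smul, Units.val_neg, neg_smul]
      rw [← neg_one_smul ℂ, form_smul, h1, h1]
      simp only [nu, Fin.le_def]
      split_ifs <;> first | omega | simp
  have hlast : m (lastNode n) = 0 := hm0 _ (by simp [hC, lastNode]; omega)
  have hval : ∀ l, (m l : ℂ) * (if l.val + 1 < n then 1 else 2) =
      form (∑ j, m j • simpleRoot j) (latt (nu l)) := by
    intro l; rw [hzm, hsum]; simp
  have hnl : nu (lastNode n) = fun _ => 1 := by
    funext j
    have := j.2
    simp only [nu, Fin.le_def, lastNode]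
    rw [if_pos (by omega)]
  have haC : a ∈ C := ⟨le_rfl, by omega⟩
  have ha1 : a.val + 1 < n := by omega
  -- The last coefficient is zero, so pairing with (1, …, 1) excludes long roots and forces opposite
  -- signs. Then θ = ±(e_i − e_j), whose coefficients do not exceed 1.
  have key : (∀ l ∈ C, m l = 1) ∧ form (∑ j, m j • simpleRoot j : V n) (∑ j, m j • simpleRoot j) ≠ 4 := by
    rcases hroot with ⟨i, j, hij, c, d, hθ⟩ | ⟨i, c, hθ⟩
    · have hf : ∀ x, form (∑ j, m j • simpleRoot j : V n) x = (c : ℤ) * x i + (d : ℤ) * x j := by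
        intro x
        rw [hθ, ← Int.cast_smul_eq_zsmul ℂ, ← Int.cast_smul_eq_zsmul ℂ, form_comm, form_add, form_smul,
          form_smul, form_comm, form_e, form_comm, form_e]
      refine ⟨fun l hl => ?_, ?_⟩
      · have h1 := hval l
        have h2 := hval (lastNode n)
        have hl1 : l.val + 1 < n := by have := hl.2; omega
        rw [hf, latt_apply, latt_apply, if_pos hl1, mul_one] at h1
        rw [hf, latt_apply, latt_apply, hlast, hnl] at h2
        have h1' : (m l : ℤ) = c * nu l i + d * nu l j := by exact_mod_cast h1
        have h2' : (0 : ℤ) = c + d := by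
          have : ((0 : ℤ) : ℂ) = ((c : ℤ) + (d : ℤ) : ℤ) := by push_cast at h2 ⊢; linear_combination h2
          exact_mod_cast this
        have h3 := hge l hl
        rcases Int.units_eq_one_or c with rfl | rfl <;> rcases Int.units_eq_one_or d with rfl | rfl <;>
          simp [nu] at h1' h2' <;> split_ifs at h1' <;> omega
      · rw [hf, hθ]
        rcases Int.units_eq_one_or c with rfl | rfl <;> rcases Int.units_eq_one_or d with rfl | rfl <;>
          simp [e, hij, hij.symm] <;> norm_num
    · exfalso
      have h2 := hval (lastNode n)
      rw [hθ, ← Int.cast_smul_eq_zsmul ℂ, form_comm, form_smul, form_comm, form_e, latt_apply, hlast, hnl] at h2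
      rcases Int.units_eq_one_or c with rfl | rfl <;> simp at h2
  rw [eta, if_neg key.2]
  have h1 : ∀ j, (m j : ℂ) * eta η₁ ηn (simpleRoot j) = if a ≤ j ∧ j < b then η₁ else 0 := by
    intro j
    by_cases hj : j ∈ C
    · have hj' := hj
      rw [key.1 j hj, eta_lt (by have := hj.2; omega), if_pos]
      · simp
      · obtain ⟨h1, h2⟩ := hj'
        simp only [Fin.le_def, Fin.lt_def]; omega
    · rw [hm0 j hj, if_neg]
      · simp
      · rintro ⟨h1, h2⟩
        apply hj
        simp only [Fin.le_def, Fin.lt_def] at h1 h2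
        exact ⟨h1, by omega⟩
  simp only [h1]
  rw [← Finset.sum_filter, Finset.sum_const]
  have h2 : (Finset.univ.filter fun j => a ≤ j ∧ j < b) = Finset.Ico a b := by ext j; simp
  rw [h2, Fin.card_Ico, nsmul_eq_mul, Nat.cast_sub hab'.le]
  ring

end Params
end Koornwinder
end

noncomputable section
set_option linter.unusedSectionVars false
namespace Koornwinder
namespace Params

variable {n : ℕ} [NeZero n] {p : Params} {S : Finset (Fin n)} {η₁ ηn : ℂ}

/-! ### The parabolic walls and the stability of the restricted families -/

theorem Tail.mono {a b : Fin n} (h : Tail S a) (hab : a ≤ b) : Tail S b :=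
  fun l hl => h l (hab.trans hl)

theorem Tail.lk {a b : Fin n} (h : Tail S a) : Lk S a b := fun l hl _ => h l hl

theorem Tail.of_lk {a b : Fin n} (h : Tail S b) (hL : Lk S a b) : Tail S a := fun l hl => by
  rcases lt_or_ge l b with h1 | h1
  · exact hL l hl h1
  · exact h l h1

/-- Affine roots whose positivity cuts out the alcoves that are relevant for the restriction to the
plane `D_0`. -/
def walls (p : Params) (S : Finset (Fin n)) : Set (V n → ℂ) :=
  {f | (∃ a b, a < b ∧ Lk S a b ∧ ((f = fun x => x a - x b) ∨
      (¬ Tail S a ∧ f = fun x => p.hbar - x a + x b))) ∨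
    ∃ a, Tail S a ∧ ((f = fun x => 2 * x a) ∨ f = fun x => p.hbar - 2 * x a)}

/-- Group elements `w` such that all walls are positive at `w⁻¹ X_0`. -/
def Pos (p : Params) (S : Finset (Fin n)) (w : V n ≃ᵃ[ℂ] V n) : Prop :=
  ∀ f ∈ p.walls S, 0 < p.hv n (f (w⁻¹ (p.X0 n)))

theorem sub_mem_rts {a b : Fin n} (h : a ≠ b) (c : ℤˣ) (m : ℤ) :
    (fun x : V n => (c : ℤ) * (x a - x b) + m * p.hbar) ∈ p.rts :=
  ⟨a, b, c, -c, m, fun hh => absurd hh h, fun x => by push_cast; ring⟩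

theorem two_mem_rts (a : Fin n) (c : ℤˣ) (m : ℤ) :
    (fun x : V n => (c : ℤ) * (2 * x a) + m * p.hbar) ∈ p.rts :=
  ⟨a, a, c, c, m, fun _ => rfl, fun x => by ring⟩

theorem walls_subset : p.walls S ⊆ p.rts := by
  rintro f (⟨a, b, hab, -, rfl | ⟨-, rfl⟩⟩ | ⟨a, -, rfl | rfl⟩)
  · convert sub_mem_rts (p := p) hab.ne 1 0 using 2; push_cast; ring
  · convert sub_mem_rts (p := p) hab.ne (-1) 1 using 2; push_cast; ring
  · convert two_mem_rts (p := p) a 1 0 using 2; push_cast; ring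
  · convert two_mem_rts (p := p) a (-1) 1 using 2; push_cast; ring

theorem hv_sub (h0 : p.hbar ≠ 0) (y : Fin n → ℤ) (a b : Fin n) (c : ℤˣ) (m : ℤ) :
    p.hv n ((c : ℤ) * (p.pt y a - p.pt y b) + m * p.hbar) = ((c * (y a - y b) + m * scale n : ℤ) : ℝ) := by
  rw [show (c : ℤ) * (y a - y b) + m * scale n = c * y a + (-c : ℤˣ) * y b + m * scale n by push_cast; ring,
    ← hv_rts h0 (f := fun x : V n => (c : ℤ) * (x a - x b) + m * p.hbar)]
  intro x; push_cast; ring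

theorem hv_two (h0 : p.hbar ≠ 0) (y : Fin n → ℤ) (a : Fin n) (c : ℤˣ) (m : ℤ) :
    p.hv n ((c : ℤ) * (2 * p.pt y a) + m * p.hbar) = ((c * (2 * y a) + m * scale n : ℤ) : ℝ) := by
  rw [show (c : ℤ) * (2 * y a) + m * scale n = c * y a + c * y a + m * scale n by ring,
    ← hv_rts h0 (f := fun x : V n => (c : ℤ) * (2 * x a) + m * p.hbar)]
  intro x; push_cast; ring

/-- In each block of coordinates w⁻¹X_0 lies in the fundamental alcove: the one of affine type A, or
of type C for the block that reaches the last node. -/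
theorem pos_iff (h0 : p.hbar ≠ 0) {w : V n ≃ᵃ[ℂ] V n} {y : Fin n → ℤ} (hy : w⁻¹ (p.X0 n) = p.pt y) :
    p.Pos S w ↔ (∀ a b, a < b → Lk S a b → y b < y a ∧ (¬ Tail S a → y a - y b < scale n)) ∧
      ∀ a, Tail S a → 0 < y a ∧ 2 * y a < scale n := by
  have e1 : ∀ a b, p.hv n (p.pt y a - p.pt y b) = ((y a - y b : ℤ) : ℝ) := fun a b => by
    simpa using hv_sub h0 y a b 1 0
  have e2 : ∀ a b, p.hv n (p.hbar - p.pt y a + p.pt y b) = ((scale n - (y a - y b) : ℤ) : ℝ) := fun a b => by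
    have := hv_sub h0 y a b (-1) 1
    rw [show p.hbar - p.pt y a + p.pt y b = ((-1 : ℤˣ) : ℤ) * (p.pt y a - p.pt y b) + (1 : ℤ) * p.hbar by
      push_cast; ring, this]
    push_cast; ring
  have e3 : ∀ a, p.hv n (2 * p.pt y a) = ((2 * y a : ℤ) : ℝ) := fun a => by
    simpa using hv_two h0 y a 1 0
  have e4 : ∀ a, p.hv n (p.hbar - 2 * p.pt y a) = ((scale n - 2 * y a : ℤ) : ℝ) := fun a => by
    have := hv_two h0 y a (-1) 1
    rw [show p.hbar - 2 * p.pt y a = ((-1 : ℤˣ) : ℤ) * (2 * p.pt y a) + (1 : ℤ) * p.hbar by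
      push_cast; ring, this]
    push_cast; ring
  constructor
  · intro h
    refine ⟨fun a b hab hL => ⟨?_, fun hT => ?_⟩, fun a hT => ⟨?_, ?_⟩⟩
    · have := h _ (.inl ⟨a, b, hab, hL, .inl rfl⟩)
      rw [hy] at this
      simp only [e1, Int.cast_pos] at this; omega
    · have := h _ (.inl ⟨a, b, hab, hL, .inr ⟨hT, rfl⟩⟩)
      rw [hy] at this
      simp only [e2, Int.cast_pos] at this; omega
    · have := h _ (.inr ⟨a, hT, .inl rfl⟩)
      rw [hy] at this
      simp only [e3, Int.cast_pos] at this; omega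
    · have := h _ (.inr ⟨a, hT, .inr rfl⟩)
      rw [hy] at this
      simp only [e4, Int.cast_pos] at this; omega
  · rintro ⟨h1, h2⟩ f (⟨a, b, hab, hL, rfl | ⟨hT, rfl⟩⟩ | ⟨a, hT, rfl | rfl⟩) <;> rw [hy] <;>
      simp only [e1, e2, e3, e4, Int.cast_pos]
    · have := (h1 a b hab hL).1; omega
    · have := (h1 a b hab hL).2 hT; omega
    · have := (h2 a hT).1; omega
    · have := (h2 a hT).2; omega

theorem pos_one (h0 : p.hbar ≠ 0) : p.Pos S (1 : V n ≃ᵃ[ℂ] V n) := by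
  rw [pos_iff h0 (y := fun j => n - j.val) rfl, scale]
  refine ⟨fun a b hab _ => ⟨?_, fun _ => ?_⟩, fun a _ => ⟨?_, ?_⟩⟩
  all_goals have ha := a.2
  · simp only [Fin.lt_def] at hab; omega
  · have := b.2; omega
  · omega
  · omega

theorem exists_pt (h0 : p.hbar ≠ 0) {w : V n ≃ᵃ[ℂ] V n} (hw : w ∈ p.affW n) :
    ∃ y : Fin n → ℤ, w⁻¹ (p.X0 n) = p.pt y := by
  obtain ⟨σ, ε, μ, h⟩ := p.exists_NF (inv_mem hw)
  exact ⟨_, h.pt h0 _⟩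

/-- A root separating adjacent alcoves is not a sum of positive roots. -/
theorem no_split (h0 : p.hbar ≠ 0) {w : V n ≃ᵃ[ℂ] V n} (hw : w ∈ p.affW n) {i : Option (Fin n)}
    {f₁ f₂ : V n → ℂ} (h1 : f₁ ∈ p.rts) (h2 : f₂ ∈ p.rts) (p1 : 0 < p.hv n (f₁ (w⁻¹ (p.X0 n))))
    (p2 : 0 < p.hv n (f₂ (w⁻¹ (p.X0 n)))) {k : ℕ} (hk : k ≠ 0)
    (h : ∀ x, p.al i (w x) = k * f₁ x + f₂ x) : False := by
  have h1' := p.rts_comp h1 (inv_mem hw)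
  have h2' := p.rts_comp h2 (inv_mem hw)
  have hmul : ∀ z z', p.hv n (k * z + z') = k * p.hv n z + p.hv n z' := fun z z' => by
    rw [hv_add]
    congr 1
    rw [hv, hv, show (scale n : ℂ) * (k * z) / p.hbar = ((k : ℝ) : ℂ) * (scale n * z / p.hbar) by
      push_cast; ring, Complex.re_ofReal_mul]
  have h' : ∀ x, p.al i x = k * f₁ (w⁻¹ x) + f₂ (w⁻¹ x) := fun x => by
    rw [← h]; exact congrArg _ (w.apply_symm_apply x).symm
  have hpos := al_X0_pos h0 i
  have hneg : p.hv n (p.al i (p.s i (p.X0 n))) < 0 := by rw [al_s, hv_neg]; linarith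
  have hk' : (1 : ℝ) ≤ k := by exact_mod_cast Nat.one_le_iff_ne_zero.2 hk
  have hX := h' (p.X0 n)
  rw [h', hmul] at hneg
  -- The reflection s_i makes the sum negative, hence one of the two summands. By `eq_al` that
  -- summand is α_i ∘ w itself, which leaves no room for the other positive one.
  rcases lt_or_ge (p.hv n (f₁ (w⁻¹ (p.s i (p.X0 n))))) 0 with h3 | h3
  · have h4 := congrFun (eq_al h0 h1' i p1 h3) (p.X0 n)
    rw [h'] at hpos
    rw [h4, hmul] at hpos
    have h5 := congrArg (p.hv n) hX
    rw [hmul, h4] at h5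
    have h6 : 0 < p.hv n (p.al i (p.X0 n)) := al_X0_pos h0 i
    nlinarith
  · have h3' : p.hv n (f₂ (w⁻¹ (p.s i (p.X0 n)))) < 0 := by nlinarith
    have h4 := congrFun (eq_al h0 h2' i p2 h3') (p.X0 n)
    have h5 := congrArg (p.hv n) hX
    rw [hmul, h4] at h5
    nlinarith

/-- The difference of values at e_a and 0 is the coefficient of x_a, which is 0 or ±1 for short and
0 or ±2 for long roots. So the form of α_i ∘ w reveals the length of α_i. -/
theorem al_comp_short {i : Option (Fin n)} (hi : IsShort i) {w : V n ≃ᵃ[ℂ] V n} (hw : w ∈ p.affW n)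
    (a : Fin n) : p.al i (w (e a)) - p.al i (w 0) ≠ 2 ∧ p.al i (w (e a)) - p.al i (w 0) ≠ -2 := by
  obtain ⟨σ, ε, μ, h⟩ := p.exists_NF hw
  obtain ⟨j, rfl, hj⟩ := hi
  have hne : σ j ≠ σ ⟨j.val + 1, hj⟩ := fun hh => by
    simpa using congrArg Fin.val (σ.injective hh)
  rw [al_lt _ hj, al_lt _ hj, h, h, h, h]
  rcases Int.units_eq_one_or (ε j) with h1 | h1 <;>
    rcases Int.units_eq_one_or (ε ⟨j.val + 1, hj⟩) with h2 | h2 <;>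
    by_cases h3 : σ j = a <;> by_cases h4 : σ ⟨j.val + 1, hj⟩ = a <;>
    first
      | exact absurd (h3.trans h4.symm) hne
      | (simp [h1, h2, h3, h4, e]; done)
      | (simp [h1, h2, h3, h4, e]; norm_num)

theorem al_comp_long {i : Option (Fin n)} (hi : ¬ IsShort i) {w : V n ≃ᵃ[ℂ] V n} (hw : w ∈ p.affW n)
    (a : Fin n) : p.al i (w (e a)) - p.al i (w 0) ≠ 1 ∧ p.al i (w (e a)) - p.al i (w 0) ≠ -1 := by
  obtain ⟨σ, ε, μ, h⟩ := p.exists_NF hw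
  rcases i with _ | i
  · rw [al_none, al_none, h, h]
    rcases Int.units_eq_one_or (ε 0) with h1 | h1 <;> by_cases h3 : σ 0 = a <;>
      simp [h1, h3, e] <;> ring_nf <;> norm_num
  · have hl : ¬ i.val + 1 < n := fun h => hi ⟨i, rfl, h⟩
    rw [al_last _ hl, al_last _ hl, h, h]
    rcases Int.units_eq_one_or (ε i) with h1 | h1 <;> by_cases h3 : σ i = a <;>
      simp [h1, h3, e] <;> ring_nf <;> norm_num

/-- The value at the origin distinguishes the orbits of the two long affine simple roots. -/
theorem al_comp_none (h0 : p.hbar ≠ 0) {w : V n ≃ᵃ[ℂ] V n} (hw : w ∈ p.affW n) :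
    p.al none (w (0 : V n)) ≠ 0 := by
  obtain ⟨σ, ε, μ, h⟩ := p.exists_NF hw
  rw [al_none, h]
  intro hh
  have : p.hbar * ((1 - 2 * μ 0 : ℤ) : ℂ) = 0 := by
    push_cast; simp only [PiLp.zero_apply, mul_zero, zero_add] at hh; linear_combination hh
  rcases mul_eq_zero.1 this with h1 | h1
  · exact h0 h1
  · have := Int.cast_eq_zero.1 h1; omega

theorem al_comp_last (h0 : p.hbar ≠ 0) {w : V n ≃ᵃ[ℂ] V n} (hw : w ∈ p.affW n) {i : Fin n}
    (hi : ¬ i.val + 1 < n) : p.al (some i) (w (0 : V n)) ≠ p.hbar := by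
  obtain ⟨σ, ε, μ, h⟩ := p.exists_NF hw
  rw [al_last _ hi, h]
  intro hh
  have : p.hbar * ((1 - 2 * μ i : ℤ) : ℂ) = 0 := by
    push_cast; simp only [PiLp.zero_apply, mul_zero, zero_add] at hh; linear_combination -hh
  rcases mul_eq_zero.1 this with h1 | h1
  · exact h0 h1
  · have := Int.cast_eq_zero.1 h1; omega

theorem numC_short {i : Option (Fin n)} (hi : IsShort i) (h : (p.t₁ : ℂ) ^ 2 = Complex.exp η₁) :
    p.numC i η₁ = 0 := by
  obtain ⟨j, rfl, hj⟩ := hi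
  have hl : j ≠ lastNode n := fun h => (lastNode_iff j).1 h hj
  have ht : p.t (some j) = p.t₁ := if_neg hl
  have hu : p.u (some j) = 1 := if_neg hl
  have he : Complex.exp (-(1 / 2 * η₁)) ^ 2 * Complex.exp η₁ = 1 := by
    rw [sq, ← Complex.exp_add, ← Complex.exp_add, Complex.exp_eq_one_iff]; exact ⟨0, by push_cast; ring⟩
  rw [numC, ht, hu]
  simp only [inv_one, Units.val_one, mul_one]
  have : (1 - (p.t₁ : ℂ) * Complex.exp (-(1 / 2 * η₁))) * (1 + p.t₁ * Complex.exp (-(1 / 2 * η₁))) = 0 := by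
    linear_combination -he - Complex.exp (-(1 / 2 * η₁)) ^ 2 * h
  rw [this, mul_zero]

theorem numC_eq_zero {i : Option (Fin n)} {z : ℂ} (ε : ℤˣ)
    (h : ((ε : ℤ) : ℂ) * p.t i * (p.u i ^ (ε : ℤ) : ℂˣ) * Complex.exp (-(1 / 2 * z)) = 1) :
    p.numC i z = 0 := by
  rcases Int.units_eq_one_or ε with rfl | rfl
  · simp only [Units.val_one, Int.cast_one, one_mul, zpow_one] at h
    rw [numC, h]; simp
  · simp only [Units.val_neg, Units.val_one, Int.cast_neg, Int.cast_one, zpow_neg, zpow_one] at h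
    have : 1 + (p.t i : ℂ) * (p.u i : ℂ)⁻¹ * Complex.exp (-(1 / 2 * z)) = 0 := by
      rw [Units.val_inv_eq_inv_val] at h; linear_combination -h
    rw [numC, this]; simp

theorem exp_mul_neg_half (z : ℂ) : Complex.exp (z / 2) * Complex.exp (-(1 / 2 * z)) = 1 := by
  rw [← Complex.exp_add, Complex.exp_eq_one_iff]; exact ⟨0, by push_cast; ring⟩

/-- The assumptions on the parameters. -/
structure Good (p : Params) (S : Finset (Fin n)) (η₁ ηn : ℂ) : Prop where
  hbar_ne : p.hbar ≠ 0
  cox : ∀ i ∈ S, lastNode n ∉ component S i → IsCoxeterNumber η₁ ηn (component S i) p.hbar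
  short : 1 < n → (p.t₁ : ℂ) ^ 2 = Complex.exp η₁
  long : ∃ εn : ℤˣ,
      ((εn : ℤ) : ℂ) * p.tn * (p.un ^ (εn : ℤ) : ℂˣ) = Complex.exp (ηn / 2) ∧
      (lastNode n ∈ S → ∃ ε₀ : ℤˣ,
        ((ε₀ : ℤ) : ℂ) * ((εn : ℤ) : ℂ) * p.tn * p.t₀ * (p.un ^ (εn : ℤ) : ℂˣ) *
          (p.u₀ ^ (ε₀ : ℤ) : ℂˣ) * (p.t₁ : ℂ) ^ (2 * ((component S (lastNode n)).ncard - 1)) *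
          p.q⁻¹ = 1)

/-- The size of a block in a component of type `A` is determined by `ħ`. -/
theorem Good.block (h : Good p S η₁ ηn) {a b : Fin n} (hab : a < b) (hL : Lk S a b)
    (hl : ∀ l : Fin n, l.val + 1 = a.val → l ∉ S) (hb : b ∉ S) :
    ((b.val : ℂ) - a.val + 1) * η₁ = p.hbar := by
  have hab' : a.val < b.val := hab
  have hc : component S a = {l : Fin n | a.val ≤ l.val ∧ l.val ≤ b.val - 1} := by
    refine component_eq le_rfl (by omega) (fun l h1 h2 => hL l h1 (Fin.lt_def.2 (by omega))) hl
      fun l h1 => ?_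
    rwa [show l = b from Fin.ext (by omega)]
  refine coxeter (ηn := ηn) hab ?_
  rw [← hc]
  refine h.cox a (hL a le_rfl hab) ?_
  rw [hc]
  have := b.2
  simp only [Set.mem_ofPred_eq, lastNode]
  omega

/-- By `no_split` the root α_i ∘ w is a wall that is not a sum of walls, so it is of one of four
kinds. On D_0 a simple short root has value η_1, the affine root of a type A block has value η_1 by
the Coxeter condition, 2x_n has value η_n, and ħ − 2x_a at the start of the tail has value ħ − η_n −
2(k̃ − 1)η_1. In each case one assumption on the parameters annihilates the numerator. -/
theorem Good.stab_wall (h : Good p S η₁ ηn) {w : V n ≃ᵃ[ℂ] V n} (hw : w ∈ p.affW n) (hP : p.Pos S w)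
    {i : Option (Fin n)} (hf : (fun x => p.al i (w x)) ∈ p.walls S) :
    ∀ x ∈ D0 S η₁ ηn, p.numC i (p.al i (w x)) = 0 := by
  have h0 := h.hbar_ne
  have split : ∀ {f₁ f₂ : V n → ℂ} (k : ℕ), k ≠ 0 → f₁ ∈ p.walls S → f₂ ∈ p.walls S →
      (∀ x, p.al i (w x) = k * f₁ x + f₂ x) → False := fun k hk h1 h2 h =>
    no_split h0 hw (walls_subset h1) (walls_subset h2) (hP _ h1) (hP _ h2) hk h
  rcases hf with ⟨a, b, hab, hL, hf | ⟨hT, hf⟩⟩ | ⟨a, hT, hf | hf⟩ <;>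
    replace hf := fun x => congrFun hf x <;> simp only at hf
  · have hab' : a.val < b.val := hab
    have hi : IsShort i := by
      by_contra hi
      apply (al_comp_long hi hw a).1
      rw [hf, hf]; simp [e, hab.ne']
    have hb : b.val = a.val + 1 := by
      by_contra hne
      have hlt : a.val + 1 < n := by have := b.2; omega
      have h1 : a < ⟨a.val + 1, hlt⟩ := by simp [Fin.lt_def]
      have h2 : (⟨a.val + 1, hlt⟩ : Fin n) < b := by simp only [Fin.lt_def]; omega
      refine split 1 one_ne_zero
        (.inl ⟨a, ⟨a.val + 1, hlt⟩, h1, fun l h3 h4 => hL l h3 (h4.trans h2), .inl rfl⟩)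
        (.inl ⟨⟨a.val + 1, hlt⟩, b, h2, fun l h3 h4 => hL l (h1.le.trans h3) h4, .inl rfl⟩) fun x => ?_
      rw [hf]; push_cast; ring
    intro x hx
    rw [hf, D0_sub hx hab.le hL, hb]
    push_cast
    rw [add_sub_cancel_left, one_mul]
    exact numC_short hi (h.short (by have := b.2; omega))
  · have hab' : a.val < b.val := hab
    have hi : IsShort i := by
      by_contra hi
      apply (al_comp_long hi hw a).2
      rw [hf, hf]; simp [e, hab.ne']
    -- If the block extended beyond a or b, the root ħ − x_a + x_b would be a sum of two walls. So a
    -- and b are its ends and `Good.block` applies.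
    have hl : ∀ l : Fin n, l.val + 1 = a.val → l ∉ S := by
      intro l hla hlS
      have hla' : l < a := by simp only [Fin.lt_def]; omega
      have hLl : Lk S l b := fun j h1 h2 => by
        by_cases hj : j = l
        · rwa [hj]
        · have : j.val ≠ l.val := fun hh => hj (Fin.ext hh)
          exact hL j (by simp only [Fin.le_def] at h1 ⊢; omega) h2
      refine split 1 one_ne_zero
        (.inl ⟨l, a, hla', fun j h1 h2 => hLl j h1 (h2.trans hab), .inl rfl⟩)
        (.inl ⟨l, b, hla'.trans hab, hLl, .inr ⟨fun hh => hT (hh.mono hla'.le), rfl⟩⟩) fun x => ?_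
      rw [hf]; push_cast; ring
    have hb : b ∉ S := by
      intro hbS
      by_cases hlt : b.val + 1 < n
      · have h1 : b < ⟨b.val + 1, hlt⟩ := by simp [Fin.lt_def]
        have hLb : Lk S a ⟨b.val + 1, hlt⟩ := fun j h1 h2 => by
          by_cases hj : j = b
          · rwa [hj]
          · have : j.val ≠ b.val := fun hh => hj (Fin.ext hh)
            exact hL j h1 (by simp only [Fin.lt_def] at h2 ⊢; omega)
        refine split 1 one_ne_zero
          (.inl ⟨b, ⟨b.val + 1, hlt⟩, h1, fun j h1 h2 => hLb j (hab.le.trans h1) h2, .inl rfl⟩)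
          (.inl ⟨a, ⟨b.val + 1, hlt⟩, hab.trans h1, hLb, .inr ⟨hT, rfl⟩⟩) fun x => ?_
        rw [hf]; push_cast; ring
      · refine hT (Tail.of_lk (b := b) (fun l hl => ?_) hL)
        have := l.2
        rwa [show l = b from Fin.ext (by simp only [Fin.le_def] at hl; omega)]
    intro x hx
    have hk := h.block hab hL hl hb
    rw [hf, show p.hbar - x a + x b = η₁ by linear_combination -hk - D0_sub hx hab.le hL]
    exact numC_short hi (h.short (by have := b.2; omega))
  · have hi : ¬ IsShort i := by
      intro hi
      apply (al_comp_short hi hw a).1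
      rw [hf, hf]; simp [e]
    have hal : ¬ a.val + 1 < n := by
      intro hlt
      refine split 2 two_ne_zero
        (.inl ⟨a, ⟨a.val + 1, hlt⟩, by simp [Fin.lt_def], hT.lk, .inl rfl⟩)
        (.inr ⟨⟨a.val + 1, hlt⟩, hT.mono (by simp [Fin.le_def]), .inl rfl⟩) fun x => ?_
      rw [hf]; push_cast; ring
    obtain ⟨εn, h1, -⟩ := h.long
    intro x hx
    have hi' : i = some (lastNode n) := by
      rcases i with _ | i
      · exact absurd (by rw [hf]; simp) (al_comp_none h0 hw)
      · rw [(lastNode_iff i).2 fun h => hi ⟨i, rfl, h⟩]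
    have ha : (a.val : ℂ) = n - 1 := by
      rw [eq_sub_iff_add_eq]
      have := a.2
      exact_mod_cast (by omega : a.val + 1 = n)
    rw [hf, D0_tail hx hT, ha, sub_self, mul_zero, zero_mul, add_zero]
    refine numC_eq_zero εn ?_
    rw [hi', show p.t (some (lastNode n)) = p.tn from if_pos rfl,
      show p.u (some (lastNode n)) = p.un from if_pos rfl, h1, exp_mul_neg_half]
  · have hi : ¬ IsShort i := by
      intro hi
      apply (al_comp_short hi hw a).2
      rw [hf, hf]; simp [e]
    have hl : ∀ l : Fin n, l.val + 1 = a.val → l ∉ S := by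
      intro l hla hlS
      have hTl : Tail S l := fun j h1 => by
        by_cases hj : j = l
        · rwa [hj]
        · have : j.val ≠ l.val := fun hh => hj (Fin.ext hh)
          exact hT j (by simp only [Fin.le_def] at h1 ⊢; omega)
      refine split 2 two_ne_zero
        (.inl ⟨l, a, by simp only [Fin.lt_def]; omega, hTl.lk, .inl rfl⟩)
        (.inr ⟨l, hTl, .inr rfl⟩) fun x => ?_
      rw [hf]; push_cast; ring
    have hi' : i = none := by
      rcases i with _ | i
      · rfl
      · exact absurd (by rw [hf]; simp) (al_comp_last h0 hw (i := i) fun h => hi ⟨i, rfl, h⟩)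
    have ha := a.2
    have hc : component S (lastNode n) = {l : Fin n | a.val ≤ l.val ∧ l.val ≤ n - 1} :=
      component_eq (by simp only [lastNode]; omega) le_rfl (fun l h1 _ => hT l h1) hl
        fun l h1 => by have := l.2; omega
    have hcard : (component S (lastNode n)).ncard - 1 = n - 1 - a.val := by
      have : component S (lastNode n) = (Finset.Ici a : Finset (Fin n)) := by
        rw [hc]; ext l
        have := l.2
        simp only [Set.mem_ofPred_eq, Finset.coe_Ici, Set.mem_Ici, Fin.le_def]; omega
      rw [this, Set.ncard_coe_finset, Fin.card_Ici]; omega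
    obtain ⟨εn, h1, h2⟩ := h.long
    obtain ⟨ε₀, h2⟩ := h2 (hT _ (by simp only [Fin.le_def, lastNode]; omega))
    rw [hcard] at h2
    intro x hx
    rw [hf, show p.hbar - 2 * x a = p.hbar - ηn - 2 * ((n : ℂ) - 1 - a.val) * η₁ by
      rw [D0_tail hx hT]; ring]
    refine numC_eq_zero ε₀ ?_
    have h3 : Complex.exp (((n : ℂ) - 1 - a.val) * η₁) = (p.t₁ : ℂ) ^ (2 * (n - 1 - a.val)) := by
      have : ((n : ℂ) - 1 - a.val) = ((n - 1 - a.val : ℕ) : ℂ) := by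
        rw [Nat.cast_sub (by omega), Nat.cast_sub (by omega)]; simp
      rw [this, Complex.exp_nat_mul]
      -- The assumption on t_1 is available only for n > 1; for exponent 0 it is not needed.
      rcases Nat.eq_zero_or_pos (n - 1 - a.val) with h4 | h4
      · rw [h4]; simp
      · rw [pow_mul, h.short (by omega)]
    have h4 : Complex.exp (-(1 / 2 * (p.hbar - ηn - 2 * ((n : ℂ) - 1 - a.val) * η₁))) =
        p.q⁻¹ * Complex.exp (ηn / 2) * (p.t₁ : ℂ) ^ (2 * (n - 1 - a.val)) := by
      rw [← h3, q, ← Complex.exp_neg, ← Complex.exp_add, ← Complex.exp_add]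
      congr 1; ring
    rw [h4, ← h1, hi', show p.t none = p.t₀ from rfl, show p.u none = p.u₀ from rfl]
    linear_combination h2

end Params
end Koornwinder
end

/-! ### Stability of `Pos` and its action on D_0 by translations. -/

noncomputable section
set_option linter.unusedSectionVars false
namespace Koornwinder
namespace Params

variable {n : ℕ} [NeZero n] {p : Params} {S : Finset (Fin n)} {η₁ ηn : ℂ}

/-- The indicator vector of a block of type `A` is a direction of `D_0`. -/
theorem exists_indicator {a : Fin n} (ha : ¬ Tail S a) : ∃ v ∈ (D0 S η₁ ηn).direction, v a = 1 ∧
    ∀ b, v b = 0 ∨ v b = 1 ∧ ¬ Tail S b ∧ ((a ≤ b ∧ Lk S a b) ∨ (b ≤ a ∧ Lk S b a)) := by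
  obtain ⟨c, hca, hc, hcm⟩ := exists_left S a
  obtain ⟨d, had, hd, hdm⟩ := exists_right S a
  have hcd : Lk S c d := fun l h1 h2 => by
    rcases lt_or_ge l a with h | h
    · exact hc l h1 h
    · exact hd l h h2
  have hdS : d ∉ S := by
    intro h
    by_cases h1 : d.val + 1 < n
    · exact hdm h1 h
    · refine ha (Tail.of_lk (b := d) (fun l hl => ?_) hd)
      have := l.2
      rwa [show l = d from Fin.ext (by simp only [Fin.le_def] at hl; omega)]
  have hv : ∀ j, (WithLp.toLp 2 fun j : Fin n => if c ≤ j ∧ j ≤ d then (1 : ℂ) else 0 : V n) j =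
    if c ≤ j ∧ j ≤ d then (1 : ℂ) else 0 := fun j => rfl
  refine ⟨_, mem_direction_iff.2 fun i hi => ?_, (hv a).trans (if_pos ⟨hca, had⟩), fun b => ?_⟩
  · have hid : i ≠ d := fun h => hdS (h ▸ hi)
    have hid' : i.val ≠ d.val := fun h => hid (Fin.ext h)
    have hic : i.val + 1 ≠ c.val := fun h => hcm i h hi
    by_cases h1 : i.val + 1 < n
    · rw [form_simpleRoot_lt h1, hv, hv]
      simp only [Fin.le_def]
      split_ifs <;> first | omega | simp
    · have := d.2
      rw [form_simpleRoot_last h1, hv, if_neg, mul_zero]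
      simp only [Fin.le_def]; omega
  · by_cases hb : c ≤ b ∧ b ≤ d
    · refine .inr ⟨(hv b).trans (if_pos hb), fun hT => hdS (hT d hb.2), ?_⟩
      rcases le_total a b with h | h
      · exact .inl ⟨h, fun l h1 h2 => hd l h1 (h2.trans_le hb.2)⟩
      · exact .inr ⟨h, fun l h1 h2 => hc l (hb.1.trans h1) h2⟩
    · exact .inl ((hv b).trans (if_neg hb))

theorem linear_eq_zero_of_exp {A : AffineSubspace ℂ (V n)} [Nonempty A] {f : V n → ℂ} {a b : Fin n}
    {ε δ c : ℂ} (hf : ∀ x, f x = ε * x a + δ * x b + c) (h : ∀ x ∈ A, Complex.exp (-f x) = 1)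
    {v : V n} (hv : v ∈ A.direction) : ε * v a + δ * v b = 0 := by
  obtain ⟨x₀, hx₀⟩ : Nonempty A := inferInstance
  by_contra hc
  set k := ε * v a + δ * v b with hk
  have h2 := h (k⁻¹ • v + x₀) (by
    have := AffineSubspace.vadd_mem_of_mem_direction (A.direction.smul_mem k⁻¹ hv) hx₀
    rwa [vadd_eq_add] at this)
  have h3 : f (k⁻¹ • v + x₀) = f x₀ + 1 := by
    rw [hf, hf, ← inv_mul_cancel₀ hc, hk]
    simp only [PiLp.add_apply, PiLp.smul_apply, smul_eq_mul]
    ring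
  rw [h3, neg_add, Complex.exp_add, h x₀ hx₀, one_mul] at h2
  have := congrArg (fun z : ℂ => ‖z‖) h2
  simp [Complex.norm_exp] at this

/-- If e^{−α_i ∘ w} = 1 on D_0, then the linear part of α_i ∘ w vanishes on the directions of D_0,
so the root involves coordinates of a single type A block or of the tail only. Such a root has the
same sign at any two points of the alcove described in `pos_iff`, yet it separates w⁻¹X_0 from
w⁻¹s_iX_0. -/
theorem Good.stab_pos (h0 : p.hbar ≠ 0) {w : V n ≃ᵃ[ℂ] V n} (hw : w ∈ p.affW n) (hP : p.Pos S w)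
    {i : Option (Fin n)} (hP' : p.Pos S (p.s i * w)) :
    ∃ x ∈ D0 S η₁ ηn, Complex.exp (- p.al i (w x)) ≠ 1 := by
  by_contra! hc
  obtain ⟨y, hy⟩ := exists_pt h0 hw
  obtain ⟨y', hy'⟩ := exists_pt h0 (mul_mem (p.s_mem i) hw)
  obtain ⟨h1, h2⟩ := (pos_iff h0 hy).1 hP
  obtain ⟨h1', h2'⟩ := (pos_iff h0 hy').1 hP'
  obtain ⟨a, b, ε, δ, m, hab, hf⟩ := p.rts_comp (p.al_mem i) hw
  simp only at hf
  have hpos := al_X0_pos h0 i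
  have e1 : 0 < ε * y a + δ * y b + m * scale n := by
    have := hv_rts h0 hf y
    rw [← hy, show w (w⁻¹ (p.X0 n)) = p.X0 n from w.apply_symm_apply _] at this
    rw [this] at hpos
    exact_mod_cast hpos
  have e2 : ε * y' a + δ * y' b + m * scale n < 0 := by
    have := hv_rts h0 hf y'
    rw [← hy', mul_inv_rev, s_inv, show w ((w⁻¹ * p.s i) (p.X0 n)) = p.s i (p.X0 n) from
      w.apply_symm_apply _, al_s, hv_neg] at this
    have h3 : ((ε * y' a + δ * y' b + m * scale n : ℤ) : ℝ) < 0 := by rw [← this]; linarith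
    exact_mod_cast h3
  have hm := mul_scale_cases (n := n) m
  have hs : 0 < scale n := by rw [scale]; omega
  have lin : ∀ v ∈ (D0 S η₁ ηn).direction, ((ε : ℤ) : ℂ) * v a + ((δ : ℤ) : ℂ) * v b = 0 := fun v hv =>
    linear_eq_zero_of_exp (c := m * p.hbar) hf hc hv
  have hε := Int.units_eq_one_or ε
  have hδ := Int.units_eq_one_or δ
  have hdiff : ∀ {a b : Fin n}, ¬ Tail S a → a ≠ b → ((a ≤ b ∧ Lk S a b) ∨ (b ≤ a ∧ Lk S b a)) → ¬ Tail S b →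
      (0 < y a - y b ∧ y a - y b < scale n ∧ 0 < y' a - y' b ∧ y' a - y' b < scale n) ∨
      (0 < y b - y a ∧ y b - y a < scale n ∧ 0 < y' b - y' a ∧ y' b - y' a < scale n) := by
    intro a b ha hne hL hb
    rcases hL with ⟨h3, hL⟩ | ⟨h3, hL⟩
    · have h4 := h1 a b (lt_of_le_of_ne h3 hne) hL
      have h5 := h1' a b (lt_of_le_of_ne h3 hne) hL
      have := h4.2 ha
      have := h5.2 ha
      omega
    · have h4 := h1 b a (lt_of_le_of_ne h3 hne.symm) hL
      have h5 := h1' b a (lt_of_le_of_ne h3 hne.symm) hL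
      have := h4.2 hb
      have := h5.2 hb
      omega
  -- Testing the linear part on the indicator vector of a type A block forces a and b into that
  -- block with opposite signs.
  have main : ¬ Tail S a ∨ ¬ Tail S b →
      δ = -ε ∧ ((0 < y a - y b ∧ y a - y b < scale n ∧ 0 < y' a - y' b ∧ y' a - y' b < scale n) ∨
      (0 < y b - y a ∧ y b - y a < scale n ∧ 0 < y' b - y' a ∧ y' b - y' a < scale n)) := by
    rintro (ha | hb)
    · obtain ⟨v, hv, hva, hvb⟩ := exists_indicator (η₁ := η₁) (ηn := ηn) ha
      have h3 := lin v hv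
      rw [hva] at h3
      rcases hvb b with h4 | ⟨h4, h5, h6⟩ <;> rw [h4] at h3
      · rcases hε with rfl | rfl <;> simp at h3
      · have hd : δ = -ε := by
          rcases hε with rfl | rfl <;> rcases hδ with rfl | rfl <;>
            first | (exfalso; norm_num at h3; done) | simp
        refine ⟨hd, hdiff ha ?_ h6 h5⟩
        rintro rfl
        rw [hab rfl] at hd
        rcases hδ with rfl | rfl <;> simp [Units.ext_iff] at hd
    · obtain ⟨v, hv, hva, hvb⟩ := exists_indicator (η₁ := η₁) (ηn := ηn) hb
      have h3 := lin v hv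
      rw [hva] at h3
      rcases hvb a with h4 | ⟨h4, h5, h6⟩ <;> rw [h4] at h3
      · rcases hδ with rfl | rfl <;> simp at h3
      · have hd : δ = -ε := by
          rcases hε with rfl | rfl <;> rcases hδ with rfl | rfl <;>
            first | (exfalso; norm_num at h3; done) | simp
        have hne : b ≠ a := by
          rintro rfl
          rw [hab rfl] at hd
          rcases hδ with rfl | rfl <;> simp [Units.ext_iff] at hd
        exact ⟨hd, (hdiff hb hne h6 h5).symm⟩
  by_cases ht : ¬ Tail S a ∨ ¬ Tail S b
  · obtain ⟨rfl, h⟩ := main ht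
    rcases hε with rfl | rfl <;> simp at e1 e2 <;> omega
  · push Not at ht
    have a1 := h2 a ht.1
    have a2 := h2 b ht.2
    have a3 := h2' a ht.1
    have a4 := h2' b ht.2
    have a5 : (a = b ∧ y a = y b ∧ y' a = y' b) ∨ (y b < y a ∧ y' b < y' a) ∨ (y a < y b ∧ y' a < y' b) := by
      rcases lt_trichotomy a b with h | h | h
      · exact .inr (.inl ⟨(h1 a b h ht.1.lk).1, (h1' a b h ht.1.lk).1⟩)
      · exact .inl ⟨h, by rw [h], by rw [h]⟩
      · exact .inr (.inr ⟨(h1 b a h ht.2.lk).1, (h1' b a h ht.2.lk).1⟩)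
    rcases hε with rfl | rfl <;> rcases hδ with rfl | rfl <;> simp at e1 e2 hab <;> omega

/-- If s_iw leaves `Pos`, some wall f is positive at w⁻¹X_0 and negative at w⁻¹s_iX_0. Then f ∘ w⁻¹
= α_i by `eq_al`, so α_i ∘ w is a wall. -/
theorem Good.stab (h : Good p S η₁ ηn) : p.Stab (D0 S η₁ ηn) (p.Pos S) := by
  intro w hw hP i
  by_cases hP' : p.Pos S (p.s i * w)
  · exact .inl ⟨hP', Good.stab_pos h.hbar_ne hw hP hP'⟩
  · refine .inr (h.stab_wall hw hP ?_)
    simp only [Pos, not_forall] at hP'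
    obtain ⟨f, hf, hneg⟩ := hP'
    have hr := p.rts_comp (walls_subset hf) (inv_mem hw)
    have hne := hv_X0_ne h.hbar_ne (p.rts_comp hr (p.s_mem i))
    rw [mul_inv_rev, s_inv] at hneg
    have h3 := eq_al h.hbar_ne hr i (hP f hf) (lt_of_le_of_ne (not_lt.1 hneg) hne)
    convert hf
    rw [← h3]
    exact congrArg f (w.symm_apply_apply _)

theorem left_unique {a a' j j' : Fin n} (haj : a ≤ j) (haj' : a' ≤ j') (hjj : j ≤ j') (hL : Lk S a j)
    (hL' : Lk S a' j') (hm : ∀ l : Fin n, l.val + 1 = a.val → l ∉ S)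
    (hm' : ∀ l : Fin n, l.val + 1 = a'.val → l ∉ S) (hJ : Lk S j j') : a = a' := by
  simp only [Fin.le_def] at haj haj' hjj
  have := a.2
  have := a'.2
  rcases lt_trichotomy a.val a'.val with h | h | h
  · exfalso
    refine hm' ⟨a'.val - 1, by omega⟩ (by simp only; omega) ?_
    rcases lt_or_ge (a'.val - 1) j.val with h1 | h1
    · exact hL _ (by simp only [Fin.le_def]; omega) (by simp only [Fin.lt_def]; omega)
    · exact hJ _ (by simp only [Fin.le_def]; omega) (by simp only [Fin.lt_def]; omega)
  · exact Fin.ext h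
  · exfalso
    refine hm ⟨a.val - 1, by omega⟩ (by simp only; omega) ?_
    exact hL' _ (by simp only [Fin.le_def]; omega) (by simp only [Fin.lt_def]; omega)

theorem right_unique {b b' j j' : Fin n} (hbj : j ≤ b) (hbj' : j' ≤ b') (hjj : j ≤ j') (hL : Lk S j b)
    (hL' : Lk S j' b') (hm : b.val + 1 < n → b ∉ S)
    (hm' : b'.val + 1 < n → b' ∉ S) (hJ : Lk S j j') : b = b' := by
  simp only [Fin.le_def] at hbj hbj' hjj
  have := b.2
  have := b'.2
  rcases lt_trichotomy b.val b'.val with h | h | h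
  · exfalso
    refine hm (by omega) ?_
    rcases lt_or_ge b.val j'.val with h1 | h1
    · exact hJ _ (by simp only [Fin.le_def]; omega) (by simp only [Fin.lt_def]; omega)
    · exact hL' _ (by simp only [Fin.le_def]; omega) (by simp only [Fin.lt_def]; omega)
  · exact Fin.ext h
  · exfalso
    refine hm' (by omega) ?_
    exact hL _ (by simp only [Fin.le_def]; omega) (by simp only [Fin.lt_def]; omega)

/-- On each block of `S` the coordinates can be permuted so that adding `μ` becomes a translation
along `D_0`. -/
theorem Good.exists_rotation (h : Good p S η₁ ηn) (μ : Fin n → ℤ)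
    (h1 : ∀ a b, a < b → Lk S a b → μ a - μ b = 0 ∨ μ a - μ b = 1) (h2 : ∀ a, Tail S a → μ a = 0) :
    ∃ r : Equiv.Perm (Fin n), ∃ v ∈ (D0 S η₁ ηn).direction,
      ∀ x ∈ D0 S η₁ ηn, ∀ j, x (r j) + p.hbar * μ j = v j + x j := by
  choose lf l1 l2 l3 using exists_left S
  choose rt r1 r2 r3 using exists_right S
  have hin : ∀ j i, lf j ≤ i → i ≤ rt j → lf i = lf j ∧ rt i = rt j := by
    intro j i h3 h4
    rcases le_total i j with h5 | h5
    · have hL : Lk S i j := fun l h6 h7 => l2 j l (h3.trans h6) h7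
      exact ⟨left_unique (l1 i) (l1 j) h5 (l2 i) (l2 j) (l3 i) (l3 j) hL,
        right_unique (r1 i) (r1 j) h5 (r2 i) (r2 j) (r3 i) (r3 j) hL⟩
    · have hL : Lk S j i := fun l h6 h7 => r2 j l h6 (h7.trans_le h4)
      exact ⟨(left_unique (l1 j) (l1 i) h5 (l2 j) (l2 i) (l3 j) (l3 i) hL).symm,
        (right_unique (r1 j) (r1 i) h5 (r2 j) (r2 i) (r3 j) (r3 i) hL).symm⟩
  have hLk : ∀ j a b, lf j ≤ a → b ≤ rt j → Lk S a b := by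
    intro j a b h3 h4 l h5 h6
    rcases lt_or_ge l j with h7 | h7
    · exact l2 j l (h3.trans h5) h7
    · exact r2 j l h7 (h6.trans_le h4)
  -- In a block of size N, μ equals c + 1 on the first m entries and c on the rest. Thus s_j is N −
  -- m or −m, and j ↦ j + s_j is the cyclic rotation of the block.
  set s : Fin n → ℤ := fun j => ∑ i ∈ Finset.Icc (lf j) (rt j), (μ j - μ i) with hs
  have hub : ∀ j, s j ≤ (rt j).val - j.val := by
    intro j
    calc s j ≤ ∑ i ∈ Finset.Icc (lf j) (rt j), (if j < i then (1 : ℤ) else 0) := by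
          refine Finset.sum_le_sum fun i hi => ?_
          rw [Finset.mem_Icc] at hi
          rcases lt_trichotomy j i with h3 | h3 | h3
          · rw [if_pos h3]
            have := h1 j i h3 (hLk j j i (l1 j) hi.2); omega
          · subst h3; simp
          · rw [if_neg h3.not_gt]
            have := h1 i j h3 (hLk j i j hi.1 (r1 j)); omega
      _ = (rt j).val - j.val := by
          rw [Finset.sum_boole, show (Finset.Icc (lf j) (rt j)).filter (j < ·) = Finset.Ioc j (rt j) by
            ext i; simp only [Finset.mem_filter, Finset.mem_Icc, Finset.mem_Ioc]
            exact ⟨fun h => ⟨h.2, h.1.2⟩, fun h => ⟨⟨(l1 j).trans h.1.le, h.2⟩, h.1⟩⟩, Fin.card_Ioc]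
          have : j.val ≤ (rt j).val := r1 j
          push_cast [this]; rfl
  have hlb : ∀ j, -((j.val : ℤ) - (lf j).val) ≤ s j := by
    intro j
    calc -((j.val : ℤ) - (lf j).val) = ∑ i ∈ Finset.Icc (lf j) (rt j), (-(if i < j then (1 : ℤ) else 0)) := by
          rw [Finset.sum_neg_distrib, Finset.sum_boole,
            show (Finset.Icc (lf j) (rt j)).filter (· < j) = Finset.Ico (lf j) j by
            ext i; simp only [Finset.mem_filter, Finset.mem_Icc, Finset.mem_Ico]
            exact ⟨fun h => ⟨h.1.1, h.2⟩, fun h => ⟨⟨h.1, h.2.le.trans (r1 j)⟩, h.2⟩⟩, Fin.card_Ico]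
          have : (lf j).val ≤ j.val := l1 j
          push_cast [this]; rfl
      _ ≤ s j := by
          refine Finset.sum_le_sum fun i hi => ?_
          rw [Finset.mem_Icc] at hi
          rcases lt_trichotomy j i with h3 | h3 | h3
          · rw [if_neg h3.not_gt]
            have := h1 j i h3 (hLk j j i (l1 j) hi.2); omega
          · subst h3; simp
          · rw [if_pos h3]
            have := h1 i j h3 (hLk j i j hi.1 (r1 j)); omega
  have hex : ∀ j, ∃ i : Fin n, (i.val : ℤ) = j.val + s j := by
    intro j
    have h3 := hub j
    have h4 := hlb j
    have := (rt j).2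
    exact ⟨⟨(j.val + s j).toNat, by omega⟩, by simp only; omega⟩
  choose r hr using hex
  have hrb : ∀ j, lf j ≤ r j ∧ r j ≤ rt j := by
    intro j
    have h3 := hub j
    have h4 := hlb j
    have h5 := hr j
    simp only [Fin.le_def]
    omega
  -- A jump of μ within a block is matched by a jump of s equal to the block size times that of μ.
  -- This gives injectivity of r and, through the Coxeter condition, constancy of v on the block.
  have hcard : ∀ j j', lf j ≤ j' → j' ≤ rt j →
      s j' - s j = ((rt j).val + 1 - (lf j).val) * (μ j' - μ j) := by
    intro j j' h3 h4
    obtain ⟨h5, h6⟩ := hin j j' h3 h4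
    simp only [hs]
    rw [h5, h6, ← Finset.sum_sub_distrib, Finset.sum_congr rfl (g := fun _ => μ j' - μ j) fun i _ => by ring,
      Finset.sum_const, Fin.card_Icc, nsmul_eq_mul]
    have h7 : (lf j).val ≤ (rt j).val := (l1 j).trans (r1 j)
    push_cast [show (lf j).val ≤ (rt j).val + 1 by omega]
    ring
  have hinj : Function.Injective r := by
    have key : ∀ j j', j < j' → r j ≠ r j' := by
      intro j j' hlt he
      obtain ⟨h3, h4⟩ := hin j (r j) (hrb j).1 (hrb j).2
      obtain ⟨h5, h6⟩ := hin j' (r j') (hrb j').1 (hrb j').2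
      rw [he] at h3 h4
      have hl : lf j = lf j' := h3.symm.trans h5
      have hr' : rt j = rt j' := h4.symm.trans h6
      have h7 : lf j ≤ j' := (l1 j).trans hlt.le
      have h8 : j' ≤ rt j := hr' ▸ r1 j'
      have h9 := hcard j j' h7 h8
      have e1 := hr j
      have e2 := hr j'
      rw [he] at e1
      have hlt' : j.val < j'.val := hlt
      have h10 : (lf j).val ≤ j.val := l1 j
      have h11 : j'.val ≤ (rt j).val := h8
      rcases h1 j j' hlt (hLk j j j' (l1 j) h8) with h12 | h12
      · rw [show μ j' - μ j = 0 by omega, mul_zero] at h9; omega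
      · rw [show μ j' - μ j = -1 by omega] at h9; omega
    intro j j' he
    rcases lt_trichotomy j j' with h3 | h3 | h3
    · exact absurd he (key _ _ h3)
    · exact h3
    · exact absurd he.symm (key _ _ h3)
  have hsub : ∀ x ∈ D0 S η₁ ηn, ∀ j, x (r j) - x j = -(s j : ℂ) * η₁ := by
    intro x hx j
    have e1 : ((r j).val : ℂ) = j.val + s j := by exact_mod_cast hr j
    rcases le_total j (r j) with h3 | h3
    · have := D0_sub hx h3 (hLk j j (r j) (l1 j) (hrb j).2)
      rw [e1] at this; linear_combination -this
    · have := D0_sub hx h3 (hLk j (r j) j (hrb j).1 (r1 j))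
      rw [e1] at this; linear_combination this
  refine ⟨Equiv.ofBijective r (Finite.injective_iff_bijective.1 hinj),
    WithLp.toLp 2 fun j => -(s j : ℂ) * η₁ + p.hbar * μ j, mem_direction_iff.2 fun i hi => ?_,
    fun x hx j => ?_⟩
  · by_cases h3 : i.val + 1 < n
    · rw [form_simpleRoot_lt h3, sub_eq_zero]
      change -(s i : ℂ) * η₁ + p.hbar * μ i = -(s ⟨i.val + 1, h3⟩ : ℂ) * η₁ + p.hbar * μ ⟨i.val + 1, h3⟩
      have hii : i < ⟨i.val + 1, h3⟩ := by simp [Fin.lt_def]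
      have hL : Lk S i ⟨i.val + 1, h3⟩ := fun l h4 h5 => by
        rwa [show l = i from Fin.ext (by simp only [Fin.le_def, Fin.lt_def] at h4 h5; omega)]
      have hrt := right_unique (r1 i) (r1 _) hii.le (r2 i) (r2 _) (r3 i) (r3 _) hL
      have h4 : ⟨i.val + 1, h3⟩ ≤ rt i := hrt ▸ r1 _
      have h5 := hcard i ⟨i.val + 1, h3⟩ ((l1 i).trans hii.le) h4
      by_cases hT : rt i ∈ S
      · have hT' : Tail S i := by
          refine Tail.of_lk (b := rt i) (fun l hl => ?_) (r2 i)
          have := l.2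
          have h6 : ¬ (rt i).val + 1 < n := fun h => r3 i h hT
          rwa [show l = rt i from Fin.ext (by simp only [Fin.le_def] at hl; omega)]
        rw [h2 i hT', h2 _ (hT'.mono hii.le), sub_self, mul_zero] at h5
        rw [h2 i hT', h2 _ (hT'.mono hii.le), sub_eq_zero.1 h5]
      -- The block size times η_1 is ħ, so −s_jη_1 + ħμ_j does not depend on j in the block.
      · have h6 := h.block (a := lf i) (b := rt i) ((l1 i).trans_lt (hii.trans_le h4))
          (hLk i _ _ le_rfl le_rfl) (l3 i) hT
        have h7 : (s ⟨i.val + 1, h3⟩ : ℂ) - s i =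
            ((rt i).val + 1 - (lf i).val) * (μ ⟨i.val + 1, h3⟩ - μ i) := by exact_mod_cast h5
        rw [← h6]
        linear_combination η₁ * h7
    · rw [form_simpleRoot_last h3]
      have hT : Tail S i := fun l hl => by
        have := l.2
        rwa [show l = i from Fin.ext (by simp only [Fin.le_def] at hl; omega)]
      change 2 * (-(s i : ℂ) * η₁ + p.hbar * μ i) = 0
      have h4 : s i = 0 := Finset.sum_eq_zero fun j hj => by
        rw [Finset.mem_Icc] at hj
        have := rt i
        have h5 : j ≤ i := hj.2.trans (by have := (rt i).2; simp only [Fin.le_def]; omega)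
        rw [h2 i hT, h2 j (hT.of_lk (hLk i j i hj.1 (r1 i))), sub_self]
      rw [h4, h2 i hT]; simp
  · change x (r j) + p.hbar * μ j = (-(s j : ℂ) * η₁ + p.hbar * μ j) + x j
    linear_combination hsub x hx j

/-- The coordinates of w⁻¹X_0 are ±1, …, ±n up to order, plus (2n+2)μ_j. The alcove inequalities
force μ = 0 on the tail and differences 0 or 1 along each other block, which is what
`exists_rotation` requires. -/
theorem Good.transl (h : Good p S η₁ ηn) : p.Transl (D0 S η₁ ηn) (p.Pos S) := by
  intro w hw hP
  obtain ⟨σ, ε, μ, hN⟩ := p.exists_NF (inv_mem hw)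
  have hy := hN.pt h.hbar_ne fun j => n - j.val
  obtain ⟨h1, h2⟩ := (pos_iff h.hbar_ne hy).1 hP
  have hb : ∀ j, (ε j = 1 ∨ ε j = -1) ∧ (σ j).val < n := fun j => ⟨Int.units_eq_one_or _, (σ j).2⟩
  have hμ2 : ∀ a, Tail S a → μ a = 0 := by
    intro a ha
    have h3 := h2 a ha
    have h4 := hb a
    have hm := mul_scale_cases (n := n) (μ a)
    rw [mul_comm (scale n)] at h3
    simp only [scale] at h3 hm
    rcases h4 with ⟨h4 | h4, h5⟩ <;> rw [h4] at h3 <;> simp at h3 <;> omega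
  have hμ1 : ∀ a b, a < b → Lk S a b → μ a - μ b = 0 ∨ μ a - μ b = 1 := by
    intro a b hab hL
    by_cases hT : Tail S a
    · rw [hμ2 a hT, hμ2 b (hT.mono hab.le)]; simp
    · have h3 := (h1 a b hab hL).1
      have h4 := (h1 a b hab hL).2 hT
      have hm := mul_scale_cases (n := n) (μ a - μ b)
      rw [sub_mul] at hm
      rw [mul_comm (scale n), mul_comm (scale n)] at h3 h4
      simp only [scale] at h3 h4 hm
      have ha := hb a
      have hb := hb b
      rcases ha with ⟨h5 | h5, h6⟩ <;> rcases hb with ⟨h7 | h7, h8⟩ <;> rw [h5, h7] at h3 h4 <;>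
        simp at h3 h4 <;> omega
  obtain ⟨r, v, hv, hrv⟩ := h.exists_rotation μ hμ1 hμ2
  -- The element u cancels the signs and the permutation of w⁻¹ and inserts the rotation r, so that
  -- w⁻¹u sends x_j to x_{r j} + ħμ_j.
  obtain ⟨u, hu, hNu⟩ := exists_signed (p := p) (r * σ⁻¹) (fun l => ε (σ⁻¹ l))
  refine ⟨u⁻¹, inv_mem hu, ⟨v, hv⟩, fun x => ?_⟩
  rw [mul_inv_rev, inv_inv]
  ext j
  change (w⁻¹) (u x) j = v j + (x : V n) j
  rw [hN, hNu, ← hrv x x.2 j]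
  have hσ : σ⁻¹ (σ j) = j := σ.symm_apply_apply j
  simp only [Equiv.Perm.mul_apply, hσ]
  rcases Int.units_eq_one_or (ε j) with h | h <;> simp [h]

end Params
end Koornwinder
end

noncomputable section
set_option linter.unusedSectionVars false
namespace Koornwinder

/-! ### The algebra of restricted operators -/

theorem adjoin_eq_span_of_mul {B : Type*} [Ring B] [Algebra ℂ B] {s : Set B} (h1 : 1 ∈ Submodule.span ℂ s)
    (h : ∀ x ∈ s, ∀ y ∈ s, x * y ∈ Submodule.span ℂ s) :
    Subalgebra.toSubmodule (Algebra.adjoin ℂ s) = Submodule.span ℂ s := by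
  have hmul : ∀ x y : B, x ∈ Submodule.span ℂ s → y ∈ Submodule.span ℂ s → x * y ∈ Submodule.span ℂ s := by
    intro x y hx hy
    induction hx using Submodule.span_induction with
    | mem x hx =>
      induction hy using Submodule.span_induction with
      | mem y hy => exact h x hx y hy
      | zero => rw [mul_zero]; exact zero_mem _
      | add y y' _ _ ih ih' => rw [mul_add]; exact add_mem ih ih'
      | smul c y _ ih => rw [mul_smul_comm]; exact Submodule.smul_mem _ c ih
    | zero => rw [zero_mul]; exact zero_mem _
    | add x x' _ _ ih ih' => rw [add_mul]; exact add_mem ih ih'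
    | smul c x _ ih => rw [smul_mul_assoc]; exact Submodule.smul_mem _ c ih
  refine le_antisymm ?_ (Submodule.span_le.2 Algebra.subset_adjoin)
  have : Algebra.adjoin ℂ s ≤ Submodule.toSubalgebra _ h1 hmul :=
    Algebra.adjoin_le Submodule.subset_span
  exact fun x hx => this hx

theorem adjoin_comm {B : Type*} [Ring B] [Algebra ℂ B] {s : Set B} (h : ∀ x ∈ s, ∀ y ∈ s, x * y = y * x) :
    ∀ x ∈ Algebra.adjoin ℂ s, ∀ y ∈ Algebra.adjoin ℂ s, x * y = y * x := by
  intro x hx y hy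
  have key : ∀ x ∈ s, Commute x y := by
    intro x hx
    induction hy using Algebra.adjoin_induction with
    | mem y hy => exact h x hx y hy
    | algebraMap r => exact (Algebra.commutes r _).symm
    | add y y' _ _ ih ih' => exact ih.add_right ih'
    | mul y y' _ _ ih ih' => exact ih.mul_right ih'
  have : Commute x y := by
    induction hx using Algebra.adjoin_induction with
    | mem x hx => exact key x hx
    | algebraMap r => exact Algebra.commutes r _
    | add y y' _ _ ih ih' => exact ih.add_left ih'
    | mul y y' _ _ ih ih' => exact ih.mul_left ih'
  exact this

theorem adjoin_op_eq_span {P E : Type*} [NormedAddCommGroup E] [NormedSpace ℂ E] [FiniteDimensional ℂ E]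
    [AddTorsor E P]
    {ι : Type*} {f : ι → Op P}
    (h1 : 1 ∈ Submodule.span ℂ (Set.range f)) (h : ∀ i j, f i * f j ∈ Submodule.span ℂ (Set.range f)) :
    Subalgebra.toSubmodule (Algebra.adjoin ℂ (Set.range f)) = Submodule.span ℂ (Set.range f) :=
  adjoin_eq_span_of_mul h1 (by rintro _ ⟨l, rfl⟩ _ ⟨l', rfl⟩; exact h l l')

theorem adjoin_op_comm {P E : Type*} [NormedAddCommGroup E] [NormedSpace ℂ E] [FiniteDimensional ℂ E]
    [AddTorsor E P]
    {ι : Type*} {f : ι → Op P}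
    (h : ∀ i j, f i * f j = f j * f i) :
    ∀ x ∈ Algebra.adjoin ℂ (Set.range f), ∀ y ∈ Algebra.adjoin ℂ (Set.range f), x * y = y * x :=
  adjoin_comm (by rintro _ ⟨l, rfl⟩ _ ⟨l', rfl⟩; exact h l l')

namespace Params

variable {n : ℕ} [NeZero n] {p : Params} {S : Finset (Fin n)} {η₁ ηn : ℂ}

theorem sym_mY (h0 : p.hbar ≠ 0) (l : Fin n → ℤ) : p.Sym (p.mY l) :=
  ⟨mY_mem_HH l, fun i => commute_mY h0 i l⟩

theorem Mbar_eq (l : Fin n → ℤ) : p.Mbar S η₁ ηn l = bar (D0 S η₁ ηn) (p.mY l) := bar_Res _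

theorem Mbar_mul (h : Good p S η₁ ηn) {D : Op (V n)} (hD : D ∈ p.HH n) (l : Fin n → ℤ) :
    bar (D0 S η₁ ηn) (D * p.mY l) = bar (D0 S η₁ ηn) D * p.Mbar S η₁ ηn l := by
  rw [Mbar_eq]
  exact bar_mul h.stab h.transl (pos_one h.hbar_ne) hD (sym_mY h.hbar_ne l)

theorem span_le_HH : Submodule.span ℂ (Set.range (p.mY (n := n))) ≤ Subalgebra.toSubmodule (p.HH n) :=
  Submodule.span_le.2 (by rintro _ ⟨l, rfl⟩; exact mY_mem_HH l)

theorem bar_mem_span {D : Op (V n)} (hD : D ∈ Submodule.span ℂ (Set.range (p.mY (n := n)))) :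
    bar (D0 S η₁ ηn) D ∈ Submodule.span ℂ (Set.range (p.Mbar S η₁ ηn)) := by
  induction hD using Submodule.span_induction with
  | mem x hx =>
    obtain ⟨l, rfl⟩ := hx
    rw [← Mbar_eq]; exact Submodule.subset_span ⟨l, rfl⟩
  | zero =>
    have := bar_smul (A := D0 S η₁ ηn) 0 (restrictable_of_mem (A := D0 S η₁ ηn) (mY_mem_HH (p := p) 0))
    rw [zero_smul, zero_smul] at this
    rw [this]; exact zero_mem _
  | add x y hx hy ihx ihy =>
    rw [bar_add (restrictable_of_mem (span_le_HH hx)) (restrictable_of_mem (span_le_HH hy))]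
    exact add_mem ihx ihy
  | smul c x hx ih =>
    rw [bar_smul c (restrictable_of_mem (span_le_HH hx))]
    exact Submodule.smul_mem _ c ih

theorem Good.Mbar_mul_mem (h : Good p S η₁ ηn) (l l' : Fin n → ℤ) :
    p.Mbar S η₁ ηn l * p.Mbar S η₁ ηn l' ∈ Submodule.span ℂ (Set.range (p.Mbar S η₁ ηn)) := by
  rw [Mbar_eq l, ← Mbar_mul h (mY_mem_HH l)]
  exact bar_mem_span (mY_mul_mem h.hbar_ne l l')

theorem Good.Mbar_comm (h : Good p S η₁ ηn) (l l' : Fin n → ℤ) :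
    p.Mbar S η₁ ηn l * p.Mbar S η₁ ηn l' = p.Mbar S η₁ ηn l' * p.Mbar S η₁ ηn l := by
  rw [Mbar_eq l, ← Mbar_mul h (mY_mem_HH l), mY_comm h.hbar_ne, Mbar_mul h (mY_mem_HH l'), Mbar_eq l', Mbar_eq l]

theorem Good.Rbar_eq_span (h : Good p S η₁ ηn) :
    Subalgebra.toSubmodule (p.Rbar S η₁ ηn) = Submodule.span ℂ (Set.range (p.Mbar S η₁ ηn)) := by
  have h1 : (1 : Op (D0 S η₁ ηn)) ∈ Submodule.span ℂ (Set.range (p.Mbar S η₁ ηn)) := by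
    rw [← bar_one, ← mY_zero (p := p) h.hbar_ne, ← Mbar_eq]
    exact Submodule.subset_span ⟨0, rfl⟩
  rw [Rbar]
  exact adjoin_op_eq_span h1 h.Mbar_mul_mem

theorem Good.Rbar_comm (h : Good p S η₁ ηn) : ∀ x ∈ p.Rbar S η₁ ηn, ∀ y ∈ p.Rbar S η₁ ηn, x * y = y * x := by
  rw [Rbar]
  exact adjoin_op_comm h.Mbar_comm

end Params

/-! ### The dimension of `D_0` -/

section Dim

variable {n : ℕ} [NeZero n] {S : Finset (Fin n)} {η₁ ηn : ℂ}

theorem eq_zero_of_simpleRoot {x : V n} (h : ∀ i, form (simpleRoot i) x = 0) : x = 0 := by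
  have key : ∀ m : ℕ, ∀ j : Fin n, j.val + m + 1 = n → x j = 0 := by
    intro m
    induction m with
    | zero =>
      intro j hj
      have := h j
      rw [form_simpleRoot_last (by omega)] at this
      simpa using this
    | succ m ih =>
      intro j hj
      have hj' : j.val + 1 < n := by omega
      have := h j
      rw [form_simpleRoot_lt hj', ih ⟨j.val + 1, hj'⟩ (by simp only; omega), sub_zero] at this
      exact this
  ext j
  exact key (n - 1 - j.val) j (by have := j.2; omega)


variable (n) in
/-- The pairings with the simple roots. -/
def simpleForms : V n →ₗ[ℂ] (Fin n → ℂ) where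
  toFun x i := form (simpleRoot i) x
  map_add' _ _ := funext fun _ => form_add _ _ _
  map_smul' _ _ := funext fun _ => form_smul _ _ _

theorem simpleForms_bijective : Function.Bijective (simpleForms n) := by
  have hinj : Function.Injective (simpleForms n) := by
    rw [← LinearMap.ker_eq_bot, LinearMap.ker_eq_bot']
    exact fun x hx => eq_zero_of_simpleRoot fun i => congrFun hx i
  exact ⟨hinj, (LinearMap.injective_iff_surjective_of_finrank_eq_finrank (by simp)).1 hinj⟩

theorem finrank_direction :
    Module.finrank ℂ (D0 S η₁ ηn).direction = Fintype.card {j : Fin n // j ∉ S} := by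
  have hmem : ∀ v : V n, v ∈ (D0 S η₁ ηn).direction ↔ ∀ i ∈ S, simpleForms n v i = 0 :=
    fun v => Params.mem_direction_iff
  let f : (D0 S η₁ ηn).direction →ₗ[ℂ] ({j : Fin n // j ∉ S} → ℂ) :=
    (LinearMap.funLeft ℂ ℂ (Subtype.val : {j : Fin n // j ∉ S} → Fin n)) ∘ₗ simpleForms n ∘ₗ
      (D0 S η₁ ηn).direction.subtype
  have hf : Function.Bijective f := by
    constructor
    · rw [← LinearMap.ker_eq_bot, LinearMap.ker_eq_bot']
      rintro ⟨v, hv⟩ h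
      refine Subtype.ext (eq_zero_of_simpleRoot fun i => ?_)
      by_cases hi : i ∈ S
      · exact (hmem v).1 hv i hi
      · exact congrFun h ⟨i, hi⟩
    · intro c
      obtain ⟨v, hv⟩ := simpleForms_bijective.2 fun i => if h : i ∈ S then 0 else c ⟨i, h⟩
      refine ⟨⟨v, (hmem v).2 fun i hi => (congrFun hv i).trans (dif_pos hi)⟩, ?_⟩
      funext j
      change simpleForms n v j.1 = c j
      exact (congrFun hv j.1).trans (dif_neg j.2)
  rw [(LinearEquiv.ofBijective f hf).finrank_eq, Module.finrank_fintype_fun_eq_card]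

end Dim
end Koornwinder
end

noncomputable section
set_option linter.unusedSectionVars false
namespace Koornwinder
namespace Params

variable {n : ℕ} [NeZero n] {p : Params}

/-! ### Coefficients of operators on symmetric functions -/

/-- The coefficients of `Res D`, indexed by the vectors of translations. -/
def CC (D : Op (V n)) : V n →₀ Mer (V n) :=
  Finsupp.mapDomain (fun g : V n ≃ᵃ[ℂ] V n => g 0) D.coeff

theorem CC_zero : CC (0 : Op (V n)) = 0 := by
  rw [CC, SkewMonoidAlgebra.coeff_zero, Finsupp.mapDomain_zero]

theorem CC_add (D D' : Op (V n)) : CC (D + D') = CC D + CC D' := by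
  rw [CC, SkewMonoidAlgebra.coeff_add, Finsupp.mapDomain_add]; rfl

theorem CC_single (g : V n ≃ᵃ[ℂ] V n) (d : Mer (V n)) :
    CC (SkewMonoidAlgebra.single g d) = Finsupp.single (g 0) d := by
  rw [CC, SkewMonoidAlgebra.coeff_single, Finsupp.mapDomain_single]

theorem CC_smul (c : ℂ) (D : Op (V n)) (v : V n) :
    CC (c • D) v = algebraMap ℂ (Mer (V n)) c * CC D v := by
  rw [CC, SkewMonoidAlgebra.coeff_smul, Finsupp.mapDomain_smul, Finsupp.smul_apply, Algebra.smul_def]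
  rfl

theorem CC_sum {ι : Type*} (s : Finset ι) (D : ι → Op (V n)) (v : V n) :
    CC (∑ i ∈ s, D i) v = ∑ i ∈ s, CC (D i) v := by
  classical
  induction s using Finset.induction_on with
  | empty => rw [Finset.sum_empty, Finset.sum_empty, CC_zero]; rfl
  | insert a s ha ih => rw [Finset.sum_insert ha, Finset.sum_insert ha, CC_add, Finsupp.add_apply, ih]

theorem CC_single_mul (g : V n ≃ᵃ[ℂ] V n) (a : Mer (V n)) (D : Op (V n)) (v : V n) :
    CC (SkewMonoidAlgebra.single g a * D) v = a * g • CC D (g⁻¹ v) := by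
  classical
  induction D using SkewMonoidAlgebra.induction_on with
  | zero => rw [mul_zero, CC_zero, Finsupp.zero_apply, Finsupp.zero_apply, smul_zero, mul_zero]
  | add D₁ D₂ h1 h2 =>
    rw [mul_add, CC_add, CC_add, Finsupp.add_apply, Finsupp.add_apply, h1, h2, smul_add, mul_add]
  | single h d =>
    rw [SkewMonoidAlgebra.single_mul_single, CC_single, CC_single, Finsupp.single_apply, Finsupp.single_apply]
    have : (g * h) 0 = v ↔ h 0 = g⁻¹ v := by
      change g (h 0) = v ↔ _
      constructor
      · rintro rfl; exact (g.symm_apply_apply _).symm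
      · intro hh; rw [hh]; exact g.apply_symm_apply _
    simp only [this]
    split_ifs
    · rfl
    · rw [smul_zero, mul_zero]

theorem CC_T_mul (i : Option (Fin n)) (D : Op (V n)) (v : V n) :
    CC (p.T i * D) v = (p.tM i - p.coef i) * CC D v + p.coef i * p.s i • CC D (p.s i v) := by
  rw [T_eq, dl, add_mul, CC_add, Finsupp.add_apply, CC_single_mul, CC_single_mul, one_smul, aM,
    sub_sub_cancel, s_inv]
  rfl

/-- `CC` records only the action on W-invariant functions, and there T_i with i ≥ 1 is the scalar
t_i. Right factors built from such T_i therefore never affect supports. -/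
theorem CC_mul_T (i : Fin n) (D : Op (V n)) :
    CC (D * p.T (some i)) = CC ((p.t (some i) : ℂ) • D) := by
  induction D using SkewMonoidAlgebra.induction_on with
  | zero => rw [zero_mul, smul_zero]
  | add D₁ D₂ h1 h2 => rw [add_mul, CC_add, h1, h2, smul_add, CC_add]
  | single g d =>
    have h0 : (g * p.s (some i)) 0 = g 0 := congrArg g (finW_zero (s_mem_finW i))
    rw [T_eq, dl, mul_add, SkewMonoidAlgebra.single_mul_single, SkewMonoidAlgebra.single_mul_single, CC_add,
      CC_single, CC_single, mul_one, h0, ← Finsupp.single_add, ← mul_add, ← smul_add, add_sub_cancel,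
      SkewMonoidAlgebra.smul_single, CC_single, smul_tM, mul_comm, Algebra.smul_def]
    rfl

/-- Right multiplication by `X` multiplies the coefficients by a nonzero constant. -/
def RightConst (X : (Op (V n))ˣ) : Prop := ∃ c : ℂ, c ≠ 0 ∧ ∀ D : Op (V n), CC (D * (X : Op (V n))) = CC (c • D)

theorem RightConst.one : RightConst (1 : (Op (V n))ˣ) :=
  ⟨1, one_ne_zero, fun D => by rw [one_smul, Units.val_one, mul_one]⟩

theorem RightConst.mul {X Y : (Op (V n))ˣ} (hX : RightConst X) (hY : RightConst Y) : RightConst (X * Y) := by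
  obtain ⟨c, hc, h⟩ := hX
  obtain ⟨d, hd, h'⟩ := hY
  refine ⟨d * c, mul_ne_zero hd hc, fun D => ?_⟩
  rw [Units.val_mul, ← mul_assoc, h']
  ext v
  rw [CC_smul, h, CC_smul, CC_smul, map_mul, mul_assoc]

theorem RightConst.inv {X : (Op (V n))ˣ} (hX : RightConst X) : RightConst X⁻¹ := by
  obtain ⟨c, hc, h⟩ := hX
  refine ⟨c⁻¹, inv_ne_zero hc, fun D => ?_⟩
  have := h (D * (X⁻¹ : (Op (V n))ˣ))
  rw [Units.inv_mul_cancel_right] at this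
  ext v
  rw [CC_smul, this, CC_smul, ← mul_assoc, ← map_mul, inv_mul_cancel₀ hc, map_one, one_mul]

theorem rightConst_TU (i : Fin n) : RightConst (p.TU (some i)) := ⟨_, (p.t (some i)).ne_zero, CC_mul_T i⟩

theorem rightConst_gU (m : ℕ) : RightConst (p.gU m : (Op (V n))ˣ) := by
  induction m with
  | zero => exact RightConst.one
  | succ m ih =>
    rw [gU]
    split_ifs
    · exact ih.mul (rightConst_TU _)
    · exact ih.mul RightConst.one

theorem rightConst_PU (h0 : p.hbar ≠ 0) (k : Fin n) : RightConst (p.PU k) := by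
  have key : ∀ m : ℕ, ∀ k : Fin n, k.val + m + 1 = n → RightConst (p.PU k) := by
    intro m
    induction m with
    | zero =>
      intro k hk
      rw [(lastNode_iff k).2 (by omega), PU_last h0]; exact rightConst_TU _
    | succ m ih =>
      intro k hk
      have hk' : k.val + 1 < n := by omega
      rw [PU_succ h0 hk']
      exact ((rightConst_TU k).mul (ih _ (by simp only; omega))).mul (rightConst_TU k)
  exact key (n - 1 - k.val) k (by have := k.2; omega)

/-! ### Products of coefficients -/

/-- Products of nonzero constants and of functions `g • coef i` for which the linear part of the
root `α_i ∘ g⁻¹` satisfies `R`. -/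
def NZ (p : Params) (R : V n → Prop) : Submonoid (Mer (V n)) :=
  Submonoid.closure ({x | ∃ c : ℂ, c ≠ 0 ∧ x = algebraMap ℂ (Mer (V n)) c} ∪
    {x | ∃ g ∈ p.affW n, ∃ i, R (g.linear (affLin i)) ∧ x = g • p.coef i})

theorem NZ.const {R : V n → Prop} {c : ℂ} (hc : c ≠ 0) : algebraMap ℂ (Mer (V n)) c ∈ p.NZ R :=
  Submonoid.subset_closure (.inl ⟨c, hc, rfl⟩)

theorem NZ.coef {R : V n → Prop} {i : Option (Fin n)} (h : R (affLin i)) : p.coef i ∈ p.NZ R :=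
  Submonoid.subset_closure (.inr ⟨1, one_mem _, i, h, (one_smul _ _).symm⟩)

theorem NZ.mono {R R' : V n → Prop} (h : ∀ a, R a → R' a) : p.NZ R ≤ p.NZ R' :=
  Submonoid.closure_mono (Set.union_subset_union_right _ fun _ ⟨g, hg, i, hi, hx⟩ => ⟨g, hg, i, h _ hi, hx⟩)

theorem NZ.smul {R R' : V n → Prop} {h : V n ≃ᵃ[ℂ] V n} (hh : h ∈ p.affW n)
    (H : ∀ a, R a → R' (h.linear a)) {x : Mer (V n)} (hx : x ∈ p.NZ R) : h • x ∈ p.NZ R' := by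
  induction hx using Submonoid.closure_induction with
  | mem x hx =>
    rcases hx with ⟨c, hc, rfl⟩ | ⟨g, hg, i, hi, rfl⟩
    · rw [smul_C]; exact NZ.const hc
    · rw [smul_smul]
      exact Submonoid.subset_closure (.inr ⟨h * g, mul_mem hh hg, i, H _ hi, rfl⟩)
  | one => rw [smul_one]; exact one_mem _
  | mul x y _ _ hx hy => rw [smul_mul']; exact mul_mem hx hy

/-- The numerator is zero for at most two values of e^{−z/2}; any other nonzero value is attained by
choosing a logarithm. -/
theorem exists_numC_ne (i : Option (Fin n)) : ∃ z, p.numC i z ≠ 0 := by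
  set a : ℂ := p.t i * p.u i
  set b : ℂ := p.t i * (p.u i : ℂ)⁻¹
  have ha : a ≠ 0 := mul_ne_zero (p.t i).ne_zero (p.u i).ne_zero
  have hb : b ≠ 0 := mul_ne_zero (p.t i).ne_zero (inv_ne_zero (p.u i).ne_zero)
  obtain ⟨y, hy⟩ := Set.Infinite.exists_notMem_finset (Set.infinite_univ (α := ℂ)) {0, a⁻¹, -b⁻¹}
  simp only [Set.mem_univ, true_and, Finset.mem_insert, Finset.mem_singleton, not_or] at hy
  obtain ⟨h1, h2, h3⟩ := hy
  refine ⟨-2 * Complex.log y, ?_⟩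
  rw [numC, show -(1 / 2 * (-2 * Complex.log y)) = Complex.log y by ring, Complex.exp_log h1]
  refine mul_ne_zero (inv_ne_zero (p.t i).ne_zero) (mul_ne_zero ?_ ?_)
  · intro h
    exact h2 (eq_inv_of_mul_eq_one_right (sub_eq_zero.1 h).symm)
  · intro h
    refine h3 ?_
    rw [eq_neg_iff_add_eq_zero, ← mul_right_inj' hb, mul_add, mul_inv_cancel₀ hb, mul_zero, add_comm]
    exact h

/-- Coefficients whose roots are not constant on `A` have nonzero restrictions to `A`. -/
theorem NZ.restr {A : AffineSubspace ℂ (V n)} [Nonempty A] {v : V n} (hv : v ∈ A.direction) {x : Mer (V n)}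
    (hx : x ∈ p.NZ fun a => form a v ≠ 0) : ∃ h : Mer A, h ≠ 0 ∧ IsRestr A x h := by
  induction hx using Submonoid.closure_induction with
  | mem x hx =>
    rcases hx with ⟨c, hc, rfl⟩ | ⟨g, hg, i, hi, rfl⟩
    · refine ⟨_, ?_, isRestr_C c⟩
      rwa [Ne, map_eq_zero_iff _ (FaithfulSMul.algebraMap_injective ℂ (Mer A))]
    · obtain ⟨x₀, hx₀⟩ : Nonempty A := inferInstance
      obtain ⟨N, -, hN, hco⟩ := smul_coef (A := A) i (inv_mem hg)
      rw [inv_inv] at hco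
      -- Because the root pairs nontrivially with the direction v, it takes every complex value on
      -- A; hence neither numerator nor denominator vanishes identically there.
      have hval : ∀ z, ∃ x ∈ A, p.al i (g⁻¹ x) = z := by
        intro z
        set c := form (affLin i) ((g⁻¹ : V n ≃ᵃ[ℂ] V n).linear v) with hc
        have hc0 : c ≠ 0 := by
          rw [hc, ← form_linear p hg]
          have : g.linear ((g⁻¹ : V n ≃ᵃ[ℂ] V n).linear v) = v := g.linear.apply_symm_apply _
          rwa [this]
        refine ⟨x₀ - ((p.al i (g⁻¹ x₀) - z) / c) • v, ?_, ?_⟩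
        · have := AffineSubspace.vadd_mem_of_mem_direction
            (A.direction.smul_mem (-((p.al i (g⁻¹ x₀) - z) / c)) hv) hx₀
          rwa [vadd_eq_add, neg_smul, neg_add_eq_sub] at this
        · rw [map_sub_smul, al, form_sub, form_smul, ← hc, div_mul_cancel₀ _ hc0, al]; ring
      obtain ⟨z, hz⟩ := exists_numC_ne (p := p) i
      obtain ⟨x₁, hx₁, h1⟩ := hval z
      obtain ⟨x₂, hx₂, h2⟩ := hval 1
      have hN0 : resHol A N ≠ 0 := by
        intro h
        have := congrFun (congrArg Subtype.val h) ⟨x₁, hx₁⟩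
        change N.1 x₁ = 0 at this
        rw [hN, h1] at this
        exact hz this
      have hd : resHol A (1 - exn fun x => - p.al i (g⁻¹ x)) ≠ 0 := by
        refine resHol_one_sub_ne ((p.aff_al i).neg.comp g⁻¹) hx₂ ?_
        rw [h2]
        intro h
        have := congrArg (fun z : ℂ => ‖z‖) h
        simp [Complex.norm_exp] at this
      refine ⟨_, ?_, N, _, hd, ?_, rfl⟩
      · exact div_ne_zero (toA_ne_zero hN0) (toA_ne_zero hd)
      · rw [hco, one_sub_exM_eq]
  | one => 
    refine ⟨1, one_ne_zero, ?_⟩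
    have := isRestr_C (A := A) 1
    rwa [map_one, map_one] at this
  | mul x y _ _ hx hy =>
    obtain ⟨h, h0, hx⟩ := hx
    obtain ⟨h', h0', hy⟩ := hy
    exact ⟨h * h', mul_ne_zero h0 h0', hx.mul hy⟩

end Params
end Koornwinder
end

noncomputable section
set_option linter.unusedSectionVars false
namespace Koornwinder
namespace Params

variable {n : ℕ} [NeZero n] {p : Params}

/-! ### The dominance order -/

/-- The coordinates of `l` are `0` and `±1`. -/
def Small (l : Fin n → ℤ) : Prop := ∀ i, -1 ≤ l i ∧ l i ≤ 1

/-- The `ℓ¹`-norm. -/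
def wt (l : Fin n → ℤ) : ℤ := ∑ i, |l i|

/-- The sum of the first `m` coordinates. -/
def ps (m : ℕ) (l : Fin n → ℤ) : ℤ := ∑ j, (if j.val < m then 1 else 0) * l j

/-- The dominance order: `l ≤ l'` if the partial sums of `l` do not exceed those of `l'`. -/
def Dm (l l' : Fin n → ℤ) : Prop := ∀ m ≤ n, ps m l ≤ ps m l'

theorem ps_succ {m : ℕ} (h : m < n) (l : Fin n → ℤ) : ps (m + 1) l = ps m l + l ⟨m, h⟩ := by
  have : l ⟨m, h⟩ = ∑ j : Fin n, (if j = ⟨m, h⟩ then 1 else 0) * l j := by simp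
  rw [ps, ps, this, ← Finset.sum_add_distrib]
  refine Finset.sum_congr rfl fun j _ => ?_
  rw [← add_mul]
  congr 1
  simp only [Fin.ext_iff]
  split_ifs <;> omega

theorem sum_mul_sl (i : Fin n) (f l : Fin n → ℤ) : ∑ j, f j * sl i l j =
    ∑ j, f j * l j - nuCoef l i * if h : i.val + 1 < n then f i - f ⟨i.val + 1, h⟩ else 2 * f i := by
  rw [eq_sub_iff_add_eq, ← eq_sub_iff_add_eq', ← Finset.sum_sub_distrib]
  by_cases h : i.val + 1 < n
  · rw [dif_pos h, nuCoef_lt h]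
    have : ∀ j, f j * l j - f j * sl i l j = (if j = i then f i * (l i - l ⟨i.val + 1, h⟩) else 0) +
        if j = ⟨i.val + 1, h⟩ then f ⟨i.val + 1, h⟩ * (l ⟨i.val + 1, h⟩ - l i) else 0 := by
      intro j
      rw [sl_lt h]
      by_cases h1 : j = i
      · subst h1
        rw [if_pos rfl, if_pos rfl, if_neg (fun hh => by simpa using congrArg Fin.val hh)]; ring
      · by_cases h2 : j = ⟨i.val + 1, h⟩
        · subst h2
          rw [if_neg (by simp), if_pos rfl, if_neg h1, if_pos rfl]; ring
        · rw [if_neg (fun hh => h1 (Fin.ext hh)), if_neg (fun hh => h2 (Fin.ext hh)), if_neg h1, if_neg h2]; ring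
    simp only [this]
    rw [Finset.sum_add_distrib, Finset.sum_ite_eq' Finset.univ i, Finset.sum_ite_eq' Finset.univ]
    simp only [Finset.mem_univ, if_true]
    ring
  · rw [dif_neg h, nuCoef_last h]
    have : ∀ j, f j * l j - f j * sl i l j = if j = i then 2 * f i * l i else 0 := by
      intro j
      rw [sl_last h]
      split_ifs with h1
      · subst h1; ring
      · ring
    simp only [this, Finset.sum_ite_eq', Finset.mem_univ, if_true]
    ring

theorem ps_sl {m : ℕ} (hm : m ≤ n) (i : Fin n) (l : Fin n → ℤ) : ps m (sl i l) =
    ps m l - if m = i.val + 1 then nuCoef l i * (if i.val + 1 < n then 1 else 2) else 0 := by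
  rw [ps, sum_mul_sl, ← ps]
  have hi := i.2
  congr 1
  dsimp only
  split_ifs <;> omega

theorem wt_sl (i : Fin n) (l : Fin n → ℤ) : wt (sl i l) = wt l := by
  by_cases h : i.val + 1 < n
  · have : ∀ j, sl i l j = l (Equiv.swap i ⟨i.val + 1, h⟩ j) := fun j => by rw [sl, dif_pos h]
    simp only [wt, this]
    exact Equiv.sum_comp (Equiv.swap i ⟨i.val + 1, h⟩) fun j => |l j|
  · refine Finset.sum_congr rfl fun j _ => ?_
    rw [sl_last h]
    split_ifs with h1
    · rw [abs_neg, h1]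
    · rfl

theorem Small.sl {l : Fin n → ℤ} (h : Small l) (i : Fin n) : Small (sl i l) := by
  intro j
  have h1 := h i
  have h2 := h j
  by_cases hi : i.val + 1 < n
  · have h3 := h ⟨i.val + 1, hi⟩
    rw [sl_lt hi]
    split_ifs <;> omega
  · rw [sl_last hi]
    split_ifs <;> omega

theorem Dm.sl_left {l l' : Fin n → ℤ} (h : Dm l l') {i : Fin n} (hi : 0 < nuCoef l i) : Dm (sl i l) l' := by
  intro m hm
  have := h m hm
  rw [ps_sl hm]
  split_ifs <;> omega

theorem not_dm_sl {l : Fin n → ℤ} {i : Fin n} (hi : 0 < nuCoef l i) : ¬ Dm l (sl i l) := by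
  intro h
  have h2 := i.2
  have : ps (i.val + 1) l ≤ ps (i.val + 1) (sl i l) := h _ h2
  rw [ps_sl (m := i.val + 1) h2, if_pos rfl] at this
  split_ifs at this <;> omega

/-- Only the partial sum ending at i changes under s_i. Its inequality follows from those for the
neighbouring partial sums because the entries are 0 or ±1 and l has positive pairing with α_i. -/
theorem Dm.sl {l l' : Fin n → ℤ} (h : Dm l l') (hl : Small l) (hl' : Small l') {i : Fin n}
    (hi : 0 < nuCoef l i) : Dm (sl i l) (sl i l') := by
  intro m hm
  rw [ps_sl hm, ps_sl hm]
  by_cases hmi : m = i.val + 1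
  · subst hmi
    rw [if_pos rfl, if_pos rfl]
    have e0 := h i.val i.2.le
    have e1 := h _ hm
    rw [ps_succ i.2, ps_succ i.2] at e1 ⊢
    simp only [Fin.eta] at e1 ⊢
    have l1 := hl i
    have l1' := hl' i
    by_cases hn : i.val + 1 < n
    · have e2 := h _ hn
      rw [ps_succ hn, ps_succ hn, ps_succ i.2, ps_succ i.2] at e2
      simp only [Fin.eta] at e2
      have l2 := hl ⟨_, hn⟩
      have l2' := hl' ⟨_, hn⟩
      rw [nuCoef_lt hn] at hi ⊢
      rw [nuCoef_lt hn, if_pos hn]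
      omega
    · rw [nuCoef_last hn] at hi ⊢
      rw [nuCoef_last hn, if_neg hn]
      omega
  · rw [if_neg hmi, if_neg hmi]
    have := h m hm
    omega

/-- `e_1 + ... + e_k`. -/
def nuN (k : ℕ) : Fin n → ℤ := fun i => if i.val < k then 1 else 0

theorem nu_eq_nuN (j : Fin n) : nu j = nuN (j.val + 1) := by
  funext i
  simp only [nu, nuN, Fin.le_def, Nat.lt_succ_iff]

theorem nuCoef_nuN (k : ℕ) (i : Fin n) : nuCoef (nuN k) i = if i.val + 1 = k ∨ i.val + 1 = n ∧ n < k then 1 else 0 := by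
  have := i.2
  simp only [nuCoef, nuN]
  split_ifs <;> omega

theorem nuN_succ {k : ℕ} (h : k < n) : nuN (k + 1) = (Pi.single ⟨k, h⟩ 1 : Fin n → ℤ) + nuN k := by
  funext i
  simp only [nuN, Pi.add_apply, Pi.single_apply, Fin.ext_iff]
  split_ifs <;> omega

theorem exists_nuN {l : Fin n → ℤ} (hl : Small l) (h : ∀ i, 0 ≤ nuCoef l i) : ∃ k ≤ n, l = nuN k := by
  have hd : Dom l := by
    have : domPart l = l := eq_of_nuCoef fun j => by rw [nuCoef_domPart, max_eq_left (h j)]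
    rw [← this]; exact dom_domPart l
  have hex : ∃ m : ℕ, ∀ j : Fin n, m ≤ j.val → l j = 0 := ⟨n, fun j hj => absurd j.2 (not_lt.2 hj)⟩
  refine ⟨Nat.find hex, Nat.find_min' hex fun j hj => absurd j.2 (not_lt.2 hj), ?_⟩
  funext i
  rw [nuN]
  have h1 := hl i
  have h2 := hd.2 i
  split_ifs with hi
  · have := Nat.find_min hex hi
    push Not at this
    obtain ⟨j, hj, hj0⟩ := this
    have h3 : l j ≤ l i := hd.1 hj
    have h4 := hd.2 j
    omega
  · exact Nat.find_spec hex i (not_lt.1 hi)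

theorem wt_nuN {k : ℕ} (h : k ≤ n) : wt (nuN k : Fin n → ℤ) = k := by
  induction k with
  | zero => simp [wt, nuN]
  | succ k ih =>
    have hk : k < n := h
    have : ∀ i : Fin n, |(nuN (k + 1) : Fin n → ℤ) i| = (if i = ⟨k, hk⟩ then 1 else 0) + |(nuN k : Fin n → ℤ) i| := by
      intro i
      simp only [nuN, Fin.ext_iff]
      split_ifs <;> first | omega | simp
    rw [wt, Finset.sum_congr rfl fun i _ => this i, Finset.sum_add_distrib, ← wt, ih (by omega)]
    simp [add_comm]

theorem abs_ps_le_wt (m : ℕ) (l : Fin n → ℤ) : |ps m l| ≤ wt l := by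
  refine (Finset.abs_sum_le_sum_abs _ _).trans (Finset.sum_le_sum fun j _ => ?_)
  split_ifs <;> simp

theorem neg_le_ps {l : Fin n → ℤ} (h : Small l) {m : ℕ} (hm : m ≤ n) : -(m : ℤ) ≤ ps m l := by
  induction m with
  | zero => simp [ps]
  | succ m ih =>
    have h1 := ih (by omega)
    have h2 := h ⟨m, hm⟩
    rw [ps_succ hm]
    push_cast
    omega

theorem eq_neg_nuN {l : Fin n → ℤ} {k : ℕ} (hk : k ≤ n) (h1 : Small l) (h2 : wt l ≤ k)
    (h3 : ps k l ≤ -(k : ℤ)) : l = -nuN k := by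
  -- Each of these terms is nonnegative and is zero only at the corresponding entry of −ν_k; the
  -- hypotheses say that their sum is at most k + k − 2k = 0.
  have hc : ∀ i ∈ Finset.univ, 0 ≤ |l i| + |(nuN k : Fin n → ℤ) i| + 2 * ((if i.val < k then 1 else 0) * l i) := by
    intro i _
    have := h1 i
    rw [nuN]
    split_ifs
    · rcases abs_cases (l i) with h | h <;> simp <;> omega
    · simp
  have hs : ∑ i, (|l i| + |(nuN k : Fin n → ℤ) i| + 2 * ((if i.val < k then 1 else 0) * l i)) ≤ 0 := by
    rw [Finset.sum_add_distrib, Finset.sum_add_distrib, ← Finset.mul_sum]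
    have h4 := wt_nuN hk
    rw [wt] at h2 h4
    rw [ps] at h3
    rw [h4]
    omega
  have h0 := (Finset.sum_eq_zero_iff_of_nonneg hc).1 (le_antisymm hs (Finset.sum_nonneg hc))
  funext i
  have h5 := h0 i (Finset.mem_univ i)
  have h6 := h1 i
  rw [Pi.neg_apply]
  rw [nuN] at h5 ⊢
  split_ifs at h5 ⊢
  · rcases abs_cases (l i) with h | h <;> simp at h5 <;> omega
  · simpa using h5

end Params
end Koornwinder
end

noncomputable section
set_option linter.unusedSectionVars false
namespace Koornwinder
namespace Params

variable {n : ℕ} [NeZero n] {p : Params}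

/-! ### Supports and leading coefficients of the Cherednik-Dunkl operators -/

/-- The coefficient of `D` at the translation `τ(l)`. -/
def cf (p : Params) (D : Op (V n)) (l : Fin n → ℤ) : Mer (V n) := CC D (p.hbar • latt l)

/-- The action of simple affine reflections on the coroot lattice. -/
def sa : Option (Fin n) → (Fin n → ℤ) → Fin n → ℤ
  | none, l => Function.update l 0 (1 - l 0)
  | some i, l => sl i l

theorem sa_sa (i : Option (Fin n)) (l : Fin n → ℤ) : sa i (sa i l) = l := by
  cases i with
  | none => simp [sa]
  | some i => exact sl_sl i l

theorem s_latt (i : Option (Fin n)) (l : Fin n → ℤ) :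
    p.s i (p.hbar • latt l) = p.hbar • latt (sa i l) := by
  ext j
  cases i with
  | none =>
    rw [s_none_apply, PiLp.smul_apply, PiLp.smul_apply, PiLp.smul_apply, latt_apply, latt_apply,
      latt_apply, sa, Function.update_apply]
    split_ifs
    · push_cast; simp only [smul_eq_mul]; ring
    · rfl
  | some i =>
    by_cases h : i.val + 1 < n
    · rw [s_lt_apply _ h, PiLp.smul_apply, PiLp.smul_apply, latt_apply, latt_apply, sa, sl, dif_pos h]
    · rw [s_last_apply _ h, PiLp.smul_apply, PiLp.smul_apply, PiLp.smul_apply, latt_apply, latt_apply,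
        latt_apply, sa, sl, dif_neg h]
      split_ifs
      · push_cast; simp only [smul_eq_mul]; ring
      · rfl

theorem hbar_latt_injective (h0 : p.hbar ≠ 0) {l l' : Fin n → ℤ} (h : p.hbar • latt l = p.hbar • latt l') :
    l = l' := latt_injective (smul_right_injective _ h0 h)

/-- The translations that occur in `Res D` are by vectors `ħl` with `H l`, and the coefficient at
`τ(l₀)` is a product of nonzero factors with the roots restricted by `R`. -/
structure Lead (p : Params) (D : Op (V n)) (H : (Fin n → ℤ) → Prop) (l₀ : Fin n → ℤ) (R : V n → Prop) :
    Prop where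
  supp : ∀ v, CC D v ≠ 0 → ∃ l, H l ∧ v = p.hbar • latt l
  lead : p.cf D l₀ ∈ p.NZ R

variable {D E : Op (V n)} {H H' : (Fin n → ℤ) → Prop} {l₀ : Fin n → ℤ} {R R' : V n → Prop}

theorem cf_eq_zero (h0 : p.hbar ≠ 0) (hD : ∀ v, CC D v ≠ 0 → ∃ l, H l ∧ v = p.hbar • latt l)
    {l : Fin n → ℤ} (hl : ¬ H l) : p.cf D l = 0 := by
  by_contra h
  obtain ⟨l', hl', h'⟩ := hD _ h
  exact hl (hbar_latt_injective h0 h' ▸ hl')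

theorem Lead.mono (h : p.Lead D H l₀ R) (hH : ∀ l, H l → H' l) (hR : ∀ a, R a → R' a) :
    p.Lead D H' l₀ R' :=
  ⟨fun v hv => (h.supp v hv).imp fun _ => And.imp_left (hH _), NZ.mono hR h.lead⟩

theorem Lead.congr (h : p.Lead D H l₀ R) {c : ℂ} (hc : c ≠ 0) (hE : CC E = CC (c • D)) :
    p.Lead E H l₀ R := by
  constructor
  · intro v hv
    rw [hE, CC_smul] at hv
    exact h.supp v (right_ne_zero_of_mul hv)
  · rw [cf, hE, CC_smul]
    exact mul_mem (NZ.const hc) h.lead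

theorem Lead.mul_right (h : p.Lead D H l₀ R) {X : (Op (V n))ˣ} (hX : RightConst X) :
    p.Lead (D * (X : Op (V n))) H l₀ R := by
  obtain ⟨c, hc, hX⟩ := hX
  exact h.congr hc (hX D)

theorem CC_T_mul_sub (i : Option (Fin n)) (D : Op (V n)) (c : ℂ) (v : V n) :
    CC (p.T i * D - c • D) v =
      (p.tM i - p.coef i - algebraMap ℂ _ c) * CC D v + p.coef i * p.s i • CC D (p.s i v) := by
  rw [sub_eq_add_neg, ← neg_smul, CC_add, Finsupp.add_apply, CC_T_mul, CC_smul, map_neg]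
  ring

theorem supp_T_mul_sub (h : ∀ v, CC D v ≠ 0 → ∃ l, H l ∧ v = p.hbar • latt l) (i : Option (Fin n)) (c : ℂ)
    (hH : ∀ l, H l → H' l ∧ H' (sa i l)) :
    ∀ v, CC (p.T i * D - c • D) v ≠ 0 → ∃ l, H' l ∧ v = p.hbar • latt l := by
  intro v hv
  by_cases h1 : CC D v = 0
  · by_cases h2 : CC D (p.s i v) = 0
    · rw [CC_T_mul_sub, h1, h2, smul_zero, mul_zero, mul_zero, add_zero] at hv
      exact absurd rfl hv
    · obtain ⟨l, hl, hv⟩ := h _ h2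
      refine ⟨sa i l, (hH l hl).2, ?_⟩
      rw [← s_latt, ← hv, s_s_apply]
  · obtain ⟨l, hl, hv⟩ := h _ h1
    exact ⟨l, (hH l hl).1, hv⟩

/-- At s_il_0 the operator D has no coefficient, so the only contribution comes from l_0 through the
reflection. It is the coefficient of T_i times the reflected leading coefficient, without
cancellation. -/
theorem Lead.T_mul_sub (h0 : p.hbar ≠ 0) (h : p.Lead D H l₀ R) (i : Option (Fin n)) (c : ℂ)
    (hH : ∀ l, H l → H' l ∧ H' (sa i l)) (hl : ¬ H (sa i l₀))
    (hR : ∀ a, R a → R' ((p.s i).linear a)) (hi : R' (affLin i)) :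
    p.Lead (p.T i * D - c • D) H' (sa i l₀) R' := by
  refine ⟨supp_T_mul_sub h.supp i c hH, ?_⟩
  have h1 := cf_eq_zero h0 h.supp hl
  have h2 := h.lead
  rw [cf] at h1 h2
  rw [cf, CC_T_mul_sub, h1, mul_zero, zero_add, s_latt, sa_sa]
  exact mul_mem (NZ.coef hi) (NZ.smul (p.s_mem i) hR h2)

theorem Lead.T_mul (h0 : p.hbar ≠ 0) (h : p.Lead D H l₀ R) (i : Option (Fin n))
    (hH : ∀ l, H l → H' l ∧ H' (sa i l)) (hl : ¬ H (sa i l₀))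
    (hR : ∀ a, R a → R' ((p.s i).linear a)) (hi : R' (affLin i)) :
    p.Lead (p.T i * D) H' (sa i l₀) R' := by
  have := h.T_mul_sub h0 i 0 hH hl hR hi
  rwa [zero_smul, sub_zero] at this

theorem TU_inv_mul (i : Option (Fin n)) (D : Op (V n)) :
    (((p.TU i)⁻¹ : (Op (V n))ˣ) : Op (V n)) * D = p.T i * D - ((p.t i : ℂ) - (p.t i : ℂ)⁻¹) • D := by
  rw [TU_inv_eq, sub_mul, kC, Algebra.smul_def]

theorem Lead.sub (h0 : p.hbar ≠ 0) (h : p.Lead D H l₀ R)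
    (hE : ∀ v, CC E v ≠ 0 → ∃ l, H' l ∧ v = p.hbar • latt l) (hH : ∀ l, H' l → H l) (hl : ¬ H' l₀) (c : ℂ) :
    p.Lead (D - c • E) H l₀ R := by
  have e : ∀ v, CC (D - c • E) v = CC D v - algebraMap ℂ _ c * CC E v := by
    intro v
    rw [sub_eq_add_neg, ← neg_smul, CC_add, Finsupp.add_apply, CC_smul, map_neg]
    ring
  constructor
  · intro v hv
    by_cases h1 : CC D v = 0
    · by_cases h2 : CC E v = 0
      · rw [e, h1, h2, mul_zero, sub_zero] at hv
        exact absurd rfl hv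
      · exact (hE v h2).imp fun _ => And.imp_left (hH _)
    · exact h.supp v h1
  · have h1 := cf_eq_zero h0 hE hl
    rw [cf] at h1
    rw [cf, e, h1, mul_zero, sub_zero]
    exact h.lead

theorem s_linear_latt (i : Fin n) (l : Fin n → ℤ) : (p.s (some i)).linear (latt l) = latt (sl i l) := by
  have h : (p.s (some i)).linear (latt l) = p.s (some i) (latt l) := by
    have := (p.s (some i)).map_vadd (0 : V n) (latt l)
    rw [finW_zero (s_mem_finW i), vadd_eq_add, vadd_eq_add, add_zero, add_zero] at this
    exact this.symm
  rw [h]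
  ext j
  by_cases h : i.val + 1 < n
  · rw [s_lt_apply _ h, latt_apply, latt_apply, sl, dif_pos h]
  · rw [s_last_apply _ h, latt_apply, latt_apply, latt_apply, sl, dif_neg h]
    split_ifs <;> push_cast <;> rfl

theorem form_simpleRoot_latt (i : Fin n) (l : Fin n → ℤ) :
    form (simpleRoot i) (latt l) = (if i.val + 1 < n then 1 else 2) * nuCoef l i := by
  by_cases h : i.val + 1 < n
  · rw [simpleRoot, dif_pos h, form_comm, form_sub, form_comm, form_e, form_comm, form_e, latt_apply, latt_apply, nuCoef_lt h,
      if_pos h]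
    push_cast; ring
  · rw [simpleRoot, dif_neg h, form_comm, form_smul, form_comm, form_e, latt_apply, nuCoef_last h, if_neg h]

end Params
end Koornwinder
end

/-! ### Building the leading term of Y^{ν_k} by moving a hole. -/

noncomputable section
set_option linter.unusedSectionVars false
namespace Koornwinder
namespace Params

variable {n : ℕ} [NeZero n] {p : Params}

/-- `e_1 + ... + e_{k+1} - e_{q+1}`. -/
def hole (k q : ℕ) : Fin n → ℤ := fun i => if i.val ≤ k ∧ i.val ≠ q then 1 else 0

theorem hole_self (k : ℕ) : (hole k k : Fin n → ℤ) = nuN k := by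
  funext i
  simp only [hole, nuN]
  split_ifs <;> omega

theorem sl_hole {k m q : ℕ} (hm : m < q) (hq : q ≤ k) (hk : k < n) :
    sl ⟨m, by omega⟩ (hole k q : Fin n → ℤ) = if q = m + 1 then hole k m else hole k q := by
  funext j
  rw [sl_lt (show m + 1 < n by omega)]
  dsimp only
  split_ifs <;> simp only [hole] <;> split_ifs <;> omega

theorem wt_hole {k q : ℕ} (hq : q ≤ k) (hk : k < n) : wt (hole k q : Fin n → ℤ) = k := by
  have h := wt_nuN (n := n) (k := k + 1) hk
  have : ∀ i : Fin n, |(nuN (k + 1) : Fin n → ℤ) i| =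
      (if i = ⟨q, by omega⟩ then 1 else 0) + |(hole k q : Fin n → ℤ) i| := by
    intro i
    simp only [nuN, hole, Fin.ext_iff]
    split_ifs <;> first | omega | simp
  rw [wt, Finset.sum_congr rfl fun i _ => this i, Finset.sum_add_distrib, ← wt] at h
  simp at h
  omega

/-- The coordinates of `l` are `0` and `1`. -/
def ZO (l : Fin n → ℤ) : Prop := ∀ i, l i = 0 ∨ l i = 1

theorem ZO.sl {l : Fin n → ℤ} (h : ZO l) {i : Fin n} (hi : i.val + 1 < n) : ZO (sl i l) := by
  intro j
  have h1 := h i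
  have h2 := h j
  have h3 := h ⟨i.val + 1, hi⟩
  rw [sl_lt hi]
  split_ifs <;> assumption

theorem wt_update {l : Fin n → ℤ} (h : ZO l) : wt (Function.update l 0 (1 - l 0)) = wt l + 1 - 2 * l 0 := by
  have : ∀ j, |Function.update l 0 (1 - l 0) j| = |l j| + if j = 0 then 1 - 2 * l 0 else 0 := by
    intro j
    rw [Function.update_apply]
    split_ifs with hj
    · subst hj
      rcases h 0 with h | h <;> rw [h] <;> simp
    · simp
  rw [wt, Finset.sum_congr rfl fun j _ => this j, Finset.sum_add_distrib, ← wt]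
  simp
  ring

/-- Linear functions that are nonpositive on `e_i` for `l i = 1`, nonnegative on `e_i` for `l i = 0` and
negative on `l`. -/
def Sg (l : Fin n → ℤ) (a : V n) : Prop :=
  ∃ b : Fin n → ℤ, a = latt b ∧ (∀ i, (l i = 1 → b i ≤ 0) ∧ (l i = 0 → 0 ≤ b i)) ∧ ∑ i, b i * l i < 0

theorem Sg.sl {l : Fin n → ℤ} {a : V n} (h : Sg l a) {i : Fin n} (hi : i.val + 1 < n) :
    Sg (sl i l) ((p.s (some i)).linear a) := by
  obtain ⟨b, rfl, h1, h2⟩ := h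
  refine ⟨Params.sl i b, s_linear_latt i b, fun j => ?_, ?_⟩
  · rw [Params.sl, Params.sl, dif_pos hi, dif_pos hi]
    exact h1 _
  · have : ∀ j, Params.sl i b j * Params.sl i l j = (fun j => b j * l j) (Equiv.swap i ⟨i.val + 1, hi⟩ j) := by
      intro j
      rw [Params.sl, Params.sl, dif_pos hi, dif_pos hi]
    rw [Finset.sum_congr rfl fun j _ => this j, Equiv.sum_comp _ fun j => b j * l j]
    exact h2

/-- Adding e_1 to l and reflecting b lowers their pairing by b_1 ≥ 0. This is why the sign condition
is carried along: mere nonvanishing of the pairing would not persist under s_0. -/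
theorem Sg.update {l : Fin n → ℤ} {a : V n} (h : Sg l a) (h0 : l 0 = 0) :
    Sg (Function.update l 0 1) ((p.s none).linear a) := by
  obtain ⟨b, rfl, h1, h2⟩ := h
  have hb := (h1 0).2 h0
  refine ⟨Function.update b 0 (- b 0), ?_, fun j => ?_, ?_⟩
  · have h := (p.s none).map_vadd (0 : V n) (latt b)
    rw [vadd_eq_add, vadd_eq_add, add_zero, ← sub_eq_iff_eq_add] at h
    rw [← h]
    ext j
    rw [PiLp.sub_apply, s_none_apply, s_none_apply, latt_apply, latt_apply, latt_apply, Function.update_apply]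
    split_ifs <;> simp
  · rw [Function.update_apply, Function.update_apply]
    split_ifs with hj
    · omega
    · exact h1 j
  · have : ∀ j, Function.update b 0 (- b 0) j * Function.update l 0 1 j =
        b j * l j + if j = 0 then - b 0 else 0 := by
      intro j
      rw [Function.update_apply, Function.update_apply]
      split_ifs with hj
      · subst hj; rw [h0]; ring
      · ring
    rw [Finset.sum_congr rfl fun j _ => this j, Finset.sum_add_distrib]
    simp
    omega

theorem Sg.form_ne {l : Fin n → ℤ} {a : V n} (h : Sg l a) : form a (latt l) ≠ 0 := by
  obtain ⟨b, rfl, h1, h2⟩ := h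
  have : form (latt b) (latt l) = ((∑ i, b i * l i : ℤ) : ℂ) := by
    simp only [form, latt_apply]; push_cast; rfl
  rw [this, Int.cast_ne_zero]
  exact h2.ne

/-- The leading term property of `T_1 ... T_q Y^{ν_k}` up to conjugation. -/
def HoleLead (p : Params) (k m : ℕ) (D : Op (V n)) : Prop :=
  p.Lead D (fun l => ZO l ∧ (wt l < k ∨ ∃ q, m ≤ q ∧ q ≤ k ∧ l = hole k q)) (hole k m) (Sg (hole k m))

/-- The reflection exchanges the positions m and m + 1, moving the hole of the leading vector one
place to the left. The other vectors of the same length have their hole farther right, so they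
cannot produce the new leading vector. -/
theorem HoleLead.T_mul (h0 : p.hbar ≠ 0) {k m : ℕ} (hm : m < k) (hk : k < n) {D : Op (V n)}
    (h : HoleLead p k (m + 1) D) : HoleLead p k m (p.T (some ⟨m, by omega⟩) * D) := by
  have hm1 : m + 1 < n := by omega
  have hs : hole k m = sl ⟨m, by omega⟩ (hole k (m + 1) : Fin n → ℤ) := by
    rw [sl_hole (by omega) (by omega) hk, if_pos rfl]
  have := Lead.T_mul h0 h (some ⟨m, by omega⟩) (H' := fun l => ZO l ∧ (wt l < k ∨ ∃ q, m ≤ q ∧ q ≤ k ∧ l = hole k q))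
    (R' := Sg (hole k m)) ?_ ?_ ?_ ?_
  · rw [sa, ← hs] at this
    exact this
  · rintro l ⟨hz, hl⟩
    refine ⟨⟨hz, hl.imp_right fun ⟨q, h1, h2, h3⟩ => ⟨q, by omega, h2, h3⟩⟩, hz.sl hm1, ?_⟩
    rcases hl with hl | ⟨q, h1, h2, rfl⟩
    · left; rwa [sa, wt_sl]
    · right
      rw [sa, sl_hole h1 h2 hk]
      split_ifs with h
      · exact ⟨m, le_rfl, hm.le, rfl⟩
      · exact ⟨q, by omega, h2, rfl⟩
  · rw [sa, ← hs]
    rintro ⟨-, h | ⟨q, h1, h2, h3⟩⟩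
    · rw [wt_hole hm.le hk] at h; omega
    · have := congrFun h3 ⟨m, by omega⟩
      simp only [hole] at this
      split_ifs at this <;> omega
  · intro a ha
    rw [hs]
    exact ha.sl hm1
  · refine ⟨Pi.single ⟨m, by omega⟩ 1 - Pi.single ⟨m + 1, hm1⟩ 1, ?_, fun j => ?_, ?_⟩
    · ext j
      rw [affLin, simpleRoot, dif_pos (show m + 1 < n from hm1), latt_apply]
      simp [e, Pi.single_apply]
    · simp only [hole, Pi.sub_apply, Pi.single_apply, Fin.ext_iff]
      split_ifs <;> omega
    · simp only [Pi.sub_apply, sub_mul, Finset.sum_sub_distrib, Pi.single_apply, ite_mul, one_mul, zero_mul,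
        Finset.sum_ite_eq', Finset.mem_univ, if_true, hole]
      split_ifs <;> omega

theorem HoleLead.gU_mul (h0 : p.hbar ≠ 0) {k : ℕ} (hk : k < n) (m : ℕ) (hm : m ≤ k) (D : Op (V n))
    (h : HoleLead p k m D) : HoleLead p k 0 (((p.gU m : (Op (V n))ˣ) : Op (V n)) * D) := by
  induction m generalizing D with
  | zero => rwa [gU, Units.val_one, one_mul]
  | succ m ih =>
    rw [gU, dif_pos (by omega), Units.val_mul, mul_assoc]
    exact ih (by omega) _ (h.T_mul h0 hm hk)

/-- With the hole in the first place, s_0 fills it and yields ν_{k+1}. Vectors with another hole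
have first entry 1 and become shorter, and shorter vectors gain at most one. -/
theorem HoleLead.T_none_mul (h0 : p.hbar ≠ 0) {k : ℕ} (hk : k < n) {D : Op (V n)} (h : HoleLead p k 0 D) :
    p.Lead (p.T none * D) (fun l => ZO l ∧ (wt l < (k + 1 : ℕ) ∨ l = nuN (k + 1))) (nuN (k + 1))
      (Sg (nuN (k + 1))) := by
  have hu : Function.update (hole k 0 : Fin n → ℤ) 0 1 = nuN (k + 1) := by
    funext j
    rw [Function.update_apply]
    simp only [hole, nuN, Fin.ext_iff, Fin.val_zero]
    split_ifs <;> omega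
  have h00 : (hole k 0 : Fin n → ℤ) 0 = 0 := by simp [hole]
  have hs : sa none (hole k 0 : Fin n → ℤ) = nuN (k + 1) := by rw [sa, h00, sub_zero, hu]
  have := Lead.T_mul h0 h none (H' := fun l => ZO l ∧ (wt l < (k + 1 : ℕ) ∨ l = nuN (k + 1)))
    (R' := Sg (nuN (k + 1))) ?_ ?_ ?_ ?_
  · rwa [hs] at this
  · rintro l ⟨hz, hl⟩
    refine ⟨⟨hz, .inl ?_⟩, ?_, ?_⟩
    · rcases hl with hl | ⟨q, h1, h2, rfl⟩
      · push_cast; omega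
      · rw [wt_hole h2 hk]; push_cast; omega
    · intro j
      rw [sa, Function.update_apply]
      split_ifs
      · have := hz 0; omega
      · exact hz j
    · rcases hl with hl | ⟨q, h1, h2, rfl⟩
      · left
        rw [sa, wt_update hz]
        have := hz 0
        push_cast
        omega
      · by_cases hq : q = 0
        · subst hq; exact .inr hs
        · left
          rw [sa, wt_update hz, wt_hole h2 hk]
          have : (hole k q : Fin n → ℤ) 0 = 1 := by
            rw [hole, if_pos]; simp; omega
          rw [this]
          push_cast
          omega
  · rw [hs]
    rintro ⟨-, h | ⟨q, h1, h2, h3⟩⟩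
    · rw [wt_nuN hk] at h; push_cast at h; omega
    · have := congrArg wt h3
      rw [wt_nuN hk, wt_hole h2 hk] at this
      push_cast at this
      omega
  · intro a ha
    rw [← hu]
    exact ha.update h00
  · refine ⟨Pi.single 0 (-2), ?_, fun j => ?_, ?_⟩
    · ext j
      rw [affLin, latt_apply]
      simp only [e, PiLp.neg_apply, PiLp.smul_apply, PiLp.single_apply, Pi.single_apply]
      split_ifs <;> simp
    · simp only [nuN, Pi.single_apply, Fin.ext_iff, Fin.val_zero]
      split_ifs <;> omega
    · simp only [Pi.single_apply, ite_mul, zero_mul, Finset.sum_ite_eq', Finset.mem_univ, if_true, nuN]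
      simp

end Params
end Koornwinder
end

/-! ### Leading terms of Y^l for vectors with entries 0 and ±1. -/

noncomputable section
set_option linter.unusedSectionVars false
namespace Koornwinder
namespace Params

variable {n : ℕ} [NeZero n] {p : Params}

section ring

variable {A : Type*} [Ring A]

/-- The Bernstein relation for pairing 2 with a short root: X and T⁻¹XT⁻¹ play the roles of Y^{e_i}
and Y^{e_{i+1}}, and L is the part of Y^l commuting with T. -/
theorem sl_relation_two {T X L : Aˣ} {k : A} (hT : ((T⁻¹ : Aˣ) : A) = T - k) (hk : ∀ x, k * x = x * k)
    (hL : T * L = L * T) : ((L * (T⁻¹ * X * T⁻¹) * X⁻¹ : Aˣ) : A) =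
      (T⁻¹ : Aˣ) * (L * X * (T⁻¹ * X * T⁻¹)⁻¹ : Aˣ) * (T⁻¹ : Aˣ) - k * ((T⁻¹ : Aˣ) * L) := by
  have h1 : L * (T⁻¹ * X * T⁻¹) * X⁻¹ = T⁻¹ * L * X * T⁻¹ * X⁻¹ := by
    have : L * T⁻¹ = T⁻¹ * L := ((show Commute T L from hL).inv_left.eq).symm
    rw [← mul_assoc, ← mul_assoc, this]
  have h2 : T⁻¹ * (L * X * (T⁻¹ * X * T⁻¹)⁻¹) * T⁻¹ = T⁻¹ * L * X * T * X⁻¹ := by group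
  have h3 : (T : A) = (T⁻¹ : Aˣ) + k := by rw [hT]; abel
  rw [h1, ← Units.val_mul, ← Units.val_mul, h2]
  simp only [Units.val_mul]
  rw [h3, mul_add, add_mul, ← hk, mul_assoc k, Units.mul_inv_cancel_right, add_sub_cancel_right]

/-- The corresponding relation at the last node, with XT in the role of Y^{e_n}; the quadratic
relation used is that of X. -/
theorem sl_relation_last {T X L : Aˣ} {k : A} (hX : ((X⁻¹ : Aˣ) : A) = X - k) (hk : ∀ x, k * x = x * k)
    (hL : T * L = L * T) : ((L * (X * T)⁻¹ : Aˣ) : A) =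
      (T⁻¹ : Aˣ) * (L * (X * T) : Aˣ) * (T⁻¹ : Aˣ) - k * ((T⁻¹ : Aˣ) * L) := by
  have h1 : L * (X * T)⁻¹ = T⁻¹ * L * X⁻¹ := by
    have : L * T⁻¹ = T⁻¹ * L := ((show Commute T L from hL).inv_left.eq).symm
    rw [mul_inv_rev, ← mul_assoc, this]
  have h2 : T⁻¹ * (L * (X * T)) * T⁻¹ = T⁻¹ * L * X := by group
  rw [h1, ← Units.val_mul, ← Units.val_mul, h2]
  simp only [Units.val_mul]
  rw [hX, mul_sub, ← hk]

end ring

/-- The translations in `Res Y^l` are by vectors `ħl'` with `l'` shorter than `l`, or of the same length and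
dominating `l`, and the coefficient at `τ(l)` is a product of nonzero factors. -/
def YLead (p : Params) (l : Fin n → ℤ) : Prop :=
  p.Lead (p.YU l : Op (V n)) (fun l' => Small l' ∧ (wt l' < wt l ∨ wt l' = wt l ∧ Dm l l')) l
    fun a => form a (latt l) ≠ 0

theorem gU_YU_comm (h0 : p.hbar ≠ 0) {m : ℕ} {l : Fin n → ℤ} (h : ∀ i : Fin n, i.val < m → nuCoef l i = 0) :
    p.gU m * p.YU l = p.YU l * p.gU m := by
  induction m with
  | zero => rw [gU, one_mul, mul_one]
  | succ m ih =>
    have h1 : Commute (p.gU m) (p.YU l) := ih fun i hi => h i (by omega)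
    rw [gU]
    split_ifs with hm
    · have h2 : Commute (p.TU (some ⟨m, hm⟩)) (p.YU l) := TU_YU_comm h0 (h ⟨m, hm⟩ (by simp))
      exact h1.mul_left h2
    · rw [mul_one]; exact h1

theorem PU_YU_comm (h0 : p.hbar ≠ 0) {l : Fin n → ℤ} (k : Fin n) (h : ∀ i : Fin n, k ≤ i → nuCoef l i = 0) :
    p.PU k * p.YU l = p.YU l * p.PU k := by
  have key : ∀ m : ℕ, ∀ k : Fin n, (∀ i : Fin n, k ≤ i → nuCoef l i = 0) → k.val + m + 1 = n →
      Commute (p.PU k) (p.YU l) := by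
    intro m
    induction m with
    | zero =>
      intro k h hk
      rw [(lastNode_iff k).2 (by omega), PU_last h0]
      exact TU_YU_comm h0 (h _ (Fin.le_def.2 (by simp [lastNode]; omega)))
    | succ m ih =>
      intro k h hk
      have hk' : k.val + 1 < n := by omega
      have h1 : Commute (p.TU (some k)) (p.YU l) := TU_YU_comm h0 (h k le_rfl)
      rw [PU_succ h0 hk']
      exact (h1.mul_left (ih _ (fun i hi => h i (le_trans (Fin.le_def.2 (by simp)) hi)) (by simp only; omega))).mul_left h1
  exact key (n - 1 - k.val) k h (by have := k.2; omega)

/-- Exhibits Y^{ν_{k+1}} as T_0 T_1 ⋯ T_k Y^{ν_k} times factors that act on symmetric functions by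
constants. The left factors first move the hole to the front and then fill it. -/
theorem gU_YU_nuN_succ (h0 : p.hbar ≠ 0) {k : ℕ} (hk : k < n) : p.YU (nuN (k + 1) : Fin n → ℤ) =
    p.TU none * (p.gU k * p.YU (nuN k)) * (p.PU ⟨k, hk⟩ * (p.gU k)⁻¹) := by
  have h1 := gU_YU_comm h0 (p := p) (m := k) (l := (nuN (k + 1) : Fin n → ℤ)) fun i hi => by
    rw [nuCoef_nuN, if_neg]; omega
  have h2 := PU_YU_comm h0 (p := p) (l := (nuN k : Fin n → ℤ)) ⟨k, hk⟩ fun i hi => by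
    rw [nuCoef_nuN, if_neg]; have := Fin.le_def.1 hi; simp only at this; omega
  have h3 : p.gU k * p.YU (nuN (k + 1) : Fin n → ℤ) =
      p.TU none * (p.gU k * p.YU (nuN k)) * p.PU ⟨k, hk⟩ := by
    rw [nuN_succ hk, YU_add h0, YU_single h0, mul_assoc _ (p.PU _), h2]
    group
  rw [← mul_assoc, ← h3, h1, mul_inv_cancel_right]

theorem CC_one_ne {v : V n} (h : CC (1 : Op (V n)) v ≠ 0) : v = 0 := by
  classical
  rw [show (1 : Op (V n)) = SkewMonoidAlgebra.single 1 1 from rfl, CC_single, Finsupp.single_apply] at h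
  by_contra h'
  exact h (if_neg fun h => h' h.symm)

theorem lead_nuN (h0 : p.hbar ≠ 0) {k : ℕ} (hk : k ≤ n) :
    p.Lead (p.YU (nuN k : Fin n → ℤ) : Op (V n)) (fun l => ZO l ∧ (wt l < k ∨ l = nuN k)) (nuN k)
      (Sg (nuN k)) := by
  induction k with
  | zero =>
    have hz : (nuN 0 : Fin n → ℤ) = 0 := by funext i; simp [nuN]
    have hl : p.hbar • latt (0 : Fin n → ℤ) = 0 := by ext j; rw [PiLp.smul_apply, latt_apply]; simp
    rw [hz, YU_zero h0, Units.val_one]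
    refine ⟨fun v hv => ⟨0, ⟨fun _ => .inl rfl, .inr rfl⟩, ?_⟩, ?_⟩
    · rw [CC_one_ne hv, hl]
    · rw [cf, hl, show (1 : Op (V n)) = SkewMonoidAlgebra.single 1 1 from rfl, CC_single]
      change Finsupp.single (0 : V n) (1 : Mer (V n)) 0 ∈ _
      rw [Finsupp.single_eq_same]
      exact one_mem _
  | succ k ih =>
    have h1 : HoleLead p k k (p.YU (nuN k : Fin n → ℤ) : Op (V n)) := by
      rw [HoleLead, hole_self]
      refine (ih (by omega)).mono (fun l hl => ⟨hl.1, hl.2.imp_right fun h => ⟨k, le_rfl, le_rfl, ?_⟩⟩) fun _ h => h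
      rw [hole_self, h]
    have h2 := (h1.gU_mul h0 hk k le_rfl).T_none_mul h0 hk
    rw [gU_YU_nuN_succ h0 hk, Units.val_mul, Units.val_mul, Units.val_mul, TU_val]
    exact (h2.mul_right ((rightConst_PU h0 _).mul (rightConst_gU k).inv))

/-- For entries 0 and ±1 a positive pairing is 1 or 2 with a short root, and at the last node the
entry is 1. The correction term, if any, has the entries involved set to zero, so it is shorter. -/
theorem YU_sl_relation (h0 : p.hbar ≠ 0) {i : Fin n} {l : Fin n → ℤ} (hl : Small l) (hi : 0 < nuCoef l i) :
    ∃ (c : ℂ) (l' : Fin n → ℤ), Small l' ∧ wt l' < wt l ∧ (p.YU (sl i l) : Op (V n)) =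
      (((p.TU (some i))⁻¹ : (Op (V n))ˣ) : Op (V n)) * (p.YU l : Op (V n)) *
        (((p.TU (some i))⁻¹ : (Op (V n))ˣ) : Op (V n)) -
        c • ((((p.TU (some i))⁻¹ : (Op (V n))ˣ) : Op (V n)) * (p.YU l' : Op (V n))) := by
  have hle : ∀ j, |l j| ≤ wt l := fun j =>
    Finset.single_le_sum (f := fun j => |l j|) (fun j _ => abs_nonneg (l j)) (Finset.mem_univ j)
  by_cases hn : i.val + 1 < n
  · set k : Fin n := ⟨i.val + 1, hn⟩ with hk
    have hik : k ≠ i := fun hh => by simpa [hk] using congrArg Fin.val hh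
    have hnu : nuCoef l i = l i - l k := nuCoef_lt hn l
    have hli := hl i
    have hlk := hl k
    by_cases h1 : nuCoef l i = 1
    · refine ⟨0, 0, fun j => by simp, ?_, ?_⟩
      · have h2 := hle i
        have h3 := hle k
        have h4 := le_abs_self (l i)
        have h5 := neg_abs_le (l k)
        rw [hnu] at h1
        simp only [wt, Pi.zero_apply, abs_zero, Finset.sum_const_zero] at h2 h3 ⊢
        omega
      · rw [zero_smul, sub_zero, YU_sl_one h0 hn h1]; rfl
    · rw [hnu] at h1 hi
      have hi1 : l i = 1 := by omega
      have hk1 : l k = -1 := by omega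
      obtain ⟨l', hl'⟩ : ∃ l' : Fin n → ℤ, l' = l - Pi.single i 1 + Pi.single k 1 := ⟨_, rfl⟩
      have e : ∀ j, l' j = if j = i then 0 else if j = k then 0 else l j := by
        intro j
        rw [hl', Pi.add_apply, Pi.sub_apply, Pi.single_apply, Pi.single_apply]
        split_ifs with h2 h3 h3
        · exact absurd (h3.symm.trans h2) hik
        · rw [h2]; omega
        · rw [h3]; omega
        · omega
      have hc : nuCoef l' i = 0 := by
        rw [nuCoef_lt hn, e, e, if_pos rfl, if_neg hik, if_pos rfl, sub_zero]
      have e1 : l = l' + Pi.single i 1 + -Pi.single k 1 := by rw [hl']; abel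
      have e2 : sl i l = l' + Pi.single k 1 + -Pi.single i 1 := by
        funext j
        rw [sl_lt hn, Pi.add_apply, Pi.add_apply, e, Pi.neg_apply, Pi.single_apply, Pi.single_apply, ← hk]
        have h2 : j = i ↔ j.val = i.val := Fin.ext_iff
        have h3 : j = k ↔ j.val = i.val + 1 := Fin.ext_iff
        simp only [h2, h3]
        split_ifs <;> omega
      refine ⟨(p.t (some i) : ℂ) - (p.t (some i) : ℂ)⁻¹, l', fun j => ?_, ?_, ?_⟩
      · rw [e]; have := hl j; split_ifs <;> omega
      · refine Finset.sum_lt_sum (fun j _ => ?_) ⟨i, Finset.mem_univ _, ?_⟩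
        · rw [e]; split_ifs <;> simp
        · rw [e, if_pos rfl, hi1]; simp
      · have e3 := congrArg p.YU e1
        rw [e2, e3]
        rw [YU_add h0, YU_add h0, YU_add h0, YU_add h0, YU_neg h0, YU_neg h0, YU_single_succ h0 hn]
        rw [Algebra.smul_def]
        exact sl_relation_two (T := p.TU (some i)) (X := p.YU (Pi.single i 1)) (L := p.YU l') (k := p.kC (some i))
          (TU_inv_eq _) (kC_comm _) (TU_YU_comm h0 hc)
  · have hl1 : l i = 1 := by
      rw [nuCoef_last hn] at hi
      have := hl i
      omega
    obtain ⟨l', hl'⟩ : ∃ l' : Fin n → ℤ, l' = l - Pi.single i 1 := ⟨_, rfl⟩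
    have e : ∀ j, l' j = if j = i then 0 else l j := by
      intro j
      rw [hl', Pi.sub_apply, Pi.single_apply]
      split_ifs with h2
      · rw [h2]; omega
      · omega
    have hc : nuCoef l' i = 0 := by rw [nuCoef_last hn, e, if_pos rfl]
    have e1 : l = l' + Pi.single i 1 := by rw [hl']; abel
    have e2 : sl i l = l' + -Pi.single i 1 := by
      funext j
      rw [sl_last hn, Pi.add_apply, e, Pi.neg_apply, Pi.single_apply]
      split_ifs <;> omega
    obtain ⟨X, hX, hX'⟩ := exists_YU_last (n := n) h0
    rw [← (lastNode_iff i).2 hn] at hX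
    refine ⟨(p.t (none : Option (Fin n)) : ℂ) - (p.t (none : Option (Fin n)) : ℂ)⁻¹, l', fun j => ?_, ?_, ?_⟩
    · rw [e]; have := hl j; split_ifs <;> omega
    · refine Finset.sum_lt_sum (fun j _ => ?_) ⟨i, Finset.mem_univ _, ?_⟩
      · rw [e]; split_ifs <;> simp
      · rw [e, if_pos rfl, hl1]; simp
    · have e3 := congrArg p.YU e1
      rw [e2, e3]
      rw [YU_add h0, YU_add h0, YU_neg h0, hX]
      rw [Algebra.smul_def]
      exact sl_relation_last (T := p.TU (some i)) (X := X) (L := p.YU l') (k := p.kC (none : Option (Fin n))) hX' (kC_comm _) (TU_YU_comm h0 hc)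

/-- In T_i⁻¹Y^lT_i⁻¹ the right factor is a constant on symmetric functions and the left one moves
the leading term from l to s_il, which l did not reach since s_il does not dominate l. The
correction involves shorter vectors only. -/
theorem yLead_sl (h0 : p.hbar ≠ 0) {i : Fin n} {l : Fin n → ℤ} (hl : Small l) (hi : 0 < nuCoef l i)
    (h : YLead p l) (ih : ∀ l' : Fin n → ℤ, Small l' → wt l' < wt l → YLead p l') : YLead p (sl i l) := by
  obtain ⟨c, l', h1, h2, h3⟩ := YU_sl_relation h0 hl hi
  rw [YLead, h3]
  have hw := wt_sl i l
  refine Lead.sub h0 (H' := fun m => Small m ∧ wt m < wt l) ?_ ?_ ?_ ?_ c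
  · refine Lead.mul_right ?_ (rightConst_TU i).inv
    rw [TU_inv_mul]
    refine Lead.T_mul_sub h0 h _ _ ?_ ?_ ?_ ?_
    · rintro m ⟨hm, hm'⟩
      refine ⟨⟨hm, ?_⟩, hm.sl i, ?_⟩
      · rw [hw]; exact hm'.imp_right (And.imp_right fun h => h.sl_left hi)
      · rw [hw, sa, wt_sl]; exact hm'.imp_right (And.imp_right fun h => h.sl hl hm hi)
    · rintro ⟨-, h | ⟨-, h⟩⟩
      · rw [sa, wt_sl] at h; exact lt_irrefl _ h
      · exact not_dm_sl hi h
    · intro a ha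
      rwa [← s_linear_latt (p := p), form_linear p (p.s_mem _)]
    · rw [affLin, form_simpleRoot_latt, nuCoef_sl]
      refine mul_ne_zero (by split_ifs <;> norm_num) ?_
      rw [Int.cast_ne_zero]
      omega
  · rw [TU_inv_mul]
    refine supp_T_mul_sub (ih l' h1 h2).supp _ _ ?_
    rintro m ⟨hm, hm'⟩
    have : wt m < wt l := by rcases hm' with h | ⟨h, -⟩ <;> omega
    refine ⟨⟨hm, this⟩, hm.sl i, ?_⟩
    rwa [sa, wt_sl]
  · rintro m ⟨h4, h5⟩
    exact ⟨h4, .inl (by rwa [hw])⟩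
  · rintro ⟨-, h⟩
    rw [hw] at h
    exact lt_irrefl _ h

theorem yLead (h0 : p.hbar ≠ 0) {l : Fin n → ℤ} (hl : Small l) : YLead p l := by
  have key : ∀ w : ℕ, ∀ l : Fin n → ℤ, Small l → wt l = w → YLead p l := by
    intro w
    induction w using Nat.strong_induction_on with
    | _ w ihw =>
      have hw : ∀ l' : Fin n → ℤ, Small l' → wt l' < w → YLead p l' := fun l' h h' =>
        ihw (wt l').toNat (by
          have : 0 ≤ wt l' := Finset.sum_nonneg fun _ _ => abs_nonneg _
          omega) l' h (by
          have : 0 ≤ wt l' := Finset.sum_nonneg fun _ _ => abs_nonneg _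
          omega)
      -- Inner induction within a fixed length: reflecting in a simple root with negative pairing
      -- lowers this sum, until the vector is dominant and therefore some ν_k.
      have key : ∀ N : ℕ, ∀ l : Fin n → ℤ, Small l → wt l = w →
          ∑ j : Fin n, ((n : ℤ) - j.val) * (1 - l j) ≤ N → YLead p l := by
        intro N
        induction N using Nat.strong_induction_on with
        | _ N ihN =>
          intro l hl hlw hN
          by_cases hd : ∀ i, 0 ≤ nuCoef l i
          · obtain ⟨k, hk, rfl⟩ := exists_nuN hl hd
            refine (lead_nuN h0 hk).mono (fun m hm => ⟨fun i => ?_, ?_⟩) fun a ha => ha.form_ne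
            · have := hm.1 i; omega
            · rw [wt_nuN hk]
              exact hm.2.imp_right fun h => by rw [h]; exact ⟨wt_nuN hk, fun _ _ => le_rfl⟩
          · push Not at hd
            obtain ⟨i, hi⟩ := hd
            have hi' : 0 < nuCoef (sl i l) i := by rw [nuCoef_sl]; omega
            have h1 : ∑ j : Fin n, ((n : ℤ) - j.val) * (1 - sl i l j) ≤
                ∑ j : Fin n, ((n : ℤ) - j.val) * (1 - l j) - 1 := by
              simp only [mul_sub, Finset.sum_sub_distrib]
              rw [sum_mul_sl i fun j => (n : ℤ) - j.val]
              have := i.2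
              split_ifs <;> push_cast <;> nlinarith
            have h2 : 0 ≤ ∑ j : Fin n, ((n : ℤ) - j.val) * (1 - sl i l j) := by
              refine Finset.sum_nonneg fun j _ => mul_nonneg ?_ ?_
              · have := j.2; omega
              · have := hl.sl i j; omega
            have := yLead_sl h0 (hl.sl i) hi'
              (ihN (N - 1) (by omega) _ (hl.sl i) (by rw [wt_sl, hlw]) (by omega)) (by
              rw [wt_sl, hlw]; exact hw)
            rwa [sl_sl] at this
      refine fun l h h' => key (∑ j : Fin n, ((n : ℤ) - j.val) * (1 - l j)).toNat l h h' (Int.self_le_toNat _)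
  have : 0 ≤ wt l := Finset.sum_nonneg fun _ _ => abs_nonneg _
  exact key (wt l).toNat l hl (by omega)

end Params
end Koornwinder
end

noncomputable section
set_option linter.unusedSectionVars false
namespace Koornwinder
namespace Params

variable {n : ℕ} [NeZero n] {p : Params}

/-! ### Leading coefficients of orbit sums -/

theorem wt_sact (g : SP n) (l : Fin n → ℤ) : wt (sact g l) = wt l := by
  have : ∀ j, |sact g l j| = |l (g.1 j)| := fun j => by
    rw [sact, abs_mul]
    rcases Int.units_eq_one_or (g.2 j) with h | h <;> rw [h] <;> simp
  rw [wt, Finset.sum_congr rfl fun j _ => this j]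
  exact Equiv.sum_comp g.1 fun j => |l j|

theorem Small.sact {l : Fin n → ℤ} (h : Small l) (g : SP n) : Small (sact g l) := by
  intro j
  have := h (g.1 j)
  rw [Params.sact]
  rcases Int.units_eq_one_or (g.2 j) with h | h <;> rw [h] <;> simp <;> omega

theorem ps_neg (m : ℕ) (l : Fin n → ℤ) : ps m (-l) = - ps m l := by
  simp only [ps, Pi.neg_apply, mul_neg, Finset.sum_neg_distrib]

theorem wt_neg (l : Fin n → ℤ) : wt (-l) = wt l := by simp only [wt, Pi.neg_apply, abs_neg]

theorem ps_nuN {k m : ℕ} (hm : m ≤ n) : ps m (nuN k : Fin n → ℤ) = (min m k : ℕ) := by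
  rw [← wt_nuN (n := n) (k := min m k) ((min_le_left _ _).trans hm)]
  refine Finset.sum_congr rfl fun i _ => ?_
  simp only [nuN, lt_min_iff]
  split_ifs <;> first | omega | simp

theorem small_neg_nuN (k : ℕ) : Small (-nuN k : Fin n → ℤ) := fun i => by
  rw [Pi.neg_apply, nuN]; split_ifs <;> omega

/-- At the translation −ν_k only the summands with g(−ν_k) = −ν_k contribute: the translations in
Y^m of the length of m dominate m, and −ν_k has the least k-th partial sum, attained by it alone. So
the coefficient is a positive multiple of that of Y^{−ν_k}. -/
theorem lead_EY (h0 : p.hbar ≠ 0) {k : ℕ} (hk : k ≤ n) :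
    p.Lead (p.EY (-nuN k : Fin n → ℤ)) (fun l => Small l ∧ wt l ≤ k) (-nuN k)
      fun a => form a (latt (-nuN k)) ≠ 0 := by
  classical
  have hY : ∀ g : SP n, YLead p (sact g (-nuN k)) := fun g => yLead h0 ((small_neg_nuN k).sact g)
  have hw : ∀ g : SP n, wt (sact g (-nuN k)) = k := fun g => by rw [wt_sact, wt_neg, wt_nuN hk]
  constructor
  · intro v hv
    rw [EY, CC_sum] at hv
    obtain ⟨g, -, hg⟩ := Finset.exists_ne_zero_of_sum_ne_zero hv
    rw [← YU_val] at hg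
    obtain ⟨l, ⟨h1, h2⟩, h3⟩ := (hY g).supp v hg
    rw [hw] at h2
    exact ⟨l, ⟨h1, by rcases h2 with h | h <;> omega⟩, h3⟩
  · have h1 : ∀ g : SP n, p.cf (p.Y (sact g (-nuN k))) (-nuN k) =
        if sact g (-nuN k) = (-nuN k : Fin n → ℤ) then p.cf (p.YU (-nuN k : Fin n → ℤ) : Op (V n)) (-nuN k) else 0 := by
      intro g
      split_ifs with hg
      · rw [hg, YU_val]
      · rw [← YU_val]
        refine cf_eq_zero h0 (hY g).supp ?_
        rintro ⟨-, h | ⟨-, h⟩⟩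
        · rw [hw, wt_neg, wt_nuN hk] at h; exact lt_irrefl _ h
        · refine hg (eq_neg_nuN hk ((small_neg_nuN k).sact g) (hw g).le ((h k hk).trans ?_))
          rw [ps_neg, ps_nuN hk, min_self]
    have h2 : p.cf (p.EY (-nuN k : Fin n → ℤ)) (-nuN k) = ∑ g : SP n, p.cf (p.Y (sact g (-nuN k))) (-nuN k) := by
      rw [cf, EY, CC_sum]; rfl
    rw [h2, Finset.sum_congr rfl fun g _ => h1 g, ← Finset.sum_filter, Finset.sum_const, nsmul_eq_mul]
    refine mul_mem ?_ (yLead h0 (small_neg_nuN k)).lead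
    rw [← map_natCast (algebraMap ℂ (Mer (V n)))]
    refine NZ.const (Nat.cast_ne_zero.2 (Finset.card_ne_zero_of_mem (a := ((1, 1) : SP n)) ?_))
    rw [Finset.mem_filter]
    refine ⟨Finset.mem_univ _, ?_⟩
    funext j
    simp [sact]

theorem lead_mY (h0 : p.hbar ≠ 0) {k : ℕ} (hk : k ≤ n) :
    p.Lead (p.mY (-nuN k : Fin n → ℤ)) (fun l => Small l ∧ wt l ≤ k) (-nuN k)
      fun a => form a (latt (-nuN k)) ≠ 0 := by
  obtain ⟨c, hc, h⟩ := EY_eq (p := p) (-nuN k : Fin n → ℤ)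
  refine (lead_EY h0 hk).congr (inv_ne_zero (Nat.cast_ne_zero.2 hc)) ?_
  rw [h, smul_smul, inv_mul_cancel₀ (Nat.cast_ne_zero.2 hc), one_smul]

/-- The pairing with `∑ ν_k`, `k ∉ S`. -/
def Lz (S : Finset (Fin n)) (l : Fin n → ℤ) : ℤ := ∑ k ∈ Sᶜ, ps (k.val + 1) l

theorem form_latt_sum_nu (S : Finset (Fin n)) (l : Fin n → ℤ) :
    form (latt (∑ k ∈ Sᶜ, nu k)) (latt l) = Lz S l := by
  have : ∑ i, (∑ k ∈ Sᶜ, nu k) i * l i = Lz S l := by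
    simp only [Finset.sum_apply, Finset.sum_mul, Lz, ps]
    rw [Finset.sum_comm]
    refine Finset.sum_congr rfl fun k _ => Finset.sum_congr rfl fun i _ => ?_
    rw [nu_eq_nuN, nuN]
  rw [← this]
  simp only [form, latt_apply]
  push_cast
  rfl

/-- Among vectors with entries 0, ±1 and length at most that of the given −ν, this vector minimizes
every partial sum, and for the one ending at j it is the only minimizer. -/
theorem Lz_lt {S : Finset (Fin n)} {j : Fin n} (hj : j ∉ S) {l : Fin n → ℤ} (h1 : Small l)
    (h2 : wt l ≤ (j.val + 1 : ℕ)) (h3 : l ≠ -nuN (j.val + 1)) : Lz S (-nuN (j.val + 1)) < Lz S l := by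
  have hj2 := j.2
  refine Finset.sum_lt_sum (fun k _ => ?_) ⟨j, Finset.mem_compl.2 hj, ?_⟩
  · have hk := k.2
    rw [ps_neg, ps_nuN hk]
    have h4 := neg_le_ps h1 (m := k.val + 1) hk
    have h5 := abs_ps_le_wt (k.val + 1) l
    have h6 := neg_abs_le (ps (k.val + 1) l)
    rcases min_cases (k.val + 1) (j.val + 1) with ⟨h, -⟩ | ⟨h, -⟩ <;> rw [h] <;> omega
  · rw [ps_neg, ps_nuN hj2, min_self]
    by_contra h
    exact h3 (eq_neg_nuN hj2 h1 h2 (not_lt.1 h))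

end Params

/-! ### Leading terms of difference operators on an affine subspace -/

section LeadP

variable {n : ℕ} {A : AffineSubspace ℂ (V n)} [Nonempty A]

/-- The coefficient of `g` at `v` is nonzero, and the other coefficients are at vectors with greater
values of `L`. -/
def LeadP (L : A.direction →+ ℝ) (g : A.direction →₀ Mer A) (v : A.direction) : Prop :=
  g v ≠ 0 ∧ ∀ u, g u ≠ 0 → u = v ∨ L v < L u

/-- A product term at the sum of the leading exponents can come only from the two leading terms, by
comparing values of L; it is nonzero because the coefficients lie in a field and translations act
injectively. -/
theorem LeadP.conv {L : A.direction →+ ℝ} {g g' : A.direction →₀ Mer A} {a b : A.direction}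
    (h : LeadP L g a) (h' : LeadP L g' b) : LeadP L (conv g g') (a + b) := by
  constructor
  · rw [conv_apply, Finset.sum_eq_single a]
    · rw [add_sub_cancel_left]
      exact mul_ne_zero h.1 ((smul_ne_zero_iff_ne _).2 h'.1)
    · intro v hv hva
      by_contra hne
      have h1 := (h.2 v (left_ne_zero_of_mul hne)).resolve_left hva
      have h2 := h'.2 (a + b - v) ((smul_ne_zero_iff_ne _).1 (right_ne_zero_of_mul hne))
      rcases h2 with h2 | h2
      · exact hva (by rw [sub_eq_iff_eq_add, add_comm, add_right_inj] at h2; exact h2.symm)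
      · rw [map_sub, map_add] at h2; linarith
    · intro ha
      rw [Finsupp.notMem_support_iff.1 ha, zero_mul]
  · intro u hu
    rw [conv_apply] at hu
    obtain ⟨v, -, hv⟩ := Finset.exists_ne_zero_of_sum_ne_zero hu
    have h1 := h.2 v (left_ne_zero_of_mul hv)
    have h2 := h'.2 (u - v) ((smul_ne_zero_iff_ne _).1 (right_ne_zero_of_mul hv))
    have h3 : L (u - v) = L u - L v := map_sub _ _ _
    have h4 : L (a + b) = L a + L b := map_add _ _ _
    rcases h1 with rfl | h1
    · rcases h2 with h2 | h2
      · left; rw [← h2]; abel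
      · right; linarith
    · right
      rcases h2 with h2 | h2
      · rw [h2] at h3; linarith
      · linarith

/-- `x` is a difference operator with the leading term at `v`. -/
def LeadO (L : A.direction →+ ℝ) (x : Op A) (v : A.direction) : Prop :=
  ∃ g, x = ofPr A g ∧ LeadP L g v

theorem LeadO.mul {L : A.direction →+ ℝ} {x y : Op A} {v w : A.direction} (hx : LeadO L x v)
    (hy : LeadO L y w) : LeadO L (x * y) (v + w) := by
  obtain ⟨g, rfl, hg⟩ := hx
  obtain ⟨g', rfl, hg'⟩ := hy
  exact ⟨_, ofPr_mul g g', hg.conv hg'⟩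

theorem leadO_one (L : A.direction →+ ℝ) : LeadO L (1 : Op A) 0 := by
  classical
  refine ⟨Finsupp.single 0 1, ?_, ?_, fun u hu => ?_⟩
  · rw [ofPr_single, SkewMonoidAlgebra.one_def]
    congr 1
    ext x
    change (x : V n) _ = (((0 : A.direction) +ᵥ x : A) : V n) _
    rw [zero_vadd]
  · rw [Finsupp.single_eq_same]; exact one_ne_zero
  · left
    by_contra h
    rw [Finsupp.single_apply, if_neg fun h' => h h'.symm] at hu
    exact hu rfl

end LeadP

section coefficients

variable {P E : Type*} [NormedAddCommGroup E] [NormedSpace ℂ E] [FiniteDimensional ℂ E] [AddTorsor E P]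

/-- The coefficients of operators as linear functionals. -/
def coeffL (g : P ≃ᵃ[ℂ] P) : Op P →ₗ[ℂ] Mer P where
  toFun D := D.coeff g
  map_add' D D' := by rw [SkewMonoidAlgebra.coeff_add]; rfl
  map_smul' c D := by rw [SkewMonoidAlgebra.coeff_smul]; rfl

open Classical in
theorem coeffL_single (g h : P ≃ᵃ[ℂ] P) (a : Mer P) :
    coeffL g (SkewMonoidAlgebra.single h a) = if h = g then a else 0 := by
  change (SkewMonoidAlgebra.single h a).coeff g = _
  rw [SkewMonoidAlgebra.coeff_single, Finsupp.single_apply]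

end coefficients

theorem coeffL_ofPr {n : ℕ} {A : AffineSubspace ℂ (V n)} [Nonempty A] (g : A.direction →₀ Mer A)
    (v : A.direction) : coeffL (AffineEquiv.constVAdd ℂ A v) (ofPr A g) = g v := by
  classical
  induction g using Finsupp.induction_linear with
  | zero => rw [map_zero, map_zero]; rfl
  | add g g' h h' => rw [map_add, map_add, h, h', Finsupp.add_apply]
  | single w a =>
    rw [ofPr_single, coeffL_single, Finsupp.single_apply]
    have : AffineEquiv.constVAdd ℂ A w = AffineEquiv.constVAdd ℂ A v ↔ w = v := by
      refine ⟨fun h => ?_, fun h => by rw [h]⟩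
      obtain ⟨x⟩ : Nonempty A := inferInstance
      exact vadd_right_cancel x (congrFun (congrArg DFunLike.coe h) x)
    simp only [this]

end Koornwinder
end

noncomputable section
set_option linter.unusedSectionVars false
namespace Koornwinder

/-! ### Algebraic independence -/

section leading

variable {ι M K : Type*} [Finite ι] [AddCommGroup M] [Field K] [Algebra ℂ K]

/-- In a nonzero polynomial take a monomial whose leading exponent has the least value of L. Leading
exponents of different monomials differ, so nothing else contributes at that exponent and the value
of the polynomial is nonzero. -/
theorem algebraicIndependent_of_lead {C : Type*} [CommRing C] [Algebra ℂ C] (f : ι → C) (co : M → C →ₗ[ℂ] K)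
    (L : M →+ ℝ) (P : C → M → Prop)
    (hP : ∀ b v, P b v → co v b ≠ 0 ∧ ∀ u, co u b ≠ 0 → u = v ∨ L v < L u) (h1 : P 1 0)
    (hmul : ∀ a b v w, P a v → P b w → P (a * b) (v + w)) (v : ι → M) (hf : ∀ i, P (f i) (v i))
    (hv : ∀ m m' : ι →₀ ℕ, (m.sum fun i k => k • v i) = (m'.sum fun i k => k • v i) → m = m') :
    AlgebraicIndependent ℂ f := by
  classical
  have hpow : ∀ (i : ι) (k : ℕ), P (f i ^ k) (k • v i) := by
    intro i k
    induction k with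
    | zero => rw [pow_zero, zero_smul]; exact h1
    | succ k ih => rw [pow_succ, succ_nsmul]; exact hmul _ _ _ _ ih (hf i)
  have hprod : ∀ m : ι →₀ ℕ, P (m.prod fun i k => f i ^ k) (m.sum fun i k => k • v i) := by
    intro m
    rw [Finsupp.prod, Finsupp.sum]
    induction m.support using Finset.induction_on with
    | empty => exact h1
    | insert i s hi ih =>
      rw [Finset.prod_insert hi, Finset.sum_insert hi]
      exact hmul _ _ _ _ (hpow _ _) ih
  rw [algebraicIndependent_iff]
  intro F hF
  by_contra hF0
  obtain ⟨m, hm, hmin⟩ := F.support.exists_min_image (fun m => L (m.sum fun i k => k • v i))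
    (Finset.nonempty_iff_ne_empty.2 fun h => hF0 (MvPolynomial.support_eq_empty.1 h))
  set u := m.sum fun i k => k • v i with hu
  have h2 : co u (MvPolynomial.aeval f F) = F.coeff m • co u (m.prod fun i k => f i ^ k) := by
    rw [MvPolynomial.aeval_def, MvPolynomial.eval₂_eq, map_sum, Finset.sum_eq_single m]
    · rw [← Algebra.smul_def, map_smul]; rfl
    · intro m' hm' hne
      rw [← Algebra.smul_def, map_smul]
      by_contra h
      have h3 := right_ne_zero_of_smul h
      rcases (hP _ _ (hprod m')).2 u h3 with h4 | h4
      · exact hne (hv _ _ h4).symm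
      · exact absurd (hmin m' hm') (not_le.2 h4)
    · intro h; exact absurd hm h
  rw [hF, map_zero] at h2
  exact smul_ne_zero (MvPolynomial.mem_support_iff.1 hm) (hP _ _ (hprod m)).1 h2.symm

theorem algIndep_of_lead {B : Type*} [Ring B] [Algebra ℂ B] (A : Subalgebra ℂ B)
    (hA : ∀ x ∈ A, ∀ y ∈ A, x * y = y * x) (f : ι → A) (co : M → B →ₗ[ℂ] K)
    (L : M →+ ℝ) (P : B → M → Prop)
    (hP : ∀ b v, P b v → co v b ≠ 0 ∧ ∀ u, co u b ≠ 0 → u = v ∨ L v < L u) (h1 : P 1 0)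
    (hmul : ∀ a b v w, P a v → P b w → P (a * b) (v + w)) (v : ι → M) (hf : ∀ i, P (f i) (v i))
    (hv : ∀ m m' : ι →₀ ℕ, (m.sum fun i k => k • v i) = (m'.sum fun i k => k • v i) → m = m') :
    AlgIndep A hA f := by
  let _ : CommRing A :=
    { (inferInstance : Ring A) with mul_comm := fun x y => Subtype.ext (hA x x.2 y y.2) }
  exact algebraicIndependent_of_lead f (fun u => (co u).comp A.val.toLinearMap) L (fun x => P x)
    (fun b => hP b) h1 (fun a b => hmul a b) v hf hv

theorem algIndep_op_of_lead {T E : Type*} [NormedAddCommGroup E] [NormedSpace ℂ E] [FiniteDimensional ℂ E]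
    [AddTorsor E T] (A : Subalgebra ℂ (Op T))
    (hA : ∀ x ∈ A, ∀ y ∈ A, x * y = y * x) (f : ι → A) (co : M → Op T →ₗ[ℂ] K)
    (L : M →+ ℝ) (P : Op T → M → Prop)
    (hP : ∀ b v, P b v → co v b ≠ 0 ∧ ∀ u, co u b ≠ 0 → u = v ∨ L v < L u) (h1 : P 1 0)
    (hmul : ∀ a b v w, P a v → P b w → P (a * b) (v + w)) (v : ι → M) (hf : ∀ i, P (f i) (v i))
    (hv : ∀ m m' : ι →₀ ℕ, (m.sum fun i k => k • v i) = (m'.sum fun i k => k • v i) → m = m') :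
    AlgIndep A hA f :=
  algIndep_of_lead A hA f co L P hP h1 hmul v hf hv

end leading

namespace Params

variable {n : ℕ} [NeZero n] {p : Params} {S : Finset (Fin n)} {η₁ ηn : ℂ}

theorem latt_mem_direction {l : Fin n → ℤ} (h : ∀ i ∈ S, nuCoef l i = 0) :
    latt l ∈ (D0 S η₁ ηn).direction := by
  rw [mem_direction_iff]
  intro i hi
  rw [form_simpleRoot_latt, h i hi, Int.cast_zero, mul_zero]

theorem latt_sum_nu_mem_direction : latt (∑ k ∈ Sᶜ, nu k) ∈ (D0 S η₁ ηn).direction := by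
  refine latt_mem_direction fun i hi => ?_
  have : (∑ k ∈ Sᶜ, nu k : Fin n → ℤ) = ∑ k, (if k ∈ Sᶜ then (1 : ℤ) else 0) • nu k := by
    simp only [ite_smul, one_smul, zero_smul, Finset.sum_ite_mem, Finset.univ_inter]
  rw [this, nuCoef_sum, if_neg (by simpa using hi)]

theorem inner_latt (l : Fin n → ℤ) (x : V n) : inner ℂ (latt l) x = form (latt l) x := by
  rw [form, PiLp.inner_apply]
  refine Finset.sum_congr rfl fun j _ => ?_
  rw [latt_apply]
  simp [mul_comm]

theorem form_latt_proj {L : Submodule ℂ (V n)} {l : Fin n → ℤ} (h : latt l ∈ L) (x : V n) :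
    form (latt l) (L.orthogonalProjectionOnto x : V n) = form (latt l) x := by
  rw [← inner_latt, ← inner_latt]
  exact Submodule.inner_orthogonalProjectionOnto_eq_of_mem_left (⟨latt l, h⟩ : L) x

/-- The pairing with a vector as a functional on a subspace. -/
def formS (L : Submodule ℂ (V n)) (a : V n) : L →+ ℂ where
  toFun v := form a v
  map_zero' := by simp [form]
  map_add' v w := form_add a v w

/-- The real part of the pairing with `∑ ν_k / ħ`, `k ∉ S`. -/
def LS (p : Params) (S : Finset (Fin n)) (L : Submodule ℂ (V n)) : L →+ ℝ :=
  Complex.reAddGroupHom.comp ((AddMonoidHom.mulRight p.hbar⁻¹).comp (formS L (latt (∑ k ∈ Sᶜ, nu k))))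

/-- The projection of `ħl`. -/
def pv (p : Params) (S : Finset (Fin n)) (η₁ ηn : ℂ) (l : Fin n → ℤ) : (D0 S η₁ ηn).direction :=
  (D0 S η₁ ηn).direction.orthogonalProjectionOnto (p.hbar • latt l)

theorem LS_pv (h0 : p.hbar ≠ 0) (l : Fin n → ℤ) : LS p S (D0 S η₁ ηn).direction (pv p S η₁ ηn l) = Lz S l := by
  change (form _ ((D0 S η₁ ηn).direction.orthogonalProjectionOnto (p.hbar • latt l) : V n) * p.hbar⁻¹).re = _
  rw [form_latt_proj latt_sum_nu_mem_direction, form_smul, form_latt_sum_nu, mul_comm, inv_mul_cancel_left₀ h0]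
  simp

theorem projCoeff_eq (A : AffineSubspace ℂ (V n)) [Nonempty A] (D : Op (V n)) :
    projCoeff A D = (CC D).mapDomain A.direction.orthogonalProjectionOnto := by
  rw [CC, ← Finsupp.mapDomain_comp]
  rfl

/-- Different shifts may have equal projections, but the functional is the pairing with a sum of ν_k
lying in the direction of D_0, so it sees only projections, and −ν_j is its strict minimum. Hence no
other shift merges with −ν_j. Its coefficient restricts to a nonzero function by `NZ.restr`, applied
to the direction −ν_j of D_0. -/
theorem leadP_mY (h0 : p.hbar ≠ 0) {j : Fin n} (hj : j ∉ S) :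
    LeadP (LS p S (D0 S η₁ ηn).direction) (pr (D0 S η₁ ηn) (p.mY (-nu j))) (pv p S η₁ ηn (-nu j)) := by
  classical
  rw [nu_eq_nuN]
  have H := lead_mY (p := p) h0 (k := j.val + 1) (n := n) j.2
  set l₀ : Fin n → ℤ := -nuN (j.val + 1) with hl₀
  set D : Op (V n) := p.mY l₀
  have hL : ∀ v, CC D v ≠ 0 → v = p.hbar • latt l₀ ∨ LS p S (D0 S η₁ ηn).direction (pv p S η₁ ηn l₀) <
      LS p S (D0 S η₁ ηn).direction ((D0 S η₁ ηn).direction.orthogonalProjectionOnto v) := by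
    intro v hv
    obtain ⟨l, ⟨h1, h2⟩, rfl⟩ := H.supp v hv
    by_cases hl : l = l₀
    · left; rw [hl]
    · right
      change _ < LS p S (D0 S η₁ ηn).direction (pv p S η₁ ηn l)
      rw [LS_pv h0, LS_pv h0, Int.cast_lt]
      exact Lz_lt hj h1 h2 hl
  have hpr : ∀ u, pr (D0 S η₁ ηn) D u = restr (D0 S η₁ ηn) (projCoeff (D0 S η₁ ηn) D u) := fun u =>
    Finsupp.mapRange_apply ..
  constructor
  · have hcf : projCoeff (D0 S η₁ ηn) D (pv p S η₁ ηn l₀) = p.cf D l₀ := by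
      rw [projCoeff_eq, Finsupp.mapDomain, Finsupp.sum_apply, Finsupp.sum,
        Finset.sum_eq_single (p.hbar • latt l₀)]
      · exact Finsupp.single_eq_same
      · intro v hv hne
        rw [Finsupp.single_apply, if_neg]
        intro h
        have := (hL v (Finsupp.mem_support_iff.1 hv)).resolve_left hne
        rw [h] at this
        exact lt_irrefl _ this
      · intro h
        rw [Finsupp.notMem_support_iff.1 h, Finsupp.single_zero, Finsupp.zero_apply]
    have hd : latt l₀ ∈ (D0 S η₁ ηn).direction := latt_mem_direction fun i hi => by
      rw [hl₀, ← nu_eq_nuN, nuCoef_neg, nuCoef_nu, if_neg (by rintro rfl; exact hj hi), neg_zero]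
    obtain ⟨h, hh, hr⟩ := NZ.restr hd H.lead
    rw [hpr, hcf, hr.restr_eq]
    exact hh
  · intro u hu
    have h1 : projCoeff (D0 S η₁ ηn) D u ≠ 0 := by
      intro h
      rw [hpr, h, restr_zero] at hu
      exact hu rfl
    rw [projCoeff_eq, ← Finsupp.mem_support_iff] at h1
    obtain ⟨v, hv, rfl⟩ := Finset.mem_image.1 (Finsupp.mapDomain_support h1)
    rcases hL v (Finsupp.mem_support_iff.1 hv) with rfl | h
    · exact .inl rfl
    · exact .inr h

/-- The ν_j involved lie in the direction of D_0 and are not changed by projection; pairing with α_i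
then recovers the exponent of the i-th factor up to a nonzero constant. -/
theorem sum_pv_injective (h0 : p.hbar ≠ 0) (m m' : {j : Fin n // j ∉ S} →₀ ℕ)
    (h : (m.sum fun i k => k • pv p S η₁ ηn (-nu i.1)) = m'.sum fun i k => k • pv p S η₁ ηn (-nu i.1)) :
    m = m' := by
  classical
  have hpv : ∀ j : {j : Fin n // j ∉ S}, (pv p S η₁ ηn (-nu j.1) : V n) = p.hbar • latt (-nu j.1) := by
    intro j
    have hd : p.hbar • latt (-nu j.1) ∈ (D0 S η₁ ηn).direction :=
      Submodule.smul_mem _ _ (latt_mem_direction fun i hi => by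
        rw [nuCoef_neg, nuCoef_nu, if_neg (by rintro rfl; exact j.2 hi), neg_zero])
    exact congrArg Subtype.val (Submodule.orthogonalProjectionOnto_mem_subspace_eq_self
      (⟨_, hd⟩ : (D0 S η₁ ηn).direction))
  have hs : ∀ (m : {j : Fin n // j ∉ S} →₀ ℕ) (i : {j : Fin n // j ∉ S}),
      formS _ (simpleRoot i.1) (m.sum fun i k => k • pv p S η₁ ηn (-nu i.1)) =
      -(p.hbar * (if i.1.val + 1 < n then 1 else 2)) * m i := by
    intro m i
    have hf : ∀ j : {j : Fin n // j ∉ S}, formS _ (simpleRoot i.1) (pv p S η₁ ηn (-nu j.1)) =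
        if j = i then -(p.hbar * (if i.1.val + 1 < n then 1 else 2)) else 0 := by
      intro j
      change form _ (pv p S η₁ ηn (-nu j.1) : V n) = _
      rw [hpv, form_smul, form_simpleRoot_latt, nuCoef_neg, nuCoef_nu]
      have : i.1 = j.1 ↔ j = i := by rw [Subtype.ext_iff, eq_comm]
      simp only [this]
      split_ifs <;> simp
    rw [map_finsuppSum, Finsupp.sum_fintype _ _ (fun j => by rw [zero_smul, map_zero])]
    simp only [map_nsmul, hf, smul_ite, smul_zero, Finset.sum_ite_eq', Finset.mem_univ, if_true]
    rw [nsmul_eq_mul, mul_comm]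
  ext i
  have h1 := hs m i
  rw [h, hs m' i] at h1
  have h2 : -(p.hbar * (if i.1.val + 1 < n then 1 else 2)) ≠ 0 :=
    neg_ne_zero.2 (mul_ne_zero h0 (by split_ifs <;> norm_num))
  exact_mod_cast (mul_left_cancel₀ h2 h1).symm

theorem algIndep (h0 : p.hbar ≠ 0)
    (hcomm : ∀ x ∈ p.Rbar S η₁ ηn, ∀ y ∈ p.Rbar S η₁ ηn, x * y = y * x) :
    AlgIndep (p.Rbar S η₁ ηn) hcomm fun j : {j : Fin n // j ∉ S} =>
      ⟨p.Mbar S η₁ ηn (-nu j.1), p.Mbar_mem S η₁ ηn _⟩ := by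
  refine algIndep_op_of_lead _ _ _ (fun u => coeffL (AffineEquiv.constVAdd ℂ (D0 S η₁ ηn) u)) (LS p S (D0 S η₁ ηn).direction)
    (LeadO (LS p S (D0 S η₁ ηn).direction)) ?_ (leadO_one _) (fun a b v w h h' => h.mul h')
    (fun j => pv p S η₁ ηn (-nu j.1)) (fun j => ?_) (sum_pv_injective h0)
  · rintro _ v ⟨g, rfl, hg⟩
    simp only [coeffL_ofPr]
    exact hg
  · exact ⟨_, (Mbar_eq _).trans (bar_eq _), leadP_mY h0 j.2⟩

end Params
end Koornwinder
end

theorem mainTheorem7 (n : ℕ) [NeZero n] (p : Koornwinder.Params)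
    (hq : ∀ r : ℚ, p.hbar ≠ Real.pi * Complex.I * r)
    (S : Finset (Fin n)) (η₁ ηn : ℂ)
    (hcox : ∀ i ∈ S, Koornwinder.lastNode n ∉ Koornwinder.component S i →
      Koornwinder.IsCoxeterNumber η₁ ηn (Koornwinder.component S i) p.hbar)
    (ht₁ : 1 < n → (p.t₁ : ℂ) ^ 2 = Complex.exp η₁)
    (htn : ∃ εn : ℤˣ,
      ((εn : ℤ) : ℂ) * p.tn * (p.un ^ (εn : ℤ) : ℂˣ) = Complex.exp (ηn / 2) ∧
      (Koornwinder.lastNode n ∈ S → ∃ ε₀ : ℤˣ,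
        ((ε₀ : ℤ) : ℂ) * ((εn : ℤ) : ℂ) * p.tn * p.t₀ * (p.un ^ (εn : ℤ) : ℂˣ) *
          (p.u₀ ^ (ε₀ : ℤ) : ℂˣ) * (p.t₁ : ℂ) ^ (2 * ((Koornwinder.component S (Koornwinder.lastNode n)).ncard - 1)) *
          p.q⁻¹ = 1)) :
    (∀ l : Fin n → ℤ, Koornwinder.Restrictable (Koornwinder.D0 S η₁ ηn) (p.M l)) ∧
    Subalgebra.toSubmodule (p.Rbar S η₁ ηn) = Submodule.span ℂ (Set.range (p.Mbar S η₁ ηn)) ∧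
    Module.finrank ℂ (Koornwinder.D0 S η₁ ηn).direction = Fintype.card {j : Fin n // j ∉ S} ∧
    ∃ hcomm : ∀ x ∈ p.Rbar S η₁ ηn, ∀ y ∈ p.Rbar S η₁ ηn, x * y = y * x,
      Koornwinder.AlgIndep (p.Rbar S η₁ ηn) hcomm fun j : {j : Fin n // j ∉ S} =>
        ⟨p.Mbar S η₁ ηn (-Koornwinder.nu j.1), p.Mbar_mem S η₁ ηn _⟩ := by
  have h0 : p.hbar ≠ 0 := by simpa using hq 0
  have h : p.Good S η₁ ηn := ⟨h0, hcox, ht₁, htn⟩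
  refine ⟨fun l => ?_, h.Rbar_eq_span, Koornwinder.finrank_direction, h.Rbar_comm,
    Koornwinder.Params.algIndep h0 _⟩
  exact Koornwinder.restrictable_Res (Koornwinder.Params.restrictable_of_mem (Koornwinder.Params.mY_mem_HH l))
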